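/- Let $\mathbb F$ be $\mathbb R$ or $\mathbb C$, let $n_1,n_2,n_3,r$ be positive integers with $r<\min\{n_1,n_2\}$, and put $\mathcal V=\mathbb F^{n_1}\otimes\mathbb F^{n_2}$, $\mathcal W=\mathbb F^{n_3}$ and $\mathcal X_r=\{v\in\mathcal V:\operatorname{rank}(v)\le r\}$, where $v$ is regarded as an $n_1\times n_2$ matrix. An *$r$-aided decomposition* (or $(r,r,1)$-block decomposition) of length $R$ of $T\in\mathcal V\otimes\mathcal W=\mathbb F^{n_1}\otimes\mathbb F^{n_2}\otimes\mathbb F^{n_3}$ is an expression $T=\sum_{a=1}^R v_a\otimes w_a$ with $v_a\in\mathcal X_r$ and $w_a\in\mathcal W$. The *$r$-aided rank* of $T$ is the least such $R$; a decomposition of that length is *the unique $r$-aided rank decomposition* if every other one of that length is obtained from it by permuting the summands. A property holds for a *generically chosen* tensor of $r$-aided rank at most $R$ if there is a Zariski open dense subset $\mathcal A\subseteq\mathcal X_r^{\times R}\times\mathcal W^{\times R}$ such that it holds for $T=\sum_a v_a\otimes w_a$ for all $(v,w)\in\mathcal A$. *Simultaneous diagonalization.* Given a tensor $S$ with three modes,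 choose $f,g$ at random in the dual of the first mode, so that the contractions $S(f),S(g)$ are matrices indexed by the second and third modes. Compute eigenvectors $y_a$ of $S(f)S(g)^{+}$ for its non-zero eigenvalues $\lambda_a$, and eigenvectors $t_a$ of $(S(f)^{+}S(g))^{\mathsf T}$ for the eigenvalues $\lambda_a^{-1}$, where ${}^+$ is the Moore–Penrose inverse; fail unless each of the two matrices has as many distinct non-zero eigenvalues in $\mathbb F$ as its rank, and those of the second are exactly the $\lambda_a^{-1}$. Put $z_a=S(h_a)$ for functionals $h_a$ dual to the $y_a\otimes t_a$; fail if two of the $z_a$ are parallel; otherwise output the terms $z_a\otimes y_a\otimes t_a$. *Algorithm 1*, on input a basis of a subspace $\mathcal U\subseteq\mathcal V$ of dimension $\ell$ and polynomials, homogeneous of degree $d$ and spanning $I_d$, that cut out a conic variety $\mathcal X\subseteq\mathcal V$: compute a basis $P_1,\dots,P_s$ of $S^d(\mathcal U)\cap I_d^\perp$. If $s=0$, output "$\mathcal U\cap\mathcal X=\{0\}$". If $s>\ell$, output "Fail". Otherwise run simultaneous diagonalization on $\sum_i e_i\otimes P_i\in\mathbb F^s\otimes\mathcal V\otimes\mathcal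 V^{\otimes(d-1)}$; if it outputs a decomposition of this tensor into terms $z_i\otimes x_i^{\otimes d}$, $i\in[s]$, with $z_1,\dots,z_s$ and $x_1,\dots,x_s$ linearly independent, output "the only elements of $\mathcal U\cap\mathcal X$ are $x_1,\dots,x_s$ (up to scale)"; otherwise output "Fail". *Decomposition procedure.* On input $T$, run Algorithm 1 with $\mathcal X=\mathcal X_r$, given by the $(r+1)\times(r+1)$ minors ($d=r+1$), on a basis of $\mathcal U=T(\mathcal W^*)$. If it outputs exactly $\dim\mathcal U$ elements $x_a$, output the decomposition $\sum_a x_a\otimes T(h_a)$ with functionals $h_a$ dual to the $x_a$ (for $\mathcal U=0$: the empty decomposition); otherwise output nothing. Write $$B=\frac{\binom{n_1}{r+1}\binom{n_2}{r+1}}{(r+1)!\,\binom{n_1n_2+r}{r+1}}\,(n_1n_2+r).$$ Then the following hold. 1. $B=\Omega_r(n_1n_2)$: for each $r\ge1$ there is $c_r>0$ with $B\ge c_r\,n_1n_2$ for all $n_1,n_2>r$. 2. Whenever the decomposition procedure outputs a decomposition, for any $T$ and any random choices, it is the unique $r$-aided rank decomposition of $T$. 3. For every $R\le\min\{n_3,B\}$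 and a generically chosen tensor $T=\sum_{a=1}^R v_a\otimes w_a$ of $r$-aided rank at most $R$: the $r$-aided rank of $T$ is $R$ and this is its unique $r$-aided rank decomposition; on any basis of $T(\mathcal W^*)$, and for any choice of the basis $P_1,\dots,P_s$, Algorithm 1 outputs $v_1,\dots,v_R$ (up to order and scale; for $R=0$ it outputs "$\mathcal U\cap\mathcal X_r=\{0\}$") for almost all $f,g$. 4. There are a constant $C$ and a program for a real random access machine (field arithmetic over $\mathbb F$ with conjugation and zero tests, addition, truncated subtraction and comparison of integers, and an oracle that diagonalizes square matrices over $\mathbb F$, a call on a $k\times k$ matrix being charged $k^2+1$ steps) that, for all $n_1,n_2,n_3,r$ as above, carries out the decomposition procedure on every input $T\in\mathbb F^{n_1}\otimes\mathbb F^{n_2}\otimes\mathbb F^{n_3}$ and all random vectors, with at most $C$ oracle calls and in at most $(n_1n_2)^{Cr}+n_3\,(n_1n_2)^{C}$ steps, that is, in $(n_1n_2)^{O(r)}$ time apart from a term $n_3\,(n_1n_2)^{O(1)}$ for reading $T$ and writing the decomposition. For $T$ as in 3 it outputs, with probability 1 over the random vectors, the unique $r$-aided rank decomposition of $T$. -/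

import Mathlib

open MvPolynomial MeasureTheory

noncomputable section

namespace BlockDecomp

/-! ## Tensors, block decompositions

The field `𝕜` is `ℝ` or `ℂ` (`RCLike 𝕜`). We put `V = 𝕜^{n₁} ⊗ 𝕜^{n₂}`, the space of functions
`Fin n₁ × Fin n₂ → 𝕜`, and identify `𝕜^{n₁} ⊗ 𝕜^{n₂} ⊗ 𝕜^{n₃} = V ⊗ W`, `W = 𝕜^{n₃}`, with
functions `T : Fin n₁ × Fin n₂ → Fin n₃ → 𝕜`. -/

variable {𝕜 : Type*} [RCLike 𝕜]

/-- The space `V = 𝕜^{n₁} ⊗ 𝕜^{n₂}`. -/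
abbrev MatSpace (𝕜 : Type*) (n₁ n₂ : ℕ) : Type _ := Fin n₁ × Fin n₂ → 𝕜

/-- The space `𝕜^{n₁} ⊗ 𝕜^{n₂} ⊗ 𝕜^{n₃}`. -/
abbrev TensorSpace (𝕜 : Type*) (n₁ n₂ n₃ : ℕ) : Type _ := Fin n₁ × Fin n₂ → Fin n₃ → 𝕜

/-- The determinantal variety `X_r` of elements of `V` of matrix rank at most `r`. -/
def detVariety (𝕜 : Type*) [RCLike 𝕜] (n₁ n₂ r : ℕ) : Set (MatSpace 𝕜 n₁ n₂) :=
  {v | (Matrix.of fun i j => v (i, j)).rank ≤ r}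

/-- The tensor `∑ a, v a ⊗ w a`. -/
def sumTensor {n₁ n₂ n₃ R : ℕ} (v : Fin R → MatSpace 𝕜 n₁ n₂) (w : Fin R → Fin n₃ → 𝕜) :
    TensorSpace 𝕜 n₁ n₂ n₃ :=
  fun i k => ∑ a, v a i * w a k

/-- `T = ∑ a, v a ⊗ w a` with every `v a` of rank at most `r`: an `r`-aided
(that is, `(r,r,1)`-block) decomposition of length `R`. -/
def IsAidedDecomposition {n₁ n₂ n₃ : ℕ} (r : ℕ) (T : TensorSpace 𝕜 n₁ n₂ n₃) {R : ℕ}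
    (v : Fin R → MatSpace 𝕜 n₁ n₂) (w : Fin R → Fin n₃ → 𝕜) : Prop :=
  (∀ a, v a ∈ detVariety 𝕜 n₁ n₂ r) ∧ T = sumTensor v w

/-- The `r`-aided rank: the least length of an `r`-aided decomposition. (For `r ≥ 1` every tensor
has one.) -/
def aidedRank {n₁ n₂ n₃ : ℕ} (r : ℕ) (T : TensorSpace 𝕜 n₁ n₂ n₃) : ℕ :=
  sInf {R | ∃ (v : Fin R → MatSpace 𝕜 n₁ n₂) (w : Fin R → Fin n₃ → 𝕜),
    IsAidedDecomposition r T v w}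

/-- Two families of `R` summands agree up to a permutation: `v' (σ a) ⊗ w' (σ a) = v a ⊗ w a`. -/
def SameSummands {n₁ n₂ n₃ R : ℕ} (v v' : Fin R → MatSpace 𝕜 n₁ n₂)
    (w w' : Fin R → Fin n₃ → 𝕜) : Prop :=
  ∃ σ : Equiv.Perm (Fin R), ∀ a i k, v' (σ a) i * w' (σ a) k = v a i * w a k

/-- `(v, w)` is the unique `r`-aided rank decomposition of `T`: it is an `r`-aided decomposition
whose length is the `r`-aided rank of `T`, and every other `r`-aided decomposition of that length
arises from it by permuting the summands. -/
def IsUniqueAidedRankDecomposition {n₁ n₂ n₃ : ℕ} (r : ℕ) (T : TensorSpace 𝕜 n₁ n₂ n₃) {R : ℕ}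
    (v : Fin R → MatSpace 𝕜 n₁ n₂) (w : Fin R → Fin n₃ → 𝕜) : Prop :=
  IsAidedDecomposition r T v w ∧ aidedRank r T = R ∧
    ∀ (v' : Fin R → MatSpace 𝕜 n₁ n₂) (w' : Fin R → Fin n₃ → 𝕜),
      IsAidedDecomposition r T v' w' → SameSummands v v' w w'

/-- The subspace `T(W^*) ⊆ V`, spanned by the slices of `T` along the third mode. -/
def sliceSpan {n₁ n₂ n₃ : ℕ} (T : TensorSpace 𝕜 n₁ n₂ n₃) : Submodule 𝕜 (MatSpace 𝕜 n₁ n₂) :=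
  Submodule.span 𝕜 (Set.range fun k i => T i k)

/-- The bound on the number of summands. -/
def rankBound (n₁ n₂ r : ℕ) : ℝ :=
  ((n₁.choose (r + 1) : ℝ) * (n₂.choose (r + 1) : ℝ)) /
    (((r + 1).factorial : ℝ) * ((n₁ * n₂ + r).choose (r + 1) : ℝ)) * ((n₁ : ℝ) * n₂ + r)

/-! ## The Zariski topology and genericity -/

/-- An algebraic subset of `𝕜^σ`: the common zeros of a set of polynomials. -/
def IsZariskiClosed {σ : Type*} (Z : Set (σ → 𝕜)) : Prop :=
  ∃ F : Set (MvPolynomial σ 𝕜), Z = {x | ∀ p ∈ F, MvPolynomial.eval x p = 0}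

/-- `A` is a Zariski open dense subset of `Y` (in the topology induced on `Y`). -/
def IsZariskiOpenDenseIn {σ : Type*} (A Y : Set (σ → 𝕜)) : Prop :=
  (∃ Z, IsZariskiClosed Z ∧ A = Y \ Z) ∧ ∀ Z, IsZariskiClosed Z → A ⊆ Z → Y ⊆ Z

/-- Coordinates on `V^{×R} × W^{×R}`. -/
abbrev ParamIndex (n₁ n₂ n₃ R : ℕ) : Type := (Fin R × Fin n₁ × Fin n₂) ⊕ (Fin R × Fin n₃)

/-- The `V`-components `v_1, …, v_R` of a point of `V^{×R} × W^{×R}`. -/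
def paramV {n₁ n₂ n₃ R : ℕ} (x : ParamIndex n₁ n₂ n₃ R → 𝕜) : Fin R → MatSpace 𝕜 n₁ n₂ :=
  fun a i => x (Sum.inl (a, i))

/-- The `W`-components `w_1, …, w_R` of a point of `V^{×R} × W^{×R}`. -/
def paramW {n₁ n₂ n₃ R : ℕ} (x : ParamIndex n₁ n₂ n₃ R → 𝕜) : Fin R → Fin n₃ → 𝕜 :=
  fun a k => x (Sum.inr (a, k))

/-- The variety `X_r^{×R} × W^{×R}`. A property holds for a generic tensor of `r`-aided rank at
most `R` if it holds for `∑ a, v a ⊗ w a` for all `(v, w)` in a Zariski open dense subset of it. -/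
def paramVariety (𝕜 : Type*) [RCLike 𝕜] (n₁ n₂ n₃ r R : ℕ) : Set (ParamIndex n₁ n₂ n₃ R → 𝕜) :=
  {x | ∀ a, paramV x a ∈ detVariety 𝕜 n₁ n₂ r}

/-! ## Symmetric powers and polynomials -/

section Symmetric

variable {ι : Type*}

/-- `U^{⊗d}` inside `(𝕜^ι)^{⊗d}`, whose elements are functions of `d`-tuples of indices. -/
def tensorPow (U : Submodule 𝕜 (ι → 𝕜)) (d : ℕ) : Submodule 𝕜 ((Fin d → ι) → 𝕜) :=
  Submodule.span 𝕜 {t | ∃ x : Fin d → ι → 𝕜, (∀ k, x k ∈ U) ∧ t = fun a => ∏ k, x k (a k)}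

/-- The symmetric tensors in `(𝕜^ι)^{⊗d}`. -/
def symTensors (𝕜 : Type*) [RCLike 𝕜] (ι : Type*) (d : ℕ) : Submodule 𝕜 ((Fin d → ι) → 𝕜) where
  carrier := {t | ∀ (σ : Equiv.Perm (Fin d)) (a : Fin d → ι), t (a ∘ σ) = t a}
  add_mem' := by
    intro s t hs ht σ a
    simp [hs σ a, ht σ a]
  zero_mem' := by
    intro σ a
    rfl
  smul_mem' := by
    intro c t ht σ a
    simp [ht σ a]

/-- The symmetric power `S^d(U)`: the symmetric tensors in `U^{⊗d}`. -/
def symPow (U : Submodule 𝕜 (ι → 𝕜)) (d : ℕ) : Submodule 𝕜 ((Fin d → ι) → 𝕜) :=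
  tensorPow U d ⊓ symTensors 𝕜 ι d

/-- The element of `S^d(V^*)` that corresponds to a homogeneous polynomial `f` of degree `d`, as a
symmetric array: the entry at `a` is the coefficient in `f` of the monomial `x_{a_1} ⋯ x_{a_d}`
divided by the number of rearrangements of `a`, i.e. a product `x_{a_1} ⋯ x_{a_d}` goes to the
average of the arrays `e_{a_{σ(1)}} ⊗ ⋯ ⊗ e_{a_{σ(d)}}`. -/
def polyArray (d : ℕ) (f : MvPolynomial ι 𝕜) (a : Fin d → ι) : 𝕜 :=
  MvPolynomial.coeff (∑ k, Finsupp.single (a k) 1) f /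
    ((∑ k, Finsupp.single (a k) 1 : ι →₀ ℕ).multinomial : 𝕜)

/-- The annihilator, among all tensors, of the polynomials `fs c`. Intersected with symmetric
tensors this is `I_d^⊥ ⊆ S^d(V)`, where `I_d` is the span of the `fs c`. -/
def polyAnnihilator [Fintype ι] {κ : Type*} (d : ℕ) (fs : κ → MvPolynomial ι 𝕜) :
    Submodule 𝕜 ((Fin d → ι) → 𝕜) where
  carrier := {t | ∀ c, ∑ a, polyArray d (fs c) a * t a = 0}
  add_mem' := by
    intro s t hs ht c
    simp only [Pi.add_apply, mul_add, Finset.sum_add_distrib, hs c, ht c, add_zero]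
  zero_mem' := by
    intro c
    simp
  smul_mem' := by
    intro b t ht c
    have h : ∀ a, polyArray d (fs c) a * (b • t) a = b * (polyArray d (fs c) a * t a) := by
      intro a
      simp only [Pi.smul_apply, smul_eq_mul]
      ring
    simp only [h, ← Finset.mul_sum, ht c, mul_zero]

end Symmetric

/-- The family `b` is a basis of the subspace `K`. -/
def IsBasisOf {E : Type*} [AddCommGroup E] [Module 𝕜 E] {m : ℕ} (b : Fin m → E)
    (K : Submodule 𝕜 E) : Prop :=
  LinearIndependent 𝕜 b ∧ Submodule.span 𝕜 (Set.range b) = K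

/-- The `(r+1) × (r+1)` minors of the generic `n₁ × n₂` matrix, indexed by the choices of
`r + 1` rows and `r + 1` columns in increasing order. They cut out `X_r`. -/
def minors (𝕜 : Type*) [RCLike 𝕜] (n₁ n₂ r : ℕ) :
    (Fin (r + 1) ↪o Fin n₁) × (Fin (r + 1) ↪o Fin n₂) → MvPolynomial (Fin n₁ × Fin n₂) 𝕜 :=
  fun c => ((Matrix.mvPolynomialX (Fin n₁) (Fin n₂) 𝕜).submatrix c.1 c.2).det

/-! ## The simultaneous diagonalization algorithm -/

section SimDiag

variable {α β γ : Type*} [Fintype α] [Fintype β] [Fintype γ]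

/-- `T(f)`: the contraction of the first mode of `T` with the functional `f`. -/
def contractFirst (T : α → β → γ → 𝕜) (f : α → 𝕜) : Matrix β γ 𝕜 :=
  Matrix.of fun b c => ∑ i, f i * T i b c

/-- `B` is the Moore-Penrose pseudoinverse of `A`. -/
structure IsMoorePenrose (A : Matrix β γ 𝕜) (B : Matrix γ β 𝕜) : Prop where
  left : A * B * A = A
  right : B * A * B = B
  herm_left : (A * B).IsHermitian
  herm_right : (B * A).IsHermitian

/-- The non-zero eigenvalues of `M` are `lam 1, …, lam k`, none of them repeated, where
`k = rank M`, and `x 1, …, x k` are corresponding eigenvectors. -/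
structure SimpleNonzeroSpectrum (M : Matrix β β 𝕜) (k : ℕ) (lam : Fin k → 𝕜)
    (x : Fin k → β → 𝕜) : Prop where
  rank_eq : M.rank = k
  injective : Function.Injective lam
  value_ne : ∀ a, lam a ≠ 0
  vector_ne : ∀ a, x a ≠ 0
  eigen : ∀ a, M.mulVec (x a) = lam a • x a

/-- A list of `length` triples `(u a, v a, w a)`, standing for the rank-one terms
`u a ⊗ v a ⊗ w a`. -/
structure TripleList (𝕜 α β γ : Type*) where
  length : ℕ
  u : Fin length → α → 𝕜
  v : Fin length → β → 𝕜
  w : Fin length → γ → 𝕜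

/-- `h` is dual to the family `v a ⊗ w a`. -/
def IsDualToProducts {k : ℕ} (v : Fin k → β → 𝕜) (w : Fin k → γ → 𝕜) (h : Fin k → β → γ → 𝕜) :
    Prop :=
  ∀ a b, ∑ i, ∑ j, h a i j * (v b i * w b j) = if a = b then 1 else 0

/-- `T(h)` for a functional `h` on the product of the second and the third mode. -/
def contractLast (T : α → β → γ → 𝕜) (h : β → γ → 𝕜) : α → 𝕜 :=
  fun i => ∑ b, ∑ c, T i b c * h b c

/-- `SimDiag T f g out`: `out` is a possible output of the simultaneous diagonalization algorithm
on the tensor `T` when the random functionals are `f` and `g`; `none` is the output "Fail". The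
eigenvectors, and the dual functionals, may be chosen in any way.

With `A = T(f)⁺` and `B = T(g)⁺` the algorithm computes the eigenvectors `v a` of `T(f) T(g)⁺` for
the non-zero eigenvalues `lam a`, and the eigenvectors `w a` of `T(f)⁺ T(g)`, acting on the third
mode itself (hence the transpose), for the eigenvalues `(lam a)⁻¹`; it fails if the non-zero
eigenvalues are not simple or do not match. It then solves for `u a = T(h a)`, and fails if two of
these vectors are parallel. -/
inductive SimDiag (T : α → β → γ → 𝕜) (f g : α → 𝕜) : Option (TripleList 𝕜 α β γ) → Prop
  | failFirst (B : Matrix γ β 𝕜) (hB : IsMoorePenrose (contractFirst T g) B)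
      (h : ¬ ∃ (k : ℕ) (lam : Fin k → 𝕜) (v : Fin k → β → 𝕜),
        SimpleNonzeroSpectrum (contractFirst T f * B) k lam v) :
      SimDiag T f g none
  | failSecond (A B : Matrix γ β 𝕜) (hA : IsMoorePenrose (contractFirst T f) A)
      (hB : IsMoorePenrose (contractFirst T g) B)
      (k : ℕ) (lam : Fin k → 𝕜) (v : Fin k → β → 𝕜)
      (hv : SimpleNonzeroSpectrum (contractFirst T f * B) k lam v)
      (h : ¬ ∃ w : Fin k → γ → 𝕜,
        SimpleNonzeroSpectrum (A * contractFirst T g).transpose k (fun a => (lam a)⁻¹) w) :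
      SimDiag T f g none
  | failParallel (A B : Matrix γ β 𝕜) (hA : IsMoorePenrose (contractFirst T f) A)
      (hB : IsMoorePenrose (contractFirst T g) B)
      (k : ℕ) (lam : Fin k → 𝕜) (v : Fin k → β → 𝕜) (w : Fin k → γ → 𝕜)
      (hv : SimpleNonzeroSpectrum (contractFirst T f * B) k lam v)
      (hw : SimpleNonzeroSpectrum (A * contractFirst T g).transpose k (fun a => (lam a)⁻¹) w)
      (h : Fin k → β → γ → 𝕜) (hh : IsDualToProducts v w h)
      (hpar : ∃ a b, a ≠ b ∧
        contractLast T (h a) ∈ Submodule.span 𝕜 {contractLast T (h b)}) :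
      SimDiag T f g none
  | found (A B : Matrix γ β 𝕜) (hA : IsMoorePenrose (contractFirst T f) A)
      (hB : IsMoorePenrose (contractFirst T g) B)
      (k : ℕ) (lam : Fin k → 𝕜) (v : Fin k → β → 𝕜) (w : Fin k → γ → 𝕜)
      (hv : SimpleNonzeroSpectrum (contractFirst T f * B) k lam v)
      (hw : SimpleNonzeroSpectrum (A * contractFirst T g).transpose k (fun a => (lam a)⁻¹) w)
      (h : Fin k → β → γ → 𝕜) (hh : IsDualToProducts v w h)
      (hpar : ¬ ∃ a b, a ≠ b ∧
        contractLast T (h a) ∈ Submodule.span 𝕜 {contractLast T (h b)}) :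
      SimDiag T f g (some ⟨k, fun a => contractLast T (h a), v, w⟩)

end SimDiag

/-! ## Algorithm 1: computing `U ∩ X` -/

section Algorithm1

variable {ι : Type*} [Fintype ι]

/-- The outputs of Algorithm 1: "`U` trivially intersects `X`", "the only elements of `U ∩ X` are
`v 1, …, v s` (up to scale)", and "Fail". -/
inductive Alg1Output (𝕜 ι : Type*) where
  | trivial : Alg1Output 𝕜 ι
  | only (s : ℕ) (v : Fin s → ι → 𝕜) : Alg1Output 𝕜 ι
  | fail : Alg1Output 𝕜 ι

/-- The subspace `S^d(U) ∩ I_d^⊥`, where `U` is spanned by `u` and `I_d` by `fs`. -/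
def liftedSpace {κ : Type*} {R : ℕ} (d : ℕ) (fs : κ → MvPolynomial ι 𝕜) (u : Fin R → ι → 𝕜) :
    Submodule 𝕜 ((Fin d → ι) → 𝕜) :=
  symPow (Submodule.span 𝕜 (Set.range u)) d ⊓ polyAnnihilator d fs

/-- The tensor `∑ i, e_i ⊗ P i ∈ 𝕜^s ⊗ V^{⊗(e+1)}`, regarded as an element of
`𝕜^s ⊗ V ⊗ V^{⊗e}`. -/
def stackTensor {e s : ℕ} (P : Fin s → (Fin (e + 1) → ι) → 𝕜) :
    Fin s → ι → (Fin e → ι) → 𝕜 :=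
  fun i a b => P i (Fin.cons a b)

/-- The triples in `L` are a decomposition of `T` of the form `z i ⊗ (x i)^{⊗(e+1)}`, `i ∈ [s]`,
with `z` and `x` linearly independent. -/
structure IsPowerForm {e s : ℕ} (T : Fin s → ι → (Fin e → ι) → 𝕜)
    (L : TripleList 𝕜 (Fin s) ι (Fin e → ι)) (z : Fin L.length → Fin s → 𝕜)
    (x : Fin L.length → ι → 𝕜) : Prop where
  length_eq : L.length = s
  indep_z : LinearIndependent 𝕜 z
  indep_x : LinearIndependent 𝕜 x
  terms : ∀ k i a b, L.u k i * L.v k a * L.w k b = z k i * x k a * ∏ j, x k (b j)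
  sum_eq : ∀ i a b, T i a b = ∑ k, z k i * x k a * ∏ j, x k (b j)

/-- `Algorithm1 fs u P f g out`: `out` is a possible output of Algorithm 1, for polynomials `fs`
that are homogeneous of degree `d = e + 1`, on the basis `u` of a subspace `U` of dimension `R`,
when `P` is the basis of `S^d(U) ∩ I_d^⊥` computed in the first step, and `f` and `g` are the random
functionals in the call of the simultaneous diagonalization algorithm. -/
inductive Algorithm1 {κ : Type*} {e R s : ℕ} (fs : κ → MvPolynomial ι 𝕜) (u : Fin R → ι → 𝕜)
    (P : Fin s → (Fin (e + 1) → ι) → 𝕜) (f g : Fin s → 𝕜) : Alg1Output 𝕜 ι → Prop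
  | trivial (h : liftedSpace (e + 1) fs u = ⊥) : Algorithm1 fs u P f g Alg1Output.trivial
  | failLarge (h : liftedSpace (e + 1) fs u ≠ ⊥) (hs : R < s) :
      Algorithm1 fs u P f g Alg1Output.fail
  | failDiag (h : liftedSpace (e + 1) fs u ≠ ⊥) (hs : s ≤ R)
      (hd : SimDiag (stackTensor P) f g none) :
      Algorithm1 fs u P f g Alg1Output.fail
  | failForm (h : liftedSpace (e + 1) fs u ≠ ⊥) (hs : s ≤ R)
      (L : TripleList 𝕜 (Fin s) ι (Fin e → ι)) (hd : SimDiag (stackTensor P) f g (some L))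
      (hf : ¬ ∃ z x, IsPowerForm (stackTensor P) L z x) :
      Algorithm1 fs u P f g Alg1Output.fail
  | found (h : liftedSpace (e + 1) fs u ≠ ⊥) (hs : s ≤ R)
      (L : TripleList 𝕜 (Fin s) ι (Fin e → ι)) (hd : SimDiag (stackTensor P) f g (some L))
      (z : Fin L.length → Fin s → 𝕜) (x : Fin L.length → ι → 𝕜)
      (hf : IsPowerForm (stackTensor P) L z x) :
      Algorithm1 fs u P f g (Alg1Output.only L.length x)

/-- The output says that the elements of `U ∩ X` are exactly `v 1, …, v R`, up to order and
scale. -/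
def Alg1Output.Lists {R : ℕ} (v : Fin R → ι → 𝕜) : Alg1Output 𝕜 ι → Prop
  | Alg1Output.trivial => R = 0
  | Alg1Output.only s x => ∃ σ : Fin R ≃ Fin s, ∀ a, ∃ c : 𝕜, c ≠ 0 ∧ x (σ a) = c • v a
  | Alg1Output.fail => False

end Algorithm1

/-! ## Using Algorithm 1 to decompose a tensor -/

/-- A list of `length` pairs `(v a, w a)`, standing for the terms `v a ⊗ w a`. -/
structure BlockList (𝕜 : Type*) (n₁ n₂ n₃ : ℕ) where
  length : ℕ
  v : Fin length → MatSpace 𝕜 n₁ n₂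
  w : Fin length → Fin n₃ → 𝕜

/-- `h` is dual to the family `x`. -/
def IsDualTo {ι : Type*} [Fintype ι] {k : ℕ} (x h : Fin k → ι → 𝕜) : Prop :=
  ∀ a b, ∑ i, h a i * x b i = if a = b then 1 else 0

/-- `AidedDecompose T u P f g out`: `out` is a possible output of the following procedure on `T`.
Run Algorithm 1, with the `(r+1) × (r+1)` minors, on the basis `u` of `U = T(W^*)`. If it outputs
`R = dim U` matrices `x 1, …, x R`, take functionals `h a` dual to them, and output the terms
`x a ⊗ T(h a)`, together with the claim that they form the unique `r`-aided rank decomposition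
of `T`. Otherwise output `none` (no decomposition found), except that the empty decomposition is
the output when `U = 0`. -/
inductive AidedDecompose {n₁ n₂ n₃ r ℓ s : ℕ} (T : TensorSpace 𝕜 n₁ n₂ n₃)
    (u : Fin ℓ → MatSpace 𝕜 n₁ n₂) (P : Fin s → (Fin (r + 1) → Fin n₁ × Fin n₂) → 𝕜)
    (f g : Fin s → 𝕜) : Option (BlockList 𝕜 n₁ n₂ n₃) → Prop
  | empty (hℓ : ℓ = 0) (h : Algorithm1 (minors 𝕜 n₁ n₂ r) u P f g Alg1Output.trivial)
      (v : Fin 0 → MatSpace 𝕜 n₁ n₂) (w : Fin 0 → Fin n₃ → 𝕜) :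
      AidedDecompose T u P f g (some ⟨0, v, w⟩)
  | found (x h : Fin ℓ → MatSpace 𝕜 n₁ n₂)
      (hx : Algorithm1 (minors 𝕜 n₁ n₂ r) u P f g (Alg1Output.only ℓ x)) (hh : IsDualTo x h) :
      AidedDecompose T u P f g (some ⟨ℓ, x, fun a k => ∑ i, h a i * T i k⟩)
  | noneTrivial (hℓ : ℓ ≠ 0) (h : Algorithm1 (minors 𝕜 n₁ n₂ r) u P f g Alg1Output.trivial) :
      AidedDecompose T u P f g none
  | noneFewer (k : ℕ) (hk : k ≠ ℓ) (x : Fin k → MatSpace 𝕜 n₁ n₂)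
      (hx : Algorithm1 (minors 𝕜 n₁ n₂ r) u P f g (Alg1Output.only k x)) :
      AidedDecompose T u P f g none
  | noneFail (h : Algorithm1 (minors 𝕜 n₁ n₂ r) u P f g Alg1Output.fail) :
      AidedDecompose T u P f g none

/-! ## A real random access machine with a diagonalization oracle

Programs are written in a small imperative language. A state has integer registers, arrays of
natural numbers and arrays of field elements; arrays may have any number of indices, and the
indices are held in registers. Integers can be added, subtracted (with truncation) and compared;
integer multiplication is not a primitive. Field elements can be added, subtracted, multiplied,
divided (division by zero gives zero), conjugated and tested for zero. Every assignment, every test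
and every call of the oracle is charged; expressions in a program have a fixed size. The language
does not depend on the field. -/

/-- Integer expressions. -/
inductive NExp where
  | lit (n : ℕ) : NExp
  | reg (i : ℕ) : NExp
  | cell (A : ℕ) (idx : List ℕ) : NExp
  | add (a b : NExp) : NExp
  | sub (a b : NExp) : NExp

/-- Field expressions. -/
inductive FExp where
  | zero : FExp
  | one : FExp
  | cell (A : ℕ) (idx : List ℕ) : FExp
  | add (a b : FExp) : FExp
  | sub (a b : FExp) : FExp
  | mul (a b : FExp) : FExp
  | div (a b : FExp) : FExp
  | conj (a : FExp) : FExp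

/-- Tests. -/
inductive Test where
  | lt (a b : NExp) : Test
  | eq (a b : NExp) : Test
  | isZero (a : FExp) : Test

/-- Programs. `diag A Q L k flag` calls the oracle on the matrix in the field array `A`, of the
size held in register `k`; eigenvectors are written to `Q`, eigenvalues to `L`, and register `flag`
tells whether the matrix is diagonalizable. -/
inductive Cmd where
  | setReg (i : ℕ) (e : NExp) : Cmd
  | setNat (A : ℕ) (idx : List ℕ) (e : NExp) : Cmd
  | setFld (A : ℕ) (idx : List ℕ) (e : FExp) : Cmd
  | seq (p q : Cmd) : Cmd
  | cond (b : Test) (p q : Cmd) : Cmd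
  | loop (b : Test) (p : Cmd) : Cmd
  | diag (A Q L k flag : ℕ) : Cmd

/-- The state of the machine. -/
structure MState (𝕜 : Type*) where
  reg : ℕ → ℕ
  narr : ℕ → List ℕ → ℕ
  farr : ℕ → List ℕ → 𝕜

/-- Write `n` to register `i`. -/
def MState.putReg (st : MState 𝕜) (i n : ℕ) : MState 𝕜 :=
  { st with reg := Function.update st.reg i n }

/-- Write `n` to the entry `idx` of the integer array `A`. -/
def MState.putNat (st : MState 𝕜) (A : ℕ) (idx : List ℕ) (n : ℕ) : MState 𝕜 :=
  { st with narr := Function.update st.narr A (Function.update (st.narr A) idx n) }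

/-- Write `c` to the entry `idx` of the field array `A`. -/
def MState.putFld (st : MState 𝕜) (A : ℕ) (idx : List ℕ) (c : 𝕜) : MState 𝕜 :=
  { st with farr := Function.update st.farr A (Function.update (st.farr A) idx c) }

/-- The value of an integer expression. -/
def NExp.val (st : MState 𝕜) : NExp → ℕ
  | NExp.lit n => n
  | NExp.reg i => st.reg i
  | NExp.cell A idx => st.narr A (idx.map st.reg)
  | NExp.add a b => a.val st + b.val st
  | NExp.sub a b => a.val st - b.val st

/-- The value of a field expression. -/
def FExp.val (st : MState 𝕜) : FExp → 𝕜
  | FExp.zero => 0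
  | FExp.one => 1
  | FExp.cell A idx => st.farr A (idx.map st.reg)
  | FExp.add a b => a.val st + b.val st
  | FExp.sub a b => a.val st - b.val st
  | FExp.mul a b => a.val st * b.val st
  | FExp.div a b => a.val st / b.val st
  | FExp.conj a => (starRingEnd 𝕜) (a.val st)

/-- The truth of a test. -/
def Test.Holds (st : MState 𝕜) : Test → Prop
  | Test.lt a b => a.val st < b.val st
  | Test.eq a b => a.val st = b.val st
  | Test.isZero a => a.val st = 0

/-- `(Q, l)` diagonalizes the matrix `M` over `𝕜`. -/
def Diagonalizes {k : ℕ} (M Q : Matrix (Fin k) (Fin k) 𝕜) (l : Fin k → 𝕜) : Prop :=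
  IsUnit Q ∧ M * Q = Q * Matrix.diagonal l

/-- An oracle that diagonalizes square matrices over `𝕜`, and reports `none` exactly when the
matrix is not diagonalizable over `𝕜`. -/
structure DiagOracle (𝕜 : Type*) [RCLike 𝕜] where
  answer : (k : ℕ) → Matrix (Fin k) (Fin k) 𝕜 → Option (Matrix (Fin k) (Fin k) 𝕜 × (Fin k → 𝕜))
  sound : ∀ k M Q l, answer k M = some (Q, l) → Diagonalizes M Q l
  complete : ∀ k M, answer k M = none → ¬ ∃ Q l, Diagonalizes M Q l

/-- Overwrite the entries `[i, j]`, `i, j < k`, of an array by those of a matrix. -/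
def writeMatrix {k : ℕ} (Q : Matrix (Fin k) (Fin k) 𝕜) (m : List ℕ → 𝕜) : List ℕ → 𝕜
  | [i, j] => if h : i < k ∧ j < k then Q ⟨i, h.1⟩ ⟨j, h.2⟩ else m [i, j]
  | idx => m idx

/-- Overwrite the entries `[i]`, `i < k`, of an array by those of a vector. -/
def writeVector {k : ℕ} (l : Fin k → 𝕜) (m : List ℕ → 𝕜) : List ℕ → 𝕜
  | [i] => if h : i < k then l ⟨i, h⟩ else m [i]
  | idx => m idx

/-- The `k × k` matrix in the entries `[i, j]`, `i, j < k`, of an array. -/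
def readMatrix (k : ℕ) (m : List ℕ → 𝕜) : Matrix (Fin k) (Fin k) 𝕜 :=
  Matrix.of fun i j => m [(i : ℕ), (j : ℕ)]

/-- The state after a call of the oracle. -/
def MState.afterDiag (D : DiagOracle 𝕜) (st : MState 𝕜) (A Q L k flag : ℕ) : MState 𝕜 :=
  match D.answer (st.reg k) (readMatrix (st.reg k) (st.farr A)) with
  | none => st.putReg flag 0
  | some (q, l) =>
    let m := Function.update st.farr Q (writeMatrix q (st.farr Q))
    { reg := Function.update st.reg flag 1
      narr := st.narr
      farr := Function.update m L (writeVector l (m L)) }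

/-- `Exec D p st st' t q`: started in state `st`, the program `p` halts in state `st'` after `t`
steps, with `q` calls of the oracle `D`. A call on a `k × k` matrix is charged `k² + 1` steps. -/
inductive Exec (D : DiagOracle 𝕜) : Cmd → MState 𝕜 → MState 𝕜 → ℕ → ℕ → Prop
  | setReg (st : MState 𝕜) (i : ℕ) (e : NExp) :
      Exec D (Cmd.setReg i e) st (st.putReg i (e.val st)) 1 0
  | setNat (st : MState 𝕜) (A : ℕ) (idx : List ℕ) (e : NExp) :
      Exec D (Cmd.setNat A idx e) st
        (st.putNat A (idx.map st.reg) (e.val st)) 1 0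
  | setFld (st : MState 𝕜) (A : ℕ) (idx : List ℕ) (e : FExp) :
      Exec D (Cmd.setFld A idx e) st
        (st.putFld A (idx.map st.reg) (e.val st)) 1 0
  | seq {p p' : Cmd} {st st' st'' : MState 𝕜} {t t' q q' : ℕ}
      (h : Exec D p st st' t q) (h' : Exec D p' st' st'' t' q') :
      Exec D (Cmd.seq p p') st st'' (t + t') (q + q')
  | condTrue {b : Test} {p p' : Cmd} {st st' : MState 𝕜} {t q : ℕ} (hb : b.Holds st)
      (h : Exec D p st st' t q) : Exec D (Cmd.cond b p p') st st' (t + 1) q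
  | condFalse {b : Test} {p p' : Cmd} {st st' : MState 𝕜} {t q : ℕ} (hb : ¬ b.Holds st)
      (h : Exec D p' st st' t q) : Exec D (Cmd.cond b p p') st st' (t + 1) q
  | loopDone {b : Test} {p : Cmd} {st : MState 𝕜} (hb : ¬ b.Holds st) :
      Exec D (Cmd.loop b p) st st 1 0
  | loopStep {b : Test} {p : Cmd} {st st' st'' : MState 𝕜} {t t' q q' : ℕ} (hb : b.Holds st)
      (h : Exec D p st st' t q) (h' : Exec D (Cmd.loop b p) st' st'' t' q') :
      Exec D (Cmd.loop b p) st st'' (t + t' + 1) (q + q')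
  | diag (st : MState 𝕜) (A Q L k flag : ℕ) :
      Exec D (Cmd.diag A Q L k flag) st (st.afterDiag D A Q L k flag)
        (st.reg k * st.reg k + 1) 1

/-- A vector, continued by zeros. -/
def extendZero {N : ℕ} (f : Fin N → 𝕜) (i : ℕ) : 𝕜 :=
  if h : i < N then f ⟨i, h⟩ else 0

/-- The initial state: registers 0 to 3 hold `n₁, n₂, n₃, r`, field array 0 holds `T`, and field
arrays 1 and 2 hold the random vectors `f` and `g`. Everything else is zero. -/
def initState {n₁ n₂ n₃ N : ℕ} (r : ℕ) (T : TensorSpace 𝕜 n₁ n₂ n₃) (f g : Fin N → 𝕜) :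
    MState 𝕜 where
  reg := fun i => if i = 0 then n₁ else if i = 1 then n₂ else if i = 2 then n₃
    else if i = 3 then r else 0
  narr := fun _ _ => 0
  farr := fun A idx =>
    match A, idx with
    | 0, [i, j, k] =>
      if h : i < n₁ ∧ j < n₂ ∧ k < n₃ then T (⟨i, h.1⟩, ⟨j, h.2.1⟩) ⟨k, h.2.2⟩ else 0
    | 1, [i] => extendZero f i
    | 2, [i] => extendZero g i
    | _, _ => 0

/-- The output of a halting computation: `none` if register 0 holds zero; otherwise register 1
holds the number of terms, and field arrays 3 and 4 hold the `v a` and the `w a`. -/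
def readOutput (n₁ n₂ n₃ : ℕ) (st : MState 𝕜) : Option (BlockList 𝕜 n₁ n₂ n₃) :=
  if st.reg 0 = 0 then none
  else some
    { length := st.reg 1
      v := fun a i => st.farr 3 [(a : ℕ), (i.1 : ℕ), (i.2 : ℕ)]
      w := fun a k => st.farr 4 [(a : ℕ), (k : ℕ)] }

/-- On input `T`, and with random vectors `f` and `g`, the program `p` halts after `t` steps and
`q` calls of the oracle, with output `out`. -/
def Computes (D : DiagOracle 𝕜) (p : Cmd) {n₁ n₂ n₃ N : ℕ} (r : ℕ) (T : TensorSpace 𝕜 n₁ n₂ n₃)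
    (f g : Fin N → 𝕜) (t q : ℕ) (out : Option (BlockList 𝕜 n₁ n₂ n₃)) : Prop :=
  ∃ st, Exec D p (initState r T f g) st t q ∧ readOutput n₁ n₂ n₃ st = out

/-- The class of Lebesgue-null sets on pairs of vectors in `𝕜^N`, through a Haar measure. -/
def pairMeasure (𝕜 : Type*) [RCLike 𝕜] (N : ℕ) : Measure ((Fin N → 𝕜) × (Fin N → 𝕜)) :=
  (Measure.addHaar : Measure (Fin N → 𝕜)).prod Measure.addHaar

end BlockDecomp

end

open BlockDecomp

noncomputable section

namespace BlockDecomp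

set_option linter.unusedSectionVars false

open Finset (sum_congr mul_sum sum_comm univ sum_eq_single mem_univ sum_mul sum_range prod_congr
  prod_mul_distrib prod_range sum_sub_distrib sum_const sum_eq_zero sum_div)
open Submodule (span subset_span span_le span_union finrank_mono)
open Function (Injective update update_of_ne update_self ne_iff)
open Matrix (of diagonal of_apply)
open Set (range mem_iUnion)
open Equiv.Perm (sign)
open Equiv (Perm swap)
open Module (finrank)
open Bool (and_eq_true)
open Fintype (card card_fin sum_equiv)
open Pi (single)
open List (map_nil map_cons)
open Sum (inl inr)

variable {𝕜 : Type*} [RCLike 𝕜]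

section Mathematics

variable {n1 n2 n3 r R ℓ s d e N : ℕ} {v : Fin R → MatSpace 𝕜 n1 n2} {w : Fin R → Fin n3 → 𝕜} {u :
  Fin ℓ → MatSpace 𝕜 n1 n2} {P : Fin s → (Fin (r + 1) → Fin n1 × Fin n2) → 𝕜} {T : TensorSpace 𝕜
  n1 n2 n3}

/-! ## Independence of vectors over a ring of functions -/

lemma exists_det_ne_zero {m : ℕ} {C : Type*} [Finite C] {v : Fin m → C → 𝕜}
    (hv : LinearIndependent 𝕜 v) : ∃ e : Fin m → C, (of fun i j => v i (e j)).det ≠ 0 := by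
  classical
  have := Fintype.ofFinite C
  have hspan : span 𝕜 (range fun c i => v i c) = ⊤ := by
    have h1 : (of v).rank = m := by
      have := LinearIndependent.rank_matrix (M := of v) (by exact hv)
      simpa using this
    rw [Matrix.rank_eq_finrank_span_cols] at h1
    apply Submodule.eq_top_of_finrank_eq
    rw [Module.finrank_fin_fun]
    exact h1
  obtain ⟨κ, a, ha, hs, hl⟩ := exists_linearIndependent' 𝕜 (fun c i => v i c : C → Fin m → 𝕜)
  rw [hspan] at hs
  have : Finite κ := Finite.of_injective a ha
  have := Fintype.ofFinite κ
  let b := Module.Basis.mk hl hs.ge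
  have hcard : card κ = m := by
    have := Module.finrank_eq_card_basis b
    simpa using this.symm
  let ε : Fin m ≃ κ := (Fintype.equivFinOfCardEq hcard).symm
  refine ⟨a ∘ ε, ?_⟩
  have hl' := hl.comp ε ε.injective
  have h2 : IsUnit (of fun i j => v i ((a ∘ ε) j)).det := by
    rw [← Matrix.isUnit_iff_isUnit_det, ← Matrix.linearIndependent_cols_iff_isUnit]
    exact hl'
  exact h2.ne_zero

lemma linearIndependent_of_det_ne_zero {m : ℕ} {C : Type*} {v : Fin m → C → 𝕜} (e : Fin m → C)
    (h : (of fun i j => v i (e j)).det ≠ 0) : LinearIndependent 𝕜 v := by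
  have h2 : LinearIndependent 𝕜 (fun i j => v i (e j)) := by
    have : IsUnit (of fun i j => v i (e j)) := by rw [Matrix.isUnit_iff_isUnit_det]; exact h.isUnit
    exact Matrix.linearIndependent_rows_iff_isUnit.2 this
  exact LinearIndependent.of_comp (LinearMap.funLeft 𝕜 𝕜 e) h2

/-- Linear independence is an open condition on the points of a ring. -/
lemma exists_ne_zero_imp_linearIndependent {A : Type*} [CommRing A] {m : ℕ} {C : Type*} [Finite C]
    (v : Fin m → C → A) (φ : A →+* 𝕜) (h : LinearIndependent 𝕜 fun i c => φ (v i c)) :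
    ∃ a : A, φ a ≠ 0 ∧ ∀ ψ : A →+* 𝕜, ψ a ≠ 0 → LinearIndependent 𝕜 fun i c => ψ (v i c) := by
  obtain ⟨e, he⟩ := exists_det_ne_zero h
  have key : ∀ ψ : A →+* 𝕜, ψ (of fun i j => v i (e j)).det =
      (of fun i j => ψ (v i (e j))).det := by
    intro ψ
    rw [RingHom.map_det]
    rfl
  refine ⟨(of fun i j => v i (e j)).det, ?_, fun ψ hψ => ?_⟩
  · rw [key]; exact he
  rw [key] at hψ
  exact linearIndependent_of_det_ne_zero (v := fun i c => ψ (v i c)) e hψ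

/-! ## Arrays that are alternating in the rows and in the columns -/

section Alternating

/-- Arrays with `d` row indices and `d` column indices. -/
abbrev BiArray (𝕜 : Type*) (n1 n2 d : ℕ) : Type _ := (Fin d → Fin n1) → (Fin d → Fin n2) → 𝕜

/-- The arrays that are alternating in the row indices and in the column indices. -/
def altArrays (𝕜 : Type*) [RCLike 𝕜] (n1 n2 d : ℕ) : Submodule 𝕜 (BiArray 𝕜 n1 n2 d) where
  carrier := {F | (∀ (σ : Perm (Fin d)) s t, F (s ∘ σ) t = ((sign σ : ℤ) : 𝕜) * F s t) ∧
    ∀ (σ : Perm (Fin d)) s t, F s (t ∘ σ) = ((sign σ : ℤ) : 𝕜) * F s t}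
  add_mem' := by
    rintro F G ⟨hF, hF'⟩ ⟨hG, hG'⟩
    refine ⟨fun σ s t => ?_, fun σ s t => ?_⟩
    · simp only [Pi.add_apply, hF σ, hG σ, mul_add]
    simp only [Pi.add_apply, hF' σ, hG' σ, mul_add]
  zero_mem' := by simp
  smul_mem' := by
    rintro c F ⟨hF, hF'⟩
    refine ⟨fun σ s t => ?_, fun σ s t => ?_⟩
    · simp only [Pi.smul_apply, hF σ, smul_eq_mul]; ring
    simp only [Pi.smul_apply, hF' σ, smul_eq_mul]; ring

lemma sign_cast_ne_zero (σ : Perm (Fin d)) : ((sign σ : ℤ) : 𝕜) ≠ 0 := by simp_all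

lemma eq_zero_of_not_injective {α : Type*} {φ : (Fin d → α) → 𝕜}
    (hφ : ∀ (σ : Perm (Fin d)) s, φ (s ∘ σ) = ((sign σ : ℤ) : 𝕜) * φ s)
    {s : Fin d → α} (hs : ¬ Injective s) : φ s = 0 := by
  simp only [Injective, not_forall] at hs
  obtain ⟨i, j, hij, hne⟩ := hs
  have h := hφ (swap i j) s
  have h2 : s ∘ swap i j = s := by grind
  rw [h2, Equiv.Perm.sign_swap hne] at h
  simp only [Units.val_neg, Units.val_one, Int.cast_neg, Int.cast_one, neg_mul, one_mul] at h
  grind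

/-- Contraction of the first row and column index with a matrix. -/
def contr {d : ℕ} (z : MatSpace 𝕜 n1 n2) : BiArray 𝕜 n1 n2 (d + 1) →ₗ[𝕜] BiArray 𝕜 n1 n2 d where
  toFun F s t := ∑ p : Fin n1 × Fin n2, z p * F (Fin.cons p.1 s) (Fin.cons p.2 t)
  map_add' F G := by
    funext s t
    simp only [Pi.add_apply, mul_add, Finset.sum_add_distrib]
  map_smul' c F := by
    funext s t
    simp only [Pi.smul_apply, smul_eq_mul, RingHom.id_apply, mul_sum]
    grind

lemma contr_apply (z : MatSpace 𝕜 n1 n2) (F : BiArray 𝕜 n1 n2 (d + 1)) (s t) :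
    contr z F s t = ∑ p : Fin n1 × Fin n2, z p * F (Fin.cons p.1 s) (Fin.cons p.2 t) := rfl

lemma cons_comp_perm {α : Type*} (i : α) (s : Fin d → α) (σ : Perm (Fin d)) :
    (Fin.cons i (s ∘ σ) : Fin (d + 1) → α) =
      Fin.cons i s ∘ Equiv.Perm.decomposeFin.symm (0, σ) := by
  funext k
  refine Fin.cases ?_ (fun k => ?_) k
  · simp
  simp

lemma contr_mem (z : MatSpace 𝕜 n1 n2) {F : BiArray 𝕜 n1 n2 (d + 1)}
    (hF : F ∈ altArrays 𝕜 n1 n2 (d + 1)) : contr z F ∈ altArrays 𝕜 n1 n2 d := by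
  refine ⟨fun σ s t => ?_, fun σ s t => ?_⟩
  · simp only [contr_apply, cons_comp_perm, hF.1, mul_sum]
    refine sum_congr rfl fun p _ => ?_
    simp
    ring
  simp only [contr_apply, cons_comp_perm, hF.2, mul_sum]
  refine sum_congr rfl fun p _ => ?_
  simp
  ring

/-- The pairing of an array with a product of matrices. -/
def pair {d : ℕ} (F : BiArray 𝕜 n1 n2 d) (z : Fin d → MatSpace 𝕜 n1 n2) : 𝕜 :=
  ∑ s, ∑ t, F s t * ∏ k, z k (s k, t k)

lemma sum_cons {α : Type*} [Fintype α] (φ : (Fin (d + 1) → α) → 𝕜) :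
    ∑ s, φ s = ∑ i, ∑ s : Fin d → α, φ (Fin.cons i s) := by
  rw [← Fintype.sum_prod_type']
  exact (sum_equiv (Fin.consEquiv fun _ => α) _ _ fun _ => rfl).symm

lemma pair_succ (F : BiArray 𝕜 n1 n2 (d + 1)) (z : Fin (d + 1) → MatSpace 𝕜 n1 n2) :
    pair F z = pair (contr (z 0) F) (fun k => z k.succ) := by
  simp only [pair, contr_apply, sum_cons, Fin.prod_univ_succ, Fin.cons_zero, Fin.cons_succ,
    Fintype.sum_prod_type, sum_mul]
  rw [sum_comm]
  refine sum_congr rfl fun s _ => ?_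
  rw [Finset.sum_comm' (t' := univ) (s' := fun _ => univ) (by simp)]
  simp_rw [sum_comm (s := (univ : Finset (Fin d → Fin n2)))]
  rw [sum_comm]
  grind

lemma pair_add (F G : BiArray 𝕜 n1 n2 d) (z) : pair (F + G) z = pair F z + pair G z := by
  simp only [pair, Pi.add_apply, add_mul, Finset.sum_add_distrib]

lemma pair_smul (c : 𝕜) (F : BiArray 𝕜 n1 n2 d) (z) : pair (c • F) z = c * pair F z := by
  simp only [pair, Pi.smul_apply, smul_eq_mul, mul_sum, mul_assoc]

lemma pair_zero_left (z : Fin d → MatSpace 𝕜 n1 n2) : pair 0 z = 0 := by simp [pair]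

/-- The product of a column and a row. -/
def outer (x : Fin n1 → 𝕜) (y : Fin n2 → 𝕜) : MatSpace 𝕜 n1 n2 := fun p => x p.1 * y p.2

/-! ### Averaging over the contractions with unit matrices -/

lemma exists_coords {E : Type*} {ι : Type} [AddCommGroup E] [Module 𝕜 E] [FiniteDimensional 𝕜 E]
    (φ : ι → Module.Dual 𝕜 E) (hφ : ∀ x, (∀ i, φ i x = 0) → x = 0) :
    ∃ (κ : Type) (_ : Fintype κ) (a : κ → ι), LinearIndependent 𝕜 (φ ∘ a) ∧
      card κ = finrank 𝕜 E := by
  obtain ⟨κ, a, ha, hs, hl⟩ := exists_linearIndependent' 𝕜 φ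
  have := hl.finite
  have : Fintype κ := Fintype.ofFinite κ
  refine ⟨κ, this, a, hl, ?_⟩
  have htop : span 𝕜 (range φ) = ⊤ := by
    have h1 : (span 𝕜 (range φ)).dualCoannihilator = ⊥ := by
      rw [eq_bot_iff]
      intro x hx
      rw [Submodule.mem_dualCoannihilator] at hx
      exact hφ x fun i => hx _ (subset_span ⟨i, rfl⟩)
    have h2 := Subspace.dualCoannihilator_dualAnnihilator_eq (W := span 𝕜 (range φ))
    simp_all
  rw [htop] at hs
  have := Module.finrank_eq_card_basis (Module.Basis.mk hl hs.ge)
  simp_all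

lemma exists_perm_head {α : Type*} (s : Fin (d + 1) → α) {i : α}
    (hi : i ∈ range s) : ∃ (σ : Perm (Fin (d + 1))) (s' : Fin d → α), s ∘ σ = Fin.cons i s' := by
  obtain ⟨k, rfl⟩ := hi
  refine ⟨swap 0 k, Fin.tail (s ∘ swap 0 k), ?_⟩
  conv_lhs => rw [← Fin.cons_self_tail (s ∘ swap 0 k)]
  simp

lemma contr_single (p : Fin n1 × Fin n2) (F : BiArray 𝕜 n1 n2 (d + 1)) (s t) :
    contr (single p 1) F s t = F (Fin.cons p.1 s) (Fin.cons p.2 t) := by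
  rw [contr_apply, sum_eq_single p]
  · simp
  · grind
  simp

lemma card_le_finrank_map {E E' κ : Type*} [AddCommGroup E] [Module 𝕜 E] [AddCommGroup E']
    [Module 𝕜 E'] [Fintype κ] (g : E →ₗ[𝕜] E') (K : Submodule 𝕜 E) [FiniteDimensional 𝕜 K]
    (φ : κ → Module.Dual 𝕜 K) (hφ : LinearIndependent 𝕜 φ)
    (h : ∀ c, ∃ (ψ : Module.Dual 𝕜 E') (u : 𝕜), u ≠ 0 ∧ ∀ x : K, ψ (g x) = u * φ c x) :
    card κ ≤ finrank 𝕜 (K.map g) := by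
  choose ψ u hu hψ using h
  let g' : K →ₗ[𝕜] K.map g := g.restrict fun x hx => Submodule.mem_map_of_mem hx
  let ψ' : κ → Module.Dual 𝕜 (K.map g) := fun c => (ψ c).comp (K.map g).subtype
  have h1 : LinearIndependent 𝕜 ψ' := by
    refine LinearIndependent.of_comp g'.dualMap ?_
    have h2 := hφ.units_smul (fun c => Units.mk0 (u c) (hu c))
    convert h2 using 1
    funext c
    refine LinearMap.ext fun x => ?_
    exact hψ c x
  have h3 := h1.fintype_card_le_finrank
  simp_all

/-- The entry of an array as a functional. -/
def entryDual {d : ℕ} (s : Fin d → Fin n1) (t : Fin d → Fin n2) :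
    Module.Dual 𝕜 (BiArray 𝕜 n1 n2 d) where
  toFun F := F s t
  map_add' _ _ := rfl
  map_smul' _ _ := rfl

lemma entryDual_apply (s : Fin d → Fin n1) (t : Fin d → Fin n2)
    (F : BiArray 𝕜 n1 n2 d) : entryDual s t F = F s t := rfl

lemma sum_finrank_contr (K : Submodule 𝕜 (BiArray 𝕜 n1 n2 (d + 1)))
    (hK : K ≤ altArrays 𝕜 n1 n2 (d + 1)) :
    (d + 1) ^ 2 * finrank 𝕜 K ≤ ∑ p : Fin n1 × Fin n2, finrank 𝕜 (K.map (contr (single p 1))) := by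
  classical
  let φ : (Fin (d + 1) → Fin n1) × (Fin (d + 1) → Fin n2) → Module.Dual 𝕜 K := fun q =>
    (entryDual q.1 q.2).comp K.subtype
  have hφ : ∀ q (x : K), φ q x = x.1 q.1 q.2 := fun _ _ => rfl
  obtain ⟨κ, _, a, hl, hcard⟩ := exists_coords φ (fun x hx => by
    apply Subtype.ext
    funext s t
    simp_all)
  have hinj : ∀ c, Injective (a c).1 ∧ Injective (a c).2 := by
    intro c
    have h0 := hl.ne_zero c
    constructor <;> by_contra hni <;> apply h0 <;> refine LinearMap.ext fun x => ?_
    · exact eq_zero_of_not_injective (φ := fun s => x.1 s (a c).2) (fun σ s => (hK x.2).1 σ s _) hni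
    exact eq_zero_of_not_injective (φ := fun t => x.1 (a c).1 t) (fun σ t => (hK x.2).2 σ _ t) hni
  have hle : ∀ p : Fin n1 × Fin n2,
      (Finset.univ.filter fun c : κ => p.1 ∈ range (a c).1 ∧ p.2 ∈ range (a c).2).card ≤
        finrank 𝕜 (K.map (contr (single p 1))) := by
    intro p
    have h := card_le_finrank_map (contr (single p 1)) K (fun c : ↥(Finset.univ.filter fun c : κ =>
        p.1 ∈ range (a c).1 ∧ p.2 ∈ range (a c).2) => φ (a c.1))
      (hl.comp _ Subtype.val_injective)
    rw [Fintype.card_coe] at h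
    refine h ?_
    rintro ⟨c, hc⟩
    obtain ⟨h1, h2⟩ := (Finset.mem_filter.1 hc).2
    obtain ⟨σ, s', hs⟩ := exists_perm_head _ h1
    obtain ⟨τ, t', ht⟩ := exists_perm_head _ h2
    refine ⟨entryDual s' t', ((sign σ : ℤ) : 𝕜) * ((sign τ : ℤ) : 𝕜),
      mul_ne_zero (sign_cast_ne_zero σ) (sign_cast_ne_zero τ), fun x => ?_⟩
    rw [entryDual_apply, hφ, contr_single, ← hs, ← ht, (hK x.2).1, (hK x.2).2]
    ring
  refine le_trans ?_ (Finset.sum_le_sum fun p _ => hle p)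
  simp only [Finset.card_filter]
  rw [sum_comm]
  have hone : ∀ c : κ, (∑ p : Fin n1 × Fin n2,
      if p.1 ∈ range (a c).1 ∧ p.2 ∈ range (a c).2 then 1 else 0) = (d + 1) ^ 2 := by
    intro c
    rw [← Finset.card_filter]
    have : (Finset.univ.filter fun p : Fin n1 × Fin n2 =>
        p.1 ∈ range (a c).1 ∧ p.2 ∈ range (a c).2) =
        (Finset.univ.image (a c).1) ×ˢ (Finset.univ.image (a c).2) := by
      ext p; simp
    rw [this, Finset.card_product, Finset.card_image_of_injective _ (hinj c).1,
      Finset.card_image_of_injective _ (hinj c).2]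
    simp [sq]
  simp only [hone, sum_const, Finset.card_univ, smul_eq_mul, hcard]
  rw [mul_comm]

lemma exists_finrank_contr (K : Submodule 𝕜 (BiArray 𝕜 n1 n2 (d + 1)))
    (hK : K ≤ altArrays 𝕜 n1 n2 (d + 1)) (hn : 0 < n1 * n2) :
    ∃ x y, (d + 1) ^ 2 * finrank 𝕜 K ≤ n1 * n2 * finrank 𝕜 (K.map (contr (outer x y))) := by
  classical
  have : Nonempty (Fin n1 × Fin n2) :=
    ⟨(⟨0, Nat.pos_of_mul_pos_right hn⟩, ⟨0, Nat.pos_of_mul_pos_left hn⟩)⟩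
  have h := sum_finrank_contr K hK
  obtain ⟨p, hp⟩ : ∃ p : Fin n1 × Fin n2, (d + 1) ^ 2 * finrank 𝕜 K ≤
      n1 * n2 * finrank 𝕜 (K.map (contr (single p 1))) := by
    by_contra! hcon
    have h2 := Finset.sum_lt_sum_of_nonempty (s := (univ : Finset (Fin n1 × Fin n2)))
      Finset.univ_nonempty fun p _ => hcon p
    rw [← mul_sum] at h2
    simp only [sum_const, Finset.card_univ, Fintype.card_prod, card_fin, smul_eq_mul] at h2
    exact absurd (Nat.mul_le_mul_left (n1 * n2) h) (not_le.2 h2)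
  refine ⟨single p.1 1, single p.2 1, ?_⟩
  have : outer (single p.1 1) (single p.2 1) = (single p 1 : MatSpace 𝕜 n1 n2) := by
    funext q
    simp only [outer, Pi.single_apply, Prod.ext_iff]
    grind
  rwa [this]

lemma finrank_altArrays_le (d : ℕ) (hn : 0 < n1 * n2) :
    finrank 𝕜 (altArrays 𝕜 n1 n2 d) * (d.factorial) ^ 2 ≤ (n1 * n2) ^ d := by
  induction d with
  | zero =>
    have := Submodule.finrank_le (altArrays 𝕜 n1 n2 0)
    rw [Module.finrank_pi_fintype] at this
    simpa using this
  | succ d ih =>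
    obtain ⟨x, y, hxy⟩ := exists_finrank_contr (altArrays 𝕜 n1 n2 (d + 1)) le_rfl hn
    have h1 : finrank 𝕜 ((altArrays 𝕜 n1 n2 (d + 1)).map (contr (outer x y))) ≤
        finrank 𝕜 (altArrays 𝕜 n1 n2 d) := by
      apply finrank_mono
      rintro _ ⟨F, hF, rfl⟩
      exact contr_mem _ hF
    calc _ = ((d + 1) ^ 2 * finrank 𝕜 (altArrays 𝕜 n1 n2 (d + 1))) * d.factorial ^ 2 := by
          rw [Nat.factorial_succ]; ring
      _ ≤ (n1 * n2 * finrank 𝕜 (altArrays 𝕜 n1 n2 d)) * d.factorial ^ 2 :=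
          Nat.mul_le_mul_right _ (hxy.trans (Nat.mul_le_mul_left _ h1))
      _ ≤ (n1 * n2) * (n1 * n2) ^ d := by rw [mul_assoc]; simp_all
      _ = _ := by ring

end Alternating

section Alternating

/-! ### Rank-one matrices in general position -/

/-- Contraction with the product of a column and a row does not decrease the dimension of `K` by
more than the factor `(e + 1) ^ 2 / (n1 * n2)`. -/
def LargeContr (z : MatSpace 𝕜 n1 n2) : (d : ℕ) → Submodule 𝕜 (BiArray 𝕜 n1 n2 d) → Prop
  | 0, _ => True
  | e + 1, K => (e + 1) ^ 2 * finrank 𝕜 K ≤ n1 * n2 * finrank 𝕜 (K.map (contr z))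

lemma exists_poly_largeContr (hn : 0 < n1 * n2) (d : ℕ) (K : Submodule 𝕜 (BiArray 𝕜 n1 n2 d))
    (hK : K ≤ altArrays 𝕜 n1 n2 d) :
    ∃ a : MvPolynomial (Fin n1 ⊕ Fin n2) 𝕜, a ≠ 0 ∧ ∀ xy : Fin n1 ⊕ Fin n2 → 𝕜,
      MvPolynomial.eval xy a ≠ 0 → LargeContr (outer (xy ∘ inl) (xy ∘ inr)) d K := by
  rcases d with _ | d
  · exact ⟨1, one_ne_zero, fun _ _ => trivial⟩
  obtain ⟨x, y, hxy⟩ := exists_finrank_contr K hK hn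
  obtain ⟨v, hv⟩ := exists_linearIndependent_of_le_finrank
    (le_refl (finrank 𝕜 (K.map (contr (outer x y)))))
  have hv2 : LinearIndependent 𝕜 fun i => (v i).1 :=
    hv.map' (Submodule.subtype _) (Submodule.ker_subtype _)
  choose F hFK hF using fun i => (v i).2
  let V : Fin (finrank 𝕜 (K.map (contr (outer x y)))) →
      (Fin d → Fin n1) × (Fin d → Fin n2) → MvPolynomial (Fin n1 ⊕ Fin n2) 𝕜 := fun i q =>
    ∑ p : Fin n1 × Fin n2, X (inl p.1) * X (inr p.2) * C (F i (Fin.cons p.1 q.1) (Fin.cons p.2 q.2))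
  have hV : ∀ xy : Fin n1 ⊕ Fin n2 → 𝕜, (fun i q => MvPolynomial.eval xy (V i q)) =
      fun i q => contr (outer (xy ∘ inl) (xy ∘ inr)) (F i) q.1 q.2 := by
    intro xy
    funext i q
    simp [V, contr_apply, outer]
  have hcurry : ∀ {m : ℕ} (w : Fin m → BiArray 𝕜 n1 n2 d),
      LinearIndependent 𝕜 (fun i (q : (Fin d → Fin n1) × (Fin d → Fin n2)) => w i q.1 q.2) ↔
        LinearIndependent 𝕜 w := fun w =>
    LinearMap.linearIndependent_iff (LinearEquiv.curry 𝕜 𝕜 (Fin d → Fin n1)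
      (Fin d → Fin n2)).symm.toLinearMap (LinearEquiv.ker _) (v := w)
  obtain ⟨a, ha, ha'⟩ := exists_ne_zero_imp_linearIndependent V
    (MvPolynomial.eval (Sum.elim x y)) (by simp_all)
  refine ⟨a, fun h => ha (by rw [h, map_zero]), fun xy h => ?_⟩
  have h2 := ha' _ h
  rw [hV, hcurry] at h2
  refine hxy.trans (Nat.mul_le_mul_left _ ?_)
  have h3 : LinearIndependent 𝕜 fun i => (⟨contr (outer (xy ∘ inl) (xy ∘ inr)) (F i),
      Submodule.mem_map_of_mem (hFK i)⟩ : K.map (contr (outer (xy ∘ inl) (xy ∘ inr)))) :=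
    LinearIndependent.of_comp (Submodule.subtype _) h2
  simpa using h3.fintype_card_le_finrank

lemma exists_eval_ne_zero {σ : Type*} {a : MvPolynomial σ 𝕜} (ha : a ≠ 0) :
    ∃ x, MvPolynomial.eval x a ≠ 0 := by
  by_contra! h
  exact ha (MvPolynomial.funext fun x => by simpa using h x)

lemma exists_largeContr (hn : 0 < n1 * n2) {κ : Type*} [Finite κ] (d : κ → ℕ)
    (K : ∀ k, Submodule 𝕜 (BiArray 𝕜 n1 n2 (d k))) (hK : ∀ k, K k ≤ altArrays 𝕜 n1 n2 (d k)) :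
    ∃ x y, ∀ k, LargeContr (outer x y) (d k) (K k) := by
  have := Fintype.ofFinite κ
  choose a ha ha' using fun k => exists_poly_largeContr hn (d k) (K k) (hK k)
  obtain ⟨xy, hxy⟩ := exists_eval_ne_zero (Finset.prod_ne_zero_iff.2 fun k (_ : k ∈ univ) => ha k)
  rw [map_prod, Finset.prod_ne_zero_iff] at hxy
  exact ⟨_, _, fun k => ha' k xy (hxy k (mem_univ k))⟩

/-- The products of the matrices `z`, over increasing sequences, are independent as functionals
on `K`. -/
def Separates {M : ℕ} (z : Fin M → MatSpace 𝕜 n1 n2) (d : ℕ)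
    (K : Submodule 𝕜 (BiArray 𝕜 n1 n2 d)) : Prop :=
  ∀ c : (Fin d → Fin M) → 𝕜, ∃ F ∈ K, ∀ s, StrictMono s → pair F (z ∘ s) = c s

/-- A lower bound for the dimension of `K`, which is sufficient for the existence of `M` matrices of
rank one with independent products. -/
def IsLarge (M : ℕ) : (d : ℕ) → Submodule 𝕜 (BiArray 𝕜 n1 n2 d) → Prop
  | 0, K => K ≠ ⊥
  | e + 1, K => (n1 * n2) ^ e * M ≤ finrank 𝕜 K * e.factorial ^ 2

/-- The part of `K` that is killed by the contraction with `z`. -/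
def kerPart (z : MatSpace 𝕜 n1 n2) :
    (d : ℕ) → Submodule 𝕜 (BiArray 𝕜 n1 n2 d) → Submodule 𝕜 (BiArray 𝕜 n1 n2 d)
  | 0, K => K
  | _ + 1, K => K ⊓ LinearMap.ker (contr z)

/-- The image of `K` under the contraction with `z`. -/
def imPart (z : MatSpace 𝕜 n1 n2) :
    (d : ℕ) → Submodule 𝕜 (BiArray 𝕜 n1 n2 d) → Submodule 𝕜 (BiArray 𝕜 n1 n2 (d - 1))
  | 0, K => K
  | _ + 1, K => K.map (contr z)

lemma kerPart_le (z : MatSpace 𝕜 n1 n2) (d : ℕ) (K : Submodule 𝕜 (BiArray 𝕜 n1 n2 d)) :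
    kerPart z d K ≤ K := by
  rcases d with _ | d
  · exact le_rfl
  exact inf_le_left

lemma imPart_le (z : MatSpace 𝕜 n1 n2) (d : ℕ) (K : Submodule 𝕜 (BiArray 𝕜 n1 n2 d))
    (hK : K ≤ altArrays 𝕜 n1 n2 d) : imPart z d K ≤ altArrays 𝕜 n1 n2 (d - 1) := by
  rcases d with _ | d
  · exact hK
  rintro _ ⟨F, hF, rfl⟩
  exact contr_mem _ (hK hF)

lemma finrank_kerPart_add (z : MatSpace 𝕜 n1 n2) (d : ℕ)
    (K : Submodule 𝕜 (BiArray 𝕜 n1 n2 (d + 1))) :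
    finrank 𝕜 (kerPart z (d + 1) K) + finrank 𝕜 (K.map (contr z)) = finrank 𝕜 K := by
  have h := LinearMap.finrank_range_add_finrank_ker ((contr z).domRestrict K)
  rw [LinearMap.range_domRestrict, LinearMap.ker_domRestrict] at h
  rw [← h, add_comm]
  congr 1
  rw [← LinearMap.finrank_range_of_inj (f := K.subtype.comp (Submodule.subtype _))
    (K.injective_subtype.comp (Submodule.injective_subtype _))]
  rw [LinearMap.range_comp, Submodule.range_subtype, Submodule.map_comap_subtype]
  rfl

lemma IsLarge.kerPart {z : MatSpace 𝕜 n1 n2} (hn : 0 < n1 * n2) {M : ℕ}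
    {K : Submodule 𝕜 (BiArray 𝕜 n1 n2 d)} (hK : K ≤ altArrays 𝕜 n1 n2 d)
    (h : IsLarge (M + 1) d K) : IsLarge M d (kerPart z d K) := by
  rcases d with _ | d
  · exact h
  have h1 := finrank_kerPart_add z d K
  have h2 : finrank 𝕜 (K.map (contr z)) ≤ finrank 𝕜 (altArrays 𝕜 n1 n2 d) :=
    finrank_mono (imPart_le z (d + 1) K hK)
  have h3 := finrank_altArrays_le (𝕜 := 𝕜) d hn
  simp only [IsLarge] at h ⊢
  rw [← h1] at h
  have h4 := Nat.mul_le_mul_right (d.factorial ^ 2) h2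
  nlinarith

lemma IsLarge.imPart {z : MatSpace 𝕜 n1 n2} (hn : 0 < n1 * n2) {M : ℕ}
    {K : Submodule 𝕜 (BiArray 𝕜 n1 n2 d)} (hz : LargeContr z d K)
    (h : IsLarge (M + 1) d K) : IsLarge M (d - 1) (imPart z d K) := by
  rcases d with _ | _ | d
  · exact h
  · intro hbot
    have hbot' : K.map (contr z) = ⊥ := hbot
    simp only [IsLarge, LargeContr] at hz h
    rw [hbot'] at hz
    simp only [finrank_bot, mul_zero, Nat.le_zero, mul_eq_zero] at hz
    grind
  change (n1 * n2) ^ d * M ≤ finrank 𝕜 (K.map (contr z)) * d.factorial ^ 2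
  simp only [IsLarge, LargeContr] at hz h
  generalize finrank 𝕜 (K.map (contr z)) = j at *
  generalize finrank 𝕜 K = k at *
  rw [Nat.factorial_succ, pow_succ] at h
  refine Nat.le_of_mul_le_mul_left (c := n1 * n2) ?_ hn
  calc n1 * n2 * ((n1 * n2) ^ d * M) ≤ (n1 * n2) ^ d * (n1 * n2) * (M + 1) := by grind
    _ ≤ k * ((d + 1) * d.factorial) ^ 2 := h
    _ ≤ ((d + 1 + 1) ^ 2 * k) * d.factorial ^ 2 := by grind
    _ ≤ (n1 * n2 * j) * d.factorial ^ 2 := Nat.mul_le_mul_right _ hz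
    _ = _ := by ring

lemma strictMono_cases {M : ℕ} {s : Fin (d + 1) → Fin (M + 1)} (hs : StrictMono s) :
    (∃ s' : Fin d → Fin M, StrictMono s' ∧ s = Fin.cons 0 (Fin.succ ∘ s')) ∨
      ∃ s' : Fin (d + 1) → Fin M, StrictMono s' ∧ s = Fin.succ ∘ s' := by
  have hpos : ∀ k : Fin d, s k.succ ≠ 0 := fun k =>
    (lt_of_le_of_lt (Fin.zero_le _) (hs (Fin.succ_pos k))).ne'
  by_cases h0 : s 0 = 0
  · left
    refine ⟨fun k => (s k.succ).pred (hpos k), fun i j hij => ?_, ?_⟩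
    · exact Fin.pred_lt_pred_iff.2 (hs (Fin.succ_lt_succ_iff.2 hij))
    funext k
    refine Fin.cases ?_ (fun k => ?_) k
    · simpa using h0
    simp
  right
  have hpos' : ∀ k, s k ≠ 0 := fun k => Fin.cases h0 hpos k
  refine ⟨fun k => (s k).pred (hpos' k), fun i j hij => Fin.pred_lt_pred_iff.2 (hs hij), ?_⟩
  funext k
  simp

lemma Separates.cons {M : ℕ} {z₀ : MatSpace 𝕜 n1 n2} {z : Fin M → MatSpace 𝕜 n1 n2}
    {K : Submodule 𝕜 (BiArray 𝕜 n1 n2 d)} (h1 : Separates z d (kerPart z₀ d K))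
    (h2 : Separates z (d - 1) (imPart z₀ d K)) :
    Separates (Fin.cons z₀ z : Fin (M + 1) → MatSpace 𝕜 n1 n2) d K := by
  rcases d with _ | d
  · intro c
    obtain ⟨F, hF, hc⟩ := h1 fun _ => c finZeroElim
    refine ⟨F, hF, fun s _ => ?_⟩
    have := hc finZeroElim (fun i => i.elim0)
    rw [Subsingleton.elim s finZeroElim, ← this]
    simp [pair]
  intro c
  obtain ⟨_, ⟨F, hF, rfl⟩, hcF⟩ : ∃ G ∈ K.map (contr z₀), ∀ s : Fin d → Fin M, StrictMono s →
        pair G (z ∘ s) = c (Fin.cons 0 (Fin.succ ∘ s)) := h2 fun s => c (Fin.cons 0 (Fin.succ ∘ s))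
  obtain ⟨G, ⟨hG, hG0⟩, hcG⟩ := h1 fun s => c (Fin.succ ∘ s) - pair F (z ∘ s)
  refine ⟨F + G, K.add_mem hF hG, fun s hs => ?_⟩
  rw [pair_add]
  rcases strictMono_cases hs with ⟨s', hs', rfl⟩ | ⟨s', hs', rfl⟩
  · have hG' : contr z₀ G = 0 := hG0
    rw [pair_succ, pair_succ]
    have hz : (Fin.cons z₀ z ∘ Fin.cons 0 (Fin.succ ∘ s') : Fin (d + 1) → MatSpace 𝕜 n1 n2) 0 = z₀ :=
      rfl
    rw [hz, hG', pair_zero_left, add_zero]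
    exact hcF s' hs'
  have hz : (Fin.cons z₀ z ∘ (Fin.succ ∘ s') : Fin (d + 1) → MatSpace 𝕜 n1 n2) = z ∘ s' := rfl
  grind

lemma separates_zero {z : Fin 0 → MatSpace 𝕜 n1 n2}
    {K : Submodule 𝕜 (BiArray 𝕜 n1 n2 d)} (h : IsLarge 0 d K) : Separates z d K := by
  rcases d with _ | d
  · intro c
    obtain ⟨F, hF, hF0⟩ := Submodule.exists_mem_ne_zero_of_ne_bot h
    have h0 : pair F (z ∘ finZeroElim) ≠ 0 := by
      intro h1
      apply hF0
      funext s t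
      rw [Subsingleton.elim s finZeroElim, Subsingleton.elim t finZeroElim]
      simpa [pair, Subsingleton.elim (default : Fin 0 → _) finZeroElim] using h1
    refine ⟨(c finZeroElim / pair F (z ∘ finZeroElim)) • F, K.smul_mem _ hF, fun s _ => ?_⟩
    rw [Subsingleton.elim s finZeroElim, pair_smul, div_mul_cancel₀ _ h0]
  exact fun c => ⟨0, K.zero_mem, fun s => (s 0).elim0⟩

lemma exists_separates (hn : 0 < n1 * n2) (M : ℕ) : ∀ {κ : Type} [Finite κ] (d : κ → ℕ)
    (K : ∀ k, Submodule 𝕜 (BiArray 𝕜 n1 n2 (d k))), (∀ k, K k ≤ altArrays 𝕜 n1 n2 (d k)) →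
    (∀ k, IsLarge M (d k) (K k)) →
    ∃ (x : Fin M → Fin n1 → 𝕜) (y : Fin M → Fin n2 → 𝕜),
      ∀ k, Separates (fun a => outer (x a) (y a)) (d k) (K k) := by
  induction M with
  | zero =>
    intro κ _ d K hK hl
    refine ⟨finZeroElim, finZeroElim, fun k => separates_zero (hl k)⟩
  | succ M ih =>
    intro κ _ d K hK hl
    obtain ⟨x₀, y₀, h0⟩ := exists_largeContr hn d K hK
    obtain ⟨x, y, hxy⟩ := ih (κ := κ ⊕ κ) (Sum.elim d fun k => d k - 1) (fun k => match k with
        | inl k => kerPart (outer x₀ y₀) (d k) (K k)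
        | inr k => imPart (outer x₀ y₀) (d k) (K k))
      (by
        rintro (k | k)
        · exact (kerPart_le _ _ _).trans (hK k)
        exact imPart_le _ _ _ (hK k))
      (by
        rintro (k | k)
        · exact (hl k).kerPart hn (hK k)
        exact (hl k).imPart hn (h0 k))
    refine ⟨Fin.cons (α := fun _ => Fin n1 → 𝕜) x₀ x, Fin.cons (α := fun _ => Fin n2 → 𝕜) y₀ y, fun k => ?_⟩
    have h := Separates.cons (hxy (inl k)) (hxy (inr k))
    have hz : (fun a => outer (Fin.cons (α := fun _ => Fin n1 → 𝕜) x₀ x a)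
        (Fin.cons (α := fun _ => Fin n2 → 𝕜) y₀ y a)) =
        Fin.cons (outer x₀ y₀) fun a => outer (x a) (y a) := by
      funext a
      refine Fin.cases ?_ (fun a => ?_) a <;> simp
    grind

end Alternating

/-! ## Minors as alternating arrays -/

section Minors

/-- The sign of the permutation that takes `s` to `s'`, for injective `s`; zero if there is none. -/
def altSign (𝕜 : Type*) [RCLike 𝕜] {α : Type*} [DecidableEq α] {d : ℕ} (s s' : Fin d → α) : 𝕜 :=
  (of fun k l => if s' k = s l then (1 : 𝕜) else 0).det

section

variable {α : Type*} [DecidableEq α] {d : ℕ}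

lemma altSign_comp_right (s s' : Fin d → α) (σ : Perm (Fin d)) :
    altSign 𝕜 s (s' ∘ σ) = ((sign σ : ℤ) : 𝕜) * altSign 𝕜 s s' := by
  have := Matrix.det_permute σ (of fun k l => if s' k = s l then (1 : 𝕜) else 0)
  exact this

lemma altSign_comp_left (s s' : Fin d → α) (σ : Perm (Fin d)) :
    altSign 𝕜 (s ∘ σ) s' = ((sign σ : ℤ) : 𝕜) * altSign 𝕜 s s' := by
  have := Matrix.det_permute' σ (of fun k l => if s' k = s l then (1 : 𝕜) else 0)
  exact this

lemma altSign_eq_sum (s s' : Fin d → α) : altSign 𝕜 s s' = ∑ σ : Perm (Fin d),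
      if s' = s ∘ σ then ((sign σ : ℤ) : 𝕜) else 0 := by
  rw [altSign, ← Matrix.det_transpose, Matrix.det_apply']
  refine sum_congr rfl fun σ _ => ?_
  simp only [Matrix.transpose_apply, of_apply]
  split_ifs with h
  · simp_all
  obtain ⟨k, hk⟩ := Function.ne_iff.1 h
  rw [Finset.prod_eq_zero (mem_univ k) (if_neg hk), mul_zero]

lemma altSign_eq_zero_of_not_injective_left {s s' : Fin d → α} (hs : ¬ Injective s) :
    altSign 𝕜 s s' = 0 :=
  eq_zero_of_not_injective (φ := fun s => altSign 𝕜 s s') (fun σ s => altSign_comp_left s s' σ) hs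

lemma altSign_strictMono {n : ℕ} (I I' : Fin d ↪o Fin n) :
    altSign 𝕜 (I : Fin d → Fin n) I' = if I = I' then 1 else 0 := by
  rw [altSign_eq_sum, sum_eq_single 1]
  · simp only [Equiv.Perm.coe_one, Function.comp_id, Equiv.Perm.sign_one, Units.val_one,
      Int.cast_one, DFunLike.coe_fn_eq]
    grind
  · intro σ _ hσ
    rw [if_neg]
    intro h
    apply hσ
    have h1 : (I' : Fin d → Fin n) = I := by
      rw [← StrictMono.range_inj I'.strictMono I.strictMono, h, Set.range_comp, σ.range_eq_univ,
        Set.image_univ]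
    ext k
    have := congrFun h k
    rw [h1] at this
    simpa using congrArg Fin.val (I.injective this).symm
  simp

lemma exists_strictMono_comp {n : ℕ} {s : Fin d → Fin n} (hs : Injective s) :
    ∃ (I : Fin d ↪o Fin n) (σ : Perm (Fin d)), s = I ∘ σ := by
  have h1 : StrictMono (s ∘ Tuple.sort s) :=
    (Tuple.monotone_sort s).strictMono_of_injective (hs.comp (Equiv.injective _))
  refine ⟨OrderEmbedding.ofStrictMono _ h1, (Tuple.sort s).symm, ?_⟩
  funext k
  simp

lemma sum_mul_altSign {n : ℕ} {φ : (Fin d → Fin n) → 𝕜}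
    (hφ : ∀ (σ : Perm (Fin d)) s, φ (s ∘ σ) = ((sign σ : ℤ) : 𝕜) * φ s)
    (s' : Fin d → Fin n) : ∑ s, φ s * altSign 𝕜 s s' = d.factorial * φ s' := by
  simp only [altSign_eq_sum, mul_sum]
  rw [sum_comm]
  have : ∀ σ : Perm (Fin d), (∑ s : Fin d → Fin n,
      φ s * if s' = s ∘ σ then ((sign σ : ℤ) : 𝕜) else 0) = φ s' := by
    intro σ
    rw [sum_eq_single (s' ∘ σ.symm)]
    · grind
    · intro s _ hs
      rw [if_neg, mul_zero]
      rintro rfl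
      grind
    simp
  simp only [this, sum_const, Finset.card_univ, Fintype.card_perm, card_fin, nsmul_eq_mul]

end

/-- The minor with rows `s` and columns `t`, as an array. -/
def minorArray (𝕜 : Type*) [RCLike 𝕜] {d : ℕ} (s : Fin d → Fin n1) (t : Fin d → Fin n2) :
    BiArray 𝕜 n1 n2 d := fun s' t' => altSign 𝕜 s s' * altSign 𝕜 t t'

lemma minorArray_mem (s : Fin d → Fin n1) (t : Fin d → Fin n2) :
    minorArray 𝕜 s t ∈ altArrays 𝕜 n1 n2 d := by
  refine ⟨fun σ s' t' => ?_, fun σ s' t' => ?_⟩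
  · simp only [minorArray, altSign_comp_right, mul_assoc]
  simp only [minorArray, altSign_comp_right]
  ring

lemma choose_le_card_orderEmb (d n : ℕ) : n.choose d ≤ card (Fin d ↪o Fin n) := by
  have h : n.choose d = card (Finset.powersetCard d (univ : Finset (Fin n))) := by simp_all
  rw [h]
  refine Fintype.card_le_of_injective
    (fun S => S.1.orderEmbOfFin (Finset.mem_powersetCard.1 S.2).2) fun S S' hSS' => ?_
  apply Subtype.ext
  rw [← Finset.coe_inj, ← Finset.range_orderEmbOfFin S.1 (Finset.mem_powersetCard.1 S.2).2,
    ← Finset.range_orderEmbOfFin S'.1 (Finset.mem_powersetCard.1 S'.2).2]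
  grind

lemma le_finrank_altArrays (d : ℕ) :
    n1.choose d * n2.choose d ≤ finrank 𝕜 (altArrays 𝕜 n1 n2 d) := by
  classical
  have hl : LinearIndependent 𝕜 fun c : (Fin d ↪o Fin n1) × (Fin d ↪o Fin n2) =>
      (⟨minorArray 𝕜 c.1 c.2, minorArray_mem _ _⟩ : altArrays 𝕜 n1 n2 d) := by
    rw [Fintype.linearIndependent_iff]
    intro g hg c
    have h1 : ∑ b, g b • minorArray 𝕜 (b.1 : Fin d → Fin n1) (b.2 : Fin d → Fin n2) = 0 := by
      have := congrArg Subtype.val hg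
      simpa [Submodule.coe_sum] using this
    have h2 := congrFun (congrFun h1 c.1) c.2
    simp only [Finset.sum_apply, Pi.smul_apply, minorArray, altSign_strictMono, smul_eq_mul,
      Pi.zero_apply] at h2
    rw [sum_eq_single c] at h2
    · simpa using h2
    · grind
    simp
  have := hl.fintype_card_le_finrank
  rw [Fintype.card_prod] at this
  exact (Nat.mul_le_mul (choose_le_card_orderEmb d n1) (choose_le_card_orderEmb d n2)).trans this

/-- The pairing of an array with a tensor. -/
def tensorPair {d : ℕ} (F : BiArray 𝕜 n1 n2 d) (t : (Fin d → Fin n1 × Fin n2) → 𝕜) : 𝕜 :=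
  ∑ a, F (fun k => (a k).1) (fun k => (a k).2) * t a

lemma sum_pairs (φ : (Fin d → Fin n1) → (Fin d → Fin n2) → 𝕜) :
    ∑ a : Fin d → Fin n1 × Fin n2, φ (fun k => (a k).1) (fun k => (a k).2) = ∑ s, ∑ t, φ s t := by
  rw [← Fintype.sum_prod_type']
  exact sum_equiv (Equiv.arrowProdEquivProdArrow (Fin d) (fun _ => Fin n1)
    (fun _ => Fin n2)) _ _ fun _ => rfl

lemma tensorPair_prod (F : BiArray 𝕜 n1 n2 d) (z : Fin d → MatSpace 𝕜 n1 n2) :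
    tensorPair F (fun a => ∏ k, z k (a k)) = pair F z :=
  sum_pairs fun s t => F s t * ∏ k, z k (s k, t k)

lemma tensorPair_minorArray_eq_zero {t : (Fin d → Fin n1 × Fin n2) → 𝕜}
    (h : ∀ (I : Fin d ↪o Fin n1) (J : Fin d ↪o Fin n2), tensorPair (minorArray 𝕜 I J) t = 0)
    (s : Fin d → Fin n1) (s' : Fin d → Fin n2) : tensorPair (minorArray 𝕜 s s') t = 0 := by
  by_cases hs : Injective s
  swap
  · simp [tensorPair, minorArray, altSign_eq_zero_of_not_injective_left hs]
  by_cases hs' : Injective s'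
  swap
  · simp [tensorPair, minorArray, altSign_eq_zero_of_not_injective_left hs']
  obtain ⟨I, σ, rfl⟩ := exists_strictMono_comp hs
  obtain ⟨J, τ, rfl⟩ := exists_strictMono_comp hs'
  have h1 := h I J
  have h2 : tensorPair (minorArray 𝕜 (I ∘ σ) (J ∘ τ)) t = ((sign σ : ℤ) : 𝕜) * ((sign τ : ℤ) : 𝕜) *
        tensorPair (minorArray 𝕜 I J) t := by
    simp only [tensorPair, minorArray, altSign_comp_left, mul_sum]
    grind
  grind

lemma tensorPair_eq_zero {t : (Fin d → Fin n1 × Fin n2) → 𝕜}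
    (h : ∀ (I : Fin d ↪o Fin n1) (J : Fin d ↪o Fin n2), tensorPair (minorArray 𝕜 I J) t = 0)
    {F : BiArray 𝕜 n1 n2 d} (hF : F ∈ altArrays 𝕜 n1 n2 d) : tensorPair F t = 0 := by
  have key : ∀ s' t', ∑ s, ∑ t, F s t * minorArray 𝕜 s t s' t' =
      (d.factorial : 𝕜) ^ 2 * F s' t' := by
    intro s' t'
    have h1 : ∀ s, ∑ t, F s t * minorArray 𝕜 s t s' t' =
        (d.factorial * F s t') * altSign 𝕜 s s' := by
      intro s
      rw [← sum_mul_altSign (φ := F s) (fun σ t => hF.2 σ s t), sum_mul]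
      exact sum_congr rfl fun t _ => by rw [minorArray]; ring
    simp only [h1]
    have h2 := sum_mul_altSign (φ := fun s => F s t') (fun σ s => hF.1 σ s t') s'
    simp only [mul_assoc, ← mul_sum]
    rw [h2]
    ring
  have h3 : (d.factorial : 𝕜) ^ 2 * tensorPair F t = 0 := by
    calc (d.factorial : 𝕜) ^ 2 * tensorPair F t
        = ∑ a : Fin d → Fin n1 × Fin n2, ∑ s, ∑ s', F s s' *
            (minorArray 𝕜 s s' (fun k => (a k).1) (fun k => (a k).2) * t a) := by
          rw [tensorPair, mul_sum]
          refine sum_congr rfl fun a _ => ?_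
          rw [← mul_assoc, ← key]
          simp only [sum_mul, mul_assoc]
      _ = ∑ s, ∑ s', F s s' * tensorPair (minorArray 𝕜 s s') t := by
          rw [sum_comm]
          refine sum_congr rfl fun s _ => ?_
          rw [sum_comm]
          refine sum_congr rfl fun s' _ => ?_
          rw [tensorPair, mul_sum]
      _ = 0 := by simp [tensorPair_minorArray_eq_zero h]
  exact (mul_eq_zero.1 h3).resolve_left (pow_ne_zero 2 (Nat.cast_ne_zero.2 d.factorial_ne_zero))

/-! ### The arrays of the minors -/

lemma sum_single_apply {ι : Type*} [DecidableEq ι] (a : Fin d → ι) (i : ι) :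
    (∑ k, Finsupp.single (a k) 1 : ι →₀ ℕ) i = (Finset.univ.filter fun k => a k = i).card := by
  rw [Finsupp.finsetSum_apply, Finset.card_filter]
  grind

lemma sum_single_eq_iff {ι : Type*} {a b : Fin d → ι} (hb : Injective b) :
    (∑ k, Finsupp.single (b k) 1 : ι →₀ ℕ) = ∑ k, Finsupp.single (a k) 1 ↔
      ∃ τ : Perm (Fin d), a = b ∘ τ := by
  classical
  constructor
  · intro h
    have hc : ∀ i, (Finset.univ.filter fun k => b k = i).card =
        (Finset.univ.filter fun k => a k = i).card := by
      intro i
      have := DFunLike.congr_fun h i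
      rwa [sum_single_apply, sum_single_apply] at this
    have hone : ∀ i, (Finset.univ.filter fun k => a k = b i).card = 1 := by
      intro i
      rw [← hc]
      simp [hb.eq_iff, Finset.filter_eq']
    have hex : ∀ k, ∃ i, b i = a k := by
      intro k
      have h1 : 0 < (Finset.univ.filter fun l => b l = a k).card := by
        rw [hc, Finset.card_pos]
        exact ⟨k, by simp⟩
      obtain ⟨i, hi⟩ := Finset.card_pos.1 h1
      grind
    choose τ hτ using hex
    have hinj : Injective τ := by
      intro k l hkl
      obtain ⟨c, hc⟩ := Finset.card_eq_one.1 (hone (τ k))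
      have h1 : k ∈ Finset.univ.filter fun m => a m = b (τ k) := by simp [hτ]
      have h2 : l ∈ Finset.univ.filter fun m => a m = b (τ k) := by simp [hkl, hτ]
      grind
    refine ⟨Equiv.ofBijective τ (Finite.injective_iff_bijective.1 hinj), ?_⟩
    grind
  rintro ⟨τ, rfl⟩
  exact (Equiv.sum_comp τ fun k => (Finsupp.single (b k) 1 : ι →₀ ℕ)).symm

lemma multinomial_sum_single {ι : Type*} {b : Fin d → ι} (hb : Injective b) :
    (∑ k, Finsupp.single (b k) 1 : ι →₀ ℕ).multinomial = d.factorial := by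
  classical
  rw [Finsupp.multinomial_eq]
  have h1 := Nat.multinomial_spec (∑ k, Finsupp.single (b k) 1 : ι →₀ ℕ).support
    (∑ k, Finsupp.single (b k) 1 : ι →₀ ℕ)
  rw [Finset.prod_eq_one, one_mul] at h1
  · rw [h1]
    congr 1
    have h2 : ∑ i ∈ (∑ k, Finsupp.single (b k) 1 : ι →₀ ℕ).support,
        (∑ k, Finsupp.single (b k) 1 : ι →₀ ℕ) i =
          Finsupp.degree (∑ k, Finsupp.single (b k) 1 : ι →₀ ℕ) := rfl
    simp_all
  intro i _
  rw [sum_single_apply]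
  have : (Finset.univ.filter fun k => b k = i).card ≤ 1 := by
    rw [Finset.card_le_one]
    grind
  simp_all

lemma polyArray_minors (c : (Fin (r + 1) ↪o Fin n1) × (Fin (r + 1) ↪o Fin n2))
    (a : Fin (r + 1) → Fin n1 × Fin n2) :
    polyArray (r + 1) (minors 𝕜 n1 n2 r c) a = ((r + 1).factorial : 𝕜)⁻¹ *
        minorArray 𝕜 c.1 c.2 (fun k => (a k).1) (fun k => (a k).2) := by
  classical
  have hinj : ∀ σ : Perm (Fin (r + 1)), Injective fun i => (c.1 (σ i), c.2 i) := by
    intro σ i j hij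
    simp_all
  have hcoeff : MvPolynomial.coeff (∑ k, Finsupp.single (a k) 1) (minors 𝕜 n1 n2 r c) =
      ∑ σ : Perm (Fin (r + 1)), if ∃ τ : Perm (Fin (r + 1)),
        a = (fun i => (c.1 (σ i), c.2 i)) ∘ τ then ((sign σ : ℤ) : 𝕜) else 0 := by
    rw [minors, Matrix.det_apply', MvPolynomial.coeff_sum]
    refine sum_congr rfl fun σ _ => ?_
    have h1 : (∏ i, (Matrix.mvPolynomialX (Fin n1) (Fin n2) 𝕜).submatrix c.1 c.2 (σ i) i) =
        MvPolynomial.monomial (∑ i, Finsupp.single (c.1 (σ i), c.2 i) 1) (1 : 𝕜) := by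
      rw [MvPolynomial.monomial_sum_one]
      rfl
    have h2 : (((sign σ : ℤ) : MvPolynomial (Fin n1 × Fin n2) 𝕜)) = C ((sign σ : ℤ) : 𝕜) := by simp
    rw [h1, h2, MvPolynomial.coeff_C_mul, MvPolynomial.coeff_monomial]
    simp only [sum_single_eq_iff (hinj σ)]
    split_ifs <;> simp
  by_cases hτ : ∃ τ : Perm (Fin (r + 1)), (fun k => (a k).2) = c.2 ∘ τ
  · obtain ⟨τ, hτ⟩ := hτ
    have hτ' : ∀ σ : Perm (Fin (r + 1)), (∃ τ' : Perm (Fin (r + 1)),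
        a = (fun i => (c.1 (σ i), c.2 i)) ∘ τ') ↔ (fun k => (a k).1) = c.1 ∘ (σ * τ) := by
      intro σ
      constructor
      · rintro ⟨τ', rfl⟩
        have : τ' = τ := by
          ext k
          have := congrFun hτ k
          simp_all
        rw [this]
        rfl
      intro h
      refine ⟨τ, ?_⟩
      funext k
      exact Prod.ext (congrFun h k) (congrFun hτ k)
    have hmult : ∀ σ : Perm (Fin (r + 1)), (fun k => (a k).1) = c.1 ∘ (σ * τ) →
        (∑ k, Finsupp.single (a k) 1 : Fin n1 × Fin n2 →₀ ℕ).multinomial = (r + 1).factorial := by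
      intro σ h
      obtain ⟨τ', h'⟩ := (hτ' σ).2 h
      rw [← (sum_single_eq_iff (hinj σ)).2 ⟨τ', h'⟩]
      exact multinomial_sum_single (hinj σ)
    rw [polyArray, hcoeff, minorArray, hτ, altSign_comp_right]
    have h1 : altSign 𝕜 (c.2 : Fin (r + 1) → Fin n2) c.2 = 1 := by
      rw [altSign_strictMono, if_pos rfl]
    rw [h1, altSign_eq_sum, sum_div, sum_mul, mul_sum]
    simp only [hτ']
    refine sum_equiv (Equiv.mulRight τ) _ _ fun σ => ?_
    rw [Equiv.coe_mulRight]
    by_cases h : (fun k => (a k).1) = c.1 ∘ (σ * τ)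
    · rw [if_pos h, if_pos h, hmult σ h, Equiv.Perm.sign_mul, div_eq_inv_mul]
      rcases Int.units_eq_one_or (sign τ) with h | h <;> simp [h]
    grind
  have h1 : altSign 𝕜 (c.2 : Fin (r + 1) → Fin n2) (fun k => (a k).2) = 0 := by
    rw [altSign_eq_sum]
    simp_all
  rw [polyArray, hcoeff, minorArray, h1, mul_zero, mul_zero, sum_eq_zero, zero_div]
  intro σ _
  rw [if_neg]
  rintro ⟨τ, rfl⟩
  exact hτ ⟨τ, rfl⟩

lemma mem_polyAnnihilator_minors_iff {t : (Fin (r + 1) → Fin n1 × Fin n2) → 𝕜} :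
    t ∈ polyAnnihilator (r + 1) (minors 𝕜 n1 n2 r) ↔
      ∀ F ∈ altArrays 𝕜 n1 n2 (r + 1), tensorPair F t = 0 := by
  have h0 : ((r + 1).factorial : 𝕜)⁻¹ ≠ 0 :=
    inv_ne_zero (Nat.cast_ne_zero.2 (r + 1).factorial_ne_zero)
  have h1 : ∀ c : (Fin (r + 1) ↪o Fin n1) × (Fin (r + 1) ↪o Fin n2),
      ∑ a, polyArray (r + 1) (minors 𝕜 n1 n2 r c) a * t a =
        ((r + 1).factorial : 𝕜)⁻¹ * tensorPair (minorArray 𝕜 c.1 c.2) t := by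
    intro c
    simp only [polyArray_minors, tensorPair, mul_sum, mul_assoc]
  constructor
  · intro ht F hF
    refine tensorPair_eq_zero (fun I J => ?_) hF
    have := ht (I, J)
    simp_all
  intro h c
  rw [h1, h _ (minorArray_mem _ _), mul_zero]

/-! ### The determinantal variety -/

lemma pair_minorArray_const (s : Fin d → Fin n1) (t : Fin d → Fin n2)
    (x : MatSpace 𝕜 n1 n2) : pair (minorArray 𝕜 s t) (fun _ => x) =
      d.factorial * (of fun i j => x (s i, t j)).det := by
  have h1 : pair (minorArray 𝕜 s t) (fun _ => x) =
      ∑ τ : Perm (Fin d), ∑ σ : Perm (Fin d), ((sign σ : ℤ) : 𝕜) *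
        ((sign τ : ℤ) : 𝕜) * ∏ k, x (s (σ k), t (τ k)) := by
    simp only [pair, minorArray, altSign_eq_sum]
    simp only [sum_mul, mul_sum]
    rw [sum_congr rfl fun s' _ => sum_comm]
    rw [sum_comm]
    rw [sum_congr rfl fun τ _ => sum_congr rfl fun s' _ => sum_comm]
    rw [sum_congr rfl fun τ _ => sum_comm]
    simp_all
  rw [h1, Matrix.det_apply']
  have h2 : ∀ τ : Perm (Fin d), (∑ σ : Perm (Fin d), ((sign σ : ℤ) : 𝕜) *
      ((sign τ : ℤ) : 𝕜) * ∏ k, x (s (σ k), t (τ k))) =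
      ∑ σ : Perm (Fin d), ((sign σ : ℤ) : 𝕜) * ∏ i, (of fun i j => x (s i, t j)) (σ i) i := by
    intro τ
    refine sum_equiv (Equiv.mulRight τ⁻¹) _ _ fun σ => ?_
    simp only [Equiv.coe_mulRight, Equiv.Perm.sign_mul, Equiv.Perm.sign_inv, of_apply,
      Units.val_mul, Int.cast_mul]
    congr 1
    refine (Fintype.prod_equiv τ _ _ fun k => ?_)
    simp
  simp only [h2, sum_const, Finset.card_univ, Fintype.card_perm, card_fin, nsmul_eq_mul]

lemma mem_detVariety_iff {x : MatSpace 𝕜 n1 n2} : x ∈ detVariety 𝕜 n1 n2 r ↔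
    ∀ (I : Fin (r + 1) ↪o Fin n1) (J : Fin (r + 1) ↪o Fin n2),
      (of fun i j => x (I i, J j)).det = 0 := by
  constructor
  · intro hx I J
    by_contra h
    have h1 := Matrix.rank_of_det_ne_zero h
    have h2 := Matrix.rank_submatrix_le (of fun i j => x (i, j)) I J
    have h3 : (of fun i j => x (i, j)).rank ≤ r := hx
    have h4 : (of fun i j => x (i, j)).submatrix I J = of fun i j => x (I i, J j) := rfl
    rw [h4, h1, card_fin] at h2
    omega
  intro h
  by_contra hx
  have hx' : r + 1 ≤ (of fun i j => x (i, j)).rank := by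
    have : ¬ (of fun i j => x (i, j)).rank ≤ r := hx
    omega
  rw [Matrix.rank_eq_finrank_span_row] at hx'
  obtain ⟨κ, a, ha, hs, hl⟩ := exists_linearIndependent' 𝕜 (of fun i j => x (i, j)).row
  have : Finite κ := Finite.of_injective a ha
  have := Fintype.ofFinite κ
  rw [← hs, finrank_span_eq_card hl] at hx'
  obtain ⟨ε⟩ : Nonempty (Fin (r + 1) ↪ κ) :=
    Function.Embedding.nonempty_of_card_le (by simpa using hx')
  have hl' := hl.comp ε ε.injective
  obtain ⟨e, he⟩ := exists_det_ne_zero hl'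
  have hae : Injective (a ∘ ε) := ha.comp ε.injective
  have hei : Injective e := by
    intro i j hij
    by_contra hne
    apply he
    refine Matrix.det_zero_of_column_eq hne fun k => ?_
    simp [hij]
  obtain ⟨I, σ, hI⟩ := exists_strictMono_comp hae
  obtain ⟨J, τ, hJ⟩ := exists_strictMono_comp hei
  apply he
  have h1 : (of fun i j => ((of fun i j => x (i, j)).row ∘ a) (ε i) (e j)) =
      ((of fun i j => x (I i, J j)).submatrix σ id).submatrix id τ := by
    ext i j
    have hi := congrFun hI i
    simp_all
  change (of fun i j => ((of fun i j => x (i, j)).row ∘ a) (ε i) (e j)).det = 0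
  rw [h1, Matrix.det_permute', Matrix.det_permute, h, mul_zero, mul_zero]

lemma pow_mem_polyAnnihilator_iff {x : MatSpace 𝕜 n1 n2} :
    (fun a => ∏ k, x (a k)) ∈ polyAnnihilator (r + 1) (minors 𝕜 n1 n2 r) ↔
      x ∈ detVariety 𝕜 n1 n2 r := by
  have h0 : ((r + 1).factorial : 𝕜) ≠ 0 := Nat.cast_ne_zero.2 (r + 1).factorial_ne_zero
  rw [mem_polyAnnihilator_minors_iff, mem_detVariety_iff]
  constructor
  · intro h I J
    have := h _ (minorArray_mem I J)
    rw [tensorPair_prod (minorArray 𝕜 I J) (fun _ => x), pair_minorArray_const] at this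
    grind
  intro h F hF
  refine tensorPair_eq_zero (fun I J => ?_) hF
  rw [tensorPair_prod (minorArray 𝕜 I J) (fun _ => x), pair_minorArray_const, h, mul_zero]

lemma pair_const_eq_zero {x : MatSpace 𝕜 n1 n2} (hx : x ∈ detVariety 𝕜 n1 n2 r)
    {F : BiArray 𝕜 n1 n2 (r + 1)} (hF : F ∈ altArrays 𝕜 n1 n2 (r + 1)) :
    pair F (fun _ => x) = 0 := by
  rw [← tensorPair_prod]
  exact mem_polyAnnihilator_minors_iff.1 (pow_mem_polyAnnihilator_iff.2 hx) F hF

end Minors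

/-! ## Powers of vectors and the lifted space -/

section Powers

variable {ι : Type*} [Fintype ι]

/-- The tensor `x^{⊗d}`. -/
def powTensor {ι' : Type*} (d : ℕ) (x : ι' → 𝕜) : (Fin d → ι') → 𝕜 := fun a => ∏ k, x (a k)

/-- The contraction of a tensor with a product of functionals. -/
def tensorEval {d : ℕ} (h : Fin d → ι → 𝕜) : ((Fin d → ι) → 𝕜) →ₗ[𝕜] 𝕜 where
  toFun t := ∑ a, (∏ k, h k (a k)) * t a
  map_add' s t := by simp only [Pi.add_apply, mul_add, Finset.sum_add_distrib]
  map_smul' c t := by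
    simp only [Pi.smul_apply, smul_eq_mul, RingHom.id_apply, mul_sum]
    grind

lemma tensorEval_apply (h : Fin d → ι → 𝕜) (t : (Fin d → ι) → 𝕜) :
    tensorEval h t = ∑ a, (∏ k, h k (a k)) * t a := rfl

lemma sum_prod_apply (φ : Fin d → ι → 𝕜) : ∑ a : Fin d → ι, ∏ k, φ k (a k) = ∏ k, ∑ i, φ k i := by
  classical
  rw [Finset.prod_univ_sum, Fintype.piFinset_univ]

lemma tensorEval_prod (h x : Fin d → ι → 𝕜) :
    tensorEval h (fun a => ∏ k, x k (a k)) = ∏ k, ∑ i, h k i * x k i := by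
  simp only [tensorEval_apply, ← prod_mul_distrib]
  exact sum_prod_apply fun k i => h k i * x k i

lemma exists_isDualTo {k : ℕ} {x : Fin k → ι → 𝕜} (hx : LinearIndependent 𝕜 x) :
    ∃ h, IsDualTo x h := by
  classical
  obtain ⟨g, hg⟩ := LinearMap.exists_leftInverse_of_injective (Fintype.linearCombination 𝕜 x)
    (LinearMap.ker_eq_bot.2 (linearIndependent_iff_injective_fintypeLinearCombination.1 hx))
  refine ⟨fun a i => g (single i 1) a, fun a b => ?_⟩
  have h1 : g (x b) = single b 1 := by
    have := LinearMap.congr_fun hg (single b 1)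
    simpa using this
  have h2 : g (x b) = ∑ i, x b i • g (single i 1) := by
    conv_lhs => rw [← LinearMap.sum_single_apply (φ := fun _ : ι => 𝕜) (v := x b)]
    rw [map_sum]
    refine sum_congr rfl fun i _ => ?_
    rw [← map_smul]
    congr 1
    funext j
    by_cases hij : j = i
    · subst hij; simp
    simp [hij]
  have h3 := congrFun h2 a
  rw [h1] at h3
  simp only [Finset.sum_apply, Pi.smul_apply, smul_eq_mul, Pi.single_apply] at h3
  grind

lemma linearIndependent_of_isDualTo {k : ℕ} {x h : Fin k → ι → 𝕜} (hxh : IsDualTo x h) :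
    LinearIndependent 𝕜 x := by
  rw [Fintype.linearIndependent_iff]
  intro g hg a
  have h1 : ∑ i, h a i * (∑ b, g b • x b) i = g a := by
    simp only [Finset.sum_apply, Pi.smul_apply, smul_eq_mul, mul_sum]
    rw [sum_comm]
    have : ∀ b, ∑ i, h a i * (g b * x b i) = g b * if a = b then 1 else 0 := by
      intro b
      rw [← hxh a b, mul_sum]
      grind
    simp [this]
  rw [← h1, hg]
  simp

lemma IsDualTo.eq_sum {k : ℕ} {x h : Fin k → ι → 𝕜} (hxh : IsDualTo x h) {y : ι → 𝕜}
    (hy : y ∈ span 𝕜 (range x)) : y = ∑ a, (∑ i, h a i * y i) • x a := by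
  obtain ⟨c, rfl⟩ := (Submodule.mem_span_range_iff_exists_fun 𝕜).1 hy
  refine sum_congr rfl fun a _ => ?_
  congr 1
  simp only [Finset.sum_apply, Pi.smul_apply, smul_eq_mul, mul_sum]
  rw [sum_comm]
  have : ∀ b, ∑ i, h a i * (c b * x b i) = c b * if a = b then 1 else 0 := by
    intro b
    rw [← hxh a b, mul_sum]
    grind
  simp [this]

lemma IsDualTo.tensorEval_prod {k : ℕ} {x h : Fin k → ι → 𝕜} (hxh : IsDualTo x h)
    (α β : Fin d → Fin k) :
    tensorEval (fun j => h (α j)) (fun a => ∏ j, x (β j) (a j)) = if α = β then 1 else 0 := by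
  rw [BlockDecomp.tensorEval_prod]
  simp only [hxh _ _]
  split_ifs with h1
  · subst h1; simp
  obtain ⟨j, hj⟩ := Function.ne_iff.1 h1
  exact Finset.prod_eq_zero (mem_univ j) (if_neg hj)

lemma IsDualTo.eq_sum_of_mem_tensorPow {k : ℕ} {x h : Fin k → ι → 𝕜} (hxh : IsDualTo x h)
    {t : (Fin d → ι) → 𝕜} (ht : t ∈ tensorPow (span 𝕜 (range x)) d) :
    t = ∑ α : Fin d → Fin k, tensorEval (fun j => h (α j)) t • fun a => ∏ j, x (α j) (a j) := by
  induction ht using Submodule.span_induction with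
  | mem t ht =>
    obtain ⟨y, hy, rfl⟩ := ht
    funext a
    have h1 : ∀ j, y j (a j) = ∑ b, (∑ i, h b i * y j i) * x b (a j) := by
      intro j
      have := congrFun (hxh.eq_sum (hy j)) (a j)
      simpa using this
    simp only [h1]
    rw [← sum_prod_apply fun j b => (∑ i, h b i * y j i) * x b (a j)]
    simp only [Finset.sum_apply, Pi.smul_apply, smul_eq_mul, prod_mul_distrib,
      BlockDecomp.tensorEval_prod]
  | zero => simp
  | add s t _ _ hs ht =>
    simp only [map_add, add_smul, Finset.sum_add_distrib]
    grind
  | smul c t _ ht =>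
    simp only [map_smul, smul_eq_mul, mul_smul, ← Finset.smul_sum]
    rw [← ht]

lemma tensorEval_symm {k : ℕ} (h : Fin k → ι → 𝕜) {t : (Fin d → ι) → 𝕜}
    (ht : t ∈ symTensors 𝕜 ι d) (α : Fin d → Fin k) (σ : Perm (Fin d)) :
    tensorEval (fun j => h (α (σ j))) t = tensorEval (fun j => h (α j)) t := by
  rw [tensorEval_apply, tensorEval_apply]
  refine sum_equiv (Equiv.arrowCongr σ (Equiv.refl ι)) _ _ fun a => ?_
  have h1 : (Equiv.arrowCongr σ (Equiv.refl ι)) a = a ∘ σ.symm := rfl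
  rw [h1, ht σ.symm a]
  congr 1
  refine Fintype.prod_equiv σ _ _ fun j => ?_
  simp

lemma powTensor_mem_symPow {ι' : Type*} {U : Submodule 𝕜 (ι' → 𝕜)} {x : ι' → 𝕜} (hx : x ∈ U) :
    powTensor d x ∈ symPow U d := by
  refine ⟨subset_span ⟨fun _ => x, fun _ => hx, rfl⟩, fun σ a => ?_⟩
  exact Fintype.prod_equiv σ _ _ fun k => rfl

/-- Contraction of all indices but the first. -/
def contractTail {e : ℕ} (h : Fin e → ι → 𝕜) : ((Fin (e + 1) → ι) → 𝕜) →ₗ[𝕜] (ι → 𝕜) where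
  toFun t i := tensorEval h fun b => t (Fin.cons i b)
  map_add' s t := by
    funext i
    exact map_add (tensorEval h) _ _
  map_smul' c t := by
    funext i
    exact map_smul (tensorEval h) c _

lemma contractTail_prod (h : Fin e → ι → 𝕜) (x : Fin (e + 1) → ι → 𝕜) :
    contractTail h (fun a => ∏ k, x k (a k)) = (∏ k, ∑ i, h k i * x k.succ i) • x 0 := by
  funext i
  change tensorEval h (fun b => ∏ k, x k ((Fin.cons i b : Fin (e + 1) → ι) k)) = _
  have h1 : (fun b : Fin e → ι => ∏ k, x k ((Fin.cons i b : Fin (e + 1) → ι) k)) =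
      x 0 i • fun b => ∏ k : Fin e, x k.succ (b k) := by
    funext b
    simp [Fin.prod_univ_succ]
  rw [h1, map_smul, tensorEval_prod, Pi.smul_apply, smul_eq_mul, smul_eq_mul, mul_comm]

lemma contractTail_mem (h : Fin e → ι → 𝕜) {U : Submodule 𝕜 (ι → 𝕜)}
    {t : (Fin (e + 1) → ι) → 𝕜} (ht : t ∈ tensorPow U (e + 1)) : contractTail h t ∈ U := by
  induction ht using Submodule.span_induction with
  | mem t ht =>
    obtain ⟨y, hy, rfl⟩ := ht
    rw [contractTail_prod]
    exact U.smul_mem _ (hy 0)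
  | zero => simp
  | add s t _ _ hs ht => rw [map_add]; exact U.add_mem hs ht
  | smul c t _ ht => rw [map_smul]; exact U.smul_mem _ ht

lemma mem_of_powTensor_mem {k : ℕ} {U : Submodule 𝕜 (ι → 𝕜)} {x h : Fin k → ι → 𝕜}
    (hxh : IsDualTo x h) {a : Fin k} (hx : powTensor (e + 1) (x a) ∈ tensorPow U (e + 1)) :
    x a ∈ U := by
  have := contractTail_mem (fun _ => h a) hx
  unfold powTensor at this
  rw [contractTail_prod (fun _ => h a) fun _ => x a] at this
  simpa [hxh a a] using this

/-- A vector of the span of the independent vectors `x a` whose power is a combination of their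
powers is a multiple of one of them. -/
lemma exists_smul_of_powTensor_mem {k : ℕ} {x : Fin k → ι → 𝕜} (hx : LinearIndependent 𝕜 x)
    {y : ι → 𝕜} (hy : y ∈ span 𝕜 (range x)) (hy0 : y ≠ 0)
    (hp : powTensor (e + 2) y ∈ span 𝕜 (range fun a => powTensor (e + 2) (x a))) :
    ∃ a, ∃ c : 𝕜, y = c • x a := by
  classical
  obtain ⟨h, hxh⟩ := exists_isDualTo hx
  obtain ⟨c, hc⟩ := (Submodule.mem_span_range_iff_exists_fun 𝕜).1 hp
  have hys := hxh.eq_sum hy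
  have key : ∀ a b, a ≠ b → (∑ i, h a i * y i) ≠ 0 → (∑ i, h b i * y i) = 0 := by
    intro a b hab ha
    have h1 := congrArg (tensorEval fun j => h ((Fin.cons b fun _ => a : Fin (e + 2) → Fin k) j)) hc
    rw [map_sum] at h1
    have h2 : ∀ b', tensorEval (fun j => h ((Fin.cons b fun _ => a : Fin (e + 2) → Fin k) j))
        (c b' • powTensor (e + 2) (x b')) = 0 := by
      intro b'
      rw [map_smul]
      have := hxh.tensorEval_prod (Fin.cons b fun _ => a : Fin (e + 2) → Fin k) (fun _ => b')
      unfold powTensor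
      rw [this, if_neg, smul_zero]
      intro heq
      have e0 := congrFun heq 0
      have e1 := congrFun heq 1
      have e1' : (Fin.cons b fun _ => a : Fin (e + 2) → Fin k) 1 = a := rfl
      rw [e1'] at e1
      exact hab (e1.trans e0.symm)
    rw [sum_eq_zero fun b' _ => h2 b'] at h1
    unfold powTensor at h1
    rw [tensorEval_prod _ fun _ => y, Fin.prod_univ_succ] at h1
    simp only [Fin.cons_zero, Fin.cons_succ, Finset.prod_const, Finset.card_fin] at h1
    exact (mul_eq_zero.1 h1.symm).resolve_right (pow_ne_zero _ ha)
  have hex : ∃ a, (∑ i, h a i * y i) ≠ 0 := by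
    by_contra! hall
    apply hy0
    rw [hys]
    simp [hall]
  obtain ⟨a, ha⟩ := hex
  refine ⟨a, ∑ i, h a i * y i, ?_⟩
  conv_lhs => rw [hys]
  exact sum_eq_single a (fun b _ hb => by rw [key a b hb.symm ha, zero_smul]) (by simp)

lemma linearIndependent_powTensor {k : ℕ} {x : Fin k → ι → 𝕜} (hx : LinearIndependent 𝕜 x) :
    LinearIndependent 𝕜 fun a => powTensor (e + 1) (x a) := by
  obtain ⟨h, hxh⟩ := exists_isDualTo hx
  rw [Fintype.linearIndependent_iff]
  intro g hg a
  have h1 := congrArg (tensorEval fun _ => h a) hg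
  have h2 : ∀ b, tensorEval (fun _ => h a) (g b • powTensor (e + 1) (x b)) =
      g b * if a = b then 1 else 0 := by
    intro b
    rw [map_smul, smul_eq_mul]
    unfold powTensor
    rw [hxh.tensorEval_prod (fun _ => a) (fun _ => b)]
    grind
  rw [map_sum, sum_congr rfl fun b _ => h2 b] at h1
  simpa using h1

end Powers

/-! ## Uniqueness of the decomposition -/

section Uniqueness

lemma slice_mem (k : Fin n3) : (fun i => T i k) ∈ sliceSpan T := subset_span ⟨k, rfl⟩

lemma sliceSpan_sumTensor_le (v : Fin R → MatSpace 𝕜 n1 n2) (w : Fin R → Fin n3 → 𝕜) :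
    sliceSpan (sumTensor v w) ≤ span 𝕜 (range v) := by
  rw [sliceSpan, span_le]
  rintro _ ⟨k, rfl⟩
  have : (fun i => sumTensor v w i k) = ∑ a, w a k • v a := by
    funext i
    simp [sumTensor, mul_comm]
  change (fun i => sumTensor v w i k) ∈ _
  rw [this]
  exact Submodule.sum_mem _ fun a _ => Submodule.smul_mem _ _ (subset_span ⟨a, rfl⟩)

lemma isUniqueAidedRankDecomposition_of_lines
    {x : Fin R → MatSpace 𝕜 n1 n2} (hx : LinearIndependent 𝕜 x)
    (hspan : span 𝕜 (range x) = sliceSpan T) (hT : T = sumTensor x w)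
    (hX : ∀ a, x a ∈ detVariety 𝕜 n1 n2 r)
    (hlines : ∀ y ∈ span 𝕜 (range x), y ∈ detVariety 𝕜 n1 n2 r → y ≠ 0 →
      ∃ a, ∃ c : 𝕜, y = c • x a) :
    IsUniqueAidedRankDecomposition r T x w := by
  have hfin : finrank 𝕜 (sliceSpan T) = R := by rw [← hspan, finrank_span_eq_card hx, card_fin]
  have hle : ∀ {R' : ℕ} {v' : Fin R' → MatSpace 𝕜 n1 n2} {w' : Fin R' → Fin n3 → 𝕜},
      IsAidedDecomposition r T v' w' → sliceSpan T ≤ span 𝕜 (range v') := by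
    rintro R' v' w' ⟨-, rfl⟩
    exact sliceSpan_sumTensor_le v' w'
  refine ⟨⟨hX, hT⟩, ?_, ?_⟩
  · apply le_antisymm
    · exact Nat.sInf_le ⟨x, w, hX, hT⟩
    refine le_csInf ⟨R, x, w, hX, hT⟩ ?_
    rintro R' ⟨v', w', h'⟩
    have h1 := finrank_mono (hle h')
    have h2 := finrank_range_le_card (R := 𝕜) v'
    rw [card_fin] at h2
    rw [hfin] at h1
    exact h1.trans h2
  rintro v' w' h'
  have h1 := finrank_mono (hle h')
  have h2 := finrank_range_le_card (R := 𝕜) v'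
  rw [card_fin] at h2
  have h3 : finrank 𝕜 (span 𝕜 (range v')) = R := le_antisymm h2 (hfin ▸ h1)
  have heq : sliceSpan T = span 𝕜 (range v') :=
    Submodule.eq_of_le_of_finrank_eq (hle h') (by rw [hfin, h3])
  have hv' : LinearIndependent 𝕜 v' := by
    rw [linearIndependent_iff_card_eq_finrank_span, Set.finrank, h3, card_fin]
  have hex : ∀ a, ∃ b, ∃ c : 𝕜, v' a = c • x b := fun a =>
    hlines _ (by rw [hspan, heq]; exact subset_span ⟨a, rfl⟩) (h'.1 a) (hv'.ne_zero a)
  choose τ c hc using hex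
  have hc0 : ∀ a, c a ≠ 0 := by
    intro a h0
    apply hv'.ne_zero a
    simp_all
  have hτ : Injective τ := by
    intro a b hab
    by_contra hne
    have h4 := Fintype.linearIndependent_iff.1 hv' (single a (c b) - single b (c a)) (by
      simp only [Pi.sub_apply, sub_smul, sum_sub_distrib, Pi.single_apply, ite_smul,
        zero_smul, Finset.sum_ite_eq', mem_univ, if_true]
      rw [hc a, hc b, hab, smul_smul, smul_smul, mul_comm, sub_self]) a
    simp_all
  let σ : Perm (Fin R) := Equiv.ofBijective τ (Finite.injective_iff_bijective.1 hτ)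
  have hw : ∀ a k, w (τ a) k = c a * w' a k := by
    intro a k
    have h5 : ∑ b, w b k • x b = ∑ b, (c (σ.symm b) * w' (σ.symm b) k) • x b := by
      have e1 : ∑ b, w b k • x b = fun i => T i k := by
        rw [hT]; funext i; simp [sumTensor, mul_comm]
      have e2 : ∑ b, w' b k • v' b = fun i => T i k := by
        rw [h'.2]; funext i; simp [sumTensor, mul_comm]
      rw [e1, ← e2]
      refine sum_equiv σ _ _ fun b => ?_
      rw [σ.symm_apply_apply, hc b, smul_smul, mul_comm]
      rfl
    have h6 : ∀ b, w b k = c (σ.symm b) * w' (σ.symm b) k := by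
      have := Fintype.linearIndependent_iff.1 hx
        (fun b => w b k - c (σ.symm b) * w' (σ.symm b) k) (by
          simp only [sub_smul, sum_sub_distrib, h5, sub_self])
      grind
    have h7 := h6 (σ a)
    grind
  refine ⟨σ.symm, fun a i k => ?_⟩
  obtain ⟨b, rfl⟩ := σ.surjective a
  rw [σ.symm_apply_apply, hc b]
  have : σ b = τ b := rfl
  rw [this, hw b k, Pi.smul_apply, smul_eq_mul]
  ring

lemma mem_of_liftedSpace_eq {x : Fin s → MatSpace 𝕜 n1 n2} (hx : LinearIndependent 𝕜 x)
    (h : liftedSpace (r + 1) (minors 𝕜 n1 n2 r) u =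
      span 𝕜 (range fun a => powTensor (r + 1) (x a))) (a : Fin s) :
    x a ∈ span 𝕜 (range u) ∧ x a ∈ detVariety 𝕜 n1 n2 r := by
  obtain ⟨h', hxh⟩ := exists_isDualTo hx
  have h1 : powTensor (r + 1) (x a) ∈ liftedSpace (r + 1) (minors 𝕜 n1 n2 r) u := by
    rw [h]
    exact subset_span ⟨a, rfl⟩
  exact ⟨mem_of_powTensor_mem hxh h1.1.1, pow_mem_polyAnnihilator_iff.1 h1.2⟩

lemma exists_smul_of_liftedSpace_eq (hr : 0 < r)
    {x : Fin s → MatSpace 𝕜 n1 n2} (hx : LinearIndependent 𝕜 x)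
    (h : liftedSpace (r + 1) (minors 𝕜 n1 n2 r) u = span 𝕜 (range fun a => powTensor (r + 1) (x a)))
    (hspan : span 𝕜 (range x) = span 𝕜 (range u))
    {y : MatSpace 𝕜 n1 n2} (hy : y ∈ span 𝕜 (range x))
    (hyX : y ∈ detVariety 𝕜 n1 n2 r) (hy0 : y ≠ 0) : ∃ a, ∃ c : 𝕜, y = c • x a := by
  obtain ⟨e, rfl⟩ : ∃ e, r = e + 1 := ⟨r - 1, by omega⟩
  refine exists_smul_of_powTensor_mem (e := e) hx hy hy0 ?_
  rw [← h]
  exact ⟨powTensor_mem_symPow (hspan ▸ hy), pow_mem_polyAnnihilator_iff.2 hyX⟩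

/-- If the lifted space is spanned by the powers of independent vectors `x a`, as many as the
dimension of `T(W^*)`, then these give the unique decomposition. -/
lemma isUniqueAidedRankDecomposition_of_liftedSpace (hr : 0 < r) (hu : IsBasisOf u (sliceSpan T))
    {x h : Fin ℓ → MatSpace 𝕜 n1 n2} (hxh : IsDualTo x h)
    (hl : liftedSpace (r + 1) (minors 𝕜 n1 n2 r) u =
      span 𝕜 (range fun a => powTensor (r + 1) (x a))) :
    IsUniqueAidedRankDecomposition r T x fun a k => ∑ i, h a i * T i k := by
  have hx := linearIndependent_of_isDualTo hxh
  have hle : span 𝕜 (range x) ≤ span 𝕜 (range u) := by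
    rw [span_le]
    rintro _ ⟨a, rfl⟩
    exact (mem_of_liftedSpace_eq hx hl a).1
  have hspan : span 𝕜 (range x) = span 𝕜 (range u) := Submodule.eq_of_le_of_finrank_eq hle (by
      rw [finrank_span_eq_card hx, finrank_span_eq_card hu.1])
  refine isUniqueAidedRankDecomposition_of_lines hx (hspan.trans hu.2) ?_
    (fun a => (mem_of_liftedSpace_eq hx hl a).2)
    (fun y hy hyX hy0 => exists_smul_of_liftedSpace_eq hr hx hl hspan hy hyX hy0)
  funext i k
  have hm : (fun i => T i k) ∈ span 𝕜 (range x) := by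
    rw [hspan, hu.2]
    exact slice_mem k
  have := congrFun (hxh.eq_sum hm) i
  simp only [Finset.sum_apply, Pi.smul_apply, smul_eq_mul] at this
  rw [this, sumTensor]
  grind

lemma IsPowerForm.eq_sum {ι : Type*} [Fintype ι] {P : Fin s → (Fin (e + 1) → ι) → 𝕜}
    {L : TripleList 𝕜 (Fin s) ι (Fin e → ι)} {z : Fin L.length → Fin s → 𝕜}
    {x : Fin L.length → ι → 𝕜} (h : IsPowerForm (stackTensor P) L z x) (i : Fin s) :
    P i = ∑ k, z k i • powTensor (e + 1) (x k) := by
  funext a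
  have h1 := h.sum_eq i (a 0) (Fin.tail a)
  simp only [stackTensor, Fin.cons_self_tail] at h1
  rw [h1]
  simp only [Finset.sum_apply, Pi.smul_apply, smul_eq_mul, powTensor, Fin.prod_univ_succ, mul_assoc]
  rfl

lemma Algorithm1.only_spec {ι κ : Type*} [Fintype ι] {k : ℕ} {fs : κ → MvPolynomial ι 𝕜}
    {u : Fin R → ι → 𝕜} {P : Fin s → (Fin (e + 1) → ι) → 𝕜} {f g : Fin s → 𝕜}
    {x : Fin k → ι → 𝕜} (h : Algorithm1 fs u P f g (Alg1Output.only k x)) :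
    liftedSpace (e + 1) fs u ≠ ⊥ ∧ s ≤ R ∧ k = s ∧ (∃ L : TripleList 𝕜 (Fin s) ι (Fin e → ι),
      L.length = k ∧ SimDiag (stackTensor P) f g (some L)) ∧ LinearIndependent 𝕜 x ∧
      ∃ z : Fin k → Fin s → 𝕜, LinearIndependent 𝕜 z ∧
        ∀ i, P i = ∑ a, z a i • powTensor (e + 1) (x a) := by
  generalize ho : Alg1Output.only k x = out at h
  cases h with
  | trivial => cases ho
  | failLarge => cases ho
  | failDiag => cases ho
  | failForm => cases ho
  | found h hs L hd z y hf =>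
    cases ho
    exact ⟨h, hs, hf.length_eq, ⟨L, rfl, hd⟩, hf.indep_x, z, hf.indep_z, hf.eq_sum⟩

lemma liftedSpace_eq_of_sum {ι κ : Type*} [Fintype ι] {fs : κ → MvPolynomial ι 𝕜}
    {u : Fin R → ι → 𝕜} {P : Fin s → (Fin (e + 1) → ι) → 𝕜}
    (hP : IsBasisOf P (liftedSpace (e + 1) fs u)) {x : Fin s → ι → 𝕜} {z : Fin s → Fin s → 𝕜}
    (h : ∀ i, P i = ∑ k, z k i • powTensor (e + 1) (x k)) :
    liftedSpace (e + 1) fs u = span 𝕜 (range fun a => powTensor (e + 1) (x a)) := by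
  rw [← hP.2]
  refine Submodule.eq_of_le_of_finrank_le ?_ ?_
  · rw [span_le]
    rintro _ ⟨i, rfl⟩
    rw [h i]
    exact Submodule.sum_mem _ fun a _ => Submodule.smul_mem _ _ (subset_span ⟨a, rfl⟩)
  rw [finrank_span_eq_card hP.1]
  exact finrank_range_le_card _

/-- A decomposition that the procedure outputs is the unique one. -/
lemma AidedDecompose.unique (hr : 0 < r)
    {f g : Fin s → 𝕜} {L : BlockList 𝕜 n1 n2 n3} (hu : IsBasisOf u (sliceSpan T))
    (hP : IsBasisOf P (liftedSpace (r + 1) (minors 𝕜 n1 n2 r) u))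
    (h : AidedDecompose T u P f g (some L)) : IsUniqueAidedRankDecomposition r T L.v L.w := by
  generalize ho : some L = out at h
  cases h with
  | empty hℓ h v w =>
    cases ho
    subst hℓ
    have hv : LinearIndependent 𝕜 v := linearIndependent_empty_type
    have hr : range u = range v := by simp
    have hs : span 𝕜 (range v) = sliceSpan T := by rw [← hr, hu.2]
    refine isUniqueAidedRankDecomposition_of_lines hv hs ?_ (fun a => a.elim0) ?_
    · funext i k
      have := slice_mem (T := T) k
      rw [← hs] at this
      simp only [Set.range_eq_empty, Submodule.span_empty, Submodule.mem_bot] at this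
      simpa [sumTensor] using congrFun this i
    intro y hy _ hy0
    simp only [Set.range_eq_empty, Submodule.span_empty, Submodule.mem_bot] at hy
    grind
  | found x h hx hh =>
    cases ho
    obtain ⟨-, -, rfl, -, -, z, -, hz⟩ := hx.only_spec
    exact isUniqueAidedRankDecomposition_of_liftedSpace hr hu hh (liftedSpace_eq_of_sum hP hz)
  | noneTrivial => cases ho
  | noneFewer => cases ho
  | noneFail => cases ho

end Uniqueness

/-! ## Simultaneous diagonalization -/

section SimDiagAnalysis

variable {α β γ : Type*} [Fintype α] [Fintype β] [Fintype γ]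

/-- The matrix `∑ a, φ a • x a ⊗ y a`. -/
def sumOuter {s : ℕ} (φ : Fin s → 𝕜) (x : Fin s → β → 𝕜) (y : Fin s → γ → 𝕜) : Matrix β γ 𝕜 :=
  of fun b c => ∑ a, φ a * x a b * y a c

lemma sumOuter_mulVec (φ : Fin s → 𝕜) (x : Fin s → β → 𝕜) (y : Fin s → γ → 𝕜)
    (v : γ → 𝕜) : (sumOuter φ x y).mulVec v = ∑ a, (φ a * ∑ c, y a c * v c) • x a := by
  funext b
  simp only [sumOuter, Matrix.mulVec, dotProduct, of_apply, sum_mul,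
    Finset.sum_apply, Pi.smul_apply, smul_eq_mul, mul_sum]
  rw [sum_comm]
  grind

lemma sumOuter_transpose (φ : Fin s → 𝕜) (x : Fin s → β → 𝕜) (y : Fin s → γ → 𝕜) :
    (sumOuter φ x y).transpose = sumOuter φ y x := by
  ext c b
  simp only [sumOuter, Matrix.transpose_apply, of_apply]
  grind

lemma sumOuter_mul_mulVec {φ ψ : Fin s → 𝕜} {x : Fin s → β → 𝕜} {y : Fin s → γ → 𝕜}
    (hx : LinearIndependent 𝕜 x) (hy : LinearIndependent 𝕜 y) (hψ : ∀ a, ψ a ≠ 0)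
    {B : Matrix γ β 𝕜} (hB : sumOuter ψ x y * B * sumOuter ψ x y = sumOuter ψ x y) (a : Fin s) :
    (sumOuter φ x y * B).mulVec (x a) = (φ a / ψ a) • x a := by
  obtain ⟨ξ, hξ⟩ := exists_isDualTo hy
  have hGξ : (sumOuter ψ x y).mulVec (ξ a) = ψ a • x a := by
    rw [sumOuter_mulVec, sum_eq_single a]
    · congr 1
      have := hξ a a
      grind
    · intro b _ hb
      have := hξ a b
      rw [if_neg hb.symm] at this
      rw [sum_congr rfl fun c _ => mul_comm (y b c) (ξ a c), this, mul_zero, zero_smul]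
    simp
  have h1 : (sumOuter ψ x y).mulVec (B.mulVec (x a)) = x a := by
    have h2 : x a = (ψ a)⁻¹ • (sumOuter ψ x y).mulVec (ξ a) := by simp_all
    conv_lhs => rw [h2]
    rw [Matrix.mulVec_smul, Matrix.mulVec_smul, Matrix.mulVec_mulVec, Matrix.mulVec_mulVec,
      hB, ← h2]
  rw [sumOuter_mulVec] at h1
  have h3 : ∀ b, ψ b * ∑ c, y b c * B.mulVec (x a) c = if b = a then 1 else 0 := by
    have := Fintype.linearIndependent_iff.1 hx
      (fun b => ψ b * ∑ c, y b c * B.mulVec (x a) c - if b = a then 1 else 0) (by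
        simp only [sub_smul, sum_sub_distrib, h1, ite_smul, one_smul, zero_smul,
          Finset.sum_ite_eq', mem_univ, if_true, sub_self])
    grind
  rw [← Matrix.mulVec_mulVec, sumOuter_mulVec, sum_eq_single a]
  · grind
  · intro b _ hb
    have := h3 b
    rw [if_neg hb] at this
    rw [(mul_eq_zero.1 this).resolve_left (hψ b), mul_zero, zero_smul]
  simp

lemma sumOuter_mul_mulVec_mem (φ : Fin s → 𝕜) (x : Fin s → β → 𝕜) (y : Fin s → γ → 𝕜)
    (B : Matrix γ β 𝕜) (v : β → 𝕜) :
    (sumOuter φ x y * B).mulVec v ∈ span 𝕜 (range x) := by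
  rw [← Matrix.mulVec_mulVec, sumOuter_mulVec]
  exact Submodule.sum_mem _ fun a _ => Submodule.smul_mem _ _ (subset_span ⟨a, rfl⟩)

lemma exists_eigenvalue_eq {x : Fin s → β → 𝕜} (hx : LinearIndependent 𝕜 x)
    {M : Matrix β β 𝕜} {ρ : Fin s → 𝕜} (hM : ∀ a, M.mulVec (x a) = ρ a • x a)
    (hr : ∀ v, M.mulVec v ∈ span 𝕜 (range x)) {v : β → 𝕜} {l : 𝕜} (hv : v ≠ 0)
    (hl : l ≠ 0) (h : M.mulVec v = l • v) :
    ∃ c : Fin s → 𝕜, v = ∑ a, c a • x a ∧ (∀ a, c a ≠ 0 → l = ρ a) ∧ ∃ a, c a ≠ 0 := by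
  have hvs : v ∈ span 𝕜 (range x) := by
    have : v = l⁻¹ • M.mulVec v := by simp_all
    rw [this]
    exact Submodule.smul_mem _ _ (hr v)
  obtain ⟨c, rfl⟩ := (Submodule.mem_span_range_iff_exists_fun 𝕜).1 hvs
  refine ⟨c, rfl, fun a ha => ?_, ?_⟩
  · have h1 : ∑ b, (c b * ρ b - l * c b) • x b = 0 := by
      have h2 : M.mulVec (∑ b, c b • x b) = ∑ b, (c b * ρ b) • x b := by
        rw [Matrix.mulVec_sum]
        exact sum_congr rfl fun b _ => by rw [Matrix.mulVec_smul, hM, smul_smul]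
      rw [h2, Finset.smul_sum] at h
      simp only [sub_smul, sum_sub_distrib, h, smul_smul, sub_self]
    have h3 := Fintype.linearIndependent_iff.1 hx _ h1 a
    grind
  by_contra! hall
  simp_all

lemma rank_eq_of_eigen {x : Fin s → β → 𝕜} (hx : LinearIndependent 𝕜 x)
    {M : Matrix β β 𝕜} {ρ : Fin s → 𝕜} (hρ : ∀ a, ρ a ≠ 0)
    (hM : ∀ a, M.mulVec (x a) = ρ a • x a)
    (hr : ∀ v, M.mulVec v ∈ span 𝕜 (range x)) : M.rank = s := by
  have : LinearMap.range M.mulVecLin = span 𝕜 (range x) := by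
    apply le_antisymm
    · rintro _ ⟨v, rfl⟩
      exact hr v
    rw [span_le]
    rintro _ ⟨a, rfl⟩
    refine ⟨(ρ a)⁻¹ • x a, ?_⟩
    simp_all
  rw [Matrix.rank, this, finrank_span_eq_card hx, card_fin]

lemma SimpleNonzeroSpectrum.linearIndependent {M : Matrix β β 𝕜} {k : ℕ} {lam : Fin k → 𝕜}
    {v : Fin k → β → 𝕜} (h : SimpleNonzeroSpectrum M k lam v) : LinearIndependent 𝕜 v := by
  refine Module.End.eigenvectors_linearIndependent' M.mulVecLin lam h.injective v fun a => ?_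
  rw [Module.End.hasEigenvector_iff, Module.End.mem_eigenspace_iff]
  exact ⟨h.eigen a, h.vector_ne a⟩

lemma SimpleNonzeroSpectrum.exists_perm {x : Fin s → β → 𝕜}
    (hx : LinearIndependent 𝕜 x) {M : Matrix β β 𝕜} {ρ : Fin s → 𝕜} (hρi : Injective ρ)
    (hM : ∀ a, M.mulVec (x a) = ρ a • x a)
    (hr : ∀ v, M.mulVec v ∈ span 𝕜 (range x)) {k : ℕ} {lam : Fin k → 𝕜}
    {v : Fin k → β → 𝕜} (h : SimpleNonzeroSpectrum M k lam v) :
    ∃ τ : Fin k → Fin s, (∀ j, lam j = ρ (τ j)) ∧ ∀ j, ∃ c : 𝕜, c ≠ 0 ∧ v j = c • x (τ j) := by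
  have key : ∀ j, ∃ a, lam j = ρ a ∧ ∃ c : 𝕜, c ≠ 0 ∧ v j = c • x a := by
    intro j
    obtain ⟨c, hc, hl, a, ha⟩ := exists_eigenvalue_eq hx hM hr (h.vector_ne j) (h.value_ne j)
      (h.eigen j)
    refine ⟨a, hl a ha, c a, ha, ?_⟩
    rw [hc]
    refine sum_eq_single a (fun b _ hb => ?_) (by simp)
    have : c b = 0 := by grind
    rw [this, zero_smul]
  choose τ hτ hτ' using key
  exact ⟨τ, hτ, hτ'⟩

lemma contractFirst_eq_sumOuter {T : α → β → γ → 𝕜} {z : Fin s → α → 𝕜}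
    {x : Fin s → β → 𝕜} {y : Fin s → γ → 𝕜}
    (hT : ∀ i b c, T i b c = ∑ a, z a i * x a b * y a c) (f : α → 𝕜) :
    contractFirst T f = sumOuter (fun a => ∑ i, f i * z a i) x y := by
  ext b c
  simp only [contractFirst, sumOuter, of_apply, hT, mul_sum, sum_mul]
  rw [sum_comm]
  grind

/-- The pair of functionals `f`, `g` is in general position with respect to the vectors `z a`. -/
structure GoodPair {s : ℕ} (z : Fin s → α → 𝕜) (f g : α → 𝕜) : Prop where
  left_ne : ∀ a, ∑ i, f i * z a i ≠ 0
  right_ne : ∀ a, ∑ i, g i * z a i ≠ 0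
  ratio : Injective fun a => (∑ i, f i * z a i) / ∑ i, g i * z a i

section Decomposed

variable {s : ℕ} {T : α → β → γ → 𝕜} {z : Fin s → α → 𝕜} {x : Fin s → β → 𝕜} {y : Fin s → γ → 𝕜}
  {f g : α → 𝕜}

lemma GoodPair.spectrum (hT : ∀ i b c, T i b c = ∑ a, z a i * x a b * y a c)
    (hx : LinearIndependent 𝕜 x) (hy : LinearIndependent 𝕜 y) (hfg : GoodPair z f g)
    {B : Matrix γ β 𝕜} (hB : IsMoorePenrose (contractFirst T g) B) :
    (∀ a, (contractFirst T f * B).mulVec (x a) = ((∑ i, f i * z a i) / ∑ i, g i * z a i) • x a) ∧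
    (∀ v, (contractFirst T f * B).mulVec v ∈ span 𝕜 (range x)) ∧
    (contractFirst T f * B).rank = s := by
  have h1 := hB.left
  rw [contractFirst_eq_sumOuter hT g] at h1
  rw [contractFirst_eq_sumOuter hT f]
  have h2 := sumOuter_mul_mulVec (φ := fun a => ∑ i, f i * z a i) hx hy hfg.right_ne h1
  have h3 := sumOuter_mul_mulVec_mem (fun a => ∑ i, f i * z a i) x y B
  exact ⟨h2, h3, rank_eq_of_eigen hx (fun a => div_ne_zero (hfg.left_ne a) (hfg.right_ne a)) h2 h3⟩

lemma GoodPair.spectrum_transpose (hT : ∀ i b c, T i b c = ∑ a, z a i * x a b * y a c)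
    (hx : LinearIndependent 𝕜 x) (hy : LinearIndependent 𝕜 y) (hfg : GoodPair z f g)
    {A : Matrix γ β 𝕜} (hA : IsMoorePenrose (contractFirst T f) A) :
    (∀ a, (A * contractFirst T g).transpose.mulVec (y a) =
      ((∑ i, f i * z a i) / ∑ i, g i * z a i)⁻¹ • y a) ∧
    (∀ v, (A * contractFirst T g).transpose.mulVec v ∈ span 𝕜 (range y)) ∧
    (A * contractFirst T g).transpose.rank = s := by
  have h1 := congrArg Matrix.transpose hA.left
  rw [contractFirst_eq_sumOuter hT f, Matrix.transpose_mul, Matrix.transpose_mul,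
    sumOuter_transpose, ← Matrix.mul_assoc] at h1
  rw [Matrix.transpose_mul, contractFirst_eq_sumOuter hT g, sumOuter_transpose]
  have h2 := sumOuter_mul_mulVec (φ := fun a => ∑ i, g i * z a i) hy hx hfg.left_ne h1
  have h3 := sumOuter_mul_mulVec_mem (fun a => ∑ i, g i * z a i) y x A.transpose
  refine ⟨fun a => by rw [h2 a, inv_div], h3, rank_eq_of_eigen hy
    (fun a => div_ne_zero (hfg.right_ne a) (hfg.left_ne a)) h2 h3⟩

/-- The triples in `L` are, up to order and scale, the terms `z a ⊗ x a ⊗ y a`. -/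
def IsTermList (L : TripleList 𝕜 α β γ) (z : Fin s → α → 𝕜) (x : Fin s → β → 𝕜)
    (y : Fin s → γ → 𝕜) : Prop :=
  L.length = s ∧ ∃ τ : Fin L.length → Fin s, Injective τ ∧ ∀ j, ∃ c c' : 𝕜,
    c ≠ 0 ∧ c' ≠ 0 ∧ L.v j = c • x (τ j) ∧ L.w j = c' • y (τ j) ∧ L.u j = (c * c')⁻¹ • z (τ j)

lemma contractLast_eq (hT : ∀ i b c, T i b c = ∑ a, z a i * x a b * y a c) (h : β → γ → 𝕜) :
    contractLast T h = ∑ a, (∑ b, ∑ c, h b c * (x a b * y a c)) • z a := by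
  funext i
  simp only [contractLast, hT, sum_mul, Finset.sum_apply, Pi.smul_apply, smul_eq_mul]
  rw [sum_congr rfl fun b _ => sum_comm, sum_comm]
  grind

lemma contractLast_of_dual (hT : ∀ i b c, T i b c = ∑ a, z a i * x a b * y a c) {k : ℕ}
    (hk : k = s) {v : Fin k → β → 𝕜} {w : Fin k → γ → 𝕜} {h : Fin k → β → γ → 𝕜}
    (hh : IsDualToProducts v w h) {τ : Fin k → Fin s} (hτ : Injective τ)
    {c c' : Fin k → 𝕜} (hc : ∀ j, c j ≠ 0) (hc' : ∀ j, c' j ≠ 0) (hv : ∀ j, v j = c j • x (τ j))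
    (hw : ∀ j, w j = c' j • y (τ j)) (j : Fin k) :
    contractLast T (h j) = (c j * c' j)⁻¹ • z (τ j) := by
  subst hk
  have hsurj := Finite.injective_iff_surjective.1 hτ
  have key : ∀ i, ∑ b, ∑ d, h j b d * (x (τ i) b * y (τ i) d) =
      (c i * c' i)⁻¹ * if j = i then 1 else 0 := by
    intro i
    rw [← hh j i, mul_sum]
    refine sum_congr rfl fun b _ => ?_
    rw [mul_sum]
    refine sum_congr rfl fun d _ => ?_
    rw [hv, hw]
    simp only [Pi.smul_apply, smul_eq_mul]
    grind
  rw [contractLast_eq hT, sum_eq_single (τ j)]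
  · grind
  · intro a _ ha
    obtain ⟨i, rfl⟩ := hsurj a
    rw [key, if_neg (fun h => ha (by rw [h])), mul_zero, zero_smul]
  simp

/-- On functionals in general position, simultaneous diagonalization finds the decomposition. -/
lemma SimDiag.isTermList (hT : ∀ i b c, T i b c = ∑ a, z a i * x a b * y a c)
    (hz : LinearIndependent 𝕜 z) (hx : LinearIndependent 𝕜 x) (hy : LinearIndependent 𝕜 y)
    (hfg : GoodPair z f g) {out : Option (TripleList 𝕜 α β γ)} (h : SimDiag T f g out) :
    ∃ L, out = some L ∧ IsTermList L z x y := by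
  have second : ∀ {A : Matrix γ β 𝕜} (_ : IsMoorePenrose (contractFirst T f) A) {k : ℕ}
      (_ : k = s) {lam : Fin k → 𝕜} (_ : Injective lam) (τ : Fin k → Fin s)
      (_ : ∀ j, lam j = (∑ i, f i * z (τ j) i) / ∑ i, g i * z (τ j) i),
      SimpleNonzeroSpectrum (A * contractFirst T g).transpose k (fun a => (lam a)⁻¹)
        fun j => y (τ j) := by
    intro A hA k hk lam hlam τ hτ
    obtain ⟨e1, -, e3⟩ := hfg.spectrum_transpose hT hx hy hA
    refine ⟨e3.trans hk.symm, fun i j hij => hlam (inv_injective hij), fun a => inv_ne_zero ?_,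
      fun a => hy.ne_zero _, fun a => ?_⟩
    · rw [hτ]
      exact div_ne_zero (hfg.left_ne _) (hfg.right_ne _)
    rw [e1, hτ]
  have main : ∀ {A B : Matrix γ β 𝕜} (_ : IsMoorePenrose (contractFirst T f) A)
      (_ : IsMoorePenrose (contractFirst T g) B) {k : ℕ} {lam : Fin k → 𝕜} {v : Fin k → β → 𝕜}
      {w : Fin k → γ → 𝕜} (_ : SimpleNonzeroSpectrum (contractFirst T f * B) k lam v)
      (_ : SimpleNonzeroSpectrum (A * contractFirst T g).transpose k (fun a => (lam a)⁻¹) w)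
      {h : Fin k → β → γ → 𝕜} (_ : IsDualToProducts v w h),
      IsTermList ⟨k, fun a => contractLast T (h a), v, w⟩ z x y := by
    intro A B hA hB k lam v w hv hw h hh
    obtain ⟨e1, e2, e3⟩ := hfg.spectrum hT hx hy hB
    obtain ⟨e1', e2', e3'⟩ := hfg.spectrum_transpose hT hx hy hA
    have hk : k = s := hv.rank_eq.symm.trans e3
    obtain ⟨τ, hτ, hτc⟩ := hv.exists_perm hx hfg.ratio e1 e2
    obtain ⟨τ', hτ', hτc'⟩ := hw.exists_perm hy
      (ρ := fun a => ((∑ i, f i * z a i) / ∑ i, g i * z a i)⁻¹)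
      (fun i j hij => hfg.ratio (inv_injective hij)) e1' e2'
    have heq : τ' = τ := by
      funext j
      apply hfg.ratio
      have := hτ' j
      grind
    subst heq
    choose c hc hcv using hτc
    choose c' hc' hcw using hτc'
    have hinj : Injective τ' := fun i j hij => hv.injective (by rw [hτ, hτ, hij])
    exact ⟨hk, τ', hinj, fun j => ⟨c j, c' j, hc j, hc' j, hcv j, hcw j,
      contractLast_of_dual hT hk hh hinj hc hc' hcv hcw j⟩⟩
  cases h with
  | failFirst B hB h =>
    obtain ⟨e1, e2, e3⟩ := hfg.spectrum hT hx hy hB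
    exact absurd ⟨s, _, x, e3, hfg.ratio,
      fun a => div_ne_zero (hfg.left_ne a) (hfg.right_ne a), hx.ne_zero, e1⟩ h
  | failSecond A B hA hB k lam v hv h =>
    obtain ⟨e1, e2, e3⟩ := hfg.spectrum hT hx hy hB
    obtain ⟨τ, hτ, -⟩ := hv.exists_perm hx hfg.ratio e1 e2
    exact absurd ⟨_, second hA (hv.rank_eq.symm.trans e3) hv.injective τ hτ⟩ h
  | failParallel A B hA hB k lam v w hv hw h hh hpar =>
    exfalso
    obtain ⟨hk, τ, hτ, hj⟩ := main hA hB hv hw hh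
    obtain ⟨a, b, hab, hm⟩ := hpar
    obtain ⟨c, c', hc, hc', -, -, hu⟩ := hj a
    obtain ⟨d, d', hd, hd', -, -, hu'⟩ := hj b
    obtain ⟨m, hm⟩ := Submodule.mem_span_singleton.1 hm
    change contractLast T (h a) = _ at hu
    change contractLast T (h b) = _ at hu'
    rw [hu, hu', smul_smul] at hm
    have hne : τ a ≠ τ b := fun e => hab (hτ e)
    have h4 := Fintype.linearIndependent_iff.1 hz
      (single (τ b) (m * (d * d')⁻¹) - single (τ a) (c * c')⁻¹) (by
        simp only [Pi.sub_apply, sub_smul, sum_sub_distrib, Pi.single_apply, ite_smul,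
          zero_smul, Finset.sum_ite_eq', mem_univ, if_true]
        rw [hm, sub_self]) (τ a)
    simp_all
  | found A B hA hB k lam v w hv hw h hh hpar => exact ⟨_, rfl, main hA hB hv hw hh⟩

lemma rank_sumOuter_le [DecidableEq β] (φ : Fin s → 𝕜) (x : Fin s → β → 𝕜) (y : Fin s → γ → 𝕜)
    (a₀ : Fin s) (h0 : φ a₀ = 0) : (sumOuter φ x y).rank < s := by
  have hle : LinearMap.range (sumOuter φ x y).mulVecLin ≤
      span 𝕜 (range fun a : {a : Fin s // a ≠ a₀} => x a) := by
    rintro _ ⟨v, rfl⟩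
    rw [Matrix.mulVecLin_apply, sumOuter_mulVec]
    refine Submodule.sum_mem _ fun a _ => ?_
    by_cases ha : a = a₀
    · subst ha; simp [h0]
    exact Submodule.smul_mem _ _ (subset_span ⟨⟨a, ha⟩, rfl⟩)
  have h1 := finrank_mono hle
  have h2 := finrank_range_le_card (R := 𝕜) fun a : {a : Fin s // a ≠ a₀} => x a
  have h3 : card {a : Fin s // a ≠ a₀} < s := by
    have := Fintype.card_subtype_lt (p := fun a : Fin s => a ≠ a₀) (x := a₀) (by simp)
    simpa using this
  exact (h1.trans h2).trans_lt h3

/-- If simultaneous diagonalization finds a decomposition with the right number of terms, then the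
functionals are in general position. -/
lemma SimDiag.goodPair (hT : ∀ i b c, T i b c = ∑ a, z a i * x a b * y a c)
    (hx : LinearIndependent 𝕜 x) (hy : LinearIndependent 𝕜 y) {L : TripleList 𝕜 α β γ}
    (hL : L.length = s) (h : SimDiag T f g (some L)) : GoodPair z f g := by
  classical
  generalize ho : some L = out at h
  cases h with
  | failFirst => cases ho
  | failSecond => cases ho
  | failParallel => cases ho
  | found A B hA hB k lam v w hv hw h hh hpar =>
    cases ho
    change k = s at hL
    subst hL
    have hrank := hv.rank_eq
    have hl : ∀ a, ∑ i, f i * z a i ≠ 0 := by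
      intro a h0
      have h1 := Matrix.rank_mul_le_left (contractFirst T f) B
      rw [contractFirst_eq_sumOuter hT f] at h1 hrank
      have h2 := rank_sumOuter_le (fun a => ∑ i, f i * z a i) x y a h0
      omega
    have hr : ∀ a, ∑ i, g i * z a i ≠ 0 := by
      intro a h0
      have h1 := Matrix.rank_mul_le_right (contractFirst T f) B
      have h2 := Matrix.rank_mul_le_right (B * contractFirst T g) B
      rw [hB.right] at h2
      have h3 := Matrix.rank_mul_le_left (B * contractFirst T g) B
      rw [hB.right] at h3
      have h4 := Matrix.rank_mul_le_right B (contractFirst T g)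
      rw [contractFirst_eq_sumOuter hT g] at h4
      have h5 := rank_sumOuter_le (fun a => ∑ i, g i * z a i) x y a h0
      rw [contractFirst_eq_sumOuter hT g] at h3
      omega
    refine ⟨hl, hr, ?_⟩
    have h1 := hB.left
    rw [contractFirst_eq_sumOuter hT g] at h1
    have e1 := sumOuter_mul_mulVec (φ := fun a => ∑ i, f i * z a i) hx hy hr h1
    have e2 := sumOuter_mul_mulVec_mem (fun a => ∑ i, f i * z a i) x y B
    have hv' := hv
    rw [contractFirst_eq_sumOuter hT f] at hv'
    have key : ∀ j, ∃ a, lam j = (∑ i, f i * z a i) / ∑ i, g i * z a i := by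
      intro j
      obtain ⟨c, -, hc, a, ha⟩ := exists_eigenvalue_eq hx e1 e2 (hv'.vector_ne j)
        (hv'.value_ne j) (hv'.eigen j)
      exact ⟨a, hc a ha⟩
    choose τ hτ using key
    have hinj : Injective τ := fun i j hij => hv.injective (by rw [hτ, hτ, hij])
    have hsurj := Finite.injective_iff_surjective.1 hinj
    intro a b hab
    obtain ⟨i, rfl⟩ := hsurj a
    obtain ⟨j, rfl⟩ := hsurj b
    simp only [← hτ] at hab
    rw [hv.injective hab]

end Decomposed

/-! ### The algorithm always has an output -/

open scoped ComplexOrder in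
lemma exists_isMoorePenrose (A : Matrix β γ 𝕜) : ∃ B, IsMoorePenrose A B := by
  classical
  have hH : (A.conjTranspose * A).IsHermitian := Matrix.isHermitian_conjTranspose_mul_self A
  let U : Matrix γ γ 𝕜 := hH.eigenvectorUnitary
  let D : γ → 𝕜 := fun i => (hH.eigenvalues i : 𝕜)
  have hU : U.conjTranspose * U = 1 := by
    have := Unitary.coe_star_mul_self hH.eigenvectorUnitary
    exact this
  have hspec : A.conjTranspose * A = U * diagonal D * U.conjTranspose := by
    have := hH.spectral_theorem
    rw [Unitary.conjStarAlgAut_apply] at this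
    exact this
  let G : Matrix γ γ 𝕜 := U * diagonal (fun i => (D i)⁻¹) * U.conjTranspose
  have hDs : ∀ i, star (D i) = D i := fun i => RCLike.conj_ofReal _
  have hG : G.conjTranspose = G := by
    simp only [G, Matrix.conjTranspose_mul, Matrix.conjTranspose_conjTranspose,
      Matrix.diagonal_conjTranspose, Matrix.mul_assoc]
    congr 3
    funext i
    simp_all
  have hmul : ∀ E E' : γ → 𝕜, U * diagonal E * U.conjTranspose *
      (U * diagonal E' * U.conjTranspose) =
        U * diagonal (fun i => E i * E' i) * U.conjTranspose := by
    intro E E'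
    calc _ = U * diagonal E * (U.conjTranspose * U) * diagonal E' *
        U.conjTranspose := by simp only [Matrix.mul_assoc]
      _ = _ := by rw [hU, Matrix.mul_one, Matrix.mul_assoc U, Matrix.diagonal_mul_diagonal]
  have hGH : G * (A.conjTranspose * A) = (A.conjTranspose * A) * G := by
    rw [hspec, hmul, hmul]
    simp only [mul_comm]
  have hHGH : (A.conjTranspose * A) * G * (A.conjTranspose * A) = A.conjTranspose * A := by
    rw [hspec, hmul, hmul]
    simp_all
  have hGHG : G * (A.conjTranspose * A) * G = G := by
    rw [hspec, hmul, hmul]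
    congr 3
    funext i
    by_cases h : D i = 0
    · simp [h]
    field_simp
  have hAP : A * G * (A.conjTranspose * A) = A := by
    have h0 : (A - A * G * (A.conjTranspose * A)).conjTranspose *
        (A - A * G * (A.conjTranspose * A)) = 0 := by
      have e1 : (A * G * (A.conjTranspose * A)).conjTranspose =
          (A.conjTranspose * A) * G * A.conjTranspose := by
        simp only [Matrix.conjTranspose_mul, Matrix.conjTranspose_conjTranspose, hG,
          Matrix.mul_assoc]
      rw [Matrix.conjTranspose_sub, e1, Matrix.sub_mul, Matrix.mul_sub, Matrix.mul_sub]
      have e2 : A.conjTranspose * (A * G * (A.conjTranspose * A)) = A.conjTranspose * A := by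
        rw [← Matrix.mul_assoc, ← Matrix.mul_assoc A.conjTranspose A G, hHGH]
      have e3 : A.conjTranspose * A * G * A.conjTranspose * A = A.conjTranspose * A := by
        rw [Matrix.mul_assoc (A.conjTranspose * A * G), hHGH]
      have e4 : A.conjTranspose * A * G * A.conjTranspose * (A * G * (A.conjTranspose * A)) =
          A.conjTranspose * A := by
        rw [Matrix.mul_assoc (A.conjTranspose * A * G), e2, hHGH]
      simp_all
    have := Matrix.conjTranspose_mul_self_eq_zero.1 h0
    exact (sub_eq_zero.1 this).symm
  refine ⟨G * A.conjTranspose, ⟨?_, ?_, ?_, ?_⟩⟩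
  · rw [← Matrix.mul_assoc, Matrix.mul_assoc _ A.conjTranspose, hAP]
  · calc G * A.conjTranspose * A * (G * A.conjTranspose)
        = G * (A.conjTranspose * A) * G * A.conjTranspose := by simp only [Matrix.mul_assoc]
      _ = _ := by rw [hGHG]
  · rw [Matrix.IsHermitian]
    simp only [Matrix.conjTranspose_mul, Matrix.conjTranspose_conjTranspose, hG, Matrix.mul_assoc]
  rw [Matrix.IsHermitian, Matrix.mul_assoc, Matrix.conjTranspose_mul, hG, hGH]
  simp only [Matrix.conjTranspose_mul, Matrix.conjTranspose_conjTranspose]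

lemma exists_isDualToProducts {k : ℕ} {v : Fin k → β → 𝕜} {w : Fin k → γ → 𝕜}
    (hv : LinearIndependent 𝕜 v) (hw : LinearIndependent 𝕜 w) : ∃ h, IsDualToProducts v w h := by
  obtain ⟨h, hh⟩ := exists_isDualTo hv
  obtain ⟨h', hh'⟩ := exists_isDualTo hw
  refine ⟨fun a i j => h a i * h' a j, fun a b => ?_⟩
  have : ∑ i, ∑ j, h a i * h' a j * (v b i * w b j) =
      (∑ i, h a i * v b i) * ∑ j, h' a j * w b j := by
    rw [Finset.sum_mul_sum]
    exact sum_congr rfl fun i _ => sum_congr rfl fun j _ => by ring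
  rw [this, hh a b, hh' a b]
  split_ifs <;> simp

lemma exists_simDiag (T : α → β → γ → 𝕜) (f g : α → 𝕜) : ∃ out, SimDiag T f g out := by
  obtain ⟨A, hA⟩ := exists_isMoorePenrose (contractFirst T f)
  obtain ⟨B, hB⟩ := exists_isMoorePenrose (contractFirst T g)
  by_cases h1 : ∃ (k : ℕ) (lam : Fin k → 𝕜) (v : Fin k → β → 𝕜),
      SimpleNonzeroSpectrum (contractFirst T f * B) k lam v
  swap
  · exact ⟨none, SimDiag.failFirst B hB h1⟩
  obtain ⟨k, lam, v, hv⟩ := h1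
  by_cases h2 : ∃ w : Fin k → γ → 𝕜,
      SimpleNonzeroSpectrum (A * contractFirst T g).transpose k (fun a => (lam a)⁻¹) w
  swap
  · exact ⟨none, SimDiag.failSecond A B hA hB k lam v hv h2⟩
  obtain ⟨w, hw⟩ := h2
  obtain ⟨h, hh⟩ := exists_isDualToProducts hv.linearIndependent hw.linearIndependent
  by_cases hpar : ∃ a b, a ≠ b ∧ contractLast T (h a) ∈ span 𝕜 {contractLast T (h b)}
  · exact ⟨none, SimDiag.failParallel A B hA hB k lam v w hv hw h hh hpar⟩
  exact ⟨_, SimDiag.found A B hA hB k lam v w hv hw h hh hpar⟩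

end SimDiagAnalysis

/-! ## Generic points -/

section Generic

lemma pair_comp_perm {F : BiArray 𝕜 n1 n2 d} (hF : F ∈ altArrays 𝕜 n1 n2 d)
    (z : Fin d → MatSpace 𝕜 n1 n2) (σ : Perm (Fin d)) : pair F (z ∘ σ) = pair F z := by
  rw [pair, pair]
  refine sum_equiv (Equiv.arrowCongr σ (Equiv.refl _)) _ _ fun s => ?_
  refine sum_equiv (Equiv.arrowCongr σ (Equiv.refl _)) _ _ fun t => ?_
  have h1 : ∀ {n : ℕ} (s : Fin d → Fin n), (Equiv.arrowCongr σ (Equiv.refl _)) s = s ∘ σ.symm :=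
    fun _ => rfl
  rw [h1, h1, hF.1 σ.symm, hF.2 σ.symm]
  have h2 : ((sign σ.symm : ℤ) : 𝕜) * ((sign σ.symm : ℤ) : 𝕜) = 1 := by
    rw [← Int.cast_mul, ← Units.val_mul, Int.units_mul_self]
    simp
  have h3 : ∏ k, (z ∘ σ) k (s k, t k) = ∏ k, z k ((s ∘ σ.symm) k, (t ∘ σ.symm) k) :=
    Fintype.prod_equiv σ _ _ fun k => by simp
  grind

lemma pair_outer_eq_zero {F : BiArray 𝕜 n1 n2 d} (hF : F ∈ altArrays 𝕜 n1 n2 d)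
    (x : Fin d → Fin n1 → 𝕜) (y : Fin d → Fin n2 → 𝕜) {i j : Fin d} (hij : i ≠ j)
    (hx : x i = x j) : pair F (fun k => outer (x k) (y k)) = 0 := by
  have h1 : pair F (fun k => outer (x k) (y k)) = - pair F (fun k => outer (x k) (y k)) := by
    conv_lhs => rw [pair]
    rw [pair, ← Finset.sum_neg_distrib]
    refine sum_equiv (Equiv.arrowCongr (swap i j) (Equiv.refl _)) _ _ fun s => ?_
    rw [← Finset.sum_neg_distrib]
    refine sum_congr rfl fun t _ => ?_
    have h1 : (Equiv.arrowCongr (swap i j) (Equiv.refl (Fin n1))) s = s ∘ swap i j := rfl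
    have h2 : ∏ k, x k (s (swap i j k)) = ∏ k, x k (s k) := by
      refine Fintype.prod_equiv (swap i j) _ _ fun k => ?_
      grind
    rw [h1, hF.1]
    simp only [outer, prod_mul_distrib, Function.comp_apply, h2, Equiv.Perm.sign_swap hij]
    push_cast
    ring
  grind

lemma pair_sum (F : BiArray 𝕜 n1 n2 d) (z : Fin d → Fin r → MatSpace 𝕜 n1 n2) :
    pair F (fun j => ∑ k, z j k) = ∑ κ : Fin d → Fin r, pair F fun j => z j (κ j) := by
  simp only [pair, Finset.sum_apply]
  conv_rhs => rw [sum_comm]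
  refine sum_congr rfl fun s _ => ?_
  conv_rhs => rw [sum_comm]
  refine sum_congr rfl fun t _ => ?_
  rw [← mul_sum, sum_prod_apply fun j k => z j k (s j, t j)]

lemma sum_outer_mem_detVariety (x : Fin r → Fin n1 → 𝕜) (y : Fin r → Fin n2 → 𝕜) :
    ∑ k, outer (x k) (y k) ∈ detVariety 𝕜 n1 n2 r := by
  have h : (of fun i j => (∑ k, outer (x k) (y k)) (i, j)) = (of fun i k => x k i) * of y := by
    ext i j
    simp [outer, Matrix.mul_apply]
  change Matrix.rank _ ≤ r
  rw [h]
  refine (Matrix.rank_mul_le_left _ _).trans ?_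
  simpa using Matrix.rank_le_card_width (of fun i k => x k i)

lemma exists_eq_sum_outer {v : MatSpace 𝕜 n1 n2} (hv : v ∈ detVariety 𝕜 n1 n2 r) :
    ∃ (x : Fin r → Fin n1 → 𝕜) (y : Fin r → Fin n2 → 𝕜), v = ∑ k, outer (x k) (y k) := by
  classical
  let M : Matrix (Fin n1) (Fin n2) 𝕜 := of fun i j => v (i, j)
  have hr : finrank 𝕜 (LinearMap.range M.mulVecLin) ≤ r := hv
  let b := Module.finBasis 𝕜 (LinearMap.range M.mulVecLin)
  let x : Fin r → Fin n1 → 𝕜 := fun k => if h : (k : ℕ) < _ then (b ⟨k, h⟩ : Fin n1 → 𝕜) else 0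
  have hsub : LinearMap.range M.mulVecLin ≤ span 𝕜 (range x) := by
    intro w hw
    have := b.sum_repr ⟨w, hw⟩
    have h2 := congrArg Subtype.val this
    simp only [Submodule.coe_sum, Submodule.coe_smul] at h2
    rw [← h2]
    refine Submodule.sum_mem _ fun k _ => Submodule.smul_mem _ _ (subset_span
      ⟨⟨k, k.2.trans_le hr⟩, ?_⟩)
    simp [x]
  have hex : ∀ j, ∃ c : Fin r → 𝕜, ∑ k, c k • x k = M.mulVec (single j 1) := fun j =>
    (Submodule.mem_span_range_iff_exists_fun 𝕜).1 (hsub ⟨single j 1, rfl⟩)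
  choose c hc using hex
  refine ⟨x, fun k j => c j k, ?_⟩
  funext ⟨i, j⟩
  have := congrFun (hc j) i
  simp only [Finset.sum_apply, Pi.smul_apply, smul_eq_mul, Matrix.mulVec_single_one] at this
  simp only [Finset.sum_apply, outer, mul_comm (x _ i)]
  rw [this]
  rfl

lemma card_fiber_le {α : Fin (d + 1) → Fin R} (h : ∃ j k, α j ≠ α k) :
    ∃ κ : Fin (d + 1) → Fin d, Injective fun j => (α j, κ j) := by
  classical
  have h1 : ∀ a, ∃ κ : {j // α j = a} → Fin d, Injective κ := by
    intro a
    have hc : card {j // α j = a} ≤ card (Fin d) := by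
      rw [card_fin]
      have : ∃ j, α j ≠ a := by grind
      obtain ⟨j, hj⟩ := this
      have := Fintype.card_subtype_lt (p := fun j => α j = a) hj
      simp_all
    obtain ⟨e⟩ := Function.Embedding.nonempty_of_card_le hc
    exact ⟨e, e.injective⟩
  choose κ hκ using h1
  refine ⟨fun j => κ (α j) ⟨j, rfl⟩, fun i j hij => ?_⟩
  grind

lemma exists_separating (hn : 0 < n1 * n2)
    (hl : IsLarge (R * r) (r + 1) (altArrays 𝕜 n1 n2 (r + 1))) :
    ∃ v : Fin R → MatSpace 𝕜 n1 n2, (∀ a, v a ∈ detVariety 𝕜 n1 n2 r) ∧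
      ∀ β : Fin (r + 1) → Fin R, (∃ j k, β j ≠ β k) → ∃ F ∈ altArrays 𝕜 n1 n2 (r + 1),
        ∀ α : Fin (r + 1) → Fin R, pair F (v ∘ α) ≠ 0 ↔ ∃ σ : Perm (Fin (r + 1)), α = β ∘ σ := by
  classical
  obtain ⟨x, y, hxy⟩ := exists_separates hn (R * r) (κ := Unit) (fun _ => r + 1)
    (fun _ => altArrays 𝕜 n1 n2 (r + 1)) (fun _ => le_rfl) (fun _ => hl)
  specialize hxy ()
  let e : Fin R × Fin r ≃ Fin (R * r) := finProdFinEquiv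
  refine ⟨fun a => ∑ k, outer (x (e (a, k))) (y (e (a, k))), fun a => sum_outer_mem_detVariety _ _,
    fun β hβ => ?_⟩
  let bl : Fin (R * r) → Fin R := fun m => (e.symm m).1
  obtain ⟨F, hF, hFs⟩ := hxy fun s => if ∃ σ : Perm (Fin (r + 1)), bl ∘ s = β ∘ σ then 1 else 0
  have val : ∀ s : Fin (r + 1) → Fin (R * r), pair F (fun j => outer (x (s j)) (y (s j))) =
      if Injective s ∧ ∃ σ : Perm (Fin (r + 1)), bl ∘ s = β ∘ σ then 1 else 0 := by
    intro s
    by_cases hs : Injective s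
    · obtain ⟨I, σ, rfl⟩ := exists_strictMono_comp hs
      have h1 := pair_comp_perm hF (fun j => outer (x (I j)) (y (I j))) σ
      have h2 := hFs I I.strictMono
      change pair F ((fun j => outer (x (I j)) (y (I j))) ∘ σ) = _
      rw [h1]
      refine h2.trans ?_
      refine if_congr ?_ rfl rfl
      constructor
      · rintro ⟨τ, hτ⟩
        refine ⟨hs, σ.trans τ, ?_⟩
        rw [← Function.comp_assoc, hτ]
        rfl
      rintro ⟨-, τ, hτ⟩
      refine ⟨σ.symm.trans τ, ?_⟩
      have : bl ∘ I = (bl ∘ (I ∘ σ)) ∘ σ.symm := by grind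
      rw [this, hτ]
      rfl
    rw [if_neg fun h => hs h.1]
    simp only [Injective, not_forall] at hs
    obtain ⟨i, j, hij, hne⟩ := hs
    exact pair_outer_eq_zero hF _ _ hne (by rw [hij])
  refine ⟨F, hF, fun α => ?_⟩
  have hval : pair F ((fun a => ∑ k, outer (x (e (a, k))) (y (e (a, k)))) ∘ α) =
      ((Finset.univ.filter fun κ : Fin (r + 1) → Fin r => (Injective fun j => (α j, κ j)) ∧
        ∃ σ : Perm (Fin (r + 1)), α = β ∘ σ).card : 𝕜) := by
    rw [Finset.card_filter]
    push_cast
    refine (pair_sum F fun j k => outer (x (e (α j, k))) (y (e (α j, k)))).trans ?_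
    refine sum_congr rfl fun κ _ => ?_
    rw [val fun j => e (α j, κ j)]
    refine if_congr (and_congr ?_ ?_) rfl rfl
    · exact e.injective.of_comp_iff fun j => (α j, κ j)
    have : (bl ∘ fun j => e (α j, κ j)) = α := by grind
    rw [this]
  rw [hval, Nat.cast_ne_zero, ← Nat.pos_iff_ne_zero, Finset.card_pos]
  constructor
  · grind
  rintro ⟨σ, rfl⟩
  obtain ⟨j, k, hjk⟩ := hβ
  obtain ⟨κ, hκ⟩ := card_fiber_le (α := β ∘ σ) ⟨σ.symm j, σ.symm k, by simpa using hjk⟩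
  exact ⟨κ, Finset.mem_filter.2 ⟨mem_univ _, hκ, σ, rfl⟩⟩

end Generic

section GenericSet

/-- Representatives of the non-constant tuples up to rearrangement. -/
abbrev MonoTuple (R d : ℕ) : Type := {α : Fin d → Fin R // Monotone α ∧ ∃ j k, α j ≠ α k}

/-- The values of the minors, polarized, at the matrices `v (α 0), v (α 1), …`. -/
def minorVec {R d : ℕ} (v : Fin R → MatSpace 𝕜 n1 n2) (α : Fin d → Fin R) :
    (Fin d ↪o Fin n1) × (Fin d ↪o Fin n2) → 𝕜 :=
  fun c => pair (minorArray 𝕜 c.1 c.2) (v ∘ α)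

lemma tensorPair_sum {κ : Type*} (F : BiArray 𝕜 n1 n2 d) (S : Finset κ) (c : κ → 𝕜)
    (t : κ → (Fin d → Fin n1 × Fin n2) → 𝕜) :
    tensorPair F (∑ q ∈ S, c q • t q) = ∑ q ∈ S, c q * tensorPair F (t q) := by
  simp only [tensorPair, Finset.sum_apply, Pi.smul_apply, smul_eq_mul, mul_sum]
  rw [sum_comm]
  grind

lemma linearIndependent_minorVec
    (h : ∀ β : Fin d → Fin R, (∃ j k, β j ≠ β k) → ∃ F ∈ altArrays 𝕜 n1 n2 d,
        ∀ α : Fin d → Fin R, pair F (v ∘ α) ≠ 0 ↔ ∃ σ : Perm (Fin d), α = β ∘ σ) :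
    LinearIndependent 𝕜 fun q : MonoTuple R d => minorVec v q.1 := by
  rw [Fintype.linearIndependent_iff]
  intro c hc q₀
  have h1 : ∀ (I : Fin d ↪o Fin n1) (J : Fin d ↪o Fin n2), tensorPair (minorArray 𝕜 I J)
      (∑ q : MonoTuple R d, c q • fun a => ∏ k, v (q.1 k) (a k)) = 0 := by
    intro I J
    rw [tensorPair_sum]
    have := congrFun hc (I, J)
    simp only [Finset.sum_apply, Pi.smul_apply, smul_eq_mul, Pi.zero_apply] at this
    rw [← this]
    exact sum_congr rfl fun q _ => by rw [tensorPair_prod]; rfl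
  obtain ⟨F, hF, hFα⟩ := h q₀.1 q₀.2.2
  have h2 := tensorPair_eq_zero h1 hF
  rw [tensorPair_sum, sum_eq_single q₀] at h2
  · refine (mul_eq_zero.1 h2).resolve_right ?_
    rw [tensorPair_prod]
    exact (hFα q₀.1).2 ⟨1, rfl⟩
  · intro q _ hq
    rw [tensorPair_prod]
    have : ¬ pair F (v ∘ q.1) ≠ 0 := by
      rw [hFα]
      rintro ⟨σ, hσ⟩
      apply hq
      have h3 := Tuple.unique_monotone (f := q₀.1) (σ := σ) (τ := 1) (by grind) q₀.2.1
      exact Subtype.ext (hσ.trans h3)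
    rw [show (pair F fun k => v (q.1 k)) = 0 from not_not.1 this, mul_zero]
  simp

/-- If the `v a` have rank at most `r`, and the polarized minors of their products are as
independent as possible, then the lifted space is spanned by the powers of the `v a`. -/
lemma liftedSpace_eq_span_powTensor
    (hX : ∀ a, v a ∈ detVariety 𝕜 n1 n2 r) (hv : LinearIndependent 𝕜 v)
    (hm : LinearIndependent 𝕜 fun q : MonoTuple R (r + 1) => minorVec v q.1)
    (hu : span 𝕜 (range u) = span 𝕜 (range v)) :
    liftedSpace (r + 1) (minors 𝕜 n1 n2 r) u = span 𝕜 (range fun a => powTensor (r + 1) (v a)) := by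
  classical
  apply le_antisymm
  swap
  · rw [span_le]
    rintro _ ⟨a, rfl⟩
    exact ⟨powTensor_mem_symPow (hu ▸ subset_span ⟨a, rfl⟩), pow_mem_polyAnnihilator_iff.2 (hX a)⟩
  intro t ht
  obtain ⟨h, hxh⟩ := exists_isDualTo hv
  have ht1 := ht.1.1
  rw [hu] at ht1
  have hts := hxh.eq_sum_of_mem_tensorPow ht1
  set b : (Fin (r + 1) → Fin R) → 𝕜 := fun α => tensorEval (fun j => h (α j)) t with hb
  have hbσ : ∀ α (σ : Perm (Fin (r + 1))), b (α ∘ σ) = b α :=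
    fun α σ => tensorEval_symm h ht.1.2 α σ
  have hmσ : ∀ α (σ : Perm (Fin (r + 1))), minorVec v (α ∘ σ) = minorVec v α := by
    intro α σ
    funext c
    exact pair_comp_perm (minorArray_mem _ _) (v ∘ α) σ
  have hconst : ∀ α : Fin (r + 1) → Fin R, (¬ ∃ j k, α j ≠ α k) → ∃ a, α = fun _ => a := by
    intro α hα
    push Not at hα
    exact ⟨α 0, funext fun j => hα j 0⟩
  have h0 : ∑ α ∈ Finset.univ.filter (fun α : Fin (r + 1) → Fin R => ∃ j k, α j ≠ α k),
      b α • minorVec v α = 0 := by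
    funext c
    have h1 := mem_polyAnnihilator_minors_iff.1 ht.2 _ (minorArray_mem (𝕜 := 𝕜) c.1 c.2)
    rw [hts, tensorPair_sum] at h1
    rw [Finset.sum_apply, Pi.zero_apply, ← h1]
    refine Finset.sum_subset_zero_on_sdiff (Finset.filter_subset _ _) (fun α hα => ?_) fun α _ => ?_
    · obtain ⟨a, rfl⟩ := hconst α (by simpa using hα)
      rw [tensorPair_prod, pair_const_eq_zero (hX a) (minorArray_mem _ _), mul_zero]
    rw [tensorPair_prod]
    rfl
  let S : Finset (Fin (r + 1) → Fin R) := Finset.univ.filter fun α => ∃ j k, α j ≠ α k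
  have hmaps : ∀ α : Fin (r + 1) → Fin R, (∃ j k, α j ≠ α k) →
      Monotone (α ∘ Tuple.sort α) ∧ ∃ j k, (α ∘ Tuple.sort α) j ≠ (α ∘ Tuple.sort α) k := by
    rintro α ⟨j, k, hjk⟩
    exact ⟨Tuple.monotone_sort α, (Tuple.sort α).symm j, (Tuple.sort α).symm k, by simpa using hjk⟩
  have hzero : ∀ q : MonoTuple R (r + 1), b q.1 = 0 := by
    have h2 : ∑ q : MonoTuple R (r + 1),
        (((S.filter fun α => α ∘ Tuple.sort α = q.1).card : 𝕜) * b q.1) • minorVec v q.1 = 0 := by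
      rw [← h0, ← Finset.sum_fiberwise_of_maps_to (t := Finset.univ.filter
          fun α : Fin (r + 1) → Fin R => Monotone α ∧ ∃ j k, α j ≠ α k)
          (g := fun α => α ∘ Tuple.sort α)
          (fun α hα => by simpa using hmaps α (by simpa using hα))]
      rw [Finset.sum_subtype (p := fun α => Monotone α ∧ ∃ j k, α j ≠ α k) _ (by simp)]
      refine sum_congr rfl fun q _ => ?_
      rw [sum_congr rfl (g := fun _ => b q.1 • minorVec v q.1), sum_const,
        mul_smul, Nat.cast_smul_eq_nsmul]
      intro α hα
      rw [Finset.mem_filter] at hα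
      rw [← hα.2, hbσ, hmσ]
    intro q
    have h3 := Fintype.linearIndependent_iff.1 hm _ h2 q
    refine (mul_eq_zero.1 h3).resolve_left ?_
    rw [Nat.cast_eq_zero, ← Ne, ← Nat.pos_iff_ne_zero, Finset.card_pos]
    refine ⟨q.1, Finset.mem_filter.2 ⟨Finset.mem_filter.2 ⟨mem_univ _, q.2.2⟩, ?_⟩⟩
    exact Tuple.unique_monotone (f := q.1) (τ := 1) (Tuple.monotone_sort _) q.2.1
  rw [hts]
  refine Submodule.sum_mem _ fun α _ => ?_
  change b α • _ ∈ _
  by_cases hα : ∃ j k, α j ≠ α k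
  · have := hzero ⟨α ∘ Tuple.sort α, hmaps α hα⟩
    rw [hbσ] at this
    rw [this, zero_smul]
    exact Submodule.zero_mem _
  obtain ⟨a, rfl⟩ := hconst α hα
  exact Submodule.smul_mem _ _ (subset_span ⟨a, rfl⟩)

/-! ### Zariski open dense subsets of a parametrized variety -/

section Parametrized

variable {σ τ : Type*} {Φ : σ → MvPolynomial τ 𝕜}

lemma exists_mem_range_eval_mul_ne_zero {a b : MvPolynomial σ 𝕜}
    (ha : ∃ x ∈ range fun (y : τ → 𝕜) i => eval y (Φ i), eval x a ≠ 0)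
    (hb : ∃ x ∈ range fun (y : τ → 𝕜) i => eval y (Φ i), eval x b ≠ 0) :
    ∃ x ∈ range fun (y : τ → 𝕜) i => eval y (Φ i), eval x (a * b) ≠ 0 := by
  have key : ∀ (c : MvPolynomial σ 𝕜) (y : τ → 𝕜),
      eval (fun i => eval y (Φ i)) c = eval y (bind₁ Φ c) := by
    intro c y
    rw [← MvPolynomial.coe_aeval_eq_eval y, ← MvPolynomial.coe_aeval_eq_eval]
    simp only [RingHom.coe_coe, aeval_bind₁]
  obtain ⟨_, ⟨y, rfl⟩, hy⟩ := ha
  obtain ⟨_, ⟨y', rfl⟩, hy'⟩ := hb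
  rw [key] at hy hy'
  have h1 : bind₁ Φ a * bind₁ Φ b ≠ 0 := by
    refine mul_ne_zero ?_ ?_
    · grind
    grind
  obtain ⟨z, hz⟩ := exists_eval_ne_zero h1
  grind

lemma isZariskiOpenDenseIn_of_eval_ne_zero {a : MvPolynomial σ 𝕜}
    (ha : ∃ x ∈ range fun (y : τ → 𝕜) i => eval y (Φ i), eval x a ≠ 0) :
    IsZariskiOpenDenseIn ((range fun (y : τ → 𝕜) i => eval y (Φ i)) \ {x | eval x a = 0})
      (range fun (y : τ → 𝕜) i => eval y (Φ i)) := by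
  refine ⟨⟨_, ⟨{a}, by simp⟩, rfl⟩, ?_⟩
  rintro Z ⟨F, rfl⟩ hA x hx p hp
  by_contra hne
  obtain ⟨y, hy, hyp⟩ := exists_mem_range_eval_mul_ne_zero ha ⟨x, hx, hne⟩
  rw [map_mul] at hyp
  exact right_ne_zero_of_mul hyp (hA ⟨hy, left_ne_zero_of_mul hyp⟩ p hp)

end Parametrized

end GenericSet

/-! ### The bound on the number of summands -/

lemma rankBound_eq (hn : 0 < n1 * n2) :
    rankBound n1 n2 r = ((n1.choose (r + 1) : ℝ) * n2.choose (r + 1)) /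
      ((n1 * n2).ascFactorial r : ℝ) := by
  have h1 : ((r + 1).factorial : ℝ) * ((n1 * n2 + r).choose (r + 1) : ℝ) =
      ((n1 : ℝ) * n2 + r) * ((n1 * n2).ascFactorial r : ℝ) := by
    have h := Nat.ascFactorial_eq_factorial_mul_choose' (n1 * n2) (r + 1)
    rw [Nat.ascFactorial_succ] at h
    have : n1 * n2 + (r + 1) - 1 = n1 * n2 + r := by omega
    rw [this] at h
    exact_mod_cast h.symm
  have h2 : (0 : ℝ) < (n1 : ℝ) * n2 + r := by
    have : (0 : ℝ) < ((n1 * n2 : ℕ) : ℝ) := Nat.cast_pos.2 hn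
    grind
  rw [rankBound, h1, div_mul_eq_mul_div, mul_comm ((n1 : ℝ) * n2 + r), mul_div_mul_right _ _ h2.ne']

lemma mul_pow_le_of_le_rankBound (hn : 0 < n1 * n2) (h : (R : ℝ) ≤ rankBound n1 n2 r) :
    R * (n1 * n2) ^ r ≤ n1.choose (r + 1) * n2.choose (r + 1) := by
  have h0 : 0 < (n1 * n2).ascFactorial r :=
    (Nat.pow_pos hn).trans_le (Nat.pow_succ_le_ascFactorial _ _)
  rw [rankBound_eq hn, le_div_iff₀ (Nat.cast_pos.2 h0)] at h
  refine (Nat.mul_le_mul_left R (Nat.pow_succ_le_ascFactorial _ _)).trans ?_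
  exact_mod_cast h

lemma exists_mul_le_rankBound (r : ℕ) : ∃ c : ℝ, 0 < c ∧ ∀ n1 n2 : ℕ, r < n1 → r < n2 →
    c * ((n1 : ℝ) * n2) ≤ rankBound n1 n2 r := by
  have hK : (0 : ℝ) < ((r + 1 : ℕ) : ℝ) ^ (r + 1) * (r + 1).factorial := by positivity
  have hr : (0 : ℝ) < r.factorial := by positivity
  have key : ∀ n : ℕ, r < n →
      (n : ℝ) ^ (r + 1) / (((r + 1 : ℕ) : ℝ) ^ (r + 1) * (r + 1).factorial) ≤ n.choose (r + 1) := by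
    intro n hn
    have h1 := Nat.pow_le_choose (α := ℝ) (r + 1) n
    have h2 : n + 1 - (r + 1) = n - r := by omega
    rw [h2, div_le_iff₀ (by positivity)] at h1
    rw [div_le_iff₀ hK]
    have h3 : n ≤ (r + 1) * (n - r) := by
      obtain ⟨m, rfl⟩ : ∃ m, n = r + 1 + m := ⟨n - (r + 1), by omega⟩
      have : r + 1 + m - r = 1 + m := by omega
      rw [this]
      nlinarith
    have h4 : (n : ℝ) ^ (r + 1) ≤ (((r + 1 : ℕ) : ℝ) * ((n - r : ℕ) : ℝ)) ^ (r + 1) := by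
      refine pow_le_pow_left₀ (Nat.cast_nonneg _) ?_ _
      exact_mod_cast h3
    calc (n : ℝ) ^ (r + 1) ≤ ((r + 1 : ℕ) : ℝ) ^ (r + 1) * ((n - r : ℕ) : ℝ) ^ (r + 1) := by
          rw [← mul_pow]; exact h4
      _ ≤ ((r + 1 : ℕ) : ℝ) ^ (r + 1) * (n.choose (r + 1) * (r + 1).factorial) := by
          refine mul_le_mul_of_nonneg_left ?_ (by positivity)
          exact_mod_cast h1
      _ = _ := by ring
  set K : ℝ := ((r + 1 : ℕ) : ℝ) ^ (r + 1) * (r + 1).factorial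
  refine ⟨1 / (K ^ 2 * r.factorial), by positivity, fun n1 n2 h₁ h₂ => ?_⟩
  have hn : 0 < n1 * n2 := Nat.mul_pos (by omega) (by omega)
  have hN : (0 : ℝ) < (n1 : ℝ) * n2 := by exact_mod_cast hn
  have h0 : 0 < (n1 * n2).ascFactorial r :=
    (Nat.pow_pos hn).trans_le (Nat.pow_succ_le_ascFactorial _ _)
  rw [rankBound_eq hn, le_div_iff₀ (Nat.cast_pos.2 h0)]
  have h5 : ((n1 * n2).ascFactorial r : ℝ) ≤ r.factorial * ((n1 : ℝ) * n2) ^ r := by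
    exact_mod_cast Nat.ascFactorial_le_factorial_mul_pow (n1 * n2) r
  calc 1 / (K ^ 2 * r.factorial) * ((n1 : ℝ) * n2) * ((n1 * n2).ascFactorial r : ℝ)
      ≤ 1 / (K ^ 2 * r.factorial) * ((n1 : ℝ) * n2) * (r.factorial * ((n1 : ℝ) * n2) ^ r) :=
        mul_le_mul_of_nonneg_left h5 (by positivity)
    _ = ((n1 : ℝ) ^ (r + 1) / K) * ((n2 : ℝ) ^ (r + 1) / K) := by
        field_simp
        ring
    _ ≤ _ := mul_le_mul (key n1 h₁) (key n2 h₂) (by positivity) (Nat.cast_nonneg _)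

/-! ### The generic set -/

section GenericPoint

/-- The conditions on `(v, w)` under which Algorithm 1 recovers the `v a` from `∑ a, v a ⊗ w a`. -/
structure IsGenericPoint (r : ℕ) {R : ℕ} (v : Fin R → MatSpace 𝕜 n1 n2) (w : Fin R → Fin n3 → 𝕜) :
    Prop where
  mem : ∀ a, v a ∈ detVariety 𝕜 n1 n2 r
  indep_v : LinearIndependent 𝕜 v
  indep_w : LinearIndependent 𝕜 w
  indep_minor : LinearIndependent 𝕜 fun q : MonoTuple R (r + 1) => minorVec v q.1

/-- Coordinates for the factors of `v a = ∑ k, x_{a,k} ⊗ y_{a,k}` and for the `w a`. -/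
abbrev FactorIndex (n1 n2 n3 r R : ℕ) : Type :=
  (Fin R × Fin r × Fin n1) ⊕ (Fin R × Fin r × Fin n2) ⊕ (Fin R × Fin n3)

/-- The polynomial map that multiplies the factors. -/
def factorMap (𝕜 : Type*) [RCLike 𝕜] (n1 n2 n3 r R : ℕ) :
    ParamIndex n1 n2 n3 R → MvPolynomial (FactorIndex n1 n2 n3 r R) 𝕜
  | inl (a, i, j) => ∑ k, X (inl (a, k, i)) * X (inr (inl (a, k, j)))
  | inr q => X (inr (inr q))

lemma range_factorMap (r R : ℕ) :
    (range fun (y : FactorIndex n1 n2 n3 r R → 𝕜) i => eval y (factorMap 𝕜 n1 n2 n3 r R i)) =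
      paramVariety 𝕜 n1 n2 n3 r R := by
  ext x
  constructor
  · rintro ⟨y, rfl⟩ a
    have : paramV (fun i => eval y (factorMap 𝕜 n1 n2 n3 r R i)) a =
        ∑ k, outer (fun i => y (inl (a, k, i))) fun j => y (inr (inl (a, k, j))) := by
      funext ⟨i, j⟩
      simp [paramV, factorMap, outer]
    rw [this]
    exact sum_outer_mem_detVariety _ _
  intro hx
  choose f g hfg using fun a => exists_eq_sum_outer (hx a)
  refine ⟨Sum.elim (fun p => f p.1 p.2.1 p.2.2) (Sum.elim (fun p => g p.1 p.2.1 p.2.2)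
    fun q => x (inr q)), ?_⟩
  funext i
  rcases i with ⟨a, i, j⟩ | q
  · have := congrFun (hfg a) (i, j)
    simp only [paramV, Finset.sum_apply, outer] at this
    simp [factorMap, this]
  simp [factorMap]

lemma single_mem_detVariety (hr : 0 < r) (p : Fin n1 × Fin n2) :
    (single p 1 : MatSpace 𝕜 n1 n2) ∈ detVariety 𝕜 n1 n2 r := by
  have h := sum_outer_mem_detVariety (𝕜 := 𝕜) (r := r)
    (fun k => if k = ⟨0, hr⟩ then single p.1 1 else 0) (fun _ => single p.2 1)
  convert h using 1
  funext q
  rw [Finset.sum_apply, sum_eq_single ⟨0, hr⟩]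
  · rcases p with ⟨i, j⟩
    rcases q with ⟨i', j'⟩
    simp only [outer, if_true, Pi.single_apply, Prod.mk.injEq]
    grind
  · intro k _ hk
    simp [outer, hk]
  simp

lemma exists_isGenericPoint (hr : 0 < r) (hn : 0 < n1 * n2) (hR3 : R ≤ n3)
    (hR : (R : ℝ) ≤ rankBound n1 n2 r) :
    ∃ A : Set (ParamIndex n1 n2 n3 R → 𝕜), IsZariskiOpenDenseIn A (paramVariety 𝕜 n1 n2 n3 r R) ∧
      ∀ x ∈ A, IsGenericPoint r (paramV x) (paramW x) := by
  classical
  have hb := mul_pow_le_of_le_rankBound hn hR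
  have hfin := le_finrank_altArrays (𝕜 := 𝕜) (n1 := n1) (n2 := n2) (r + 1)
  have hRN : R ≤ n1 * n2 := by
    have h1 := finrank_altArrays_le (𝕜 := 𝕜) (n1 := n1) (n2 := n2) (r + 1) hn
    have h2 : R * (n1 * n2) ^ r ≤ (n1 * n2) ^ (r + 1) := by
      refine (hb.trans hfin).trans (le_trans ?_ h1)
      exact Nat.le_mul_of_pos_right _ (by positivity)
    rw [pow_succ'] at h2
    simp_all
  have hlarge : IsLarge (R * r) (r + 1) (altArrays 𝕜 n1 n2 (r + 1)) := by
    change (n1 * n2) ^ r * (R * r) ≤ _ * r.factorial ^ 2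
    have h1 : r ≤ r.factorial ^ 2 := (Nat.self_le_factorial r).trans (Nat.le_self_pow two_ne_zero _)
    calc (n1 * n2) ^ r * (R * r) = (R * (n1 * n2) ^ r) * r := by ring
      _ ≤ _ := Nat.mul_le_mul (hb.trans hfin) h1
  obtain ⟨v₀, hv₀, hv₀'⟩ := exists_separating hn hlarge
  let e := Fintype.equivFin (MonoTuple R (r + 1))
  let polyM : Fin (card (MonoTuple R (r + 1))) → (Fin (r + 1) ↪o Fin n1) × (Fin (r + 1) ↪o Fin n2) →
        MvPolynomial (ParamIndex n1 n2 n3 R) 𝕜 := fun i c =>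
    ∑ s, ∑ t, C (minorArray 𝕜 c.1 c.2 s t) * ∏ k, X (inl ((e.symm i).1 k, (s k, t k)))
  have hpolyM : ∀ x : ParamIndex n1 n2 n3 R → 𝕜, (fun i c => eval x (polyM i c)) =
      (fun q : MonoTuple R (r + 1) => minorVec (paramV x) q.1) ∘ e.symm := by
    intro x
    funext i c
    simp [polyM, minorVec, pair, paramV]
  obtain ⟨a1, ha1, ha1'⟩ := exists_ne_zero_imp_linearIndependent polyM
    (eval (Sum.elim (fun p => v₀ p.1 p.2) 0)) (by
      rw [hpolyM, linearIndependent_equiv e.symm]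
      exact linearIndependent_minorVec hv₀')
  obtain ⟨ι1, hι1⟩ : ∃ ι : Fin R → Fin n1 × Fin n2, Injective ι := by
    have : card (Fin R) ≤ card (Fin n1 × Fin n2) := by simpa using hRN
    obtain ⟨ι⟩ := Function.Embedding.nonempty_of_card_le this
    exact ⟨ι, ι.injective⟩
  have hsingle : ∀ {κ : Type} [Fintype κ] [DecidableEq κ] (ι : Fin R → κ), Injective ι →
      LinearIndependent 𝕜 fun a => (single (ι a) 1 : κ → 𝕜) := by
    intro κ _ _ ι hι
    have := (Pi.basisFun 𝕜 κ).linearIndependent.comp ι hι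
    simpa [Function.comp_def] using this
  obtain ⟨a2, ha2, ha2'⟩ := exists_ne_zero_imp_linearIndependent
    (fun (a : Fin R) (i : Fin n1 × Fin n2) =>
      (X (inl (a, i)) : MvPolynomial (ParamIndex n1 n2 n3 R) 𝕜))
    (eval (Sum.elim (fun p => (single (ι1 p.1) 1 : MatSpace 𝕜 n1 n2) p.2) 0)) (by simp_all)
  obtain ⟨a3, ha3, ha3'⟩ := exists_ne_zero_imp_linearIndependent (fun (a : Fin R) (k : Fin n3) =>
      (X (inr (a, k)) : MvPolynomial (ParamIndex n1 n2 n3 R) 𝕜))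
    (eval (Sum.elim 0 (fun p => (single (Fin.castLE hR3 p.1) 1 : Fin n3 → 𝕜) p.2))) (by
      simpa using hsingle (Fin.castLE hR3) (Fin.castLE_injective hR3))
  have h0mem : (0 : MatSpace 𝕜 n1 n2) ∈ detVariety 𝕜 n1 n2 r := by
    have h1 := sum_outer_mem_detVariety (𝕜 := 𝕜) (n1 := n1) (n2 := n2) (r := r) 0 0
    have h2 : (outer 0 0 : MatSpace 𝕜 n1 n2) = 0 := by
      funext p
      simp [outer]
    simpa [h2] using h1
  have hne := exists_mem_range_eval_mul_ne_zero (Φ := factorMap 𝕜 n1 n2 n3 r R)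
    (exists_mem_range_eval_mul_ne_zero (a := a1) (b := a2)
      ⟨_, by rw [range_factorMap]; exact fun a => hv₀ a, ha1⟩
      ⟨_, by rw [range_factorMap]; exact fun a => single_mem_detVariety hr (ι1 a), ha2⟩)
    (b := a3) ⟨_, by rw [range_factorMap]; exact fun a => h0mem, ha3⟩
  have hd := isZariskiOpenDenseIn_of_eval_ne_zero hne
  rw [range_factorMap] at hd
  refine ⟨_, hd, fun x hx => ⟨hx.1, ?_, ?_, ?_⟩⟩
  · have := ha2' (eval x) fun h => hx.2 (by simp [h])
    simp only [eval_X] at this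
    exact this
  · have := ha3' (eval x) fun h => hx.2 (by simp [h])
    simp only [eval_X] at this
    exact this
  have := ha1' (eval x) fun h => hx.2 (by simp [h])
  rw [hpolyM, linearIndependent_equiv e.symm] at this
  exact this

lemma sliceSpan_sumTensor (v : Fin R → MatSpace 𝕜 n1 n2) (hw : LinearIndependent 𝕜 w) :
    sliceSpan (sumTensor v w) = span 𝕜 (range v) := by
  refine le_antisymm (sliceSpan_sumTensor_le v w) ?_
  rw [span_le]
  rintro _ ⟨a, rfl⟩
  obtain ⟨h, hwh⟩ := exists_isDualTo hw
  have : v a = ∑ k, h a k • fun i => sumTensor v w i k := by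
    funext i
    simp only [sumTensor, Finset.sum_apply, Pi.smul_apply, smul_eq_mul, mul_sum]
    rw [sum_comm]
    have h1 : ∀ b, ∑ k, h a k * (v b i * w b k) = v b i * if a = b then 1 else 0 := by
      intro b
      rw [← hwh a b, mul_sum]
      grind
    simp [h1]
  rw [this]
  exact Submodule.sum_mem _ fun k _ => Submodule.smul_mem _ _ (slice_mem k)

lemma IsGenericPoint.liftedSpace_eq (h : IsGenericPoint r v w)
    (hu : span 𝕜 (range u) = span 𝕜 (range v)) :
    liftedSpace (r + 1) (minors 𝕜 n1 n2 r) u = span 𝕜 (range fun a => powTensor (r + 1) (v a)) :=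
  liftedSpace_eq_span_powTensor h.mem h.indep_v h.indep_minor hu

lemma IsGenericPoint.unique (hr : 0 < r) (h : IsGenericPoint r v w) :
    IsUniqueAidedRankDecomposition r (sumTensor v w) v w :=
  isUniqueAidedRankDecomposition_of_lines h.indep_v (sliceSpan_sumTensor v h.indep_w).symm rfl h.mem
    fun _ hy hyX hy0 => exists_smul_of_liftedSpace_eq hr h.indep_v (h.liftedSpace_eq (u := v) rfl) rfl
      hy hyX hy0

end GenericPoint

/-! ### Random functionals -/

section Random

lemma ae_apply_ne_zero (L : (Fin N → 𝕜) →ₗ[𝕜] 𝕜) (hL : L ≠ 0) :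
    ∀ᵐ f ∂(Measure.addHaar : Measure (Fin N → 𝕜)), L f ≠ 0 := by
  have h := Measure.addHaar_submodule (Measure.addHaar : Measure (Fin N → 𝕜))
    ((LinearMap.ker L).restrictScalars ℝ) (by simp_all)
  rw [ae_iff]
  simp only [ne_eq, not_not]
  exact h

/-- The functional `z` on the first coordinates. -/
def evalFirst {N s : ℕ} (h : s ≤ N) (z : Fin s → 𝕜) : (Fin N → 𝕜) →ₗ[𝕜] 𝕜 where
  toFun f := ∑ i, f (Fin.castLE h i) * z i
  map_add' f g := by simp only [Pi.add_apply, add_mul, Finset.sum_add_distrib]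
  map_smul' c f := by simp only [Pi.smul_apply, smul_eq_mul, RingHom.id_apply, mul_sum, mul_assoc]

lemma evalFirst_single (h : s ≤ N) (z : Fin s → 𝕜) (i : Fin s) :
    evalFirst h z (single (Fin.castLE h i) 1) = z i := by
  change ∑ j, (single (Fin.castLE h i) 1 : Fin N → 𝕜) (Fin.castLE h j) * z j = z i
  rw [sum_eq_single i]
  · simp
  · grind
  simp

lemma sum_extendZero (h : s ≤ N) (z : Fin s → 𝕜) (f : Fin N → 𝕜) :
    ∑ i : Fin s, extendZero f i * z i = evalFirst h z f := by
  refine sum_congr rfl fun i _ => ?_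
  rw [extendZero, dif_pos (i.2.trans_le h)]
  rfl

lemma continuous_evalFirst (h : s ≤ N) (z : Fin s → 𝕜) : Continuous (evalFirst h z) := by
  change Continuous fun f : Fin N → 𝕜 => ∑ i, f (Fin.castLE h i) * z i
  fun_prop

lemma extendZero_val (f : Fin N → 𝕜) : (fun i : Fin N => extendZero f i) = f := by
  funext i
  simp [extendZero]

lemma ae_goodPair (h : s ≤ N) {z : Fin s → Fin s → 𝕜} (hz : LinearIndependent 𝕜 z) :
    ∀ᵐ fg ∂(pairMeasure 𝕜 N),
      GoodPair z (fun i => extendZero fg.1 i) (fun i => extendZero fg.2 i) := by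
  have h0 : ∀ a, evalFirst h (z a) ≠ 0 := by
    intro a h1
    apply hz.ne_zero a
    funext i
    rw [← evalFirst_single h (z a), h1]
    rfl
  have hcont := fun a => continuous_evalFirst h (z a)
  have h1 : ∀ᵐ fg ∂(pairMeasure 𝕜 N), ∀ a, evalFirst h (z a) fg.1 ≠ 0 := by
    rw [ae_all_iff]
    intro a
    refine (Measure.ae_prod_iff_ae_ae (IsOpen.measurableSet
      (isOpen_ne_fun ((hcont a).comp continuous_fst) continuous_const))).2 ?_
    filter_upwards [ae_apply_ne_zero _ (h0 a)] with f hf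
    simp_all
  have h2 : ∀ᵐ fg ∂(pairMeasure 𝕜 N), ∀ a, evalFirst h (z a) fg.2 ≠ 0 := by
    rw [ae_all_iff]
    intro a
    refine (Measure.ae_prod_iff_ae_ae (IsOpen.measurableSet
      (isOpen_ne_fun ((hcont a).comp continuous_snd) continuous_const))).2 ?_
    exact Filter.Eventually.of_forall fun _ => ae_apply_ne_zero _ (h0 a)
  have h3 : ∀ᵐ fg ∂(pairMeasure 𝕜 N), ∀ ab : Fin s × Fin s, ab.1 ≠ ab.2 →
      evalFirst h (z ab.1) fg.1 * evalFirst h (z ab.2) fg.2 ≠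
        evalFirst h (z ab.2) fg.1 * evalFirst h (z ab.1) fg.2 := by
    rw [ae_all_iff]
    rintro ⟨a, b⟩
    by_cases hab : a = b
    · simp_all
    simp only [ne_eq, hab, not_false_eq_true, forall_const]
    refine (Measure.ae_prod_iff_ae_ae (IsOpen.measurableSet (isOpen_ne_fun
      (((hcont a).comp continuous_fst).mul ((hcont b).comp continuous_snd))
      (((hcont b).comp continuous_fst).mul ((hcont a).comp continuous_snd))))).2 ?_
    filter_upwards [ae_apply_ne_zero _ (h0 a)] with f hf
    have hL : evalFirst h (z a) f • evalFirst h (z b) - evalFirst h (z b) f • evalFirst h (z a) ≠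
        0 := by
      intro h'
      apply hf
      have h4 : ∀ i, evalFirst h (z a) f * z b i - evalFirst h (z b) f * z a i = 0 := by
        intro i
        have := LinearMap.congr_fun h' (single (Fin.castLE h i) 1)
        simpa [evalFirst_single] using this
      have h5 := Fintype.linearIndependent_iff.1 hz
        (single b (evalFirst h (z a) f) - single a (evalFirst h (z b) f)) (by
          simp only [Pi.sub_apply, sub_smul, sum_sub_distrib, Pi.single_apply, ite_smul,
            zero_smul, Finset.sum_ite_eq', mem_univ, if_true]
          funext i
          simpa using h4 i) b
      simp_all
    filter_upwards [ae_apply_ne_zero _ hL] with g hg h'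
    simp_all
  filter_upwards [h1, h2, h3] with fg h1 h2 h3
  refine ⟨fun a => by rw [sum_extendZero h]; exact h1 a,
    fun a => by rw [sum_extendZero h]; exact h2 a, fun a b hab => ?_⟩
  simp only [sum_extendZero h] at hab
  by_contra hne
  rw [div_eq_div_iff (h2 a) (h2 b)] at hab
  simp_all

end Random

/-! ### The outputs of Algorithm 1 -/

section Outputs

variable {ι κ : Type*} [Fintype ι]

lemma exists_algorithm1 (fs : κ → MvPolynomial ι 𝕜) (u : Fin R → ι → 𝕜)
    (P : Fin s → (Fin (e + 1) → ι) → 𝕜) (f g : Fin s → 𝕜) : ∃ out, Algorithm1 fs u P f g out := by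
  by_cases h : liftedSpace (e + 1) fs u = ⊥
  · exact ⟨_, Algorithm1.trivial h⟩
  by_cases hs : R < s
  · exact ⟨_, Algorithm1.failLarge h hs⟩
  rw [not_lt] at hs
  obtain ⟨out, hout⟩ := exists_simDiag (stackTensor P) f g
  rcases out with _ | L
  · exact ⟨_, Algorithm1.failDiag h hs hout⟩
  by_cases hf : ∃ z x, IsPowerForm (stackTensor P) L z x
  · obtain ⟨z, x, hf⟩ := hf
    exact ⟨_, Algorithm1.found h hs L hout z x hf⟩
  exact ⟨_, Algorithm1.failForm h hs L hout hf⟩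

lemma stackTensor_eq {P : Fin s → (Fin (e + 1) → ι) → 𝕜} {x : Fin R → ι → 𝕜}
    {z : Fin R → Fin s → 𝕜} (hP : ∀ i, P i = ∑ a, z a i • powTensor (e + 1) (x a)) (i : Fin s)
    (c : ι) (b : Fin e → ι) :
    stackTensor P i c b = ∑ a, z a i * x a c * powTensor e (x a) b := by
  rw [stackTensor, hP]
  simp only [Finset.sum_apply, Pi.smul_apply, smul_eq_mul, powTensor, Fin.prod_univ_succ,
    Fin.cons_zero, Fin.cons_succ, mul_assoc]

lemma exists_coeff {E : Type*} [AddCommGroup E] [Module 𝕜 E] {P y : Fin s → E}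
    {K : Submodule 𝕜 E} (hP : IsBasisOf P K) (hK : K = span 𝕜 (range y)) :
    ∃ z : Fin s → Fin s → 𝕜, LinearIndependent 𝕜 z ∧ ∀ i, P i = ∑ a, z a i • y a := by
  have hex : ∀ i, ∃ c : Fin s → 𝕜, ∑ a, c a • y a = P i := fun i => by
    rw [← Submodule.mem_span_range_iff_exists_fun, ← hK, ← hP.2]
    exact subset_span ⟨i, rfl⟩
  choose c hc using hex
  refine ⟨fun a i => c i a, ?_, fun i => (hc i).symm⟩
  have h1 : LinearIndependent 𝕜 c := by
    rw [Fintype.linearIndependent_iff]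
    intro d hd i
    refine Fintype.linearIndependent_iff.1 hP.1 d ?_ i
    simp only [← hc, Finset.smul_sum, smul_smul]
    rw [sum_comm]
    refine sum_eq_zero fun a _ => ?_
    rw [← Finset.sum_smul]
    have := congrFun hd a
    simp_all
  have h2 : IsUnit (of c) := Matrix.linearIndependent_rows_iff_isUnit.1 h1
  exact Matrix.linearIndependent_cols_iff_isUnit.2 h2

lemma IsTermList.isPowerForm {P : Fin s → (Fin (e + 1) → ι) → 𝕜} {x : Fin s → ι → 𝕜}
    {z : Fin s → Fin s → 𝕜} (hx : LinearIndependent 𝕜 x) (hz : LinearIndependent 𝕜 z)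
    (hP : ∀ i, P i = ∑ a, z a i • powTensor (e + 1) (x a))
    {L : TripleList 𝕜 (Fin s) ι (Fin e → ι)}
    (hL : IsTermList L z x fun a => powTensor e (x a)) :
    ∃ z' x', IsPowerForm (stackTensor P) L z' x' := by
  obtain ⟨hlen, τ, hτ, hj⟩ := hL
  refine ⟨z ∘ τ, x ∘ τ, hlen, hz.comp τ hτ, hx.comp τ hτ, ?_, ?_⟩
  · intro k i a b
    obtain ⟨c, c', hc, hc', h1, h2, h3⟩ := hj k
    rw [h1, h2, h3]
    simp only [Pi.smul_apply, smul_eq_mul, powTensor, Function.comp_apply]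
    field_simp
  intro i a b
  have hbij : Function.Bijective τ :=
    (Fintype.bijective_iff_injective_and_card τ).2 ⟨hτ, by simp [hlen]⟩
  rw [stackTensor_eq hP]
  exact (Fintype.sum_bijective τ hbij _ _ fun k => rfl).symm

lemma IsTermList.exists_equiv {P : Fin s → (Fin (e + 1) → ι) → 𝕜} {x : Fin s → ι → 𝕜}
    {z : Fin s → Fin s → 𝕜} (hx : LinearIndependent 𝕜 x) (hz : LinearIndependent 𝕜 z)
    {L : TripleList 𝕜 (Fin s) ι (Fin e → ι)}
    (hL : IsTermList L z x fun a => powTensor e (x a)) {z' x'}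
    (h : IsPowerForm (stackTensor P) L z' x') :
    ∃ σ : Fin s ≃ Fin L.length, ∀ a, ∃ c : 𝕜, c ≠ 0 ∧ x' (σ a) = c • x a := by
  obtain ⟨hlen, τ, hτ, hj⟩ := hL
  have hbij : Function.Bijective τ :=
    (Fintype.bijective_iff_injective_and_card τ).2 ⟨hτ, by simp [hlen]⟩
  refine ⟨(Equiv.ofBijective τ hbij).symm, fun a => ?_⟩
  obtain ⟨k, rfl⟩ := hbij.2 a
  have hk : (Equiv.ofBijective τ hbij).symm (τ k) = k := Equiv.ofBijective_symm_apply_apply τ hbij k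
  rw [hk]
  obtain ⟨c, c', hc, hc', h1, h2, h3⟩ := hj k
  have hterm : ∀ (i : Fin s) (a : ι) (b : Fin e → ι), z (τ k) i * x (τ k) a * ∏ j : Fin e, x (τ k) (b j) =
      z' k i * x' k a * ∏ j, x' k (b j) := by
    intro i a b
    rw [← h.terms, h1, h2, h3]
    simp only [Pi.smul_apply, smul_eq_mul, powTensor]
    field_simp
  obtain ⟨i, hi⟩ := Function.ne_iff.1 (hz.ne_zero (τ k))
  obtain ⟨a₀, ha₀⟩ := Function.ne_iff.1 (hx.ne_zero (τ k))
  simp only [Pi.zero_apply] at hi ha₀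
  have h4 := hterm i a₀ fun _ => a₀
  have h5 : z' k i * x' k a₀ * ∏ j : Fin e, x' k a₀ ≠ 0 := by
    rw [← h4]
    exact mul_ne_zero (mul_ne_zero hi ha₀) (Finset.prod_ne_zero_iff.2 fun _ _ => ha₀)
  set q := z' k i * ∏ _j : Fin e, x' k a₀ with hq
  set q' := z (τ k) i * ∏ _j : Fin e, x (τ k) a₀ with hq'
  have hq0 : q ≠ 0 := by grind
  have hq0' : q' ≠ 0 := mul_ne_zero hi (Finset.prod_ne_zero_iff.2 fun _ _ => ha₀)
  refine ⟨q⁻¹ * q', mul_ne_zero (inv_ne_zero hq0) hq0', ?_⟩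
  funext a
  have h6 := hterm i a fun _ => a₀
  have h7 : q * x' k a = q' * x (τ k) a := by grind
  simp only [Pi.smul_apply, smul_eq_mul]
  grind

/-- If the lifted space has a basis `P i = ∑ a, z a i • (x a)^{⊗d}`, and the functionals are in
general position, then Algorithm 1 finds the `x a`. -/
lemma Algorithm1.lists (hr : 0 < r) {fs : κ → MvPolynomial ι 𝕜} {u : Fin ℓ → ι → 𝕜}
    (hs : s ≤ ℓ) {P : Fin s → (Fin (r + 1) → ι) → 𝕜} (hPb : IsBasisOf P (liftedSpace (r + 1) fs u))
    {x : Fin s → ι → 𝕜} {z : Fin s → Fin s → 𝕜} (hx : LinearIndependent 𝕜 x)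
    (hz : LinearIndependent 𝕜 z) (hP : ∀ i, P i = ∑ a, z a i • powTensor (r + 1) (x a))
    {f g : Fin s → 𝕜} (hfg : GoodPair z f g) {out : Alg1Output 𝕜 ι}
    (h : Algorithm1 fs u P f g out) : out.Lists x := by
  have hy : LinearIndependent 𝕜 fun a => powTensor r (x a) := by
    obtain ⟨e, rfl⟩ : ∃ e, r = e + 1 := ⟨r - 1, by omega⟩
    exact linearIndependent_powTensor hx
  have hdiag : ∀ {o}, SimDiag (stackTensor P) f g o →
      ∃ L, o = some L ∧ IsTermList L z x fun a => powTensor r (x a) := fun ho =>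
    SimDiag.isTermList (stackTensor_eq hP) hz hx hy hfg ho
  cases h with
  | trivial h =>
    have h1 := hPb.2
    rw [h, Submodule.span_eq_bot] at h1
    by_contra h2
    exact hPb.1.ne_zero ⟨0, Nat.pos_of_ne_zero h2⟩ (h1 _ ⟨_, rfl⟩)
  | failLarge h hs' => grind
  | failDiag h hs' hd => grind
  | failForm h hs' L hd hf =>
    obtain ⟨L', hL', ht⟩ := hdiag hd
    cases hL'
    exact absurd (ht.isPowerForm hx hz hP) hf
  | found h hs' L hd z' x' hf =>
    obtain ⟨L', hL', ht⟩ := hdiag hd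
    cases hL'
    exact ht.exists_equiv hx hz hf

lemma IsBasisOf.card_eq {E : Type*} [AddCommGroup E] [Module 𝕜 E] {t : ℕ} {P : Fin s → E}
    {Q : Fin t → E} {K : Submodule 𝕜 E} (hP : IsBasisOf P K) (hQ : IsBasisOf Q K) : s = t := by
  have h1 := finrank_span_eq_card hP.1
  have h2 := finrank_span_eq_card hQ.1
  rw [hP.2, card_fin] at h1
  rw [hQ.2, card_fin] at h2
  omega

end Outputs

/-! ## The outputs of the decomposition procedure -/

section Procedure

/-- The vectors `x a` explain the basis `P` of the lifted space, and `f`, `g` are in general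
position. -/
structure Recovers {r ℓ s : ℕ} (P : Fin s → (Fin (r + 1) → Fin n1 × Fin n2) → 𝕜) (f g : Fin s → 𝕜)
    (x : Fin ℓ → MatSpace 𝕜 n1 n2) (z : Fin ℓ → Fin s → 𝕜) : Prop where
  card_eq : s = ℓ
  indep : LinearIndependent 𝕜 x
  eq_sum : ∀ i, P i = ∑ a, z a i • powTensor (r + 1) (x a)
  good : GoodPair z f g

lemma linearIndependent_of_isBasisOf_sum {E : Type*} [AddCommGroup E] [Module 𝕜 E]
    {P y : Fin s → E} {K : Submodule 𝕜 E} (hP : IsBasisOf P K) {z : Fin s → Fin s → 𝕜}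
    (h : ∀ i, P i = ∑ a, z a i • y a) : LinearIndependent 𝕜 z := by
  have h1 : LinearIndependent 𝕜 fun i a => z a i := by
    rw [Fintype.linearIndependent_iff]
    intro d hd i
    refine Fintype.linearIndependent_iff.1 hP.1 d ?_ i
    simp only [h, Finset.smul_sum, smul_smul]
    rw [sum_comm]
    refine sum_eq_zero fun a _ => ?_
    rw [← Finset.sum_smul]
    have := congrFun hd a
    simp_all
  have h2 : IsUnit (of fun i a => z a i) := Matrix.linearIndependent_rows_iff_isUnit.1 h1
  exact Matrix.linearIndependent_cols_iff_isUnit.2 h2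

lemma not_mem_span_of_linearIndependent {E : Type*} [AddCommGroup E] [Module 𝕜 E]
    {z : Fin s → E} (hz : LinearIndependent 𝕜 z) {a b : Fin s} (hab : a ≠ b) :
    z a ∉ span 𝕜 {z b} := by
  have := hz.notMem_span_image (s := {b}) (x := a) (by simpa using hab)
  simpa using this

lemma Recovers.algorithm1 (hr : 0 < r) (hℓ : 0 < ℓ)
    (hP : IsBasisOf P (liftedSpace (r + 1) (minors 𝕜 n1 n2 r) u)) {f g : Fin s → 𝕜}
    {x : Fin ℓ → MatSpace 𝕜 n1 n2} {z : Fin ℓ → Fin s → 𝕜} (h : Recovers P f g x z) :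
    Algorithm1 (minors 𝕜 n1 n2 r) u P f g (Alg1Output.only ℓ x) := by
  obtain ⟨rfl, hx, hsum, hfg⟩ := h
  have hz := linearIndependent_of_isBasisOf_sum hP hsum
  have hy : LinearIndependent 𝕜 fun a => powTensor r (x a) := by
    obtain ⟨e, rfl⟩ : ∃ e, r = e + 1 := ⟨r - 1, by omega⟩
    exact linearIndependent_powTensor hx
  have hT := stackTensor_eq hsum
  obtain ⟨A, hA⟩ := exists_isMoorePenrose (contractFirst (stackTensor P) f)
  obtain ⟨B, hB⟩ := exists_isMoorePenrose (contractFirst (stackTensor P) g)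
  obtain ⟨h1, h2, h3⟩ := hfg.spectrum hT hx hy hB
  obtain ⟨h1', h2', h3'⟩ := hfg.spectrum_transpose hT hx hy hA
  obtain ⟨h, hh⟩ := exists_isDualToProducts hx hy
  have hu : ∀ a, contractLast (stackTensor P) (h a) = z a := by
    intro a
    have := contractLast_of_dual hT rfl hh (τ := id) Function.injective_id (c := fun _ => 1)
      (c' := fun _ => 1) (fun _ => one_ne_zero) (fun _ => one_ne_zero) (by simp) (by simp) a
    simpa using this
  refine Algorithm1.found (fun h0 => ?_) le_rfl
    ⟨s, fun a => contractLast (stackTensor P) (h a), x, fun a => powTensor r (x a)⟩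
    (SimDiag.found A B hA hB s (fun a => (∑ i, f i * z a i) / ∑ i, g i * z a i) x
      (fun a => powTensor r (x a))
      ⟨h3, hfg.ratio, fun a => div_ne_zero (hfg.left_ne a) (hfg.right_ne a), hx.ne_zero, h1⟩
      ⟨h3', fun a b hab => hfg.ratio (inv_injective hab),
        fun a => inv_ne_zero (div_ne_zero (hfg.left_ne a) (hfg.right_ne a)), hy.ne_zero, h1'⟩ h hh ?_)
    z x ⟨rfl, hz, hx, ?_, fun i a b => hT i a b⟩
  · have h4 := hP.2
    rw [h0, Submodule.span_eq_bot] at h4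
    exact hP.1.ne_zero ⟨0, hℓ⟩ (h4 _ ⟨_, rfl⟩)
  · rintro ⟨a, b, hab, hm⟩
    rw [hu, hu] at hm
    exact not_mem_span_of_linearIndependent hz hab hm
  intro k i a b
  change contractLast (stackTensor P) (h k) i * x k a * powTensor r (x k) b = _
  rw [hu]
  rfl

lemma Recovers.aidedDecompose (hr : 0 < r) (hℓ : 0 < ℓ)
    (hP : IsBasisOf P (liftedSpace (r + 1) (minors 𝕜 n1 n2 r) u)) {f g : Fin s → 𝕜}
    {x h : Fin ℓ → MatSpace 𝕜 n1 n2} {z : Fin ℓ → Fin s → 𝕜} (hx : Recovers P f g x z)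
    (hh : IsDualTo x h) :
    AidedDecompose T u P f g (some ⟨ℓ, x, fun a k => ∑ i, h a i * T i k⟩) :=
  AidedDecompose.found x h (hx.algorithm1 hr hℓ hP) hh

lemma Algorithm1.recovers (hr : 0 < r) {f g : Fin s → 𝕜} {x : Fin ℓ → MatSpace 𝕜 n1 n2}
    (h : Algorithm1 (minors 𝕜 n1 n2 r) u P f g (Alg1Output.only ℓ x)) :
    ∃ z, Recovers P f g x z := by
  obtain ⟨-, -, rfl, ⟨L, hL, hd⟩, hx, z, hz, hP⟩ := h.only_spec
  have hy : LinearIndependent 𝕜 fun a => powTensor r (x a) := by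
    obtain ⟨e, rfl⟩ : ∃ e, r = e + 1 := ⟨r - 1, by omega⟩
    exact linearIndependent_powTensor hx
  exact ⟨z, rfl, hx, hP, hd.goodPair (stackTensor_eq hP) hx hy hL⟩

lemma aidedDecompose_none (hr : 0 < r) (hℓ : 0 < ℓ) (T : TensorSpace 𝕜 n1 n2 n3)
    (u : Fin ℓ → MatSpace 𝕜 n1 n2) (P : Fin s → (Fin (r + 1) → Fin n1 × Fin n2) → 𝕜)
    (f g : Fin s → 𝕜) (h : ¬ ∃ (x : Fin ℓ → MatSpace 𝕜 n1 n2) (z : Fin ℓ → Fin s → 𝕜),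
      Recovers P f g x z) : AidedDecompose T u P f g none := by
  obtain ⟨out, hout⟩ := exists_algorithm1 (minors 𝕜 n1 n2 r) u P f g
  rcases out with _ | ⟨k, x⟩ | _
  · exact AidedDecompose.noneTrivial hℓ.ne' hout
  · by_cases hk : k = ℓ
    · subst hk
      exact absurd ⟨x, hout.recovers hr⟩ h
    exact AidedDecompose.noneFewer k hk x hout
  exact AidedDecompose.noneFail hout

lemma liftedSpace_eq_bot {ι κ : Type*} [Fintype ι] (fs : κ → MvPolynomial ι 𝕜)
    (u : Fin 0 → ι → 𝕜) : liftedSpace (d + 1) fs u = ⊥ := by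
  rw [eq_bot_iff]
  rintro t ⟨⟨ht, -⟩, -⟩
  rw [Submodule.mem_bot]
  induction ht using Submodule.span_induction with
  | mem t ht =>
    obtain ⟨y, hy, rfl⟩ := ht
    have := hy 0
    simp only [Set.range_eq_empty, Submodule.span_empty, Submodule.mem_bot] at this
    funext a
    simp_all
  | zero => rfl
  | add s t _ _ hs ht => grind
  | smul c t _ ht => rw [ht, smul_zero]

lemma IsGenericPoint.exists_coeff (h : IsGenericPoint r v w)
    (hu : IsBasisOf u (sliceSpan (sumTensor v w)))
    (hP : IsBasisOf P (liftedSpace (r + 1) (minors 𝕜 n1 n2 r) u)) :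
    ℓ = R ∧ s = R ∧ ∃ z : Fin R → Fin s → 𝕜, LinearIndependent 𝕜 z ∧
      ∀ i, P i = ∑ a, z a i • powTensor (r + 1) (v a) := by
  have hspan := sliceSpan_sumTensor v h.indep_w
  rw [hspan] at hu
  have hl := h.liftedSpace_eq hu.2
  have hℓ : ℓ = R := hu.card_eq ⟨h.indep_v, rfl⟩
  have hs : s = R := hP.card_eq ⟨linearIndependent_powTensor h.indep_v, hl.symm⟩
  subst hs
  exact ⟨hℓ, rfl, BlockDecomp.exists_coeff hP hl⟩

lemma IsGenericPoint.ae_lists (hr : 0 < r) (h : IsGenericPoint r v w)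
    (hu : IsBasisOf u (sliceSpan (sumTensor v w)))
    (hP : IsBasisOf P (liftedSpace (r + 1) (minors 𝕜 n1 n2 r) u)) :
    ∀ᵐ fg ∂(pairMeasure 𝕜 s), (∃ out, Algorithm1 (minors 𝕜 n1 n2 r) u P fg.1 fg.2 out) ∧
      ∀ out, Algorithm1 (minors 𝕜 n1 n2 r) u P fg.1 fg.2 out → out.Lists v := by
  obtain ⟨rfl, rfl, z, hz, hsum⟩ := h.exists_coeff hu hP
  filter_upwards [ae_goodPair le_rfl hz] with fg hfg
  rw [extendZero_val, extendZero_val] at hfg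
  exact ⟨exists_algorithm1 _ _ _ _ _, fun out hout => Algorithm1.lists hr le_rfl hP h.indep_v hz hsum hfg hout⟩

lemma IsGenericPoint.ae_sameSummands (hr : 0 < r) (h : IsGenericPoint r v w) (hN : n1 * n2 = N)
    (hu : IsBasisOf u (sliceSpan (sumTensor v w)))
    (hP : IsBasisOf P (liftedSpace (r + 1) (minors 𝕜 n1 n2 r) u)) :
    ∀ᵐ fg ∂(pairMeasure 𝕜 N), ∀ out,
      AidedDecompose (sumTensor v w) u P (fun i => extendZero fg.1 i) (fun i => extendZero fg.2 i)
        out → ∃ (v' : Fin R → MatSpace 𝕜 n1 n2) (w' : Fin R → Fin n3 → 𝕜),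
          out = some ⟨R, v', w'⟩ ∧ SameSummands v v' w w' := by
  obtain ⟨rfl, rfl, z, hz, hsum⟩ := h.exists_coeff hu hP
  have hle : s ≤ N := by
    have := h.indep_v.fintype_card_le_finrank
    simpa [hN] using this
  filter_upwards [ae_goodPair hle hz] with fg hfg out hout
  have hlists : ∀ {o}, Algorithm1 (minors 𝕜 n1 n2 r) u P (fun i => extendZero fg.1 i)
      (fun i => extendZero fg.2 i) o → o.Lists v := fun ho =>
    Algorithm1.lists hr le_rfl hP h.indep_v hz hsum hfg ho
  rcases out with _ | L
  · exfalso
    generalize ho : (none : Option (BlockList 𝕜 n1 n2 n3)) = o at hout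
    cases hout with
    | empty => cases ho
    | found => cases ho
    | noneTrivial hℓ h' => exact hℓ (hlists h')
    | noneFewer k hk x hx =>
      obtain ⟨σ, -⟩ := hlists hx
      have := Fintype.card_congr σ
      simp_all
    | noneFail h' => exact hlists h'
  have h1 := hout.unique hr hu hP
  have h2 := h.unique hr
  have h3 : L.length = s := h1.2.1.symm.trans h2.2.1
  obtain ⟨k, v', w'⟩ := L
  change k = s at h3
  subst h3
  exact ⟨v', w', rfl, h2.2.2 v' w' h1.1⟩

end Procedure

end Mathematics

section Programs

variable {R V : ℕ → Bool} {st st' s s' : MState 𝕜} {D : DiagOracle 𝕜} {n1 n2 n3 r ℓ N t q a b d :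
  ℕ} {T : TensorSpace 𝕜 n1 n2 n3} {g : GS}

/-! ## A structured programming language

Expressions with sums, products and case distinctions, and programs with bounded loops, together
with their compilation to the machine. Registers below 100 are visible; among these the registers 4
to 29 hold the bounds of loops. Registers from 100 to 999 are the variables of loops, sums and
products, and all others, as well as all field arrays from 100 on, are temporary storage. -/

lemma reg_put (st : MState 𝕜) (i n j : ℕ) :
    (st.putReg i n).reg j = if j = i then n else st.reg j := by
  simp only [MState.putReg, Function.update_apply]

lemma putReg_narr (st : MState 𝕜) (i n : ℕ) : (st.putReg i n).narr = st.narr := rfl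

lemma putReg_farr (st : MState 𝕜) (i n : ℕ) : (st.putReg i n).farr = st.farr := rfl

lemma putFld_reg (st : MState 𝕜) (A : ℕ) (idx : List ℕ) (c : 𝕜) :
    (st.putFld A idx c).reg = st.reg := rfl

lemma putFld_farr (st : MState 𝕜) (A : ℕ) (idx : List ℕ) (c : 𝕜) (B : ℕ) (L : List ℕ) :
    (st.putFld A idx c).farr B L = if B = A ∧ L = idx then c else st.farr B L := by
  simp only [MState.putFld, Function.update_apply]
  grind

/-- Arithmetic of integers. -/
inductive NOp where
  | add : NOp
  | sub : NOp

def NOp.fn : NOp → ℕ → ℕ → ℕ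
  | NOp.add, a, b => a + b
  | NOp.sub, a, b => a - b

def NOp.exp : NOp → NExp → NExp → NExp
  | NOp.add => NExp.add
  | NOp.sub => NExp.sub

lemma NOp.val_exp (op : NOp) (a b : NExp) (st : MState 𝕜) :
    (op.exp a b).val st = op.fn (a.val st) (b.val st) := by
  cases op <;> rfl

/-- Comparisons of integers. -/
inductive NRel where
  | lt : NRel
  | eq : NRel

def NRel.Holds : NRel → ℕ → ℕ → Prop
  | NRel.lt, a, b => a < b
  | NRel.eq, a, b => a = b

instance (c : NRel) (a b : ℕ) : Decidable (c.Holds a b) := match c with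
  | NRel.lt => inferInstanceAs (Decidable (a < b))
  | NRel.eq => inferInstanceAs (Decidable (a = b))

lemma NRel.holds_lt (a b : ℕ) : NRel.lt.Holds a b ↔ a < b := Iff.rfl

lemma NRel.holds_eq (a b : ℕ) : NRel.eq.Holds a b ↔ a = b := Iff.rfl

def NRel.test : NRel → NExp → NExp → Test
  | NRel.lt => Test.lt
  | NRel.eq => Test.eq

lemma NRel.holds_test (c : NRel) (a b : NExp) (st : MState 𝕜) :
    (c.test a b).Holds st ↔ c.Holds (a.val st) (b.val st) := by
  cases c <;> rfl

/-- Arithmetic of the field. -/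
inductive FOp where
  | add : FOp
  | sub : FOp
  | mul : FOp
  | div : FOp

def FOp.fn : FOp → 𝕜 → 𝕜 → 𝕜
  | FOp.add, a, b => a + b
  | FOp.sub, a, b => a - b
  | FOp.mul, a, b => a * b
  | FOp.div, a, b => a / b

def FOp.exp : FOp → FExp → FExp → FExp
  | FOp.add => FExp.add
  | FOp.sub => FExp.sub
  | FOp.mul => FExp.mul
  | FOp.div => FExp.div

lemma FOp.val_exp (op : FOp) (a b : FExp) (st : MState 𝕜) :
    (op.exp a b).val st = op.fn (a.val st) (b.val st) := by
  cases op <;> rfl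

/-- Sums and products. -/
inductive BigOp where
  | sum : BigOp
  | prod : BigOp

def BigOp.fn : BigOp → ℕ → (ℕ → 𝕜) → 𝕜
  | BigOp.sum, n, f => ∑ k ∈ Finset.range n, f k
  | BigOp.prod, n, f => ∏ k ∈ Finset.range n, f k

def BigOp.start : BigOp → FExp
  | BigOp.sum => FExp.zero
  | BigOp.prod => FExp.one

def BigOp.step : BigOp → FOp
  | BigOp.sum => FOp.add
  | BigOp.prod => FOp.mul

lemma BigOp.fn_zero (op : BigOp) (f : ℕ → 𝕜) (st : MState 𝕜) : op.fn 0 f = op.start.val st := by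
  cases op <;> rfl

lemma BigOp.fn_succ (op : BigOp) (n : ℕ) (f : ℕ → 𝕜) :
    op.fn (n + 1) f = op.step.fn (op.fn n f) (f n) := by
  cases op
  · exact Finset.sum_range_succ f n
  exact Finset.prod_range_succ f n

/-- Integer expressions with sums and case distinctions. In `sum i n e` the register `i` runs
through the numbers below the content of register `n`. -/
inductive NX where
  | lit (n : ℕ) : NX
  | reg (i : ℕ) : NX
  | cell (A : ℕ) (idx : List ℕ) : NX
  | bin (op : NOp) (a b : NX) : NX
  | sum (i n : ℕ) (e : NX) : NX
  | ite (c : NRel) (a b e e' : NX) : NX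

/-- Field expressions with sums, products and case distinctions. -/
inductive FX where
  | zero : FX
  | one : FX
  | cell (A : ℕ) (idx : List ℕ) : FX
  | bin (op : FOp) (a b : FX) : FX
  | conj (a : FX) : FX
  | big (op : BigOp) (i n : ℕ) (e : FX) : FX
  | bind (i : ℕ) (a : NX) (e : FX) : FX
  | ite (c : NRel) (a b : NX) (e e' : FX) : FX
  | iteZero (a e e' : FX) : FX

/-- Programs. -/
inductive Prog where
  | setReg (i : ℕ) (e : NX) : Prog
  | setNat (A : ℕ) (idx : List ℕ) (e : NX) : Prog
  | setFld (A : ℕ) (idx : List ℕ) (e : FX) : Prog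
  | seq (p q : Prog) : Prog
  | loop (i n : ℕ) (p : Prog) : Prog
  | ifZero (a : FX) (p q : Prog) : Prog

def NX.val : NX → MState 𝕜 → ℕ
  | NX.lit n, _ => n
  | NX.reg i, st => st.reg i
  | NX.cell A idx, st => st.narr A (idx.map st.reg)
  | NX.bin op a b, st => op.fn (a.val st) (b.val st)
  | NX.sum i n e, st => ∑ k ∈ Finset.range (st.reg n), e.val (st.putReg i k)
  | NX.ite c a b e e', st => if c.Holds (a.val st) (b.val st) then e.val st else e'.val st

open Classical in
def FX.val : FX → MState 𝕜 → 𝕜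
  | FX.zero, _ => 0
  | FX.one, _ => 1
  | FX.cell A idx, st => st.farr A (idx.map st.reg)
  | FX.bin op a b, st => op.fn (a.val st) (b.val st)
  | FX.conj a, st => (starRingEnd 𝕜) (a.val st)
  | FX.big op i n e, st => op.fn (st.reg n) fun k => e.val (st.putReg i k)
  | FX.bind i a e, st => e.val (st.putReg i (a.val st))
  | FX.ite c a b e e', st => if c.Holds (a.val st) (b.val st) then e.val st else e'.val st
  | FX.iteZero a e e', st => if a.val st = 0 then e.val st else e'.val st

/-- The state after `n` passes of a loop with the variable `i`. -/
def iterate (F : MState 𝕜 → MState 𝕜) (i : ℕ) : ℕ → MState 𝕜 → MState 𝕜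
  | 0, st => st
  | n + 1, st => F ((iterate F i n st).putReg i n)

open Classical in
/-- The effect of a program. Loops restore their variable. -/
def Prog.run : Prog → MState 𝕜 → MState 𝕜
  | Prog.setReg i e, st => st.putReg i (e.val st)
  | Prog.setNat A idx e, st => st.putNat A (idx.map st.reg) (e.val st)
  | Prog.setFld A idx e, st => st.putFld A (idx.map st.reg) (e.val st)
  | Prog.seq p q, st => q.run (p.run st)
  | Prog.loop i n p, st => (iterate p.run i (st.reg n) st).putReg i (st.reg i)
  | Prog.ifZero a p q, st => if a.val st = 0 then p.run st else q.run st

/-! ### Scopes -/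

/-- The registers that hold bounds of loops. -/
def isSize (n : ℕ) : Bool := decide (4 ≤ n) && decide (n < 30)

/-- The registers for the variables of loops. -/
def isBinder (i : ℕ) : Bool := decide (100 ≤ i) && decide (i < 1000)

/-- The registers that programs may write to. -/
def isWritable (i : ℕ) : Bool := decide (i < 100) && !isSize i && !(i == 2)

/-- The visible registers. -/
def visible (i : ℕ) : Bool := decide (i < 100)

def NX.Scoped (R : ℕ → Bool) : NX → Bool
  | NX.lit _ => true
  | NX.reg i => R i
  | NX.cell _ idx => idx.all R
  | NX.bin _ a b => a.Scoped R && b.Scoped R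
  | NX.sum i n e => R n && isSize n && isBinder i && !R i && e.Scoped fun j => j == i || R j
  | NX.ite _ a b e e' => a.Scoped R && b.Scoped R && e.Scoped R && e'.Scoped R

def FX.Scoped (R V : ℕ → Bool) : FX → Bool
  | FX.zero => true
  | FX.one => true
  | FX.cell A idx => V A && idx.all R
  | FX.bin _ a b => a.Scoped R V && b.Scoped R V
  | FX.conj a => a.Scoped R V
  | FX.big _ i n e => R n && isSize n && isBinder i && !R i && e.Scoped (fun j => j == i || R j) V
  | FX.bind i a e => isBinder i && !R i && a.Scoped R && e.Scoped (fun j => j == i || R j) V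
  | FX.ite _ a b e e' => a.Scoped R && b.Scoped R && e.Scoped R V && e'.Scoped R V
  | FX.iteZero a e e' => a.Scoped R V && e.Scoped R V && e'.Scoped R V

/-- All loops are bounded by size registers. -/
def Prog.light : Prog → Bool
  | Prog.seq p q | Prog.ifZero _ p q => p.light && q.light
  | Prog.loop _ n p => isSize n && p.light
  | _ => true

/-- The program reads only registers in `R` and arrays in `V`, and writes only to these. -/
def Prog.Scoped (R V : ℕ → Bool) : Prog → Bool
  | Prog.setReg i e => isWritable i && R i && e.Scoped R
  | Prog.setNat _ idx e => idx.all R && e.Scoped R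
  | Prog.setFld A idx e => V A && idx.all R && e.Scoped R V
  | Prog.seq p q => p.Scoped R V && q.Scoped R V
  | Prog.loop i n p => R n && (isSize n || n == 2) && isBinder i && !R i && p.light &&
      p.Scoped (fun j => j == i || R j) V
  | Prog.ifZero a p q => p.light && q.light && a.Scoped R V && p.Scoped R V && q.Scoped R V

/-- The states agree on the registers in `R`, the integer arrays, and the field arrays in `V`. -/
structure Agree (R V : ℕ → Bool) (st st' : MState 𝕜) : Prop where
  reg : ∀ i, R i = true → st.reg i = st'.reg i
  narr : st.narr = st'.narr
  farr : ∀ A, V A = true → st.farr A = st'.farr A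

lemma Agree.refl (R V : ℕ → Bool) (st : MState 𝕜) : Agree R V st st :=
  ⟨fun _ _ => rfl, rfl, fun _ _ => rfl⟩

lemma Agree.symm (h : Agree R V st st') : Agree R V st' st :=
  ⟨fun i hi => (h.reg i hi).symm, h.narr.symm, fun A hA => (h.farr A hA).symm⟩

lemma Agree.trans {st'' : MState 𝕜} (h : Agree R V st st')
    (h' : Agree R V st' st'') : Agree R V st st'' :=
  ⟨fun i hi => (h.reg i hi).trans (h'.reg i hi), h.narr.trans h'.narr,
    fun A hA => (h.farr A hA).trans (h'.farr A hA)⟩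

lemma Agree.map_reg (h : Agree R V st st') {idx : List ℕ}
    (hi : idx.all R = true) : idx.map st.reg = idx.map st'.reg := by
  rw [List.all_eq_true] at hi
  exact List.map_congr_left fun i hi' => h.reg i (hi i hi')

lemma Agree.putReg (h : Agree R V st st') (i n : ℕ) :
    Agree (fun j => j == i || R j) V (st.putReg i n) (st'.putReg i n) := by
  refine ⟨fun j hj => ?_, h.narr, h.farr⟩
  rw [reg_put, reg_put]
  split_ifs with hji
  · rfl
  exact h.reg j (by grind)

lemma Agree.putReg_of_not (h : Agree R V st st') {i : ℕ}
    (hi : R i = false) (n : ℕ) : Agree R V st (st'.putReg i n) := by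
  refine ⟨fun j hj => ?_, h.narr, h.farr⟩
  rw [reg_put, if_neg]
  · exact h.reg j hj
  grind

lemma Agree.mono {R' V' : ℕ → Bool} (h : Agree R V st st')
    (hR : ∀ i, R' i = true → R i = true) (hV : ∀ i, V' i = true → V i = true) :
    Agree R' V' st st' :=
  ⟨fun i hi => h.reg i (hR i hi), h.narr, fun A hA => h.farr A (hV A hA)⟩

lemma NX.val_congr (e : NX) : ∀ {R V : ℕ → Bool} {st st' : MState 𝕜}, e.Scoped R = true →
    Agree R V st st' → e.val st = e.val st' := by
  induction e with
    (intro R V st st' hs h; simp only [NX.Scoped, and_eq_true] at hs; simp only [NX.val])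
  | reg i => exact h.reg i hs
  | cell A idx => rw [h.narr, h.map_reg hs]
  | bin | ite => grind
  | sum i n e ih =>
    rw [h.reg n hs.1.1.1.1]
    exact sum_congr rfl fun k _ => ih hs.2 (h.putReg i k)

lemma FX.val_congr (e : FX) : ∀ {R V : ℕ → Bool} {st st' : MState 𝕜}, e.Scoped R V = true →
    Agree R V st st' → e.val st = e.val st' := by
  induction e with
    (intro R V st st' hs h; simp only [FX.Scoped, and_eq_true] at hs; simp only [FX.val])
  | cell A idx => rw [h.farr A hs.1, h.map_reg hs.2]
  | bin | iteZero | conj => grind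
  | big op i n e ih =>
    rw [h.reg n hs.1.1.1.1]
    congr 1
    exact funext fun k => ih hs.2 (h.putReg i k)
  | bind i a e ih =>
    rw [a.val_congr hs.1.2 h]
    exact ih hs.2 (h.putReg i _)
  | ite c a b e e' ihe ihe' =>
    rw [a.val_congr hs.1.1.1 h, b.val_congr hs.1.1.2 h, ihe hs.1.2 h, ihe' hs.2 h]

/-- A program changes only writable registers. -/
lemma Prog.run_reg (p : Prog) : ∀ {R V : ℕ → Bool} {st : MState 𝕜}, p.Scoped R V = true →
    ∀ {i : ℕ}, isWritable i = false → (p.run st).reg i = st.reg i := by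
  induction p with
    (intro R V st hs i hi; simp only [Prog.Scoped, and_eq_true] at hs; simp only [Prog.run])
  | setReg j e =>
    simp only [reg_put]
    grind
  | setNat | setFld => rfl
  | seq | ifZero => grind
  | loop j n p ih =>
    simp only [reg_put]
    split_ifs with hij
    · rw [hij]
    generalize st.reg n = m
    induction m with
    | zero => rfl
    | succ m ihm =>
      simp only [iterate]
      rw [ih hs.2 hi, reg_put, if_neg hij, ihm]

lemma Prog.run_agree (p : Prog) : ∀ {R V : ℕ → Bool} {st st' : MState 𝕜}, p.Scoped R V = true →
    Agree R V st st' → Agree R V (p.run st) (p.run st') := by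
  induction p with
    (intro R V st st' hs h
     simp only [Prog.Scoped, and_eq_true, Bool.not_eq_true'] at hs; simp only [Prog.run])
  | setReg j e =>
    rw [e.val_congr hs.2 h]
    exact (h.putReg j _).mono (fun i hi => by simp [hi]) fun _ h => h
  | setNat A idx e =>
    rw [e.val_congr hs.2 h, h.map_reg hs.1]
    exact ⟨h.reg, by simp only [MState.putNat, h.narr], h.farr⟩
  | setFld A idx e =>
    rw [e.val_congr hs.2 h, h.map_reg hs.1.2]
    refine ⟨h.reg, h.narr, fun B hB => ?_⟩
    funext L
    rw [putFld_farr, putFld_farr, h.farr B hB]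
  | seq p q ihp ihq => exact ihq hs.2 (ihp hs.1 h)
  | loop j n p ih =>
    have key : ∀ m, Agree R V (iterate p.run j m st) (iterate p.run j m st') := by
      intro m
      induction m with
      | zero => exact h
      | succ m ihm => exact (ih hs.2 (ihm.putReg j m)).mono (fun i hi => by simp [hi]) fun _ h => h
    rw [h.reg n hs.1.1.1.1.1]
    exact (((key _).putReg_of_not hs.1.1.2 _).symm.putReg_of_not hs.1.1.2 _).symm
  | ifZero a p q ihp ihq =>
    rw [a.val_congr hs.1.1.2 h]
    grind

/-! ### Compilation -/

/-- A loop of the machine, with the counter `i` running to the content of register `n`. -/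
def countLoop (i n : ℕ) (body : Cmd) : Cmd :=
  Cmd.seq (Cmd.setReg i (NExp.lit 0)) (Cmd.loop (Test.lt (NExp.reg i) (NExp.reg n))
    (Cmd.seq body (Cmd.setReg i (NExp.add (NExp.reg i) (NExp.lit 1)))))

/-- Evaluation of an expression into register `t`. -/
def NX.comp : NX → ℕ → Cmd
  | NX.lit n, t => Cmd.setReg t (NExp.lit n)
  | NX.reg i, t => Cmd.setReg t (NExp.reg i)
  | NX.cell A idx, t => Cmd.setReg t (NExp.cell A idx)
  | NX.bin op a b, t => Cmd.seq (a.comp t) (Cmd.seq (b.comp (t + 1))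
      (Cmd.setReg t (op.exp (NExp.reg t) (NExp.reg (t + 1)))))
  | NX.sum i n e, t => Cmd.seq (Cmd.setReg t (NExp.lit 0)) (countLoop i n (Cmd.seq (e.comp (t + 1))
      (Cmd.setReg t (NExp.add (NExp.reg t) (NExp.reg (t + 1))))))
  | NX.ite c a b e e', t => Cmd.seq (a.comp t) (Cmd.seq (b.comp (t + 1))
      (Cmd.cond (c.test (NExp.reg t) (NExp.reg (t + 1))) (e.comp t) (e'.comp t)))

/-- Evaluation of an expression into the field array `t`. -/
def FX.comp : FX → ℕ → Cmd
  | FX.zero, t => Cmd.setFld t [] FExp.zero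
  | FX.one, t => Cmd.setFld t [] FExp.one
  | FX.cell A idx, t => Cmd.setFld t [] (FExp.cell A idx)
  | FX.bin op a b, t => Cmd.seq (a.comp t) (Cmd.seq (b.comp (t + 1))
      (Cmd.setFld t [] (op.exp (FExp.cell t []) (FExp.cell (t + 1) []))))
  | FX.conj a, t => Cmd.seq (a.comp t) (Cmd.setFld t [] (FExp.conj (FExp.cell t [])))
  | FX.big op i n e, t => Cmd.seq (Cmd.setFld t [] op.start) (countLoop i n
      (Cmd.seq (e.comp (t + 1))
        (Cmd.setFld t [] (op.step.exp (FExp.cell t []) (FExp.cell (t + 1) [])))))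
  | FX.bind i a e, t => Cmd.seq (a.comp 1000) (Cmd.seq (Cmd.setReg i (NExp.reg 1000)) (e.comp t))
  | FX.ite c a b e e', t => Cmd.seq (a.comp 1000) (Cmd.seq (b.comp 1001)
      (Cmd.cond (c.test (NExp.reg 1000) (NExp.reg 1001)) (e.comp t) (e'.comp t)))
  | FX.iteZero a e e', t => Cmd.seq (a.comp t)
      (Cmd.cond (Test.isZero (FExp.cell t [])) (e.comp t) (e'.comp t))

def Prog.comp : Prog → Cmd
  | Prog.setReg i e => Cmd.seq (e.comp 1000) (Cmd.setReg i (NExp.reg 1000))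
  | Prog.setNat A idx e => Cmd.seq (e.comp 1000) (Cmd.setNat A idx (NExp.reg 1000))
  | Prog.setFld A idx e => Cmd.seq (e.comp 100) (Cmd.setFld A idx (FExp.cell 100 []))
  | Prog.seq p q => Cmd.seq p.comp q.comp
  | Prog.loop i n p => countLoop i n p.comp
  | Prog.ifZero a p q => Cmd.seq (a.comp 100)
      (Cmd.cond (Test.isZero (FExp.cell 100 [])) p.comp q.comp)

/-- Exponents for the running time. -/
def NX.cost : NX → ℕ
  | NX.lit _ | NX.reg _ | NX.cell _ _ => 0
  | NX.bin _ a b => a.cost + b.cost + 2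
  | NX.sum _ _ e => e.cost + 4
  | NX.ite _ a b e e' => (a.cost + b.cost + 2) + (e.cost + e'.cost + 2) + 2

def FX.cost : FX → ℕ
  | FX.zero | FX.one | FX.cell _ _ => 0
  | FX.bin _ a b => a.cost + b.cost + 2
  | FX.conj a => a.cost + 2
  | FX.big _ _ _ e => e.cost + 4
  | FX.bind _ a e => a.cost + e.cost + 2
  | FX.ite _ a b e e' => (a.cost + b.cost + 2) + (e.cost + e'.cost + 2) + 2
  | FX.iteZero a e e' => a.cost + (e.cost + e'.cost + 2) + 2

def Prog.cost : Prog → ℕ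
  | Prog.setReg _ e | Prog.setNat _ _ e => e.cost + 2
  | Prog.setFld _ _ e => e.cost + 2
  | Prog.seq p q => p.cost + q.cost + 2
  | Prog.loop _ _ p => p.cost + 4
  | Prog.ifZero a p q => a.cost + (p.cost + q.cost + 2) + 2

lemma add_two_le_pow {x y c c' : ℕ} (hx : x ≤ (b + 2) ^ c) (hy : y ≤ (b + 2) ^ c') :
    x + y + 2 ≤ (b + 2) ^ (c + c' + 2) := by
  have h1 : 1 ≤ (b + 2) ^ c := Nat.one_le_pow _ _ (by omega)
  have h2 : 1 ≤ (b + 2) ^ c' := Nat.one_le_pow _ _ (by omega)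
  have h3 : (b + 2) ^ (c + c' + 2) = (b + 2) ^ c * (b + 2) ^ c' * (b + 2) ^ 2 := by grind
  have h4 : 4 ≤ (b + 2) ^ 2 := by grind
  have h5 : (b + 2) ^ c + (b + 2) ^ c' + 2 ≤ (b + 2) ^ c * (b + 2) ^ c' * 4 := by
    nlinarith [Nat.mul_le_mul h1 h2, Nat.mul_le_mul (le_refl ((b + 2) ^ c)) h2,
      Nat.mul_le_mul h1 (le_refl ((b + 2) ^ c'))]
  grind

lemma loop_le_pow {m x c : ℕ} (hm : m ≤ a) (hx : x ≤ (b + 2) ^ c) :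
    1 + (1 + (m * (x + 3) + 1)) ≤ (a + 1) * (b + 2) ^ (c + 2) := by
  have h1 : 1 ≤ (b + 2) ^ c := Nat.one_le_pow _ _ (by omega)
  have h4 : 4 ≤ (b + 2) ^ 2 := by grind
  have h5 : m * (x + 3) ≤ a * (4 * (b + 2) ^ c) := Nat.mul_le_mul hm (by omega)
  calc 1 + (1 + (m * (x + 3) + 1)) ≤ a * (4 * (b + 2) ^ c) + 4 * (b + 2) ^ c := by omega
    _ = (a + 1) * ((b + 2) ^ c * 4) := by ring
    _ ≤ (a + 1) * ((b + 2) ^ c * (b + 2) ^ 2) := by gcongr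
    _ = _ := by rw [pow_add]

lemma loop_le_pow' {m x c : ℕ} (hm : m ≤ b) (hx : x ≤ (b + 2) ^ c) :
    1 + (1 + (m * (x + 3) + 1)) ≤ (b + 2) ^ (c + 3) := by
  refine (loop_le_pow hm hx).trans ?_
  rw [pow_succ' _ (c + 2)]
  grind

lemma Exec.seqZero {p p' : Cmd} {st'' : MState 𝕜} {t' : ℕ}
    (h : Exec D p st st' t 0) (h' : Exec D p' st' st'' t' 0) :
    Exec D (Cmd.seq p p') st st'' (t + t') 0 :=
  Exec.seq h h'

lemma exec_countLoop {body : Cmd} {i n m c : ℕ} {Inv : ℕ → MState 𝕜 → Prop}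
    (hn : ∀ k s, Inv k s → s.reg n = m) (hi : ∀ k s j, Inv k s → Inv k (s.putReg i j))
    (hstep : ∀ k s, k < m → Inv k s → s.reg i = k →
      ∃ s' τ, Exec D body s s' τ 0 ∧ Inv (k + 1) s' ∧ s'.reg i = k ∧ τ ≤ c)
    (h0 : Inv 0 st) :
    ∃ s' τ, Exec D (countLoop i n body) st s' τ 0 ∧ Inv m s' ∧ τ ≤ 1 + (m * (c + 2) + 1) := by
  have key : ∀ j k s, k + j = m → Inv k s → s.reg i = k →
      ∃ s' τ, Exec D (Cmd.loop (Test.lt (NExp.reg i) (NExp.reg n))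
        (Cmd.seq body (Cmd.setReg i (NExp.add (NExp.reg i) (NExp.lit 1))))) s s' τ 0 ∧ Inv m s' ∧
          τ ≤ j * (c + 2) + 1 := by
    intro j
    induction j with
    | zero =>
      intro k s hk hs hks
      refine ⟨s, 1, Exec.loopDone ?_, ?_, by omega⟩
      · change ¬ s.reg i < s.reg n
        grind
      grind
    | succ j ih =>
      intro k s hk hs hks
      obtain ⟨s', τ, he, hs', hi', hτ⟩ := hstep k s (by omega) hs hks
      obtain ⟨s'', τ', he', hs'', hτ'⟩ := ih (k + 1) (s'.putReg i (k + 1)) (by omega)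
        (hi _ _ _ hs') (by rw [reg_put, if_pos rfl])
      have hset := Exec.setReg (D := D) s' i (NExp.add (NExp.reg i) (NExp.lit 1))
      have hval : (NExp.add (NExp.reg i) (NExp.lit 1)).val s' = k + 1 := by
        simp only [NExp.val, hi']
      rw [hval] at hset
      refine ⟨s'', _, Exec.loopStep ?_ (Exec.seq he hset) he', hs'', ?_⟩
      · change s.reg i < s.reg n
        grind
      grind
  obtain ⟨s', τ, he, hs', hτ⟩ := key m 0 (st.putReg i 0) (by omega) (hi _ _ _ h0)
    (by rw [reg_put, if_pos rfl])
  refine ⟨s', _, Exec.seqZero (Exec.setReg _ _ _) he, hs', ?_⟩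
  omega

/-! ### Correctness of the compilation -/

/-- The register `t` is changed, and possibly registers outside `R`, but no temporary register
below `t`. -/
structure KeepsNat (R : ℕ → Bool) (t : ℕ) (s s' : MState 𝕜) : Prop where
  reg : ∀ i, R i = true → s'.reg i = s.reg i
  temp : ∀ i, 1000 ≤ i → i < t → s'.reg i = s.reg i
  narr : s'.narr = s.narr
  farr : s'.farr = s.farr

lemma KeepsNat.trans {s'' : MState 𝕜} (h : KeepsNat R t s s')
    (h' : KeepsNat R t s' s'') : KeepsNat R t s s'' :=
  ⟨fun i hi => (h'.reg i hi).trans (h.reg i hi),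
    fun i hi hi' => (h'.temp i hi hi').trans (h.temp i hi hi'),
    h'.narr.trans h.narr, h'.farr.trans h.farr⟩

lemma KeepsNat.mono {R' : ℕ → Bool} {t' : ℕ} (h : KeepsNat R t s s')
    (hR : ∀ i, R' i = true → R i = true) (ht : t' ≤ t) : KeepsNat R' t' s s' :=
  ⟨fun i hi => h.reg i (hR i hi), fun i hi hi' => h.temp i hi (hi'.trans_le ht), h.narr, h.farr⟩

lemma KeepsNat.putReg (hR : ∀ i, R i = true → i < 1000) {i : ℕ} (h : KeepsNat R t s s') (ht : t ≤ i) (hi : 1000 ≤ i) (n : ℕ) :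
    KeepsNat R t s (s'.putReg i n) := by
  refine ⟨fun j hj => ?_, fun j hj hj' => ?_, h.narr, h.farr⟩
  · rw [reg_put, if_neg (by grind), h.reg j hj]
  rw [reg_put, if_neg (by omega), h.temp j hj hj']

lemma KeepsNat.putBinder {i : ℕ} (h : KeepsNat R t s s')
    (hi : R i = false) (hi' : i < 1000) (n : ℕ) : KeepsNat R t s (s'.putReg i n) := by
  refine ⟨fun j hj => ?_, fun j hj hj' => ?_, h.narr, h.farr⟩
  · rw [reg_put, if_neg (by grind), h.reg j hj]
  rw [reg_put, if_neg (by omega), h.temp j hj hj']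

lemma KeepsNat.refl (R : ℕ → Bool) (t : ℕ) (s : MState 𝕜) : KeepsNat R t s s :=
  ⟨fun _ _ => rfl, fun _ _ _ => rfl, rfl, rfl⟩

lemma KeepsNat.agree (h : KeepsNat R t s s') (V : ℕ → Bool) : Agree R V s' s :=
  ⟨h.reg, h.narr, fun A _ => by rw [h.farr]⟩

lemma isBinder_iff {i : ℕ} : isBinder i = true ↔ 100 ≤ i ∧ i < 1000 := by simp [isBinder]

lemma isSize_iff {i : ℕ} : isSize i = true ↔ 4 ≤ i ∧ i < 30 := by simp [isSize]

/-- The content of the register for a bound is at most `b`. -/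
def SizesLE (R : ℕ → Bool) (b : ℕ) (s : MState 𝕜) : Prop :=
  ∀ n, R n = true → isSize n = true → s.reg n ≤ b

lemma SizesLE.putReg (h : SizesLE R b s) {i : ℕ}
    (hi : isBinder i = true) (k : ℕ) : SizesLE (fun j => j == i || R j) b (s.putReg i k) := by
  intro n hn hn'
  rw [isSize_iff] at hn'
  rw [isBinder_iff] at hi
  have hni : n ≠ i := by omega
  rw [reg_put, if_neg hni]
  exact h n (by grind) (isSize_iff.2 hn')

lemma SizesLE.congr (h : SizesLE R b s)
    (h' : ∀ i, R i = true → s'.reg i = s.reg i) : SizesLE R b s' :=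
  fun n hn hn' => (h' n hn).trans_le (h n hn hn')

lemma lt_of_insert (hR : ∀ i, R i = true → i < 1000) {i : ℕ}
    (hi : isBinder i = true) : ∀ j, (j == i || R j) = true → j < 1000 := by
  intro j hj
  rw [isBinder_iff] at hi
  grind

lemma NX.exec_comp (D : DiagOracle 𝕜) (e : NX) : ∀ {R : ℕ → Bool} {s : MState 𝕜} {t : ℕ},
    e.Scoped R = true → (∀ i, R i = true → i < 1000) → SizesLE R b s → 1000 ≤ t →
    ∃ s' τ, Exec D (e.comp t) s s' τ 0 ∧ KeepsNat R t s s' ∧ s'.reg t = e.val s ∧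
      τ ≤ (b + 2) ^ e.cost := by
  induction e with
    (intro R s t hs hR hb ht; simp only [NX.Scoped, and_eq_true, Bool.not_eq_true'] at hs)
  | lit | reg | cell =>
    exact ⟨_, _, Exec.setReg _ _ _, (KeepsNat.refl R t s).putReg hR le_rfl ht _,
      by rw [reg_put, if_pos rfl]; rfl, by simp [NX.cost]⟩
  | bin op a c iha ihc =>
    obtain ⟨s1, τ1, h1, k1, v1, t1⟩ := iha hs.1 hR hb ht
    obtain ⟨s2, τ2, h2, k2, v2, t2⟩ := ihc hs.2 hR (hb.congr k1.reg) (t := t + 1) (by omega)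
    refine ⟨_, _, Exec.seqZero h1 (Exec.seqZero h2 (Exec.setReg _ _ _)),
      (k1.trans (k2.mono (fun _ h => h) (by omega))).putReg hR le_rfl ht _, ?_, ?_⟩
    · rw [reg_put, if_pos rfl, NOp.val_exp]
      simp only [NExp.val, NX.val]
      rw [v2, k2.temp t ht (by omega), v1, c.val_congr hs.2 (k1.agree fun _ => false)]
    have := add_two_le_pow t1 t2
    simp only [NX.cost]
    omega
  | sum i n e ih =>
    obtain ⟨⟨⟨⟨hRn, hn⟩, hi⟩, hRi⟩, he⟩ := hs
    have hi' := isBinder_iff.1 hi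
    have hn' := isSize_iff.1 hn
    obtain ⟨s', τ, h, ⟨k, v⟩, hτ⟩ := exec_countLoop (D := D)
      (body := Cmd.seq (e.comp (t + 1)) (Cmd.setReg t (NExp.add (NExp.reg t) (NExp.reg (t + 1)))))
      (i := i) (n := n) (m := s.reg n) (c := (b + 2) ^ e.cost + 1)
      (Inv := fun k s' => KeepsNat R t s s' ∧ s'.reg t = ∑ j ∈ Finset.range k, e.val (s.putReg i j))
      (st := s.putReg t 0) (fun k s' h => h.1.reg n hRn)
      (fun k s' j h => ⟨h.1.putBinder hRi hi'.2 j, by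
        rw [reg_put, if_neg (by omega)]; exact h.2⟩)
      (by
        intro k s' hk ⟨hs', hv⟩ hik
        have hag : Agree (fun j => j == i || R j) (fun _ => false) s' (s.putReg i k) := by
          refine ⟨fun j hj => ?_, hs'.narr, fun _ h => by cases h⟩
          rw [reg_put]
          split_ifs with hji
          · rw [hji, hik]
          exact hs'.reg j (by grind)
        obtain ⟨s2, τ2, h2, k2, v2, t2⟩ := ih he (lt_of_insert hR hi)
          ((hb.putReg hi k).congr hag.reg) (t := t + 1) (by omega)
        have k2' : KeepsNat R t s' s2 := k2.mono (fun j h => by simp [h]) (by omega)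
        refine ⟨_, _, Exec.seqZero h2 (Exec.setReg _ _ _),
          ⟨(hs'.trans k2').putReg hR le_rfl ht _, ?_⟩, ?_, ?_⟩
        · rw [reg_put, if_pos rfl, Finset.sum_range_succ]
          simp only [NExp.val]
          rw [v2, k2.temp t ht (by omega), hv, e.val_congr he hag]
        · rw [reg_put, if_neg (by omega), k2.reg i (by simp), hik]
        omega)
      ⟨(KeepsNat.refl R t s).putReg hR le_rfl ht _, by rw [reg_put, if_pos rfl]; rfl⟩
    refine ⟨s', _, Exec.seqZero (Exec.setReg _ _ _) h, k, v, ?_⟩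
    have := loop_le_pow' (hb n hRn hn) (le_refl ((b + 2) ^ e.cost))
    simp only [NX.cost]
    grind
  | ite r a c e e' iha ihc ihe ihe' =>
    obtain ⟨s1, τ1, h1, k1, v1, t1⟩ := iha hs.1.1.1 hR hb ht
    obtain ⟨s2, τ2, h2, k2, v2, t2⟩ := ihc hs.1.1.2 hR (hb.congr k1.reg) (t := t + 1) (by omega)
    have k := k1.trans (k2.mono (fun _ h => h) (Nat.le_succ t))
    have htest : (r.test (NExp.reg t) (NExp.reg (t + 1))).Holds s2 ↔
        r.Holds (a.val s) (c.val s) := by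
      rw [NRel.holds_test]
      simp only [NExp.val]
      rw [v2, k2.temp t ht (by omega), v1, c.val_congr hs.1.1.2 (k1.agree fun _ => false)]
    obtain ⟨s3, τ3, h3, k3, v3, t3⟩ := ihe hs.1.2 hR (hb.congr k.reg) ht
    obtain ⟨s4, τ4, h4, k4, v4, t4⟩ := ihe' hs.2 hR (hb.congr k.reg) ht
    have hc : τ1 + (τ2 + (τ3 + τ4 + 1)) ≤ (b + 2) ^ (NX.ite r a c e e').cost := by
      have h5 := add_two_le_pow t1 t2
      have h6 := add_two_le_pow t3 t4
      have h7 := add_two_le_pow h5 h6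
      simp only [NX.cost]
      omega
    by_cases hr : r.Holds (a.val s) (c.val s)
    · exact ⟨s3, _, Exec.seqZero h1 (Exec.seqZero h2 (Exec.condTrue (htest.2 hr) h3)), k.trans k3,
        by rw [v3, NX.val, if_pos hr, e.val_congr hs.1.2 (k.agree fun _ => false)], by omega⟩
    exact ⟨s4, _, Exec.seqZero h1 (Exec.seqZero h2 (Exec.condFalse (mt htest.1 hr) h4)),
      k.trans k4, by rw [v4, NX.val, if_neg hr, e'.val_congr hs.2 (k.agree fun _ => false)],
      by omega⟩

/-- Registers in `R`, integer arrays and the field arrays below `t` are unchanged. -/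
structure KeepsFld (R : ℕ → Bool) (t : ℕ) (s s' : MState 𝕜) : Prop where
  reg : ∀ i, R i = true → s'.reg i = s.reg i
  narr : s'.narr = s.narr
  farr : ∀ A, A < t → s'.farr A = s.farr A

lemma KeepsFld.trans {s'' : MState 𝕜} (h : KeepsFld R t s s')
    (h' : KeepsFld R t s' s'') : KeepsFld R t s s'' :=
  ⟨fun i hi => (h'.reg i hi).trans (h.reg i hi), h'.narr.trans h.narr,
    fun A hA => (h'.farr A hA).trans (h.farr A hA)⟩

lemma KeepsFld.mono {R' : ℕ → Bool} {t' : ℕ} (h : KeepsFld R t s s')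
    (hR : ∀ i, R' i = true → R i = true) (ht : t' ≤ t) : KeepsFld R' t' s s' :=
  ⟨fun i hi => h.reg i (hR i hi), h.narr, fun A hA => h.farr A (hA.trans_le ht)⟩

lemma KeepsFld.putFld (h : KeepsFld R t s s')
    (idx : List ℕ) (c : 𝕜) : KeepsFld R t s (s'.putFld t idx c) := by
  refine ⟨h.reg, h.narr, fun A hA => ?_⟩
  rw [← h.farr A hA]
  funext L
  rw [putFld_farr, if_neg (by omega)]

lemma KeepsFld.putBinder {i : ℕ} (h : KeepsFld R t s s')
    (hi : R i = false) (n : ℕ) : KeepsFld R t s (s'.putReg i n) := by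
  refine ⟨fun j hj => ?_, h.narr, h.farr⟩
  rw [reg_put, if_neg (by grind), h.reg j hj]

lemma KeepsFld.refl (R : ℕ → Bool) (t : ℕ) (s : MState 𝕜) : KeepsFld R t s s :=
  ⟨fun _ _ => rfl, rfl, fun _ _ => rfl⟩

lemma KeepsFld.agree (h : KeepsFld R t s s') (hV : ∀ A, V A = true → A < t) : Agree R V s' s :=
  ⟨h.reg, h.narr, fun A hA => h.farr A (hV A hA)⟩

lemma KeepsNat.keepsFld {t' : ℕ} (h : KeepsNat R t s s') : KeepsFld R t' s s' :=
  ⟨h.reg, h.narr, fun A _ => by rw [h.farr]⟩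

lemma putFld_farr_self (s : MState 𝕜) (A : ℕ) (idx : List ℕ) (c : 𝕜) :
    (s.putFld A idx c).farr A idx = c := by
  rw [putFld_farr, if_pos ⟨rfl, rfl⟩]

lemma FX.exec_comp (D : DiagOracle 𝕜) (e : FX) : ∀ {R V : ℕ → Bool} {s : MState 𝕜} {t : ℕ},
    e.Scoped R V = true → (∀ i, R i = true → i < 1000) → SizesLE R b s →
    (∀ A, V A = true → A < t) →
    ∃ s' τ, Exec D (e.comp t) s s' τ 0 ∧ KeepsFld R t s s' ∧ s'.farr t [] = e.val s ∧
      τ ≤ (b + 2) ^ e.cost := by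
  induction e with
    (intro R V s t hs hR hb hV; simp only [FX.Scoped, and_eq_true, Bool.not_eq_true'] at hs)
  | zero | one | cell =>
    exact ⟨_, _, Exec.setFld _ _ _ _, (KeepsFld.refl R t s).putFld _ _, putFld_farr_self _ _ _ _,
      by simp [FX.cost]⟩
  | bin op a c iha ihc =>
    obtain ⟨s1, τ1, h1, k1, v1, t1⟩ := iha hs.1 hR hb hV
    obtain ⟨s2, τ2, h2, k2, v2, t2⟩ := ihc hs.2 hR (hb.congr k1.reg) (t := t + 1)
      fun A hA => (hV A hA).trans (Nat.lt_succ_self t)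
    refine ⟨_, _, Exec.seqZero h1 (Exec.seqZero h2 (Exec.setFld _ _ _ _)),
      (k1.trans (k2.mono (fun _ h => h) (by omega))).putFld _ _, ?_, ?_⟩
    · rw [map_nil, putFld_farr_self, FOp.val_exp]
      simp only [FExp.val, FX.val, map_nil]
      rw [v2, k2.farr t (by omega), v1, c.val_congr hs.2 (k1.agree hV)]
    have := add_two_le_pow t1 t2
    simp only [FX.cost]
    omega
  | conj a ih =>
    obtain ⟨s1, τ1, h1, k1, v1, t1⟩ := ih hs hR hb hV
    refine ⟨_, _, Exec.seqZero h1 (Exec.setFld _ _ _ _), k1.putFld _ _, ?_, ?_⟩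
    · rw [map_nil, putFld_farr_self]
      simp only [FExp.val, FX.val, map_nil]
      rw [v1]
    have := add_two_le_pow t1 (c' := 0) (y := 0) (Nat.zero_le _)
    simp only [FX.cost, Nat.add_zero] at *
    omega
  | big op i n e ih =>
    obtain ⟨⟨⟨⟨hRn, hn⟩, hi⟩, hRi⟩, he⟩ := hs
    obtain ⟨s', τ, h, ⟨k, v⟩, hτ⟩ := exec_countLoop (D := D) (body := Cmd.seq (e.comp (t + 1))
        (Cmd.setFld t [] (op.step.exp (FExp.cell t []) (FExp.cell (t + 1) []))))
      (i := i) (n := n) (m := s.reg n) (c := (b + 2) ^ e.cost + 1)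
      (Inv := fun k s' => KeepsFld R t s s' ∧ s'.farr t [] = op.fn k fun j => e.val (s.putReg i j))
      (st := s.putFld t [] (op.start.val s)) (fun k s' h => h.1.reg n hRn)
      (fun k s' j h => ⟨h.1.putBinder hRi j, h.2⟩)
      (by
        intro k s' hk ⟨hs', hv⟩ hik
        have hag : Agree (fun j => j == i || R j) V s' (s.putReg i k) := by
          refine ⟨fun j hj => ?_, hs'.narr, fun A hA => hs'.farr A (hV A hA)⟩
          rw [reg_put]
          split_ifs with hji
          · rw [hji, hik]
          exact hs'.reg j (by grind)
        obtain ⟨s2, τ2, h2, k2, v2, t2⟩ := ih he (lt_of_insert hR hi)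
          ((hb.putReg hi k).congr hag.reg) (t := t + 1)
          fun A hA => (hV A hA).trans (Nat.lt_succ_self t)
        have k2' : KeepsFld R t s' s2 := k2.mono (fun j h => by simp [h]) (by omega)
        refine ⟨_, _, Exec.seqZero h2 (Exec.setFld _ _ _ _),
          ⟨(hs'.trans k2').putFld _ _, ?_⟩, ?_, ?_⟩
        · rw [map_nil, putFld_farr_self, FOp.val_exp, BigOp.fn_succ]
          simp only [FExp.val, map_nil]
          rw [v2, k2.farr t (by omega), hv, e.val_congr he hag]
        · rw [putFld_reg, k2.reg i (by simp), hik]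
        omega)
      ⟨(KeepsFld.refl R t s).putFld _ _, by rw [putFld_farr_self, ← BigOp.fn_zero]⟩
    refine ⟨s', _, Exec.seqZero (Exec.setFld _ _ _ _) h, k, v, ?_⟩
    have := loop_le_pow' (hb n hRn hn) (le_refl ((b + 2) ^ e.cost))
    simp only [FX.cost]
    grind
  | bind i a e ih =>
    obtain ⟨⟨⟨hi, hRi⟩, ha⟩, he⟩ := hs
    obtain ⟨s1, τ1, h1, k1, v1, t1⟩ := a.exec_comp D ha hR hb le_rfl
    have k1' : KeepsFld R t s s1 := k1.keepsFld
    have hag : Agree (fun j => j == i || R j) V (s1.putReg i (s1.reg 1000))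
        (s.putReg i (a.val s)) := by
      rw [v1]
      exact (k1'.agree hV).putReg i _
    obtain ⟨s2, τ2, h2, k2, v2, t2⟩ := ih he (lt_of_insert hR hi)
      ((hb.putReg hi (a.val s)).congr hag.reg) hV
    refine ⟨s2, _, Exec.seqZero h1 (Exec.seqZero (Exec.setReg _ _ _) h2),
      (k1'.putBinder hRi _).trans (k2.mono (fun j h => by simp [h]) le_rfl), ?_, ?_⟩
    · rw [v2, FX.val]
      exact e.val_congr he hag
    have := add_two_le_pow t1 t2
    simp only [FX.cost]
    omega
  | ite r a c e e' ihe ihe' =>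
    obtain ⟨s1, τ1, h1, k1, v1, t1⟩ := a.exec_comp D hs.1.1.1 hR hb (t := 1000) le_rfl
    obtain ⟨s2, τ2, h2, k2, v2, t2⟩ := c.exec_comp D hs.1.1.2 hR (hb.congr k1.reg) (t := 1001)
      (by omega)
    have k : KeepsFld R t s s2 := (k1.trans (k2.mono (fun _ h => h) (Nat.le_succ _))).keepsFld
    have htest : (r.test (NExp.reg 1000) (NExp.reg 1001)).Holds s2 ↔
        r.Holds (a.val s) (c.val s) := by
      rw [NRel.holds_test]
      simp only [NExp.val]
      rw [v2, k2.temp 1000 le_rfl (by omega), v1, c.val_congr hs.1.1.2 (k1.agree fun _ => false)]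
    obtain ⟨s3, τ3, h3, k3, v3, t3⟩ := ihe hs.1.2 hR (hb.congr k.reg) hV
    obtain ⟨s4, τ4, h4, k4, v4, t4⟩ := ihe' hs.2 hR (hb.congr k.reg) hV
    have hc : τ1 + (τ2 + (τ3 + τ4 + 1)) ≤ (b + 2) ^ (FX.ite r a c e e').cost := by
      have h7 := add_two_le_pow (add_two_le_pow t1 t2) (add_two_le_pow t3 t4)
      simp only [FX.cost]
      omega
    by_cases hr : r.Holds (a.val s) (c.val s)
    · exact ⟨s3, _, Exec.seqZero h1 (Exec.seqZero h2 (Exec.condTrue (htest.2 hr) h3)),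
        k.trans k3, by rw [v3, FX.val, if_pos hr, e.val_congr hs.1.2 (k.agree hV)], by omega⟩
    exact ⟨s4, _, Exec.seqZero h1 (Exec.seqZero h2 (Exec.condFalse (mt htest.1 hr) h4)),
      k.trans k4, by rw [v4, FX.val, if_neg hr, e'.val_congr hs.2 (k.agree hV)], by omega⟩
  | iteZero a e e' iha ihe ihe' =>
    obtain ⟨s1, τ1, h1, k, v1, t1⟩ := iha hs.1.1 hR hb hV
    have htest : (Test.isZero (FExp.cell t [])).Holds s1 ↔ a.val s = 0 := by
      rw [← v1]
      rfl
    obtain ⟨s3, τ3, h3, k3, v3, t3⟩ := ihe hs.1.2 hR (hb.congr k.reg) hV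
    obtain ⟨s4, τ4, h4, k4, v4, t4⟩ := ihe' hs.2 hR (hb.congr k.reg) hV
    have hc : τ1 + (τ3 + τ4 + 1) ≤ (b + 2) ^ (FX.iteZero a e e').cost := by
      have h7 := add_two_le_pow t1 (add_two_le_pow t3 t4)
      simp only [FX.cost]
      omega
    by_cases hr : a.val s = 0
    · exact ⟨s3, _, Exec.seqZero h1 (Exec.condTrue (htest.2 hr) h3), k.trans k3,
        by rw [v3, FX.val, if_pos hr, e.val_congr hs.1.2 (k.agree hV)], by omega⟩
    exact ⟨s4, _, Exec.seqZero h1 (Exec.condFalse (mt htest.1 hr) h4), k.trans k4,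
      by rw [v4, FX.val, if_neg hr, e'.val_congr hs.2 (k.agree hV)], by omega⟩

lemma isSize_not_writable {i : ℕ} (h : isSize i = true) : isWritable i = false := by
  simp [isWritable, h]

lemma isBinder_not_writable' {i : ℕ} (h : isBinder i = true) : isWritable i = false := by
  rw [isBinder_iff] at h
  have : decide (i < 100) = false := decide_eq_false (by omega)
  simp [isWritable, this]

lemma iterate_reg {p : Prog} (hs : p.Scoped R V = true) {i j : ℕ} (hij : j ≠ i)
    (hj : isWritable j = false) (st : MState 𝕜) (k : ℕ) :
    (iterate p.run i k st).reg j = st.reg j := by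
  induction k with
  | zero => rfl
  | succ k ih =>
    simp only [iterate]
    rw [p.run_reg hs hj, reg_put, if_neg hij, ih]

/-- The factor by which the running time may exceed a power of the bounds of the loops. -/
def Prog.factor (p : Prog) (a : ℕ) : ℕ := if p.light then 1 else a + 1

lemma Prog.factor_le (p : Prog) (a : ℕ) : p.factor a ≤ a + 1 := by
  unfold Prog.factor
  grind

lemma Prog.exec_comp (D : DiagOracle 𝕜) (p : Prog) : ∀ {R V : ℕ → Bool} {st s : MState 𝕜},
    p.Scoped R V = true → (∀ i, R i = true → i < 1000) → (∀ A, V A = true → A < 100) →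
    SizesLE R b st → st.reg 2 ≤ a → Agree R V st s →
    ∃ s' τ, Exec D p.comp s s' τ 0 ∧ Agree R V (p.run st) s' ∧
      τ ≤ p.factor a * (b + 2) ^ p.cost := by
  have hset {c τ} (hτ : τ ≤ (b + 2) ^ c) : τ + 1 ≤ (b + 2) ^ (c + 2) := by
    have : τ + 0 + 2 ≤ _ := add_two_le_pow hτ (c' := 0) (y := 0) (Nat.zero_le _)
    grind
  induction p with
    (intro R V st s hs hR hV hb ha h; simp only [Prog.Scoped, and_eq_true, Bool.not_eq_true'] at hs
     have hb' : SizesLE R b s := hb.congr fun i hi => (h.reg i hi).symm)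
  | setReg i e =>
    obtain ⟨s1, τ, h₁, k, v, hτ⟩ := e.exec_comp D hs.2 hR hb' (t := 1000) le_rfl
    refine ⟨_, _, Exec.seqZero h₁ (Exec.setReg _ _ _), ?_, ?_⟩
    · simp only [Prog.run, NExp.val]
      rw [v, e.val_congr hs.2 h]
      exact ((h.trans (k.agree V).symm).putReg i _).mono (fun j hj => by simp [hj]) fun _ h => h
    simpa [Prog.factor, Prog.light, Prog.cost] using hset hτ
  | setNat A idx e =>
    obtain ⟨s1, τ, h₁, k, v, hτ⟩ := e.exec_comp D hs.2 hR hb' (t := 1000) le_rfl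
    have hag := h.trans (k.agree V).symm
    refine ⟨_, _, Exec.seqZero h₁ (Exec.setNat _ _ _ _), ?_, ?_⟩
    · simp only [Prog.run, NExp.val]
      rw [v, e.val_congr hs.2 h, hag.map_reg hs.1]
      exact ⟨hag.reg, by simp only [MState.putNat, hag.narr], hag.farr⟩
    simpa [Prog.factor, Prog.light, Prog.cost] using hset hτ
  | setFld A idx e =>
    obtain ⟨s1, τ, h₁, k, v, hτ⟩ := e.exec_comp D hs.2 hR hb' (t := 100) hV
    have hag := h.trans (k.agree hV).symm
    refine ⟨_, _, Exec.seqZero h₁ (Exec.setFld _ _ _ _), ?_, ?_⟩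
    · simp only [Prog.run, FExp.val, map_nil]
      rw [v, e.val_congr hs.2 h, hag.map_reg hs.1.2]
      refine ⟨hag.reg, hag.narr, fun B hB => ?_⟩
      funext L
      rw [putFld_farr, putFld_farr, hag.farr B hB]
    simpa [Prog.factor, Prog.light, Prog.cost] using hset hτ
  | seq p q ihp ihq =>
    obtain ⟨s1, τ1, h₁, k1, t1⟩ := ihp hs.1 hR hV hb ha h
    have hb1 : SizesLE R b (p.run st) := fun n hn hn' => by
      rw [p.run_reg hs.1 (isSize_not_writable hn')]
      exact hb n hn hn'
    obtain ⟨s2, τ2, h₂, k2, t2⟩ := ihq hs.2 hR hV hb1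
      (by rw [p.run_reg hs.1 (by decide)]; exact ha) k1
    refine ⟨s2, _, Exec.seqZero h₁ h₂, k2, ?_⟩
    have hc := add_two_le_pow (le_refl ((b + 2) ^ p.cost)) (le_refl ((b + 2) ^ q.cost))
    have hf : p.factor a ≤ (Prog.seq p q).factor a ∧ q.factor a ≤ (Prog.seq p q).factor a := by
      simp only [Prog.factor, Prog.light, and_eq_true]
      grind
    simp only [Prog.cost]
    calc τ1 + τ2 ≤ (Prog.seq p q).factor a * (b + 2) ^ p.cost +
          (Prog.seq p q).factor a * (b + 2) ^ q.cost :=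
          Nat.add_le_add (t1.trans (Nat.mul_le_mul_right _ hf.1))
            (t2.trans (Nat.mul_le_mul_right _ hf.2))
      _ = (Prog.seq p q).factor a * ((b + 2) ^ p.cost + (b + 2) ^ q.cost) := by ring
      _ ≤ _ := Nat.mul_le_mul_left _ (by omega)
  | loop i n p ih =>
    obtain ⟨⟨⟨⟨⟨hRn, hn⟩, hi⟩, hRi⟩, hl⟩, hp⟩ := hs
    have hi' := isBinder_iff.1 hi
    have hni : n ≠ i := by grind
    have hnw : isWritable n = false := by
      simp only [Bool.or_eq_true, beq_iff_eq] at hn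
      rcases hn with hn | rfl
      · exact isSize_not_writable hn
      decide
    obtain ⟨s', τ, he, hag, hτ⟩ := exec_countLoop (D := D) (body := p.comp) (i := i) (n := n)
      (m := st.reg n) (c := (b + 2) ^ p.cost) (Inv := fun k s' => Agree R V (iterate p.run i k st) s')
      (st := s)
      (fun k s' h => by rw [← h.reg n hRn, iterate_reg hp hni hnw])
      (fun k s' j h => h.putReg_of_not hRi j)
      (by
        intro k s' hk hs' hik
        have hag : Agree (fun j => j == i || R j) V ((iterate p.run i k st).putReg i k) s' := by
          refine ⟨fun j hj => ?_, hs'.narr, hs'.farr⟩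
          rw [reg_put]
          split_ifs with hji
          · rw [hji, hik]
          exact hs'.reg j (by grind)
        have hb' : SizesLE (fun j => j == i || R j) b ((iterate p.run i k st).putReg i k) := by
          refine SizesLE.putReg (fun m hm hm' => ?_) hi k
          have hmi : m ≠ i := by grind
          rw [iterate_reg hp hmi (isSize_not_writable hm')]
          exact hb m hm hm'
        obtain ⟨s2, τ2, h₂, k2, t2⟩ := ih hp (lt_of_insert hR hi) hV hb' (by
          rw [reg_put, if_neg (by omega), iterate_reg hp (by omega) (by decide)]
          exact ha) hag
        refine ⟨s2, τ2, h₂, k2.mono (fun j hj => by simp [hj]) fun _ h => h, ?_, ?_⟩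
        · rw [← k2.reg i (by simp), p.run_reg hp (isBinder_not_writable' hi), reg_put,
            if_pos rfl]
        simpa [Prog.factor, hl] using t2)
      h
    refine ⟨s', τ, he, (hag.symm.putReg_of_not hRi _).symm, ?_⟩
    have hp4 : ∀ k, (b + 2) ^ (p.cost + k) ≤ (b + 2) ^ (p.cost + k + 1) := fun k =>
      Nat.pow_le_pow_right (by omega) (by omega)
    have hm3 : st.reg n * ((b + 2) ^ p.cost + 2) ≤ st.reg n * ((b + 2) ^ p.cost + 3) :=
      Nat.mul_le_mul_left _ (by omega)
    simp only [Prog.factor, Prog.light, hl, Bool.and_true, Prog.cost]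
    split_ifs with hsz
    · have := loop_le_pow' (hb n hRn hsz) (le_refl ((b + 2) ^ p.cost))
      grind
    have hn2 : n = 2 := by grind
    have h1 := loop_le_pow (b := b) (c := p.cost) (hn2 ▸ ha : st.reg n ≤ a)
      (le_refl ((b + 2) ^ p.cost))
    have h2 : (a + 1) * (b + 2) ^ (p.cost + 2) ≤ (a + 1) * (b + 2) ^ (p.cost + 4) :=
      Nat.mul_le_mul_left _ ((hp4 2).trans (hp4 3))
    omega
  | ifZero c p q ihp ihq =>
    obtain ⟨⟨⟨⟨hlp, hlq⟩, hc⟩, hp⟩, hq⟩ := hs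
    obtain ⟨s1, τ1, h₁, k, v1, t1⟩ := c.exec_comp D hc hR hb' hV
    have hag := h.trans (k.agree hV).symm
    have htest : (Test.isZero (FExp.cell 100 [])).Holds s1 ↔ c.val st = 0 := by
      rw [c.val_congr hc h, ← v1]
      rfl
    obtain ⟨s3, τ3, h3, k3, t3⟩ := ihp hp hR hV hb ha hag
    obtain ⟨s4, τ4, h4, k4, t4⟩ := ihq hq hR hV hb ha hag
    simp only [Prog.factor, hlp, hlq, if_true, one_mul] at t3 t4
    have hcost : τ1 + (τ3 + τ4 + 1) ≤ (Prog.ifZero c p q).factor a *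
        (b + 2) ^ (Prog.ifZero c p q).cost := by
      have h7 := add_two_le_pow t1 (add_two_le_pow t3 t4)
      simp only [Prog.cost, Prog.factor, Prog.light, hlp, hlq, Bool.and_true, if_true, one_mul]
      omega
    by_cases hz : c.val st = 0
    · refine ⟨s3, _, Exec.seqZero h₁ (Exec.condTrue (htest.2 hz) h3), ?_, by omega⟩
      rw [Prog.run, if_pos hz]
      exact k3
    refine ⟨s4, _, Exec.seqZero h₁ (Exec.condFalse (fun h => hz (htest.1 h)) h4), ?_, by omega⟩
    rw [Prog.run, if_neg hz]
    exact k4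

/-! ### Chains of programs -/

/-- From any state with the same visible part as `st` the command halts in a state with the same
visible part as `st'`, after at most `t` steps and with at most `q` calls of the oracle. -/
def Runs (D : DiagOracle 𝕜) (c : Cmd) (st st' : MState 𝕜) (t q : ℕ) : Prop :=
  ∀ s, Agree visible visible st s → ∃ s' τ κ, Exec D c s s' τ κ ∧ Agree visible visible st' s' ∧
    τ ≤ t ∧ κ ≤ q

lemma Runs.seq {c c' : Cmd} {st'' : MState 𝕜} {t' q' : ℕ}
    (h : Runs D c st st' t q) (h' : Runs D c' st' st'' t' q') :
    Runs D (Cmd.seq c c') st st'' (t + t') (q + q') := by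
  intro s hs
  obtain ⟨s1, τ, κ, he, hs1, hτ, hκ⟩ := h s hs
  obtain ⟨s2, τ', κ', he', hs2, hτ', hκ'⟩ := h' s1 hs1
  exact ⟨s2, _, _, Exec.seq he he', hs2, Nat.add_le_add hτ hτ', Nat.add_le_add hκ hκ'⟩

lemma visible_iff {i : ℕ} : visible i = true ↔ i < 100 := by simp [visible]

lemma runs_comp (D : DiagOracle 𝕜) {p : Prog} (hp : p.Scoped visible visible = true) (hb : ∀ i, 4 ≤ i → i < 30 → st.reg i ≤ b) :
    Runs D p.comp st (p.run st) (p.factor (st.reg 2) * (b + 2) ^ p.cost) 0 := by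
  intro s hs
  obtain ⟨s', τ, h, hag, hτ⟩ := p.exec_comp D (a := st.reg 2) (b := b) hp
    (fun i hi => by rw [visible_iff] at hi; omega) (fun i hi => visible_iff.1 hi)
    (fun n _ hn => hb n (isSize_iff.1 hn).1 (isSize_iff.1 hn).2) le_rfl hs
  grind

lemma runs_setReg (D : DiagOracle 𝕜) {e : NExp} {i : ℕ} {n : ℕ}
    (he : ∀ s, Agree visible visible st s → e.val s = n) :
    Runs D (Cmd.setReg i e) st (st.putReg i n) 1 0 := by
  intro s hs
  refine ⟨_, _, _, Exec.setReg _ _ _, ?_, le_rfl, le_rfl⟩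
  rw [he s hs]
  exact (hs.putReg i n).mono (fun j hj => by simp [hj]) fun _ h => h

/-- The state after an answer of the oracle for the matrix `M`. -/
def answerState (D : DiagOracle 𝕜) (st : MState 𝕜) (Q L flag : ℕ) {n : ℕ}
    (M : Matrix (Fin n) (Fin n) 𝕜) : MState 𝕜 :=
  match D.answer n M with
  | none => st.putReg flag 0
  | some (q, l) =>
    let m := update st.farr Q (writeMatrix q (st.farr Q))
    { reg := update st.reg flag 1
      narr := st.narr
      farr := update m L (writeVector l (m L)) }

lemma afterDiag_eq (D : DiagOracle 𝕜) (st : MState 𝕜) (A Q L k flag : ℕ) :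
    st.afterDiag D A Q L k flag =
      answerState D st Q L flag (readMatrix (st.reg k) (st.farr A)) := by
  unfold MState.afterDiag answerState
  grind

lemma runs_diag (D : DiagOracle 𝕜) {A Q L k flag : ℕ} (hA : visible A = true)
    (hQ : visible Q = true) (hL : visible L = true) (hk : visible k = true) (st : MState 𝕜) :
    Runs D (Cmd.diag A Q L k flag) st (st.afterDiag D A Q L k flag)
      (st.reg k * st.reg k + 1) 1 := by
  intro s hs
  refine ⟨_, _, _, Exec.diag _ _ _ _ _ _, ?_, ?_, le_rfl⟩
  · rw [afterDiag_eq, afterDiag_eq, ← hs.reg k hk, ← hs.farr A hA]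
    unfold answerState
    split
    · exact (hs.putReg flag 0).mono (fun j hj => by simp [hj]) fun _ h => h
    refine ⟨((hs.putReg flag 1).mono (fun j hj => by simp [hj]) fun _ h => h).reg, hs.narr,
      fun B hB => ?_⟩
    simp only [Function.update_apply, hs.farr Q hQ, hs.farr L hL]
    split_ifs <;> first | rfl | exact hs.farr B hB
  rw [← hs.reg k hk]

/-! ### Filling arrays -/

/-- Overwrite the field array `A`. -/
def MState.setArr (st : MState 𝕜) (A : ℕ) (m : List ℕ → 𝕜) : MState 𝕜 :=
  { st with farr := update st.farr A m }

lemma setArr_reg (st : MState 𝕜) (A : ℕ) (m : List ℕ → 𝕜) : (st.setArr A m).reg = st.reg := rfl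

lemma setArr_farr (st : MState 𝕜) (A : ℕ) (m : List ℕ → 𝕜) (B : ℕ) :
    (st.setArr A m).farr B = if B = A then m else st.farr B := by
  simp only [MState.setArr, Function.update_apply]

lemma setArr_setArr (st : MState 𝕜) (A : ℕ) (m m' : List ℕ → 𝕜) :
    (st.setArr A m).setArr A m' = st.setArr A m' := by
  simp only [MState.setArr, Function.update_idem]

lemma setArr_self (st : MState 𝕜) (A : ℕ) : st.setArr A (st.farr A) = st := by
  simp only [MState.setArr, Function.update_eq_self]

lemma setArr_putReg (st : MState 𝕜) (A : ℕ) (m : List ℕ → 𝕜) (i n : ℕ) :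
    (st.setArr A m).putReg i n = (st.putReg i n).setArr A m := rfl

lemma putReg_putReg (st : MState 𝕜) (i n n' : ℕ) :
    (st.putReg i n).putReg i n' = st.putReg i n' := by
  simp only [MState.putReg, Function.update_idem]

lemma putReg_self (st : MState 𝕜) (i : ℕ) : st.putReg i (st.reg i) = st := by
  simp only [MState.putReg, Function.update_eq_self]

/-- The expression does not read the array `A`. -/
def FX.avoids (A : ℕ) : FX → Bool
  | FX.zero | FX.one => true
  | FX.cell B _ => !(B == A)
  | FX.bin _ a b => a.avoids A && b.avoids A
  | FX.conj e | FX.big _ _ _ e | FX.bind _ _ e => e.avoids A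
  | FX.ite _ _ _ e e' => e.avoids A && e'.avoids A
  | FX.iteZero a e e' => a.avoids A && e.avoids A && e'.avoids A

lemma NX.val_setArr (e : NX) (A : ℕ) (m : List ℕ → 𝕜) : ∀ st : MState 𝕜,
    e.val (st.setArr A m) = e.val st := by
  induction e with simp_all [NX.val, setArr_reg, setArr_putReg]
  | cell => exact fun _ => rfl

lemma FX.val_setArr (e : FX) (A : ℕ) (m : List ℕ → 𝕜) : e.avoids A = true → ∀ st : MState 𝕜,
    e.val (st.setArr A m) = e.val st := by
  induction e with simp_all [FX.avoids, FX.val, setArr_farr, setArr_reg, setArr_putReg, NX.val_setArr]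

/-- Nested loops that set the entries `idx` of the array `A`. -/
def fill (A : ℕ) (idx : List ℕ) : List (ℕ × ℕ) → FX → Prog
  | [], e => Prog.setFld A idx e
  | (i, n) :: bs, e => Prog.loop i n (fill A idx bs e)

/-- Assign the values `xs` to the variables of `bs`. -/
def putRegs : List (ℕ × ℕ) → List ℕ → MState 𝕜 → MState 𝕜
  | (i, _) :: bs, x :: xs, st => putRegs bs xs (st.putReg i x)
  | _, _, st => st

/-- The values `xs` are in the range of the variables of `bs`. -/
def InRange (st : MState 𝕜) : List (ℕ × ℕ) → List ℕ → Prop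
  | [], [] => True
  | (_, n) :: bs, x :: xs => x < st.reg n ∧ InRange st bs xs
  | _, _ => False

lemma putRegs_setArr (bs : List (ℕ × ℕ)) (A : ℕ) (m : List ℕ → 𝕜) : ∀ (xs : List ℕ)
    (st : MState 𝕜), putRegs bs xs (st.setArr A m) = (putRegs bs xs st).setArr A m := by
  induction bs with
  | nil => intro xs st; rfl
  | cons p bs ih =>
    intro xs st
    cases xs with
    | nil => rfl
    | cons x xs => exact ih xs (st.putReg p.1 x)

lemma putRegs_reg (bs : List (ℕ × ℕ)) : ∀ (xs : List ℕ) (st : MState 𝕜) {i : ℕ},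
    i ∉ bs.map Prod.fst → (putRegs bs xs st).reg i = st.reg i := by
  induction bs with
  | nil => intro xs st i _; rfl
  | cons p bs ih =>
    intro xs st i hi
    simp only [map_cons, List.mem_cons, not_or] at hi
    cases xs with
    | nil => rfl
    | cons x xs =>
      simp only [putRegs]
      rw [ih _ _ hi.2, reg_put, if_neg hi.1]

lemma inRange_congr {bs : List (ℕ × ℕ)}
    (h : ∀ b ∈ bs, st'.reg b.2 = st.reg b.2) : ∀ xs, InRange st' bs xs ↔ InRange st bs xs := by
  induction bs with
  | nil => intro xs; cases xs <;> rfl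
  | cons p bs ih =>
    intro xs
    cases xs with
    | nil => rfl
    | cons x xs =>
      simp only [InRange]
      grind

lemma fill_run {A : ℕ} {idx : List ℕ} {e : FX} (he : e.avoids A = true) (bs : List (ℕ × ℕ)) :
    ∀ (st : MState 𝕜), (bs.map Prod.fst).Nodup → (∀ b ∈ bs, b.1 ∈ idx) →
    (∀ b ∈ bs, b.2 ∉ bs.map Prod.fst) →
    ∃ m, (fill A idx bs e).run st = st.setArr A m ∧ (∀ xs, InRange st bs xs →
        m (idx.map (putRegs bs xs st).reg) = e.val (putRegs bs xs st)) ∧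
      ∀ L, (∀ xs, InRange st bs xs → L ≠ idx.map (putRegs bs xs st).reg) → m L = st.farr A L := by
  induction bs with
  | nil =>
    intro st _ _ _
    refine ⟨update (st.farr A) (idx.map st.reg) (e.val st), rfl, fun xs hxs => ?_, fun L hL => ?_⟩
    · exact update_self ..
    exact update_of_ne (hL [] trivial) ..
  | cons p bs ih =>
    obtain ⟨i, n⟩ := p
    intro st hnd hidx hn
    simp only [map_cons, List.nodup_cons] at hnd
    have hi : i ∈ idx := hidx (i, n) List.mem_cons_self
    have hir : ∀ (x : ℕ) (xs : List ℕ), (putRegs bs xs (st.putReg i x)).reg i = x := by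
      intro x xs
      rw [putRegs_reg bs xs _ hnd.1, reg_put, if_pos rfl]
    have hrange : ∀ (k : ℕ) (m : List ℕ → 𝕜) (xs : List ℕ),
        InRange ((st.putReg i k).setArr A m) bs xs ↔ InRange st bs xs := by
      intro k m
      apply inRange_congr
      intro b hb
      rw [setArr_reg, reg_put, if_neg]
      grind
    have key : ∀ k, ∃ m c, iterate (fill A idx bs e).run i k st = (st.setArr A m).putReg i c ∧
        (∀ x < k, ∀ xs, InRange st bs xs → m (idx.map (putRegs bs xs (st.putReg i x)).reg) =
          e.val (putRegs bs xs (st.putReg i x))) ∧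
        ∀ L, (∀ x < k, ∀ xs, InRange st bs xs →
          L ≠ idx.map (putRegs bs xs (st.putReg i x)).reg) → m L = st.farr A L := by
      intro k
      induction k with
      | zero =>
        refine ⟨st.farr A, st.reg i, ?_, fun x hx => absurd hx (Nat.not_lt_zero x), fun L _ => rfl⟩
        rw [setArr_self, putReg_self]
        rfl
      | succ k ihk =>
        obtain ⟨m, c, h1, h2, h3⟩ := ihk
        obtain ⟨m', h1', h2', h3'⟩ := ih ((st.putReg i k).setArr A m) hnd.2
          (fun b hb => hidx b (List.mem_cons_of_mem _ hb))
          (fun b hb hb' => hn b (List.mem_cons_of_mem _ hb) (List.mem_cons_of_mem _ hb'))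
        simp only [hrange, putRegs_setArr, setArr_reg, e.val_setArr A m he] at h2' h3'
        rw [setArr_farr, if_pos rfl] at h3'
        refine ⟨m', k, ?_, ?_, ?_⟩
        · simp only [iterate]
          rw [h1, putReg_putReg, setArr_putReg, h1', setArr_setArr, setArr_putReg]
        · intro x hx xs hxs
          rcases Nat.lt_succ_iff_lt_or_eq.1 hx with hx | rfl
          · rw [h3', h2 x hx xs hxs]
            intro ys hys heq
            have := List.map_inj_left.1 heq i hi
            grind
          grind
        grind
    obtain ⟨m, c, h1, h2, h3⟩ := key (st.reg n)
    refine ⟨m, ?_, ?_, ?_⟩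
    · simp only [fill, Prog.run]
      rw [h1, putReg_putReg, setArr_putReg, putReg_self]
    · intro xs hxs
      cases xs with
      | nil => exact hxs.elim
      | cons x xs => exact h2 x hxs.1 xs hxs.2
    intro L hL
    exact h3 L fun x hx xs hxs => hL (x :: xs) ⟨hx, hxs⟩

lemma fill_run2 {A : ℕ} {pre : List ℕ} {e : FX} {i n j k : ℕ} (he : e.avoids A = true)
    (hij : i ≠ j) (hni : n ≠ i) (hnj : n ≠ j) (hki : k ≠ i) (hkj : k ≠ j) (hi : i ∉ pre)
    (hj : j ∉ pre) (st : MState 𝕜) :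
    ∃ m, (fill A (pre ++ [i, j]) [(i, n), (j, k)] e).run st = st.setArr A m ∧
      (∀ x < st.reg n, ∀ y < st.reg k, m (pre.map st.reg ++ [x, y]) =
        e.val ((st.putReg i x).putReg j y)) ∧
      ∀ L, (∀ x < st.reg n, ∀ y < st.reg k, L ≠ pre.map st.reg ++ [x, y]) → m L = st.farr A L := by
  obtain ⟨m, h1, h2, h3⟩ := fill_run (A := A) (idx := pre ++ [i, j]) he [(i, n), (j, k)] st
    (by simpa using hij) (by simp) (by grind)
  have hmap : ∀ x y, (pre ++ [i, j]).map ((st.putReg i x).putReg j y).reg =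
      pre.map st.reg ++ [x, y] := by
    intro x y
    rw [List.map_append]
    congr 1
    · refine List.map_congr_left fun a ha => ?_
      rw [reg_put, if_neg (by grind), reg_put, if_neg (by grind)]
    simp [reg_put, hij]
  refine ⟨m, h1, fun x hx y hy => ?_, fun L hL => h3 L ?_⟩
  · rw [← hmap]
    exact h2 [x, y] ⟨hx, hy, trivial⟩
  intro xs hxs
  match xs, hxs with
  | [x, y], hxs =>
    simp only [putRegs]
    rw [hmap]
    exact hL x hxs.1 y hxs.2.1

lemma fill_run3 {A : ℕ} {e : FX} {l i n j k : ℕ} (he : e.avoids A = true)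
    (hai : a ≠ i) (haj : a ≠ j) (hij : i ≠ j) (hl : l ≠ a ∧ l ≠ i ∧ l ≠ j)
    (hn : n ≠ a ∧ n ≠ i ∧ n ≠ j) (hk : k ≠ a ∧ k ≠ i ∧ k ≠ j) (st : MState 𝕜) :
    ∃ m, (fill A [a, i, j] [(a, l), (i, n), (j, k)] e).run st = st.setArr A m ∧
      ∀ b < st.reg l, ∀ x < st.reg n, ∀ y < st.reg k, m [b, x, y] =
        e.val (((st.putReg a b).putReg i x).putReg j y) := by
  obtain ⟨m, h1, h2, -⟩ := fill_run (A := A) (idx := [a, i, j]) he [(a, l), (i, n), (j, k)] st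
    (by grind) (by simp) (by simp [hl, hn, hk])
  refine ⟨m, h1, fun b hb x hx y hy => ?_⟩
  have := h2 [b, x, y] ⟨hb, hx, hy, trivial⟩
  simpa [putRegs, reg_put, hai, haj, hij] using this

/-! ### Frames -/

/-- The program writes no integer array. -/
def Prog.noNat : Prog → Bool
  | Prog.setReg _ _ | Prog.setFld _ _ _ => true
  | Prog.setNat _ _ _ => false
  | Prog.seq p q | Prog.ifZero _ p q => p.noNat && q.noNat
  | Prog.loop _ _ p => p.noNat

/-- The program writes to no register in `R` and to no field array in `V`. -/
def Prog.keeps (R V : ℕ → Bool) : Prog → Bool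
  | Prog.setReg i _ => !R i
  | Prog.setNat _ _ _ => true
  | Prog.setFld A _ _ => !V A
  | Prog.seq p q | Prog.ifZero _ p q => p.keeps R V && q.keeps R V
  | Prog.loop _ _ p => p.keeps R V

lemma Prog.run_narr (p : Prog) : p.noNat = true → ∀ st : MState 𝕜, (p.run st).narr = st.narr := by
  induction p with (intro h st; simp only [Prog.noNat, and_eq_true] at h; simp only [Prog.run])
  | setReg | setFld => rfl
  | setNat => cases h
  | seq | ifZero => grind
  | loop i n p ih =>
    simp only [putReg_narr]
    generalize st.reg n = m
    induction m with
    | zero => rfl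
    | succ m ihm => simp only [iterate, ih h, putReg_narr, ihm]

lemma Prog.run_keeps_reg (p : Prog) : p.keeps R V = true →
    ∀ (st : MState 𝕜) {i : ℕ}, R i = true → (p.run st).reg i = st.reg i := by
  induction p with
    (intro h st i hi; simp only [Prog.keeps, and_eq_true] at h; simp only [Prog.run])
  | setReg j e =>
    rw [reg_put, if_neg]
    grind
  | setNat | setFld => rfl
  | seq | ifZero => grind
  | loop j n p ih =>
    rw [reg_put]
    split_ifs with hij
    · rw [hij]
    generalize st.reg n = m
    induction m with
    | zero => rfl
    | succ m ihm => simp only [iterate, ih h _ hi, reg_put, if_neg hij, ihm]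

lemma Prog.run_keeps_farr (p : Prog) : p.keeps R V = true →
    ∀ (st : MState 𝕜) {A : ℕ}, V A = true → (p.run st).farr A = st.farr A := by
  induction p with
    (intro h st A hA; simp only [Prog.keeps, and_eq_true] at h; simp only [Prog.run])
  | setReg | setNat => rfl
  | setFld B idx e =>
    funext L
    rw [putFld_farr, if_neg]
    grind
  | seq | ifZero => grind
  | loop j n p ih =>
    simp only [putReg_farr]
    generalize st.reg n = m
    induction m with
    | zero => rfl
    | succ m ihm => simp only [iterate, ih h _ hA, putReg_farr, ihm]

lemma Prog.agree_run (p : Prog) (h : p.keeps R V = true) (h' : p.noNat = true)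
    (st : MState 𝕜) : Agree R V st (p.run st) :=
  ⟨fun _ hi => (p.run_keeps_reg h st hi).symm, (p.run_narr h' st).symm,
    fun _ hA => (p.run_keeps_farr h st hA).symm⟩

/-- Invariants of loops. -/
lemma run_loop_induct {i n : ℕ} {p : Prog} {Inv : ℕ → MState 𝕜 → Prop}
    (hput : ∀ k s j, Inv k s → Inv k (s.putReg i j)) (h0 : Inv 0 st)
    (hstep : ∀ k s, k < st.reg n → Inv k s → s.reg i = k → Inv (k + 1) (p.run s)) :
    Inv (st.reg n) ((Prog.loop i n p).run st) := by
  have key : ∀ k, k ≤ st.reg n → Inv k (iterate p.run i k st) := by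
    intro k
    induction k with
    | zero => intro _; exact h0
    | succ k ih =>
      intro hk
      exact hstep k _ hk (hput _ _ _ (ih (Nat.le_of_succ_le hk))) (by rw [reg_put, if_pos rfl])
  exact hput _ _ _ (key _ le_rfl)

/-! ### Orthogonalization -/

section Ortho

variable {ι : Type*} [Fintype ι]

/-- The Hermitian inner product. -/
def hdot (a b : ι → 𝕜) : 𝕜 := ∑ i, (starRingEnd 𝕜) (a i) * b i

open ComplexOrder in
lemma hdot_self_eq_zero {a : ι → 𝕜} : hdot a a = 0 ↔ a = 0 :=
  dotProduct_star_self_eq_zero (v := a)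

lemma hdot_add (a b c : ι → 𝕜) : hdot a (b + c) = hdot a b + hdot a c := by
  simp only [hdot, Pi.add_apply, mul_add, Finset.sum_add_distrib]

lemma hdot_sub (a b c : ι → 𝕜) : hdot a (b - c) = hdot a b - hdot a c := by
  simp only [hdot, Pi.sub_apply, mul_sub, sum_sub_distrib]

lemma hdot_smul (a b : ι → 𝕜) (x : 𝕜) : hdot a (x • b) = x * hdot a b := by
  simp only [hdot, Pi.smul_apply, smul_eq_mul, mul_sum]
  grind

lemma hdot_sum {κ : Type*} (s : Finset κ) (a : ι → 𝕜) (b : κ → ι → 𝕜) :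
    hdot a (∑ k ∈ s, b k) = ∑ k ∈ s, hdot a (b k) := by
  simp only [hdot, Finset.sum_apply, mul_sum]
  exact sum_comm

lemma hdot_zero (a : ι → 𝕜) : hdot a 0 = 0 := by simp [hdot]

lemma conj_hdot (a b : ι → 𝕜) : (starRingEnd 𝕜) (hdot a b) = hdot b a := by
  simp only [hdot, map_sum, map_mul, RingHomCompTriple.comp_apply, RingHom.id_apply]
  grind

lemma hdot_eq_zero_of_mem_span {S : Set (ι → 𝕜)} {t : ι → 𝕜} (h : ∀ a ∈ S, hdot a t = 0)
    {w : ι → 𝕜} (hw : w ∈ span 𝕜 S) : hdot w t = 0 := by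
  rw [← conj_hdot, map_eq_zero]
  induction hw using Submodule.span_induction with
  | mem x hx => rw [← conj_hdot, h x hx, map_zero]
  | zero => exact hdot_zero t
  | add x y _ _ hx hy => rw [hdot_add, hx, hy, add_zero]
  | smul c x _ hx => rw [hdot_smul, hx, mul_zero]

/-- Among the rows `b k`, `k < K`, the first `c` ones are an orthogonal basis of `W`, and the others
vanish. -/
structure OrthoRows (K : ℕ) (b : ℕ → ι → 𝕜) (c : ℕ) (W : Submodule 𝕜 (ι → 𝕜)) : Prop where
  zero : ∀ k < K, c ≤ k → b k = 0
  ne : ∀ k < c, b k ≠ 0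
  orth : ∀ k < c, ∀ l < c, k ≠ l → hdot (b k) (b l) = 0
  span : span 𝕜 (range fun k : Fin c => b k) = W

lemma linearIndependent_of_orthogonal {c : ℕ} {b : Fin c → ι → 𝕜} (hne : ∀ k, b k ≠ 0)
    (h : ∀ k l, k ≠ l → hdot (b k) (b l) = 0) : LinearIndependent 𝕜 b := by
  rw [Fintype.linearIndependent_iff]
  intro g hg k
  have h1 : hdot (b k) (∑ l, g l • b l) = g k * hdot (b k) (b k) := by
    rw [hdot_sum, sum_eq_single k]
    · rw [hdot_smul]
    · intro l _ hl
      rw [hdot_smul, h k l hl.symm, mul_zero]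
    simp
  rw [hg, hdot_zero, eq_comm, mul_eq_zero] at h1
  exact h1.resolve_right fun h2 => hne k (hdot_self_eq_zero.1 h2)

namespace OrthoRows

variable {K c : ℕ} {b : ℕ → ι → 𝕜} {W : Submodule 𝕜 (ι → 𝕜)}

lemma linearIndependent (h : OrthoRows K b c W) : LinearIndependent 𝕜 fun k : Fin c => b k :=
  linearIndependent_of_orthogonal (fun k => h.ne k k.2) fun k l hkl =>
    h.orth k k.2 l l.2 fun hkl' => hkl (Fin.ext hkl')

lemma isBasisOf (h : OrthoRows K b c W) : IsBasisOf (fun k : Fin c => b k) W :=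
  ⟨h.linearIndependent, h.span⟩

lemma le_card (h : OrthoRows K b c W) : c ≤ card ι := by
  simpa using h.linearIndependent.fintype_card_le_finrank

lemma mem (h : OrthoRows K b c W) {k : ℕ} (hk : k < c) : b k ∈ W := by
  rw [← h.span]
  exact subset_span ⟨⟨k, hk⟩, rfl⟩

end OrthoRows

lemma orthoRows_bot {K : ℕ} {b : ℕ → ι → 𝕜} (hb : ∀ k < K, b k = 0) :
    OrthoRows K b 0 (⊥ : Submodule 𝕜 (ι → 𝕜)) :=
  ⟨fun k hk _ => hb k hk, fun _ hk => absurd hk (Nat.not_lt_zero _),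
    fun _ hk => absurd hk (Nat.not_lt_zero _), by simp⟩

/-- The component of `X` orthogonal to the rows. -/
def gsRes (K : ℕ) (b : ℕ → ι → 𝕜) (X : ι → 𝕜) : ι → 𝕜 :=
  fun i => X i - ∑ k ∈ Finset.range K, hdot (b k) X / hdot (b k) (b k) * b k i

lemma gsRes_eq (K : ℕ) (b : ℕ → ι → 𝕜) (X : ι → 𝕜) :
    gsRes K b X = X - ∑ k ∈ Finset.range K, (hdot (b k) X / hdot (b k) (b k)) • b k := by
  funext i
  simp [gsRes]

lemma gsRes_sum {κ : Type*} (s : Finset κ) (K : ℕ) (b : ℕ → ι → 𝕜) (x : κ → 𝕜)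
    (X : κ → ι → 𝕜) : gsRes K b (∑ m ∈ s, x m • X m) = ∑ m ∈ s, x m • gsRes K b (X m) := by
  simp only [gsRes_eq, smul_sub, sum_sub_distrib, hdot_sum, hdot_smul, sum_div,
    Finset.sum_smul, Finset.smul_sum, smul_smul, mul_div_assoc]
  rw [sum_comm]

namespace OrthoRows

variable {K c : ℕ} {b : ℕ → ι → 𝕜} {W : Submodule 𝕜 (ι → 𝕜)}

lemma hdot_row_gsRes (h : OrthoRows K b c W) (hc : c ≤ K) (X : ι → 𝕜) {l : ℕ} (hl : l < c) :
    hdot (b l) (gsRes K b X) = 0 := by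
  rw [gsRes_eq, hdot_sub, hdot_sum, sum_eq_single l]
  · rw [hdot_smul, div_mul_cancel₀, sub_self]
    exact fun h' => h.ne l hl (hdot_self_eq_zero.1 h')
  · intro k hk hkl
    rw [hdot_smul]
    by_cases hkc : k < c
    · rw [h.orth l hl k hkc hkl.symm, mul_zero]
    rw [h.zero k (Finset.mem_range.1 hk) (not_lt.1 hkc), hdot_zero (b l), mul_zero]
  grind

lemma hdot_gsRes (h : OrthoRows K b c W) (hc : c ≤ K) (X : ι → 𝕜) {w : ι → 𝕜} (hw : w ∈ W) :
    hdot w (gsRes K b X) = 0 := by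
  rw [← h.span] at hw
  refine hdot_eq_zero_of_mem_span ?_ hw
  rintro _ ⟨l, rfl⟩
  exact h.hdot_row_gsRes hc X l.2

lemma sub_gsRes_mem (h : OrthoRows K b c W) (X : ι → 𝕜) : X - gsRes K b X ∈ W := by
  rw [gsRes_eq, sub_sub_cancel]
  refine Submodule.sum_mem _ fun k hk => ?_
  by_cases hkc : k < c
  · exact W.smul_mem _ (h.mem hkc)
  rw [h.zero k (Finset.mem_range.1 hk) (not_lt.1 hkc), smul_zero]
  exact W.zero_mem

lemma gsRes_eq_self {X : ι → 𝕜} (h : OrthoRows K b c W) (hX : ∀ w ∈ W, hdot w X = 0) :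
    gsRes K b X = X := by
  rw [gsRes_eq, sum_eq_zero, sub_zero]
  intro k hk
  by_cases hkc : k < c
  · rw [hX _ (h.mem hkc), zero_div, zero_smul]
  rw [h.zero k (Finset.mem_range.1 hk) (not_lt.1 hkc), smul_zero]

lemma append_zero (h : OrthoRows K b c W) {X : ι → 𝕜} (hX : gsRes K b X = 0) :
    OrthoRows K b c (W ⊔ Submodule.span 𝕜 {X}) := by
  have hXW : X ∈ W := by
    have := h.sub_gsRes_mem X
    grind
  simp_all

lemma append_ne (h : OrthoRows K b c W) (hK : card ι ≤ K) {X : ι → 𝕜}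
    (hX : gsRes K b X ≠ 0) {b' : ℕ → ι → 𝕜} (hc : b' c = gsRes K b X)
    (hb : ∀ k, k ≠ c → b' k = b k) :
    OrthoRows K b' (c + 1) (W ⊔ Submodule.span 𝕜 {X}) := by
  have hcK : c ≤ K := h.le_card.trans hK
  refine ⟨fun k hk hck => ?_, fun k hk => ?_, fun k hk l hl hkl => ?_, ?_⟩
  · rw [hb k (by omega)]
    exact h.zero k hk (by omega)
  · rcases Nat.lt_succ_iff_lt_or_eq.1 hk with hk | rfl
    · rw [hb k (by omega)]
      exact h.ne k hk
    rwa [hc]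
  · rcases Nat.lt_succ_iff_lt_or_eq.1 hk with hk | rfl <;>
      rcases Nat.lt_succ_iff_lt_or_eq.1 hl with hl | rfl
    · rw [hb k (by omega), hb l (by omega)]
      exact h.orth k hk l hl hkl
    · rw [hb k (by omega), hc]
      exact h.hdot_row_gsRes hcK X hk
    · rw [hb l (by omega), hc, ← conj_hdot, h.hdot_row_gsRes hcK X hl, map_zero]
    grind
  have hrange : (range fun k : Fin (c + 1) => b' k) =
      (range fun k : Fin c => b k) ∪ {gsRes K b X} := by
    ext x
    constructor
    · rintro ⟨k, rfl⟩
      rcases Nat.lt_succ_iff_lt_or_eq.1 k.2 with hk | hk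
      · exact Or.inl ⟨⟨k, hk⟩, (hb k (by omega)).symm⟩
      grind
    rintro (⟨k, rfl⟩ | rfl)
    · exact ⟨⟨k, by omega⟩, hb k (by have := k.2; omega)⟩
    exact ⟨⟨c, by omega⟩, hc⟩
  rw [hrange, span_union, h.span]
  have hm := h.sub_gsRes_mem X
  apply le_antisymm
  · refine sup_le le_sup_left ((Submodule.span_singleton_le_iff_mem _ _).2 ?_)
    have : gsRes K b X = X - (X - gsRes K b X) := by abel
    rw [this]
    exact Submodule.sub_mem _ (Submodule.mem_sup_right (Submodule.mem_span_singleton_self X))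
      (Submodule.mem_sup_left hm)
  refine sup_le le_sup_left ((Submodule.span_singleton_le_iff_mem _ _).2 ?_)
  have := Submodule.add_mem _ (Submodule.mem_sup_right (S := W)
    (Submodule.mem_span_singleton_self (gsRes K b X))) (Submodule.mem_sup_left hm)
  simp_all

lemma mem_span_gsRes_single [DecidableEq ι] (h : OrthoRows K b c W) (hK : card ι ≤ K)
    (t : ι → 𝕜) :
    t ∈ Submodule.span 𝕜 (range fun m => gsRes K b (single m 1)) ↔ ∀ w ∈ W, hdot w t = 0 := by
  constructor
  · intro ht w hw
    rw [← conj_hdot, map_eq_zero]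
    refine hdot_eq_zero_of_mem_span ?_ ht
    rintro _ ⟨m, rfl⟩
    dsimp only
    rw [← conj_hdot, h.hdot_gsRes (h.le_card.trans hK) _ hw, map_zero]
  intro ht
  have h1 : t = ∑ m, t m • (single m 1 : ι → 𝕜) := by
    funext i
    simp [Finset.sum_apply, Pi.single_apply]
  rw [← h.gsRes_eq_self ht, h1, gsRes_sum]
  exact Submodule.sum_mem _ fun m _ => Submodule.smul_mem _ _ (subset_span ⟨m, rfl⟩)

end OrthoRows

/-- The functionals dual to an independent family, from the components of its members orthogonal
to all the others. -/
lemma isDualTo_of_gsRes {n K : ℕ} {x : Fin n → ι → 𝕜} (hx : LinearIndependent 𝕜 x)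
    (hK : card ι ≤ K) {b : Fin n → ℕ → ι → 𝕜} {c : Fin n → ℕ}
    (hb : ∀ j, OrthoRows K (b j) (c j) (span 𝕜 (x '' {i | i ≠ j}))) {h : Fin n → ι → 𝕜}
    (hh : ∀ j i, h j i = (starRingEnd 𝕜) (gsRes K (b j) (x j) i) /
      hdot (gsRes K (b j) (x j)) (gsRes K (b j) (x j))) : IsDualTo x h := by
  intro j l
  set y := gsRes K (b j) (x j) with hy
  have hcK : c j ≤ K := (hb j).le_card.trans hK
  have hsum : ∑ i, h j i * x l i = hdot y (x l) / hdot y y := by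
    simp only [hh, hdot, sum_div]
    grind
  rw [hsum]
  split_ifs with hjl
  · subst hjl
    have hne : y ≠ 0 := by
      intro h0
      have := (hb j).sub_gsRes_mem (x j)
      rw [← hy, h0, sub_zero] at this
      refine hx.notMem_span_image (s := {i | i ≠ j}) (x := j) (by simp) this
    have h2 : x j = y + (x j - y) := by abel
    have h3 : hdot y (x j - y) = 0 := by
      rw [← conj_hdot, (hb j).hdot_gsRes hcK _ ((hb j).sub_gsRes_mem (x j)), map_zero]
    rw [h2, hdot_add, h3, add_zero]
    exact div_self fun h4 => hne (hdot_self_eq_zero.1 h4)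
  have : hdot y (x l) = 0 := by
    rw [← conj_hdot, (hb j).hdot_gsRes hcK _ (subset_span ⟨l, fun h => hjl h.symm, rfl⟩), map_zero]
  grind

end Ortho

/-! ### Orthogonalization by a program -/

/-- The matrix in an array at the prefix `pre`. -/
def matAt (m : List ℕ → 𝕜) (pre : List ℕ) {a b : ℕ} : Fin a × Fin b → 𝕜 :=
  fun c => m (pre ++ [(c.1 : ℕ), (c.2 : ℕ)])

lemma sum_range_range {M : Type*} [AddCommMonoid M] (a b : ℕ) (f : ℕ → ℕ → M) :
    ∑ x ∈ Finset.range a, ∑ y ∈ Finset.range b, f x y = ∑ c : Fin a × Fin b, f c.1 c.2 := by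
  rw [Fintype.sum_prod_type, sum_range]
  exact sum_congr rfl fun x _ => sum_range _

/-- Sum over the pairs of values of `i` and `j`. -/
def FX.sum2 (i p j q : ℕ) (e : FX) : FX := FX.big BigOp.sum i p (FX.big BigOp.sum j q e)

lemma FX.val_sum2 {i p j : ℕ} (hqi : q ≠ i) (e : FX) (st : MState 𝕜)
    (ha : st.reg p = a) (hb : st.reg q = b) : (FX.sum2 i p j q e).val st =
      ∑ c : Fin a × Fin b, e.val ((st.putReg i c.1).putReg j c.2) := by
  simp only [FX.sum2, FX.val, BigOp.fn, reg_put, if_neg hqi]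
  rw [sum_range_range, ha, hb]

/-- The Hermitian inner product of two arrays. -/
def FX.dot (p q : ℕ) (e e' : FX) : FX := FX.sum2 113 p 114 q (FX.bin FOp.mul (FX.conj e) e')

/-- The registers and arrays that are used in an orthogonalization. -/
structure GS where
  B : ℕ
  cnt : ℕ
  p : ℕ
  q : ℕ
  K : ℕ

/-- Write to array 12 the component of array 11 that is orthogonal to the rows. -/
def GS.residual (g : GS) : Prog := fill 12 ([] ++ [110, 111]) [(110, g.p), (111, g.q)]
    (FX.bin FOp.sub (FX.cell 11 [110, 111]) (FX.big BigOp.sum 112 g.K (FX.bin FOp.mul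
      (FX.bin FOp.div (FX.dot g.p g.q (FX.cell g.B [112, 113, 114]) (FX.cell 11 [113, 114]))
        (FX.dot g.p g.q (FX.cell g.B [112, 113, 114]) (FX.cell g.B [112, 113, 114])))
      (FX.cell g.B [112, 110, 111]))))

/-- The squared norm of array 12. -/
def GS.norm (g : GS) : FX :=
  FX.dot g.p g.q (FX.cell 12 [113, 114]) (FX.cell 12 [113, 114])

/-- Orthogonalize array 11, and append the result to the rows unless it vanishes. -/
def GS.append (g : GS) : Prog :=
  Prog.seq g.residual (Prog.ifZero g.norm (Prog.setReg g.cnt (NX.reg g.cnt))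
    (Prog.seq (fill g.B ([g.cnt] ++ [110, 111]) [(110, g.p), (111, g.q)] (FX.cell 12 [110, 111]))
      (Prog.setReg g.cnt (NX.bin NOp.add (NX.reg g.cnt) (NX.lit 1)))))

/-- Write an expression to array 11 and append it. -/
def GS.push (g : GS) (e : FX) : Prog :=
  Prog.seq (fill 11 ([] ++ [110, 111]) [(110, g.p), (111, g.q)] e) g.append

/-- The conditions on the registers and arrays. -/
structure GS.Valid (g : GS) : Prop where
  B_ne : g.B ≠ 11 ∧ g.B ≠ 12
  cnt_lt : g.cnt < 100
  p_lt : g.p < 100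
  q_lt : g.q < 100
  K_lt : g.K < 100
  cnt_ne : g.cnt ≠ g.p ∧ g.cnt ≠ g.q ∧ g.cnt ≠ g.K

lemma GS.residual_run (hg : g.Valid) (ha : st.reg g.p = a) (hb : st.reg g.q = b) :
    ∃ m, g.residual.run st = st.setArr 12 m ∧ (matAt m [] : Fin a × Fin b → 𝕜) =
      gsRes (st.reg g.K) (fun k => matAt (st.farr g.B) [k]) (matAt (st.farr 11) []) := by
  obtain ⟨⟨hB, hB'⟩, hc, hp, hq, hK, -⟩ := hg
  obtain ⟨m, h1, h2, -⟩ := fill_run2 (A := 12) (pre := []) (i := 110) (j := 111) (n := g.p)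
    (k := g.q) (e := FX.bin FOp.sub (FX.cell 11 [110, 111]) (FX.big BigOp.sum 112 g.K
      (FX.bin FOp.mul (FX.bin FOp.div
        (FX.dot g.p g.q (FX.cell g.B [112, 113, 114]) (FX.cell 11 [113, 114]))
        (FX.dot g.p g.q (FX.cell g.B [112, 113, 114]) (FX.cell g.B [112, 113, 114])))
      (FX.cell g.B [112, 110, 111]))))
    (by simp [FX.avoids, FX.dot, FX.sum2, hB']) (by omega) (by omega) (by omega) (by omega)
    (by omega) (by simp) (by simp) st
  refine ⟨m, h1, ?_⟩
  funext c
  have h := h2 c.1 (by omega) c.2 (by omega)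
  rw [map_nil] at h
  rw [matAt, h]
  simp only [FX.val, BigOp.fn, FOp.fn, FX.dot, gsRes, hdot]
  have hpr : ∀ (r i : ℕ), r < 100 → 100 ≤ i → r ≠ i := by omega
  congr 1
  rw [reg_put, if_neg (by omega), reg_put, if_neg (by omega)]
  refine sum_congr rfl fun k _ => ?_
  rw [FX.val_sum2 (a := a) (b := b) (by omega)
    _ _ (by simp [reg_put, hpr g.p _ hp, ha]) (by simp [reg_put, hpr g.q _ hq, hb]),
    FX.val_sum2 (a := a) (b := b) (by omega)
    _ _ (by simp [reg_put, hpr g.p _ hp, ha]) (by simp [reg_put, hpr g.q _ hq, hb])]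
  simp [FX.val, FOp.fn, reg_put, putReg_farr, matAt]

lemma GS.val_norm (hg : g.Valid) (ha : st.reg g.p = a) (hb : st.reg g.q = b) :
    g.norm.val st = hdot (matAt (st.farr 12) [] : Fin a × Fin b → 𝕜) (matAt (st.farr 12) []) := by
  have := hg.q_lt
  rw [GS.norm, FX.dot, FX.val_sum2 (by omega) _ _ ha hb]
  simp [FX.val, FOp.fn, reg_put, putReg_farr, matAt, hdot]

/-- The rows are an orthogonal basis of `W`. -/
def GS.Ortho (g : GS) {a b : ℕ} (st : MState 𝕜)
    (W : Submodule 𝕜 (Fin a × Fin b → 𝕜)) : Prop :=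
  OrthoRows (st.reg g.K) (fun k => matAt (st.farr g.B) [k]) (st.reg g.cnt) W

lemma GS.append_run (hg : g.Valid)
    (ha : st.reg g.p = a) (hb : st.reg g.q = b) (hK : a * b ≤ st.reg g.K)
    {W : Submodule 𝕜 (Fin a × Fin b → 𝕜)} (h : g.Ortho st W) :
    g.Ortho (g.append.run st) (W ⊔ span 𝕜 {matAt (st.farr 11) []}) := by
  obtain ⟨m, h1, h2⟩ := GS.residual_run hg ha hb
  obtain ⟨⟨hB, hB'⟩, hc, hp, hq, hKl, hcp, hcq, hcK⟩ := id hg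
  have hcard : card (Fin a × Fin b) ≤ st.reg g.K := by simpa using hK
  simp only [GS.append, Prog.run]
  rw [h1]
  have hn : g.norm.val (st.setArr 12 m) = hdot (matAt m [] : Fin a × Fin b → 𝕜) (matAt m []) := by
    rw [GS.val_norm hg (st := st.setArr 12 m) (a := a) (b := b) ha hb, setArr_farr, if_pos rfl]
  rw [hn]
  split_ifs with hz
  · rw [hdot_self_eq_zero, h2] at hz
    rw [show NX.val (NX.reg g.cnt) (st.setArr 12 m) = (st.setArr 12 m).reg g.cnt from rfl,
      putReg_self]
    have := OrthoRows.append_zero h hz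
    rw [GS.Ortho, setArr_farr, if_neg hB']
    exact this
  rw [hdot_self_eq_zero, h2] at hz
  obtain ⟨m', h1', h2', h3'⟩ := fill_run2 (A := g.B) (pre := [g.cnt]) (i := 110) (j := 111)
    (n := g.p) (k := g.q) (e := FX.cell 12 [110, 111])
    (by simp [FX.avoids, Ne.symm hB']) (by omega) (by omega) (by omega) (by omega)
    (by omega) (by simp; omega) (by simp; omega) (st.setArr 12 m)
  rw [h1', GS.Ortho, reg_put, if_neg (Ne.symm hcK), reg_put, if_pos rfl, putReg_farr,
    setArr_farr, if_pos rfl]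
  refine OrthoRows.append_ne h hcard hz (b' := fun k => matAt m' [k]) ?_ ?_
  · rw [← h2]
    funext c
    have := h2' c.1 (by rw [setArr_reg]; omega) c.2 (by rw [setArr_reg]; omega)
    simpa [FX.val, putReg_farr, setArr_farr, reg_put, matAt, setArr_reg] using this
  intro k hk
  funext c
  simp only [matAt]
  rw [h3', setArr_farr, if_neg hB']
  intro x _ y _ heq
  simp [setArr_reg] at heq
  exact hk heq.1

/-- The program appends the vectors in `S`, if started in any state that agrees with `st` in
`R` and `V`. -/
def GS.Adds (g : GS) (R V : ℕ → Bool) (p : Prog) (st : MState 𝕜) {a b : ℕ}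
    (S : Set (Fin a × Fin b → 𝕜)) : Prop :=
  ∀ s, Agree R V st s → ∀ W : Submodule 𝕜 (Fin a × Fin b → 𝕜), g.Ortho s W →
    g.Ortho (p.run s) (W ⊔ span 𝕜 S)

lemma GS.Ortho.putReg
    {W : Submodule 𝕜 (Fin a × Fin b → 𝕜)} (h : g.Ortho st W) {i : ℕ} (hi : i ≠ g.K)
    (hi' : i ≠ g.cnt) (n : ℕ) : g.Ortho (st.putReg i n) W := by
  rw [GS.Ortho, reg_put, if_neg hi.symm, reg_put, if_neg hi'.symm, putReg_farr]
  exact h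

lemma GS.adds_push (hg : g.Valid) {e : FX}
    (he : e.avoids 11 = true) (hs : e.Scoped (fun j => j == 111 || (j == 110 || R j)) V = true)
    (hR : R g.p = true ∧ R g.q = true ∧ R g.K = true)
    (ha : st.reg g.p = a) (hb : st.reg g.q = b) (hK : a * b ≤ st.reg g.K) :
    g.Adds R V (g.push e) st
      {(fun c => e.val ((st.putReg 110 c.1).putReg 111 c.2) : Fin a × Fin b → 𝕜)} := by
  intro s hag W hW
  obtain ⟨⟨hB, hB'⟩, hc, hp, hq, hKl, hcp, hcq, hcK⟩ := id hg
  have ha' : s.reg g.p = a := by rw [← hag.reg _ hR.1, ha]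
  have hb' : s.reg g.q = b := by rw [← hag.reg _ hR.2.1, hb]
  have hK' : a * b ≤ s.reg g.K := by rwa [← hag.reg _ hR.2.2]
  obtain ⟨m, h1, h2, -⟩ := fill_run2 (A := 11) (pre := []) (i := 110) (j := 111)
      (n := g.p) (k := g.q) he (by omega) (by omega) (by omega) (by omega)
      (by omega) (by simp) (by simp) s
  simp only [GS.push, Prog.run]
  rw [h1]
  have hW' : g.Ortho (s.setArr 11 m) W := by
    rw [GS.Ortho, setArr_farr, if_neg hB]
    exact hW
  have := GS.append_run hg (st := s.setArr 11 m) ha' hb' hK' hW'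
  have hX : (matAt ((s.setArr 11 m).farr 11) [] : Fin a × Fin b → 𝕜) =
      fun c => e.val ((st.putReg 110 c.1).putReg 111 c.2) := by
    funext c
    rw [setArr_farr, if_pos rfl, matAt]
    have h := h2 c.1 (by omega) c.2 (by omega)
    rw [map_nil] at h
    rw [h]
    exact (e.val_congr hs ((hag.putReg 110 _).putReg 111 _)).symm
  rwa [hX] at this

lemma GS.adds_loop {i n : ℕ} {p : Prog}
    (hp : p.keeps R V = true) (hp' : p.noNat = true) (hi : R i = false) (hn : R n = true)
    (hiK : i ≠ g.K) (hic : i ≠ g.cnt)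
    {S : ℕ → Set (Fin a × Fin b → 𝕜)}
    (h : ∀ k < st.reg n, g.Adds (fun j => j == i || R j) V p (st.putReg i k) (S k)) :
    g.Adds R V (Prog.loop i n p) st (⋃ k < st.reg n, S k) := by
  intro s hag W hW
  have hns : s.reg n = st.reg n := (hag.reg n hn).symm
  have := run_loop_induct (i := i) (n := n) (p := p) (st := s)
    (Inv := fun k s' => Agree R V st s' ∧ g.Ortho s' (W ⊔ span 𝕜 (⋃ j < k, S j)))
    (fun k s' j h => ⟨h.1.putReg_of_not hi j, h.2.putReg hiK hic j⟩)
    ⟨hag, by simpa using hW⟩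
    (by
      intro k s' hk ⟨hag', hW'⟩ hik
      refine ⟨hag'.trans (p.agree_run hp hp' s'), ?_⟩
      have hag'' : Agree (fun j => j == i || R j) V (st.putReg i k) s' := by
        refine ⟨fun j hj => ?_, hag'.narr, hag'.farr⟩
        rw [reg_put]
        split_ifs with hji
        · rw [hji, hik]
        exact hag'.reg j (by grind)
      have := h k (by omega) s' hag'' _ hW'
      rw [sup_assoc, ← span_union] at this
      convert this using 3
      ext x
      simp only [mem_iUnion, Set.mem_union, exists_prop, Nat.lt_succ_iff_lt_or_eq, or_and_right,
        exists_or, exists_eq_left])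
  simp_all

/-- Append all rows of the array `S` except the one whose number is in register 100. -/
def GS.pushOthers (g : GS) (S n : ℕ) : Prog :=
  Prog.loop 101 n (g.push (FX.ite NRel.eq (NX.reg 101) (NX.reg 100) FX.zero
    (FX.cell S [101, 110, 111])))

/-- Compute the functional that is dual to the row of `S` whose number is in register 100. -/
def GS.dualRow (g : GS) (S D n : ℕ) : Prog := Prog.seq (Prog.setReg g.cnt (NX.lit 0)) <|
  Prog.seq (fill g.B [112, 110, 111] [(112, g.K), (110, g.p), (111, g.q)] FX.zero) <|
  Prog.seq (g.pushOthers S n) <|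
  Prog.seq (fill 11 ([] ++ [110, 111]) [(110, g.p), (111, g.q)] (FX.cell S [100, 110, 111])) <|
  Prog.seq g.residual (fill D ([100] ++ [110, 111]) [(110, g.p), (111, g.q)]
      (FX.bin FOp.div (FX.conj (FX.cell 12 [110, 111])) g.norm))

/-- Write to the array `D` the functionals dual to the rows of the array `S`. -/
def GS.dual (g : GS) (S D n : ℕ) : Prog := Prog.loop 100 n (g.dualRow S D n)

lemma span_others {E : Type*} [AddCommGroup E] [Module 𝕜 E] (x : ℕ → E) (k : ℕ) :
    span 𝕜 (⋃ i < N, {if i = k then 0 else x i}) =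
      span 𝕜 ((fun i : Fin N => x i) '' {i | (i : ℕ) ≠ k}) := by
  apply le_antisymm
  · rw [span_le]
    intro y hy
    simp only [mem_iUnion, Set.mem_singleton_iff, exists_prop] at hy
    obtain ⟨i, hi, rfl⟩ := hy
    split_ifs with hik
    · exact Submodule.zero_mem _
    exact subset_span ⟨⟨i, hi⟩, hik, rfl⟩
  rw [span_le]
  rintro _ ⟨i, hi, rfl⟩
  refine subset_span ?_
  simp only [mem_iUnion, Set.mem_singleton_iff, exists_prop]
  exact ⟨i, i.2, by rw [if_neg hi]⟩

/-- The conditions on the registers and arrays in the computation of dual functionals. -/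
structure GS.DualValid (g : GS) (S D n : ℕ) (R V : ℕ → Bool) : Prop where
  valid : g.Valid
  S_ne : S ≠ 11 ∧ S ≠ 12 ∧ S ≠ g.B ∧ S ≠ D
  D_ne : D ≠ 11 ∧ D ≠ 12 ∧ D ≠ g.B
  n_lt : n < 100
  n_ne : n ≠ g.cnt
  R_bounds : R g.p = true ∧ R g.q = true ∧ R g.K = true ∧ R n = true
  R_free : R 100 = false ∧ R 101 = false ∧ R 110 = false ∧ R 111 = false
  V_S : V S = true
  keeps : (g.pushOthers S n).keeps (fun i => i == 100 || R i) (fun A => A == D || V A) = true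
  cnt : R g.cnt = false
  free : V g.B = false ∧ V 11 = false ∧ V 12 = false ∧ V D = false

lemma Prog.noNat_fill (A : ℕ) (idx : List ℕ) (bs : List (ℕ × ℕ)) (e : FX) :
    (fill A idx bs e).noNat = true := by
  induction bs with
  | nil => rfl
  | cons b bs ih => exact ih

lemma GS.noNat_push (g : GS) (e : FX) : (g.push e).noNat = true := by
  simp [GS.push, GS.append, GS.residual, Prog.noNat, Prog.noNat_fill]

lemma GS.dual_run {S D n : ℕ} (hg : g.DualValid S D n R V) (ha : st.reg g.p = a)
    (hb : st.reg g.q = b) (hK : a * b ≤ st.reg g.K) (hN : st.reg n = N)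
    (hx : LinearIndependent 𝕜 fun i : Fin N => (matAt (st.farr S) [(i : ℕ)] : Fin a × Fin b → 𝕜)) :
    IsDualTo (fun i : Fin N => (matAt (st.farr S) [(i : ℕ)] : Fin a × Fin b → 𝕜))
      (fun i : Fin N => matAt (((g.dual S D n).run st).farr D) [(i : ℕ)]) := by
  obtain ⟨hv, ⟨hS11, hS12, hSB, hSD⟩, ⟨hD11, hD12, hDB⟩, hn, hnc, ⟨hRp, hRq, hRK, hRn⟩,
    ⟨hR100, hR101, hR110, hR111⟩, hVS, hkeep, hRc, hVB, hV11, hV12, hVD⟩ := hg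
  obtain ⟨⟨hB, hB'⟩, hc, hp, hq, hKl, hcp, hcq, hcK⟩ := id hv
  set x : ℕ → Fin a × Fin b → 𝕜 := fun i => matAt (st.farr S) [i] with hxdef
  have hcard : card (Fin a × Fin b) ≤ st.reg g.K := by simpa using hK
  have hne : ∀ (r i : ℕ), r < 100 → 100 ≤ i → i ≠ r := by omega
  have key := run_loop_induct (i := 100) (n := n) (p := g.dualRow S D n) (st := st)
    (Inv := fun k s => Agree R V st s ∧ ∀ j < k, ∃ (bb : ℕ → Fin a × Fin b → 𝕜) (cc : ℕ),
      OrthoRows (st.reg g.K) bb cc (span 𝕜 ((fun i : Fin N => x i) '' {i | (i : ℕ) ≠ j})) ∧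
      ∀ i, matAt (s.farr D) [j] i = (starRingEnd 𝕜) (gsRes (st.reg g.K) bb (x j) i) /
        hdot (gsRes (st.reg g.K) bb (x j)) (gsRes (st.reg g.K) bb (x j)))
    (fun k s j h => ⟨h.1.putReg_of_not hR100 j, h.2⟩)
    ⟨Agree.refl R V st, fun j hj => absurd hj (Nat.not_lt_zero j)⟩
    (by
      intro k s hk ⟨hag, hs⟩ hsk
      set s1 := s.putReg g.cnt 0 with hs1
      obtain ⟨m2, hr2, hm2⟩ := fill_run3 (A := g.B) (e := FX.zero) (a := 112) (i := 110) (j := 111)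
        (l := g.K) (n := g.p) (k := g.q) rfl (by omega) (by omega) (by omega) (by omega)
        (by omega) (by omega) s1
      set s2 := s1.setArr g.B m2 with hs2
      have hag2 : Agree R V st s2 := by
        refine ⟨fun i hi => ?_, hag.narr, fun A hA => ?_⟩
        · rw [hs2, setArr_reg, hs1, reg_put, if_neg, hag.reg i hi]
          rintro rfl
          rw [hRc] at hi
          cases hi
        rw [hs2, setArr_farr, if_neg, hs1, putReg_farr, hag.farr A hA]
        rintro rfl
        rw [hVB] at hA
        cases hA
      have hp2 : s2.reg g.p = a := by rw [← hag2.reg _ hRp, ha]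
      have hq2 : s2.reg g.q = b := by rw [← hag2.reg _ hRq, hb]
      have hK2 : s2.reg g.K = st.reg g.K := by rw [← hag2.reg _ hRK]
      have hn2 : s2.reg n = N := by rw [← hag2.reg _ hRn, hN]
      have hc2 : s2.reg g.cnt = 0 := by rw [hs2, setArr_reg, hs1, reg_put, if_pos rfl]
      have h1002 : s2.reg 100 = k := by
        rw [hs2, setArr_reg, hs1, reg_put, if_neg (hne _ _ hc le_rfl), hsk]
      have hO2 : g.Ortho s2 (⊥ : Submodule 𝕜 (Fin a × Fin b → 𝕜)) := by
        rw [GS.Ortho, hc2]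
        refine orthoRows_bot fun j hj => ?_
        funext i
        rw [hs2, setArr_farr, if_pos rfl]
        refine hm2 j hj i.1 ?_ i.2 ?_
        · rw [show s1.reg g.p = s2.reg g.p from rfl, hp2]
          exact i.1.2
        rw [show s1.reg g.q = s2.reg g.q from rfl, hq2]
        exact i.2.2
      set R' : ℕ → Bool := fun i => i == 100 || R i with hR'
      set V' : ℕ → Bool := fun A => A == D || V A with hV'
      set s3 := (g.pushOthers S n).run s2 with hs3
      have hag3 : Agree R' V' s2 s3 := (g.pushOthers S n).agree_run hkeep (g.noNat_push _) s2
      have hO3 : g.Ortho s3 (span 𝕜 ((fun i : Fin N => x i) '' {i | (i : ℕ) ≠ k})) := by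
        have h1 := GS.adds_loop (g := g) (R := R') (V := V') (i := 101) (n := n)
          (p := g.push (FX.ite NRel.eq (NX.reg 101) (NX.reg 100) FX.zero
            (FX.cell S [101, 110, 111]))) (st := s2) (a := a) (b := b)
          (S := fun i => {if i = k then 0 else x i}) hkeep (g.noNat_push _)
          (by simp [hR', hR101]) (by simp [hR', hRn]) (hne _ _ hKl (by omega))
          (hne _ _ hc (by omega)) (by
            intro i hi
            have h2 := GS.adds_push hv (R := fun j => j == 101 || R' j) (V := V')
              (e := FX.ite NRel.eq (NX.reg 101) (NX.reg 100) FX.zero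
                (FX.cell S [101, 110, 111])) (st := s2.putReg 101 i) (a := a) (b := b)
              (by simp [FX.avoids, hS11]) (by simp [FX.Scoped, NX.Scoped, hR', hV', hVS])
              (by simp [hR', hRp, hRq, hRK])
              (by rw [reg_put, if_neg (hne _ _ hp (by omega)).symm, hp2])
              (by rw [reg_put, if_neg (hne _ _ hq (by omega)).symm, hq2])
              (by rw [reg_put, if_neg (hne _ _ hKl (by omega)).symm, hK2]; exact hK)
            convert h2 using 2
            funext c
            simp only [FX.val, NX.val, reg_put, putReg_farr, map_cons, map_nil]
            norm_num
            simp only [h1002, ← hag2.farr S hVS, NRel.holds_eq]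
            split_ifs <;> rfl)
        have h3 := h1 s2 (Agree.refl _ _ _) ⊥ hO2
        rw [bot_sup_eq, hn2, span_others x k] at h3
        exact h3
      have hp3 : s3.reg g.p = a := by rw [← hag3.reg _ (by simp [hR', hRp]), hp2]
      have hq3 : s3.reg g.q = b := by rw [← hag3.reg _ (by simp [hR', hRq]), hq2]
      have hK3 : s3.reg g.K = st.reg g.K := by rw [← hag3.reg _ (by simp [hR', hRK]), hK2]
      have h1003 : s3.reg 100 = k := by rw [← hag3.reg 100 (by simp [hR']), h1002]
      obtain ⟨m4, hr4, hm4, -⟩ := fill_run2 (A := 11) (pre := []) (i := 110) (j := 111)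
        (n := g.p) (k := g.q) (e := FX.cell S [100, 110, 111]) (by simp [FX.avoids, hS11])
        (by omega) (by omega) (by omega) (by omega) (by omega) (by simp) (by simp) s3
      obtain ⟨m₅, hr₅, hm₅⟩ := GS.residual_run hv (st := s3.setArr 11 m4) hp3 hq3
      have hX : (matAt ((s3.setArr 11 m4).farr 11) [] : Fin a × Fin b → 𝕜) = x k := by
        funext i
        rw [setArr_farr, if_pos rfl, matAt]
        have h := hm4 i.1 (by omega) i.2 (by omega)
        rw [map_nil] at h
        rw [h]
        simp only [FX.val, reg_put, putReg_farr, map_cons, map_nil]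
        norm_num
        rw [h1003, ← hag3.farr S (by simp [hV', hVS]), ← hag2.farr S hVS]
        rfl
      rw [hX, setArr_reg, hK3, setArr_farr, if_neg hB] at hm₅
      obtain ⟨m₆, hr₆, hm₆, hm₆'⟩ := fill_run2 (A := D) (pre := [100]) (i := 110) (j := 111)
        (n := g.p) (k := g.q) (e := FX.bin FOp.div (FX.conj (FX.cell 12 [110, 111])) g.norm)
        (by simp [FX.avoids, GS.norm, FX.dot, FX.sum2, Ne.symm hD12])
        (by omega) (by omega) (by omega) (by omega) (by omega) (by simp) (by simp)
        ((s3.setArr 11 m4).setArr 12 m₅)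
      have hrun : (g.dualRow S D n).run s = ((s3.setArr 11 m4).setArr 12 m₅).setArr D m₆ := by
        simp only [GS.dualRow, Prog.run, NX.val]
        rw [hr2, ← hs3, hr4, hr₅, hr₆]
      rw [hrun]
      refine ⟨?_, ?_⟩
      · have h3 : Agree R V st s3 := hag2.trans (hag3.mono (fun i hi => by simp [hR', hi])
          fun A hA => by simp [hV', hA])
        refine ⟨h3.reg, h3.narr, fun A hA => ?_⟩
        rw [setArr_farr, if_neg, setArr_farr, if_neg, setArr_farr, if_neg, h3.farr A hA]
        all_goals
          rintro rfl
          simp [hV11, hV12, hVD] at hA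
      intro j hj
      rcases Nat.lt_succ_iff_lt_or_eq.1 hj with hj | rfl
      · obtain ⟨bb, cc, hO, hval⟩ := hs j hj
        refine ⟨bb, cc, hO, fun i => ?_⟩
        rw [← hval i, setArr_farr, if_pos rfl, matAt, hm₆', setArr_farr, if_neg hD12, setArr_farr,
          if_neg hD11, ← hag3.farr D (by simp [hV']), hs2, setArr_farr, if_neg hDB]
        · rfl
        intro y _ z _ heq
        simp only [setArr_reg, map_cons, map_nil, h1003, List.cons_append,
          List.nil_append, List.cons.injEq] at heq
        omega
      refine ⟨fun k => matAt (s3.farr g.B) [k], s3.reg g.cnt, ?_, fun i => ?_⟩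
      · rw [← hK3]
        exact hO3
      rw [← hm₅, setArr_farr, if_pos rfl, matAt]
      have h := hm₆ i.1 (by simp only [setArr_reg]; omega) i.2 (by simp only [setArr_reg]; omega)
      simp only [setArr_reg, map_cons, map_nil, h1003] at h
      rw [h]
      simp only [FX.val, FOp.fn]
      rw [GS.val_norm hv (a := a) (b := b)
        (by rw [reg_put, if_neg (hne _ _ hp (by omega)).symm, reg_put,
          if_neg (hne _ _ hp (by omega)).symm]; exact hp3)
        (by rw [reg_put, if_neg (hne _ _ hq (by omega)).symm, reg_put,
          if_neg (hne _ _ hq (by omega)).symm]; exact hq3)]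
      simp [putReg_farr, setArr_farr, reg_put, matAt])
  rw [hN] at key
  choose bb cc hO hval using fun j : Fin N => key.2 j j.2
  refine isDualTo_of_gsRes hx hcard (b := bb) (c := cc) (fun j => ?_) fun j i => hval j i
  convert hO j using 3
  ext i
  simp [Fin.ext_iff]

/-! ### The program

Integer registers: 4 and 5 hold `n1`, `n2`; 6 their product `N`; 7 the degree `d = r + 1`; 8 and 9
hold `n1 ^ d` and `n2 ^ d`, and 10 their product; 14 and 15 the dimensions `ℓ` of `U` and `s` of the
lifted space. A `d`-tuple of pairs is coded by two numbers, whose digits are in the integer arrays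
10 and 11. Field arrays: 10 an orthogonal basis of `U`; 13 an orthogonal basis of the orthogonal
complement of the lifted space; 14 an orthogonal basis `P` of the lifted space; 15 and 16 the
combinations of the `P i` with coefficients `f` and `g`; 17 and 18 their contractions with the basis
of `U`; 19 functionals dual to the rows of array 18; 21 the matrix for the oracle, and 22 its
eigenvectors; 3, 24, 26 the candidates for `x`, the functionals dual to them, and `z`. -/

namespace Program

def gsU : GS := ⟨10, 30, 4, 5, 6⟩
def gsW : GS := ⟨13, 33, 8, 9, 10⟩
def gsP : GS := ⟨14, 34, 8, 9, 10⟩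
def gsG : GS := ⟨20, 35, 8, 9, 10⟩
def gsX : GS := ⟨25, 37, 4, 5, 6⟩

/-- The indicator of an equality of two integers. -/
def eqInd (a b : NX) : FX := FX.ite NRel.eq a b FX.one FX.zero

/-- The squared norm of a row of an array, in register 112. -/
def rowNorm (g : GS) : FX :=
  FX.dot g.p g.q (FX.cell g.B [112, 113, 114]) (FX.cell g.B [112, 113, 114])

/-- An expression in the `d` pairs of indices of the tuple coded by the registers `m`, `m'`:
a product of entries of array `A`, with further index `a`. -/
def powCell (A a m m' : ℕ) : FX :=
  FX.big BigOp.prod 115 7 (FX.bind 116 (NX.cell 10 [m, 115]) (FX.bind 117 (NX.cell 11 [m', 115])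
    (FX.cell A [a, 116, 117])))

def sizeN : Prog := Prog.setReg 31 (NX.sum 100 4 (NX.reg 5))

def slices : Prog := Prog.loop 100 2 (gsU.push (FX.cell 0 [110, 111, 100]))

def powers : Prog := Prog.seq (Prog.setReg 31 (NX.lit 1)) <| Prog.seq (Prog.setReg 32 (NX.lit 1)) <|
  Prog.loop 100 7 (Prog.seq (Prog.setReg 31 (NX.sum 101 4 (NX.reg 31)))
    (Prog.setReg 32 (NX.sum 101 5 (NX.reg 32))))

def sizeD : Prog := Prog.setReg 31 (NX.sum 100 8 (NX.reg 9))

/-- The quotient of register 40 by the size in register `n`; it is less than the bound in register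
`b`. -/
def quot (n b : ℕ) : NX := NX.sum 102 b (NX.ite NRel.lt (NX.reg 40)
    (NX.sum 103 n (NX.bin NOp.add (NX.reg 102) (NX.lit 1))) (NX.lit 0) (NX.lit 1))

/-- Tables of digits: the entry `[m, k]` of the integer array `A` is the digit of `m` at `k`. -/
def digits (A n b : ℕ) : Prog :=
  Prog.loop 100 b (Prog.seq (Prog.setReg 40 (NX.reg 100)) (Prog.loop 101 7
    (Prog.seq (Prog.setReg 41 (quot n b))
    (Prog.seq (Prog.setNat A [100, 101] (NX.bin NOp.sub (NX.reg 40) (NX.sum 103 n (NX.reg 41))))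
      (Prog.setReg 40 (NX.reg 41))))))

/-- The indicator that the tuples in the registers 110, 111 and 100, 101 are equal. -/
def eqTuple : FX :=
  FX.ite NRel.eq (NX.reg 110) (NX.reg 100) (eqInd (NX.reg 111) (NX.reg 101)) FX.zero

/-- The indicator that the tuple in the registers 110, 111 arises from the one in 100, 101 by a
swap of the positions in 102 and 103. -/
def swapTuple : FX :=
  FX.big BigOp.prod 115 7 (FX.bind 116 (NX.ite NRel.eq (NX.reg 115) (NX.reg 102) (NX.reg 103)
      (NX.ite NRel.eq (NX.reg 115) (NX.reg 103) (NX.reg 102) (NX.reg 115)))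
    (FX.bin FOp.mul (eqInd (NX.cell 10 [110, 115]) (NX.cell 10 [100, 116]))
      (eqInd (NX.cell 11 [111, 115]) (NX.cell 11 [101, 116]))))

def symmGens : Prog := Prog.loop 100 8 (Prog.loop 101 9 (Prog.loop 102 7 (Prog.loop 103 7
    (gsW.push (FX.bin FOp.sub eqTuple swapTuple)))))

/-- The conjugate of an entry of the `d`-th power of the orthogonal projection to `U`. -/
def projTuple : FX :=
  FX.big BigOp.prod 115 7 (FX.bind 116 (NX.cell 10 [100, 115]) (FX.bind 117 (NX.cell 11 [101, 115])
    (FX.bind 118 (NX.cell 10 [110, 115]) (FX.bind 119 (NX.cell 11 [111, 115])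
      (FX.big BigOp.sum 112 14 (FX.bin FOp.div (FX.bin FOp.mul (FX.conj (FX.cell 10 [112, 116, 117]))
        (FX.cell 10 [112, 118, 119])) (rowNorm gsU)))))))

def powGens : Prog :=
  Prog.loop 100 8 (Prog.loop 101 9 (gsW.push (FX.bin FOp.sub eqTuple projTuple)))

/-- The product of the signs of the differences of the digits. -/
def signProd (A m : ℕ) : FX :=
  FX.big BigOp.prod 115 7 (FX.big BigOp.prod 116 7 (FX.ite NRel.lt (NX.reg 115) (NX.reg 116)
    (FX.ite NRel.lt (NX.cell A [m, 115]) (NX.cell A [m, 116]) FX.one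
      (FX.ite NRel.eq (NX.cell A [m, 115]) (NX.cell A [m, 116]) FX.zero
        (FX.bin FOp.sub FX.zero FX.one))) FX.one))

/-- The number of ways to find the digits of one number among those of another one. -/
def matchProd (A m x : ℕ) : FX := FX.big BigOp.prod 115 7 (FX.big BigOp.sum 116 7
    (eqInd (NX.cell A [x, 115]) (NX.cell A [m, 116])))

def signArray (A m x : ℕ) : FX :=
  FX.bin FOp.mul (FX.bin FOp.mul (signProd A m) (signProd A x)) (matchProd A m x)

def minorGens : Prog :=
  Prog.loop 100 8 (Prog.loop 101 9 (gsW.push (FX.bin FOp.mul (signArray 10 100 110)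
    (signArray 11 101 111))))

def liftGens : Prog :=
  Prog.loop 100 8 (Prog.loop 101 9 (gsP.push (FX.bin FOp.sub eqTuple (FX.big BigOp.sum 112 10
    (FX.bin FOp.mul (FX.bin FOp.div (FX.conj (FX.cell 13 [112, 100, 101])) (rowNorm gsW))
      (FX.cell 13 [112, 110, 111]))))))

def lift : Prog := Prog.seq (digits 10 4 8) <| Prog.seq (digits 11 5 9) <| Prog.seq symmGens <|
  Prog.seq powGens <| Prog.seq minorGens liftGens

/-- A combination of the rows of array 14. -/
def combine (A f : ℕ) : Prog :=
  fill A ([] ++ [110, 111]) [(110, 8), (111, 9)] (FX.big BigOp.sum 112 15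
    (FX.bin FOp.mul (FX.cell f [112]) (FX.cell 14 [112, 110, 111])))

/-- Contract the first slot with the basis of `U`; the result does not depend on the first index of
a tuple. -/
def contract (A F : ℕ) : Prog :=
  fill A [102, 110, 111] [(102, 14), (110, 8), (111, 9)] (FX.sum2 103 8 104 9
    (FX.bin FOp.mul (FX.big BigOp.prod 115 7 (FX.ite NRel.eq (NX.reg 115) (NX.lit 0)
      (FX.bind 116 (NX.cell 10 [103, 115]) (FX.bind 117 (NX.cell 11 [104, 115])
        (FX.conj (FX.cell 10 [102, 116, 117]))))
      (FX.bin FOp.mul (eqInd (NX.cell 10 [103, 115]) (NX.cell 10 [110, 115]))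
        (eqInd (NX.cell 11 [104, 115]) (NX.cell 11 [111, 115])))))
      (FX.cell F [103, 104])))

def oracleMatrix : Prog := fill 21 ([] ++ [102, 103]) [(102, 14), (103, 14)] (FX.sum2 113 8 114 9
    (FX.bin FOp.mul (FX.cell 17 [102, 113, 114]) (FX.cell 19 [103, 113, 114])))

def prepare : Prog :=
  Prog.seq (combine 15 1) <| Prog.seq (combine 16 2) <| Prog.seq (contract 17 15) <|
  Prog.seq (contract 18 16) <| Prog.seq (gsG.dual 18 19 14) oracleMatrix

def candidates : Prog :=
  fill 3 [102, 110, 111] [(102, 14), (110, 4), (111, 5)] (FX.big BigOp.sum 112 14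
    (FX.bin FOp.mul (FX.bin FOp.div (FX.cell 22 [112, 102]) (rowNorm gsU))
      (FX.cell 10 [112, 110, 111])))

def coefficients : Prog := fill 26 ([] ++ [102, 103]) [(102, 14), (103, 15)] (FX.sum2 113 8 114 9
    (FX.bin FOp.mul (FX.cell 14 [103, 113, 114]) (powCell 24 102 113 114)))

/-- The squared absolute value. -/
def sq (e : FX) : FX := FX.bin FOp.mul (FX.conj e) e

/-- Vanishes if array 24 is dual to array 3. -/
def dualError : FX := FX.big BigOp.sum 102 14 (FX.big BigOp.sum 103 14 (sq (FX.bin FOp.sub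
    (FX.sum2 113 4 114 5 (FX.bin FOp.mul (FX.cell 24 [102, 113, 114]) (FX.cell 3 [103, 113, 114])))
    (eqInd (NX.reg 102) (NX.reg 103)))))

/-- Vanishes if the basis of the lifted space consists of combinations of the powers of the
candidates. -/
def powError : FX :=
  FX.big BigOp.sum 103 15 (FX.sum2 110 8 111 9 (sq (FX.bin FOp.sub (FX.cell 14 [103, 110, 111])
    (FX.big BigOp.sum 102 14 (FX.bin FOp.mul (FX.cell 26 [102, 103]) (powCell 3 102 110 111))))))

/-- The pairing of an array with the row of array 26 in the register `a`. -/
def pairing (f a : ℕ) : FX :=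
  FX.big BigOp.sum 104 15 (FX.bin FOp.mul (FX.cell f [104]) (FX.cell 26 [a, 104]))

/-- Does not vanish if the pairings of the rows of array 26 with the two random vectors are
nonzero and have distinct ratios. -/
def genericity : FX :=
  FX.big BigOp.prod 102 14 (FX.bin FOp.mul (FX.bin FOp.mul (pairing 1 102) (pairing 2 102))
    (FX.big BigOp.prod 103 14 (FX.ite NRel.eq (NX.reg 102) (NX.reg 103) FX.one
      (FX.bin FOp.sub (FX.bin FOp.mul (pairing 1 102) (pairing 2 103))
        (FX.bin FOp.mul (pairing 1 103) (pairing 2 102))))))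

def verify : Prog := Prog.ifZero (FX.ite NRel.eq (NX.reg 15) (NX.reg 14)
      (FX.iteZero dualError (FX.iteZero powError (FX.iteZero genericity FX.one FX.zero) FX.one)
        FX.one) FX.one)
    (Prog.setReg 38 (NX.lit 1)) (Prog.setReg 38 (NX.lit 0))

def recover : Prog :=
  Prog.seq candidates <| Prog.seq (gsX.dual 3 24 14) <| Prog.seq coefficients verify

def output : Prog := Prog.seq (fill 4 [102, 100] [(100, 2), (102, 14)] (FX.sum2 113 4 114 5
    (FX.bin FOp.mul (FX.cell 24 [102, 113, 114]) (FX.cell 0 [113, 114, 100])))) <|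
  Prog.seq (Prog.setReg 0 (NX.reg 38)) (Prog.setReg 1 (NX.reg 14))

/-- Copy a register. -/
def copy (i j : ℕ) : Cmd := Cmd.setReg i (NExp.reg j)

def clear (i : ℕ) : Cmd := Cmd.setReg i (NExp.lit 0)

end Program

open Program in
/-- The program. -/
def program : Cmd := Cmd.seq (copy 4 0) <| Cmd.seq (copy 5 1) <|
  Cmd.seq sizeN.comp <| Cmd.seq (copy 6 31) <|
  Cmd.seq slices.comp <|
  Cmd.seq (copy 14 30) <| Cmd.seq (Cmd.setReg 7 (NExp.add (NExp.reg 3) (NExp.lit 1))) <|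
  Cmd.seq powers.comp <| Cmd.seq (copy 8 31) <| Cmd.seq (copy 9 32) <|
  Cmd.seq sizeD.comp <| Cmd.seq (copy 10 31) <|
  Cmd.seq lift.comp <| Cmd.seq (copy 15 34) <|
  Cmd.seq prepare.comp <| Cmd.seq (Cmd.diag 21 22 23 14 36) <|
  Cmd.seq recover.comp <|
  Cmd.seq (clear 7) <| Cmd.seq (clear 8) <| Cmd.seq (clear 9) <| Cmd.seq (clear 10) <|
  Cmd.seq (clear 15) output.comp

namespace Program

/-- The arrays other than the ones that hold the random vectors. -/
def nonrandom (A : ℕ) : Bool := decide (A < 100) && !(A == 1) && !(A == 2)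

lemma scoped_sizeN : sizeN.Scoped visible nonrandom = true := by rfl
lemma scoped_slices : slices.Scoped visible nonrandom = true := by rfl
lemma scoped_powers : powers.Scoped visible nonrandom = true := by rfl
lemma scoped_sizeD : sizeD.Scoped visible nonrandom = true := by rfl
lemma scoped_lift : lift.Scoped visible nonrandom = true := by rfl
lemma scoped_prepare : prepare.Scoped visible visible = true := by rfl
lemma scoped_recover : recover.Scoped visible visible = true := by rfl
lemma scoped_output : output.Scoped visible visible = true := by rfl

end Program

namespace Program

/-- Registers below `b`. -/
def below (b i : ℕ) : Bool := decide (i < b)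

lemma run_sizeN (st : MState 𝕜) : sizeN.run st = st.putReg 31 (st.reg 4 * st.reg 5) := by
  simp [sizeN, Prog.run, NX.val, reg_put]

lemma run_sizeD (st : MState 𝕜) : sizeD.run st = st.putReg 31 (st.reg 8 * st.reg 9) := by
  simp [sizeD, Prog.run, NX.val, reg_put]

lemma run_powers (st : MState 𝕜) :
    (powers.run st).reg 31 = st.reg 4 ^ st.reg 7 ∧ (powers.run st).reg 32 = st.reg 5 ^ st.reg 7 := by
  have h := run_loop_induct (i := 100) (n := 7)
    (p := Prog.seq (Prog.setReg 31 (NX.sum 101 4 (NX.reg 31)))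
      (Prog.setReg 32 (NX.sum 101 5 (NX.reg 32))))
    (st := (st.putReg 31 1).putReg 32 1)
    (Inv := fun k s => s.reg 4 = st.reg 4 ∧ s.reg 5 = st.reg 5 ∧ s.reg 31 = st.reg 4 ^ k ∧
      s.reg 32 = st.reg 5 ^ k)
    (fun k s j h => by simpa [reg_put] using h) (by simp [reg_put])
    (by
      intro k s _ ⟨h4, h5, h31, h32⟩ _
      simp [Prog.run, NX.val, reg_put, h4, h5, h31, h32, pow_succ']
      )
  have h7 : ((st.putReg 31 1).putReg 32 1).reg 7 = st.reg 7 := by simp [reg_put]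
  rw [h7] at h
  exact h.2.2

lemma sum_eq_div {β B : ℕ} (hβ : 0 < β) (hq : q < B) :
    ∑ c ∈ Finset.range B, (if q < β * (c + 1) then 0 else 1) = q / β := by
  have : ∀ c, (if q < β * (c + 1) then 0 else 1) = if c < q / β then 1 else 0 := by
    intro c
    have h : c < q / β ↔ ¬ q < β * (c + 1) := by
      rw [not_lt, ← Nat.succ_le_iff, Nat.le_div_iff_mul_le hβ, mul_comm]
    by_cases hc : c < q / β
    · rw [if_pos hc, if_neg (h.1 hc)]
    rw [if_neg hc, if_pos (not_not.1 fun h' => hc (h.2 h'))]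
  simp only [this]
  rw [← Finset.sum_filter, sum_const, smul_eq_mul, mul_one]
  have hle : q / β ≤ B := (Nat.div_le_self q β).trans hq.le
  have : (Finset.range B).filter (fun c => c < q / β) = Finset.range (q / β) := by
    ext c
    simp only [Finset.mem_filter, Finset.mem_range]
    omega
  rw [this, Finset.card_range]

/-- What the computation of the digits preserves. -/
def DigitFrame (A : ℕ) (st s : MState 𝕜) : Prop :=
  (∀ i < 40, s.reg i = st.reg i) ∧ s.farr = st.farr ∧ ∀ B ≠ A, s.narr B = st.narr B

lemma run_digits {A n : ℕ} (hn : n < 30) (hb : b < 30) {β : ℕ} (hβ : 0 < β)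
    (hnβ : st.reg n = β) (hd : st.reg 7 = d) (hbβ : st.reg b = β ^ d) :
    DigitFrame A st ((digits A n b).run st) ∧
      ∀ m < β ^ d, ∀ k < d, ((digits A n b).run st).narr A [m, k] = m / β ^ k % β := by
  have houter := run_loop_induct (i := 100) (n := b)
    (p := Prog.seq (Prog.setReg 40 (NX.reg 100)) (Prog.loop 101 7
    (Prog.seq (Prog.setReg 41 (quot n b))
    (Prog.seq (Prog.setNat A [100, 101] (NX.bin NOp.sub (NX.reg 40) (NX.sum 103 n (NX.reg 41))))
      (Prog.setReg 40 (NX.reg 41)))))) (st := st)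
    (Inv := fun m s => DigitFrame A st s ∧ ∀ m' < m, ∀ k < d, s.narr A [m', k] = m' / β ^ k % β)
    (fun m s j ⟨⟨h1, h2, h3⟩, h4⟩ => ⟨⟨fun i hi => by
      rw [reg_put, if_neg (by omega), h1 i hi], h2, h3⟩, h4⟩)
    ⟨⟨fun _ _ => rfl, rfl, fun _ _ => rfl⟩, fun m hm => absurd hm (Nat.not_lt_zero m)⟩
    (by
      intro m s hm ⟨⟨h1, h2, h3⟩, h4⟩ hsm
      rw [hbβ] at hm
      simp only [Prog.run]
      have hinner := run_loop_induct (i := 101) (n := 7) (p := Prog.seq (Prog.setReg 41 (quot n b))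
          (Prog.seq (Prog.setNat A [100, 101]
            (NX.bin NOp.sub (NX.reg 40) (NX.sum 103 n (NX.reg 41))))
          (Prog.setReg 40 (NX.reg 41)))) (st := s.putReg 40 (s.reg 100))
        (Inv := fun j s => DigitFrame A st s ∧ (∀ m' < m, ∀ k < d, s.narr A [m', k] =
          m' / β ^ k % β) ∧ (∀ k < j, s.narr A [m, k] = m / β ^ k % β) ∧ s.reg 100 = m ∧
          s.reg 40 = m / β ^ j)
        (fun m s j ⟨⟨h1, h2, h3⟩, h4, h5, h6, h7⟩ => ⟨⟨fun i hi => by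
          rw [reg_put, if_neg (by omega), h1 i hi], h2, h3⟩, h4, h5,
          by rw [reg_put, if_neg (by omega), h6], by rw [reg_put, if_neg (by omega), h7]⟩)
        ⟨⟨fun i hi => by rw [reg_put, if_neg (by omega), h1 i hi], h2, h3⟩, h4,
          fun k hk => absurd hk (Nat.not_lt_zero k), by rw [reg_put, if_neg (by omega), hsm],
          by rw [reg_put, if_pos rfl, hsm, pow_zero, Nat.div_one]⟩
        (by
          intro j s' hj ⟨⟨h1, h2, h3⟩, h4, h5, h6, h7⟩ hsj
          have hn' : s'.reg n = β := by rw [h1 n (by omega), hnβ]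
          have hb' : s'.reg b = β ^ d := by rw [h1 b (by omega), hbβ]
          have hquot : (quot n b).val s' = m / β ^ j / β := by
            rw [← sum_eq_div hβ (B := β ^ d) ((Nat.div_le_self m (β ^ j)).trans_lt hm)]
            simp only [quot, NX.val, reg_put, NRel.holds_lt, h7, hb', NOp.fn]
            refine sum_congr rfl fun c _ => ?_
            have h102 : n ≠ 102 := by omega
            simp [h102, hn']
          simp only [Prog.run, NX.val, hquot, map_cons, map_nil, NOp.fn]
          have h41 : n ≠ 41 := by omega
          have hval : m / β ^ j - β * (m / β ^ j / β) = m / β ^ j % β := by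
            have := Nat.div_add_mod (m / β ^ j) β
            omega
          have hA : ∀ s'' : MState 𝕜, s'' = ((s'.putReg 41 (m / β ^ j / β)).putNat A [m, j]
              (m / β ^ j % β)).putReg 40 (m / β ^ j / β) → (∀ i, s''.reg i = if i = 40 then
                m / β ^ j / β else if i = 41 then m / β ^ j / β else s'.reg i) ∧
                s''.farr = s'.farr ∧ s''.narr = update s'.narr A
                  (update (s'.narr A) [m, j] (m / β ^ j % β)) := by
            rintro _ rfl
            refine ⟨fun i => ?_, rfl, rfl⟩
            rw [reg_put]
            split_ifs with hi
            · rfl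
            all_goals
              change ((s'.putReg 41 _).reg i) = _
              rw [reg_put]
              simp [*]
          have h101 : (s'.putReg 41 (m / β ^ j / β)).reg 100 = m := by
            rw [reg_put, if_neg (by omega), h6]
          have h102 : (s'.putReg 41 (m / β ^ j / β)).reg 101 = j := by
            rw [reg_put, if_neg (by omega), hsj]
          have h103 : (s'.putReg 41 (m / β ^ j / β)).reg 40 = m / β ^ j := by
            rw [reg_put, if_neg (by omega), h7]
          have h104 : (s'.putReg 41 (m / β ^ j / β)).reg n = β := by
            rw [reg_put, if_neg h41, hn']
          have h105 : (((s'.putReg 41 (m / β ^ j / β)).putNat A [m, j]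
              (m / β ^ j % β)).reg 41) = m / β ^ j / β := by
            change (s'.putReg 41 (m / β ^ j / β)).reg 41 = _
            rw [reg_put, if_pos rfl]
          have h106 : ∑ k ∈ Finset.range β,
              ((s'.putReg 41 (m / β ^ j / β)).putReg 103 k).reg 41 = β * (m / β ^ j / β) := by
            simp [reg_put]
          rw [h101, h102, h103, h104, h106, hval, h105]
          obtain ⟨hr, hf, hna⟩ := hA _ rfl
          refine ⟨⟨fun i hi => ?_, hf.trans h2, fun B hB => ?_⟩, ?_, ?_, ?_, ?_⟩
          · rw [hr, if_neg (by omega), if_neg (by omega), h1 i hi]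
          · rw [hna, update_of_ne hB]
            exact h3 B hB
          · intro m' hm' k hk
            rw [hna, update_self, update_of_ne, h4 m' hm' k hk]
            simp
            omega
          · intro k hk
            rcases Nat.lt_succ_iff_lt_or_eq.1 hk with hk | rfl
            · rw [hna, update_self, update_of_ne, h5 k hk]
              simp
              omega
            rw [hna, update_self, update_self]
          · rw [hr, if_neg (by omega), if_neg (by omega), h6]
          rw [hr, if_pos rfl, Nat.div_div_eq_div_mul, pow_succ])
      have h7' : (s.putReg 40 (s.reg 100)).reg 7 = d := by
        rw [reg_put, if_neg (by omega), h1 7 (by omega), hd]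
      rw [h7'] at hinner
      obtain ⟨hf, h4', h5', -, -⟩ := hinner
      refine ⟨hf, fun m' hm' k hk => ?_⟩
      rcases Nat.lt_succ_iff_lt_or_eq.1 hm' with hm' | rfl
      · exact h4' m' hm' k hk
      exact h5' k hk)
  rw [hbβ] at houter
  exact houter

lemma valid_gsU : gsU.Valid := by constructor <;> simp [gsU]
lemma valid_gsW : gsW.Valid := by constructor <;> simp [gsW]
lemma valid_gsP : gsP.Valid := by constructor <;> simp [gsP]

/-- The tensor in array 0. -/
def HoldsTensor {n1 n2 n3 : ℕ} (st : MState 𝕜) (T : TensorSpace 𝕜 n1 n2 n3) : Prop :=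
  ∀ (i : Fin n1 × Fin n2) (k : Fin n3), st.farr 0 [(i.1 : ℕ), (i.2 : ℕ), (k : ℕ)] = T i k

lemma run_slices
    (h2 : st.reg 2 = n3) (h4 : st.reg 4 = n1) (h5 : st.reg 5 = n2) (h6 : st.reg 6 = n1 * n2)
    (h30 : st.reg 30 = 0) (h10 : st.farr 10 = fun _ => 0) (hT : HoldsTensor st T) :
    gsU.Ortho (slices.run st) (sliceSpan T) := by
  have h := GS.adds_loop (g := gsU) (R := below 30) (V := fun A => A == 0) (i := 100) (n := 2)
    (p := gsU.push (FX.cell 0 [110, 111, 100])) (st := st) (a := n1) (b := n2)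
    (S := fun k => {(fun c => st.farr 0 [(c.1 : ℕ), (c.2 : ℕ), k])}) rfl rfl rfl rfl
    (by decide) (by decide) (by
      intro k hk
      have := GS.adds_push valid_gsU (R := fun j => j == 100 || below 30 j)
        (V := fun A => A == 0) (e := FX.cell 0 [110, 111, 100]) (st := st.putReg 100 k)
        (a := n1) (b := n2) rfl rfl ⟨rfl, rfl, rfl⟩ (by simp [gsU, reg_put, h4])
        (by simp [gsU, reg_put, h5]) (by simp [gsU, reg_put, h6])
      simpa [FX.val, reg_put, putReg_farr] using this)
  have h' := h st (Agree.refl _ _ _) ⊥ (by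
    rw [GS.Ortho, show st.reg gsU.cnt = 0 from h30]
    refine orthoRows_bot fun k _ => ?_
    funext c
    rw [show st.farr gsU.B = fun _ => 0 from h10]
    rfl)
  rw [bot_sup_eq] at h'
  have hspan : sliceSpan T = span 𝕜 (⋃ k < st.reg 2,
      {(fun c => st.farr 0 [(c.1 : ℕ), (c.2 : ℕ), k])}) := by
    rw [sliceSpan]
    congr 1
    ext x
    simp only [Set.mem_range, mem_iUnion, Set.mem_singleton_iff, exists_prop, h2]
    constructor
    · rintro ⟨k, rfl⟩
      exact ⟨k, k.2, funext fun c => (hT c k).symm⟩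
    rintro ⟨k, hk, rfl⟩
    exact ⟨⟨k, hk⟩, funext fun c => (hT c ⟨k, hk⟩).symm⟩
  rw [hspan]
  exact h'

end Program

/-! ### Equations for the lifted space -/

/-- The sign of `b - a`. -/
def natSign (𝕜 : Type*) [RCLike 𝕜] (a b : ℕ) : 𝕜 := if a < b then 1 else if a = b then 0 else -1

lemma natSign_antisymm (a b : ℕ) : natSign 𝕜 a b = -natSign 𝕜 b a := by
  unfold natSign
  rcases lt_trichotomy a b with h | h | h
  · rw [if_pos h, if_neg (by omega), if_neg (by omega), neg_neg]
  · subst h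
    simp
  rw [if_neg (by omega), if_neg (by omega), if_pos h]

/-- The product of the signs of the differences of the entries of `s`. -/
def diffSign (𝕜 : Type*) [RCLike 𝕜] {d n : ℕ} (s : Fin d → Fin n) : 𝕜 :=
  ∏ j : Fin d, ∏ k : Fin d, if j < k then natSign 𝕜 (s j) (s k) else 1

lemma diffSign_eq {n : ℕ} (s : Fin d → Fin n) :
    diffSign 𝕜 s = ∏ j : Fin d, ∏ k ∈ Finset.Ioi j, natSign 𝕜 (s j) (s k) := by
  refine prod_congr rfl fun j _ => ?_
  rw [← Finset.prod_filter]
  refine prod_congr ?_ fun _ _ => rfl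
  ext k
  simp

lemma diffSign_comp {n : ℕ} (s : Fin d → Fin n) (σ : Perm (Fin d)) :
    diffSign 𝕜 (s ∘ σ) = ((sign σ : ℤ) : 𝕜) * diffSign 𝕜 s := by
  rw [diffSign_eq, diffSign_eq]
  exact σ.prod_Ioi_comp_eq_sign_mul_prod (f := fun i j => natSign 𝕜 (s i) (s j))
    fun i j => natSign_antisymm _ _

lemma diffSign_mul_self {n : ℕ} {s : Fin d → Fin n} (hs : Injective s) :
    diffSign 𝕜 s * diffSign 𝕜 s = 1 := by
  rw [diffSign, ← prod_mul_distrib]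
  refine Finset.prod_eq_one fun j _ => ?_
  rw [← prod_mul_distrib]
  refine Finset.prod_eq_one fun k _ => ?_
  split_ifs with hjk
  · have hne : (s j : ℕ) ≠ s k := fun h => hjk.ne (hs (Fin.ext h))
    unfold natSign
    rcases lt_or_gt_of_ne hne with h | h
    · simp [h]
    rw [if_neg (by omega), if_neg hne]
    ring
  ring

lemma diffSign_of_not_injective {n : ℕ} {s : Fin d → Fin n} (hs : ¬ Injective s) :
    diffSign 𝕜 s = 0 := by
  have : ∃ j k, s j = s k ∧ j < k := by
    simp only [Injective, not_forall] at hs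
    obtain ⟨j, k, h, hjk⟩ := hs
    rcases lt_or_gt_of_ne hjk with h' | h'
    · exact ⟨j, k, h, h'⟩
    exact ⟨k, j, h.symm, h'⟩
  obtain ⟨j, k, h, hjk⟩ := this
  refine Finset.prod_eq_zero (mem_univ j) (Finset.prod_eq_zero (mem_univ k) ?_)
  rw [if_pos hjk, h, natSign, if_neg (lt_irrefl _), if_pos rfl]

lemma altSign_self {n : ℕ} {s : Fin d → Fin n} (hs : Injective s) : altSign 𝕜 s s = 1 := by
  have : (of fun k l => if s k = s l then (1 : 𝕜) else 0) = 1 := by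
    ext k l
    simp [Matrix.one_apply, hs.eq_iff]
  rw [altSign, this, Matrix.det_one]

lemma diffSign_mul_eq_altSign {n : ℕ} (s x : Fin d → Fin n) :
    diffSign 𝕜 s * diffSign 𝕜 x * ∏ j, ∑ l, (if (x j : ℕ) = s l then (1 : 𝕜) else 0) =
      altSign 𝕜 s x := by
  by_cases hs : Injective s
  swap
  · rw [diffSign_of_not_injective hs, altSign_eq_zero_of_not_injective_left hs, zero_mul, zero_mul]
  by_cases hx : ∀ j, ∃ l, x j = s l
  · choose τ hτ using hx
    obtain rfl : x = s ∘ τ := funext hτ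
    by_cases hτ' : Injective τ
    · obtain ⟨σ, rfl⟩ : ∃ σ : Perm (Fin d), τ = σ :=
        ⟨Equiv.ofBijective τ (Finite.injective_iff_bijective.1 hτ'), rfl⟩
      rw [diffSign_comp, altSign_comp_right, altSign_self hs, Finset.prod_eq_one, mul_one, mul_one,
        mul_left_comm, diffSign_mul_self hs, mul_one]
      intro j _
      rw [sum_eq_single (σ j)]
      · simp
      · intro l _ hl
        rw [if_neg]
        intro h
        exact hl (hs (Fin.ext h)).symm
      simp
    have : ¬ Injective (s ∘ τ) := fun h => hτ' h.of_comp
    rw [diffSign_of_not_injective this, mul_zero, zero_mul]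
    symm
    exact eq_zero_of_not_injective (φ := fun x => altSign 𝕜 s x)
      (fun σ x => altSign_comp_right s x σ) this
  push Not at hx
  obtain ⟨j, hj⟩ := hx
  have h0 : ∏ j, ∑ l, (if (x j : ℕ) = s l then (1 : 𝕜) else 0) = 0 := by
    refine Finset.prod_eq_zero (mem_univ j) (sum_eq_zero fun l _ => if_neg ?_)
    exact fun h => hj l (Fin.ext h)
  rw [h0, mul_zero, altSign]
  symm
  refine Matrix.det_eq_zero_of_row_eq_zero j fun l => ?_
  exact if_neg (hj l)

lemma conj_altSign {n : ℕ} (s x : Fin d → Fin n) :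
    (starRingEnd 𝕜) (altSign 𝕜 s x) = altSign 𝕜 s x := by
  rw [altSign, RingHom.map_det]
  congr 1
  ext k l
  simp only [RingHom.mapMatrix_apply, Matrix.map_apply, of_apply]
  split_ifs <;> simp

section Equations

variable {ι : Type*} [Fintype ι]

lemma IsDualTo.mem_tensorPow_iff {k : ℕ} {x h : Fin k → ι → 𝕜} (hxh : IsDualTo x h)
    {t : (Fin d → ι) → 𝕜} : t ∈ tensorPow (span 𝕜 (range x)) d ↔
      ∀ m : Fin d → ι, t m = ∑ a : Fin d → ι, (∏ j, ∑ i, x i (m j) * h i (a j)) * t a := by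
  have key : ∀ m : Fin d → ι, ∑ a : Fin d → ι, (∏ j, ∑ i, x i (m j) * h i (a j)) * t a =
      (∑ α : Fin d → Fin k, tensorEval (fun j => h (α j)) t • fun a => ∏ j, x (α j) (a j)) m := by
    intro m
    simp only [Finset.sum_apply, Pi.smul_apply, smul_eq_mul, tensorEval_apply, sum_mul,
      ← sum_prod_apply fun j i => x i (m j) * h i (_ : ι), prod_mul_distrib]
    rw [sum_comm]
    refine sum_congr rfl fun α _ => sum_congr rfl fun a _ => ?_
    ring
  constructor
  · intro ht m
    rw [key, ← hxh.eq_sum_of_mem_tensorPow ht]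
  intro ht
  have : t = ∑ α : Fin d → Fin k, tensorEval (fun j => h (α j)) t •
      fun a => ∏ j, x (α j) (a j) := by
    funext m
    rw [ht m, key]
  rw [this]
  exact Submodule.sum_mem _ fun α _ => Submodule.smul_mem _ _
    (subset_span ⟨fun j => x (α j), fun j => subset_span ⟨_, rfl⟩, rfl⟩)

lemma mem_symTensors_iff_swap {t : (Fin d → ι) → 𝕜} :
    t ∈ symTensors 𝕜 ι d ↔ ∀ (m : Fin d → ι) (k l : Fin d), t (m ∘ swap k l) = t m := by
  constructor
  · intro h m k l
    exact h _ m
  intro h σ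
  induction σ using Equiv.Perm.swap_induction_on with
  | one => intro a; rfl
  | swap_mul f x y _ ih =>
    intro a
    rw [Equiv.Perm.coe_mul, ← Function.comp_assoc, ih, h]

variable [DecidableEq ι]

lemma hdot_single_sub (m : ι) (a t : ι → 𝕜) :
    hdot (fun x => (if x = m then 1 else 0) - a x) t = t m - hdot a t := by
  simp [hdot, sub_mul, sum_sub_distrib]

/-- The equation of symmetry under a swap. -/
def swapGen (𝕜 : Type*) [RCLike 𝕜] {d : ℕ} (m : Fin d → ι) (k l : Fin d) : (Fin d → ι) → 𝕜 :=
  fun x => (if x = m then 1 else 0) - if x = m ∘ swap k l then 1 else 0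

/-- The equation of invariance under the power of the orthogonal projection to the span of `u`. -/
def projGen {d ℓ : ℕ} (u : Fin ℓ → ι → 𝕜) (m : Fin d → ι) : (Fin d → ι) → 𝕜 :=
  fun x => (if x = m then 1 else 0) -
    ∏ j, ∑ i, (starRingEnd 𝕜) (u i (m j)) * u i (x j) / hdot (u i) (u i)

lemma hdot_swapGen (m : Fin d → ι) (k l : Fin d) (t : (Fin d → ι) → 𝕜) :
    hdot (swapGen 𝕜 m k l) t = t m - t (m ∘ swap k l) := by
  unfold swapGen
  rw [hdot_single_sub]
  simp [hdot]

lemma isDualTo_of_orthogonal {u : Fin ℓ → ι → 𝕜} (hne : ∀ i, u i ≠ 0)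
    (ho : ∀ i j, i ≠ j → hdot (u i) (u j) = 0) :
    IsDualTo u fun i c => (starRingEnd 𝕜) (u i c) / hdot (u i) (u i) := by
  intro i j
  have : ∑ c, (starRingEnd 𝕜) (u i c) / hdot (u i) (u i) * u j c =
      hdot (u i) (u j) / hdot (u i) (u i) := by
    conv_rhs => rw [hdot, sum_div]
    exact sum_congr rfl fun c _ => by ring
  rw [this]
  split_ifs with hij
  · subst hij
    exact div_self fun h => hne i (hdot_self_eq_zero.1 h)
  rw [ho i j hij, zero_div]

lemma hdot_projGen (u : Fin ℓ → ι → 𝕜) (m : Fin d → ι) (t : (Fin d → ι) → 𝕜) :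
    hdot (projGen u m) t = t m - ∑ a : Fin d → ι,
      (∏ j, ∑ i, u i (m j) * ((starRingEnd 𝕜) (u i (a j)) / hdot (u i) (u i))) * t a := by
  unfold projGen
  rw [hdot_single_sub]
  congr 1
  refine sum_congr rfl fun a _ => ?_
  congr 1
  simp only [map_prod, map_sum, map_mul, map_div₀, RCLike.conj_conj, conj_hdot, mul_div_assoc]

end Equations

/-- The equation of a minor. -/
def minorGen (𝕜 : Type*) [RCLike 𝕜] {d : ℕ} (m : Fin d → Fin n1 × Fin n2) :
    (Fin d → Fin n1 × Fin n2) → 𝕜 :=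
  fun x => minorArray 𝕜 (fun k => (m k).1) (fun k => (m k).2) (fun k => (x k).1) fun k => (x k).2

lemma hdot_minorGen (m : Fin d → Fin n1 × Fin n2) (t : (Fin d → Fin n1 × Fin n2) → 𝕜) :
    hdot (minorGen 𝕜 m) t = tensorPair (minorArray 𝕜 (fun k => (m k).1) fun k => (m k).2) t := by
  rw [hdot, tensorPair]
  refine sum_congr rfl fun a _ => ?_
  simp only [minorGen, minorArray, map_mul, conj_altSign]

lemma mem_liftedSpace_iff_hdot {u : Fin ℓ → MatSpace 𝕜 n1 n2} (hne : ∀ i, u i ≠ 0)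
    (ho : ∀ i j, i ≠ j → hdot (u i) (u j) = 0) {t : (Fin (r + 1) → Fin n1 × Fin n2) → 𝕜} :
    t ∈ liftedSpace (r + 1) (minors 𝕜 n1 n2 r) u ↔
      (∀ m k l, hdot (swapGen 𝕜 m k l) t = 0) ∧ (∀ m, hdot (projGen u m) t = 0) ∧
        ∀ m, hdot (minorGen 𝕜 m) t = 0 := by
  have hd := isDualTo_of_orthogonal hne ho
  rw [liftedSpace, Submodule.mem_inf, symPow, Submodule.mem_inf, hd.mem_tensorPow_iff,
    mem_symTensors_iff_swap, mem_polyAnnihilator_minors_iff]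
  simp only [hdot_swapGen, hdot_projGen, hdot_minorGen, sub_eq_zero]
  constructor
  · rintro ⟨⟨h1, h2⟩, h3⟩
    exact ⟨fun m k l => (h2 m k l).symm, h1, fun m => h3 _ (minorArray_mem _ _)⟩
  rintro ⟨h2, h1, h3⟩
  exact ⟨⟨h1, fun m k l => (h2 m k l).symm⟩, fun F hF => tensorPair_eq_zero (fun I J =>
    h3 fun k => (I k, J k)) hF⟩

/-! ### The computation of the lifted space -/

lemma GS.adds_loop_fin {i n : ℕ} {p : Prog}
    (hp : p.keeps R V = true) (hp' : p.noNat = true) (hi : R i = false) (hn : R n = true)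
    (hiK : i ≠ g.K) (hic : i ≠ g.cnt) {M : ℕ} (hM : st.reg n = M)
    {S : Fin M → Set (Fin a × Fin b → 𝕜)}
    (h : ∀ k : Fin M, g.Adds (fun j => j == i || R j) V p (st.putReg i k) (S k)) :
    g.Adds R V (Prog.loop i n p) st (⋃ k, S k) := by
  have := GS.adds_loop (g := g) (S := fun k => if hk : k < M then S ⟨k, hk⟩ else ∅)
    hp hp' hi hn hiK hic (st := st) (by
      intro k hk
      rw [hM] at hk
      rw [dif_pos hk]
      exact h ⟨k, hk⟩)
  rw [hM] at this
  convert this using 1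
  ext x
  simp only [mem_iUnion]
  constructor
  · rintro ⟨k, hk⟩
    exact ⟨k, k.2, by rwa [dif_pos k.2]⟩
  rintro ⟨k, hk, hx⟩
  rw [dif_pos hk] at hx
  exact ⟨_, hx⟩

/-- The pairs of numbers that code tuples of pairs. -/
def tupleCode (n1 n2 d : ℕ) : (Fin d → Fin n1 × Fin n2) ≃ Fin (n1 ^ d) × Fin (n2 ^ d) :=
  (Equiv.arrowProdEquivProdArrow (Fin d) (fun _ => Fin n1) (fun _ => Fin n2)).trans
    (Equiv.prodCongr finFunctionFinEquiv finFunctionFinEquiv)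

lemma tupleCode_symm_apply (c : Fin (n1 ^ d) × Fin (n2 ^ d)) (k : Fin d) :
    (((tupleCode n1 n2 d).symm c k).1 : ℕ) = c.1 / n1 ^ (k : ℕ) % n1 ∧
      (((tupleCode n1 n2 d).symm c k).2 : ℕ) = c.2 / n2 ^ (k : ℕ) % n2 := by
  constructor <;> rfl

lemma hdot_comp_equiv {ι ι' : Type*} [Fintype ι] [Fintype ι'] (e : ι ≃ ι') (a : ι → 𝕜)
    (t : ι' → 𝕜) : hdot (fun c => a (e.symm c)) t = hdot a fun x => t (e x) := by
  refine sum_equiv e.symm _ _ fun c => ?_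
  simp

lemma isBasisOf_comp_equiv {ι ι' : Type*} (e : ι ≃ ι') {m : ℕ} {b : Fin m → ι' → 𝕜}
    {W : Submodule 𝕜 (ι' → 𝕜)} (h : IsBasisOf b W) {W' : Submodule 𝕜 (ι → 𝕜)}
    (hW : ∀ t : ι' → 𝕜, t ∈ W ↔ (fun x => t (e x)) ∈ W') :
    IsBasisOf (fun i x => b i (e x)) W' := by
  have hker : LinearMap.ker (LinearEquiv.funCongrLeft 𝕜 𝕜 e).toLinearMap = ⊥ := LinearEquiv.ker _
  have h1 := h.1.map' _ hker
  refine ⟨h1, ?_⟩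
  have h2 : W' = W.map (LinearEquiv.funCongrLeft 𝕜 𝕜 e).toLinearMap := by
    ext t
    rw [Submodule.mem_map]
    constructor
    · intro ht
      refine ⟨fun c => t (e.symm c), (hW _).2 (by simpa using ht), ?_⟩
      funext x
      exact congrArg t (e.symm_apply_apply x)
    rintro ⟨t, ht, rfl⟩
    exact (hW t).1 ht
  rw [h2, ← h.2, Submodule.map_span, ← Set.range_comp]
  rfl

namespace Program

/-- The sizes and the tables of digits. -/
structure Tables (st : MState 𝕜) (n1 n2 d : ℕ) : Prop where
  reg4 : st.reg 4 = n1
  reg5 : st.reg 5 = n2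
  reg6 : st.reg 6 = n1 * n2
  reg7 : st.reg 7 = d
  reg8 : st.reg 8 = n1 ^ d
  reg9 : st.reg 9 = n2 ^ d
  reg10 : st.reg 10 = n1 ^ d * n2 ^ d
  digits1 : ∀ m < n1 ^ d, ∀ k < d, st.narr 10 [m, k] = m / n1 ^ k % n1
  digits2 : ∀ m < n2 ^ d, ∀ k < d, st.narr 11 [m, k] = m / n2 ^ k % n2

lemma Tables.congr (h : Tables st n1 n2 d)
    (hr : ∀ i, below 30 i = true → st.reg i = s.reg i) (hn : st.narr = s.narr) :
    Tables s n1 n2 d := by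
  obtain ⟨h4, h5, h6, h7, h8, h9, h10, hd1, hd2⟩ := h
  rw [hr _ rfl] at h4 h5 h6 h7 h8 h9 h10
  rw [hn] at hd1 hd2
  exact ⟨h4, h5, h6, h7, h8, h9, h10, hd1, hd2⟩

lemma Tables.putReg (h : Tables st n1 n2 d) {i : ℕ} (hi : 30 ≤ i) (n : ℕ) :
    Tables (st.putReg i n) n1 n2 d :=
  h.congr (fun j hj => by
    have : j < 30 := by simpa [below] using hj
    rw [reg_put, if_neg (by omega)]) rfl

/-- The registers `m` and `m'` hold the code of the tuple `x`. -/
def Digs (s : MState 𝕜) (m m' : ℕ) (x : Fin d → Fin n1 × Fin n2) : Prop :=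
  ∀ k : Fin d, s.narr 10 [s.reg m, (k : ℕ)] = (x k).1 ∧ s.narr 11 [s.reg m', (k : ℕ)] = (x k).2

lemma Tables.digs (h : Tables s n1 n2 d) {m m' : ℕ}
    {c : Fin (n1 ^ d) × Fin (n2 ^ d)} (hm : s.reg m = c.1) (hm' : s.reg m' = c.2) :
    Digs s m m' ((tupleCode n1 n2 d).symm c) := by
  intro k
  rw [hm, hm', h.digits1 _ c.1.2 _ k.2, h.digits2 _ c.2.2 _ k.2, (tupleCode_symm_apply c k).1,
    (tupleCode_symm_apply c k).2]
  exact ⟨rfl, rfl⟩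

lemma val_eqTuple {c c' : Fin (n1 ^ d) × Fin (n2 ^ d)} (h110 : s.reg 110 = c.1)
    (h111 : s.reg 111 = c.2) (h100 : s.reg 100 = c'.1) (h101 : s.reg 101 = c'.2) :
    eqTuple.val s = if c = c' then (1 : 𝕜) else 0 := by
  simp only [eqTuple, eqInd, FX.val, NX.val, NRel.holds_eq, h110, h111, h100, h101]
  by_cases h : c = c'
  · subst h
    simp
  rw [if_neg h]
  split_ifs with h1 h2
  · exact absurd (Prod.ext (Fin.ext h1) (Fin.ext h2)) h
  · rfl
  rfl

lemma val_swapTuple {x m : Fin d → Fin n1 × Fin n2} (h7 : s.reg 7 = d)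
    (hx : Digs s 110 111 x) (hm : Digs s 100 101 m) {k l : Fin d} (h102 : s.reg 102 = k)
    (h103 : s.reg 103 = l) :
    swapTuple.val s = if x = m ∘ swap k l then (1 : 𝕜) else 0 := by
  simp only [swapTuple, FX.val, BigOp.fn, h7, prod_range]
  have : ∀ j : Fin d, (if x j = m (swap k l j) then (1 : 𝕜) else 0) =
      FX.val (FX.bin FOp.mul (eqInd (NX.cell 10 [110, 115]) (NX.cell 10 [100, 116]))
        (eqInd (NX.cell 11 [111, 115]) (NX.cell 11 [101, 116])))
        ((s.putReg 115 j).putReg 116 (NX.val (NX.ite NRel.eq (NX.reg 115) (NX.reg 102) (NX.reg 103)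
            (NX.ite NRel.eq (NX.reg 115) (NX.reg 103) (NX.reg 102) (NX.reg 115)))
            (s.putReg 115 j))) := by
    intro j
    have h1 : NX.val (NX.ite NRel.eq (NX.reg 115) (NX.reg 102) (NX.reg 103)
        (NX.ite NRel.eq (NX.reg 115) (NX.reg 103) (NX.reg 102) (NX.reg 115)))
        (s.putReg 115 j) = (swap k l j : Fin d) := by
      simp only [NX.val, NRel.holds_eq, reg_put, h102, h103, Equiv.swap_apply_def]
      simp only [Fin.ext_iff]
      split_ifs <;> simp_all
    rw [h1]
    simp only [eqInd, FX.val, NX.val, NRel.holds_eq, reg_put, putReg_narr, map_cons,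
      map_nil, FOp.fn]
    norm_num
    rw [(hx j).1, (hx j).2, (hm _).1, (hm _).2]
    simp only [Prod.ext_iff, Fin.ext_iff]
    split_ifs <;> simp_all
  refine (prod_congr rfl fun j _ => (this j).symm).trans ?_
  rw [Finset.prod_boole]
  simp only [mem_univ, true_implies, funext_iff, Function.comp_apply]

lemma val_rowNorm (hg : g.Valid) (ha : s.reg g.p = a) (hb : s.reg g.q = b) : (rowNorm g).val s =
      hdot (matAt (s.farr g.B) [s.reg 112] : Fin a × Fin b → 𝕜) (matAt (s.farr g.B) [s.reg 112]) := by
  have := hg.q_lt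
  rw [rowNorm, FX.dot, FX.val_sum2 (by omega) _ _ ha hb]
  simp [FX.val, FOp.fn, reg_put, putReg_farr, matAt, hdot]

lemma val_projTuple {x m : Fin d → Fin n1 × Fin n2} (h4 : s.reg 4 = n1)
    (h5 : s.reg 5 = n2) (h7 : s.reg 7 = d) (h14 : s.reg 14 = ℓ)
    (hx : Digs s 110 111 x) (hm : Digs s 100 101 m) {u : Fin ℓ → MatSpace 𝕜 n1 n2}
    (hu : ∀ i : Fin ℓ, matAt (s.farr 10) [(i : ℕ)] = u i) :
    projTuple.val s = ∏ j, ∑ i, (starRingEnd 𝕜) (u i (m j)) * u i (x j) / hdot (u i) (u i) := by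
  simp only [projTuple, FX.val, BigOp.fn, h7, prod_range]
  refine prod_congr rfl fun j _ => ?_
  simp only [NX.val, reg_put, putReg_narr, map_cons, map_nil]
  norm_num
  rw [(hx j).1, (hx j).2, (hm _).1, (hm _).2, h14, sum_range]
  refine sum_congr rfl fun i _ => ?_
  rw [val_rowNorm valid_gsU (a := n1) (b := n2) (by simp [gsU, reg_put, h4])
    (by simp [gsU, reg_put, h5])]
  simp only [FOp.fn, gsU, putReg_farr, reg_put]
  norm_num
  rw [hu i]
  simp only [← hu i]
  rfl

lemma val_signArray {A m x n : ℕ} (hm : m < 115) (hx : x < 115)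
    (h7 : s.reg 7 = d) {y z : Fin d → Fin n} (hy : ∀ k : Fin d, s.narr A [s.reg m, (k : ℕ)] = y k)
    (hz : ∀ k : Fin d, s.narr A [s.reg x, (k : ℕ)] = z k) :
    (signArray A m x).val s = altSign 𝕜 y z := by
  have hsign : ∀ {m : ℕ}, m < 115 → ∀ {y : Fin d → Fin n},
      (∀ k : Fin d, s.narr A [s.reg m, (k : ℕ)] = y k) → (signProd A m).val s = diffSign 𝕜 y := by
    intro m hm y hy
    have h1 : m ≠ 115 := by omega
    have h2 : m ≠ 116 := by omega
    simp only [signProd, FX.val, NX.val, BigOp.fn, FOp.fn, NRel.holds_eq, NRel.holds_lt, reg_put,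
      putReg_narr, map_cons, map_nil, h7, prod_range, if_neg h1, if_neg h2]
    norm_num
    simp only [hy, diffSign, natSign, Fin.lt_def]
    rfl
  have h1 : m ≠ 115 := by omega
  have h2 : m ≠ 116 := by omega
  have h3 : x ≠ 115 := by omega
  have h4 : x ≠ 116 := by omega
  rw [← diffSign_mul_eq_altSign, ← hsign hm hy, ← hsign hx hz]
  simp only [signArray, FX.val, FOp.fn]
  congr 1
  simp only [matchProd, eqInd, FX.val, NX.val, BigOp.fn, NRel.holds_eq, reg_put,
    putReg_narr, map_cons, map_nil, h7, prod_range, if_neg h1, if_neg h2,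
    if_neg h3, if_neg h4]
  refine prod_congr rfl fun j _ => ?_
  rw [show (if (7 : ℕ) = 115 then (j : ℕ) else d) = d from rfl, sum_range]
  refine sum_congr rfl fun k _ => ?_
  rw [← hy, ← hz]
  rfl

end Program

lemma GS.adds_push_eq (hg : g.Valid) {e : FX}
    (he : e.avoids 11 = true) (hs : e.Scoped (fun j => j == 111 || (j == 110 || R j)) V = true)
    (hR : R g.p = true ∧ R g.q = true ∧ R g.K = true)
    (ha : st.reg g.p = a) (hb : st.reg g.q = b) (hK : a * b ≤ st.reg g.K)
    {X : Fin a × Fin b → 𝕜} (hX : ∀ c, e.val ((st.putReg 110 c.1).putReg 111 c.2) = X c) :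
    g.Adds R V (g.push e) st {X} := by
  have := GS.adds_push hg he hs hR ha hb hK
  rwa [funext hX] at this

namespace Program

/-- The vector of pairs of numbers that corresponds to an array. -/
def coded (t : (Fin d → Fin n1 × Fin n2) → 𝕜) : Fin (n1 ^ d) × Fin (n2 ^ d) → 𝕜 :=
  fun c => t ((tupleCode n1 n2 d).symm c)

lemma adds_symmGens (h : Tables s n1 n2 d) :
    gsW.Adds (below 30) (fun A => A == 10) symmGens s (⋃ (i : Fin (n1 ^ d)) (j : Fin (n2 ^ d))
      (k : Fin d) (l : Fin d), {coded (swapGen 𝕜 ((tupleCode n1 n2 d).symm (i, j)) k l)}) := by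
  refine GS.adds_loop_fin rfl rfl rfl rfl (by decide) (by decide) h.reg8 fun i => ?_
  have h := h.putReg (i := 100) (by decide) i
  refine GS.adds_loop_fin rfl rfl rfl rfl (by decide) (by decide) h.reg9 fun j => ?_
  have h := h.putReg (i := 101) (by decide) j
  refine GS.adds_loop_fin rfl rfl rfl rfl (by decide) (by decide) h.reg7 fun k => ?_
  have h := h.putReg (i := 102) (by decide) k
  refine GS.adds_loop_fin rfl rfl rfl rfl (by decide) (by decide) h.reg7 fun l => ?_
  have h := h.putReg (i := 103) (by decide) l
  refine GS.adds_push_eq valid_gsW rfl rfl ⟨rfl, rfl, rfl⟩ h.reg8 h.reg9 h.reg10.ge fun c => ?_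
  have h := (h.putReg (i := 110) (by decide) c.1).putReg (i := 111) (by decide) c.2
  simp only [FX.val, FOp.fn]
  rw [val_eqTuple (c := c) (c' := (i, j)) rfl rfl rfl rfl,
    val_swapTuple h.reg7 (h.digs (c := c) rfl rfl) (h.digs (c := (i, j)) rfl rfl)
      (k := k) (l := l) rfl rfl]
  simp only [coded, swapGen, EmbeddingLike.apply_eq_iff_eq]

lemma adds_powGens (h : Tables s n1 n2 d) (hℓ : s.reg 14 = ℓ) :
    gsW.Adds (below 30) (fun A => A == 10) powGens s (⋃ (i : Fin (n1 ^ d)) (j : Fin (n2 ^ d)),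
      {coded (projGen (fun i : Fin ℓ => matAt (s.farr 10) [(i : ℕ)])
        ((tupleCode n1 n2 d).symm (i, j)))}) := by
  refine GS.adds_loop_fin rfl rfl rfl rfl (by decide) (by decide) h.reg8 fun i => ?_
  have h := h.putReg (i := 100) (by decide) i
  refine GS.adds_loop_fin rfl rfl rfl rfl (by decide) (by decide) h.reg9 fun j => ?_
  have h := h.putReg (i := 101) (by decide) j
  refine GS.adds_push_eq valid_gsW rfl rfl ⟨rfl, rfl, rfl⟩ h.reg8 h.reg9 h.reg10.ge fun c => ?_
  have h := (h.putReg (i := 110) (by decide) c.1).putReg (i := 111) (by decide) c.2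
  simp only [FX.val, FOp.fn]
  rw [val_eqTuple (c := c) (c' := (i, j)) rfl rfl rfl rfl,
    val_projTuple h.reg4 h.reg5 h.reg7 (ℓ := ℓ) hℓ (h.digs (c := c) rfl rfl)
      (h.digs (c := (i, j)) rfl rfl) fun i => rfl]
  simp only [coded, projGen, EmbeddingLike.apply_eq_iff_eq]
  rfl

lemma adds_minorGens (h : Tables s n1 n2 d) :
    gsW.Adds (below 30) (fun A => A == 10) minorGens s (⋃ (i : Fin (n1 ^ d)) (j : Fin (n2 ^ d)),
      {coded (minorGen 𝕜 ((tupleCode n1 n2 d).symm (i, j)))}) := by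
  refine GS.adds_loop_fin rfl rfl rfl rfl (by decide) (by decide) h.reg8 fun i => ?_
  have h := h.putReg (i := 100) (by decide) i
  refine GS.adds_loop_fin rfl rfl rfl rfl (by decide) (by decide) h.reg9 fun j => ?_
  have h := h.putReg (i := 101) (by decide) j
  refine GS.adds_push_eq valid_gsW rfl rfl ⟨rfl, rfl, rfl⟩ h.reg8 h.reg9 h.reg10.ge fun c => ?_
  have h := (h.putReg (i := 110) (by decide) c.1).putReg (i := 111) (by decide) c.2
  have hx := h.digs (c := c) (m := 110) (m' := 111) rfl rfl
  have hm := h.digs (c := (i, j)) (m := 100) (m' := 101) rfl rfl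
  simp only [FX.val, FOp.fn]
  rw [val_signArray (by decide) (by decide) h.reg7 (fun k => (hm k).1) fun k => (hx k).1,
    val_signArray (by decide) (by decide) h.reg7 (fun k => (hm k).2) fun k => (hx k).2]
  rfl

lemma adds_liftGens (h : Tables s n1 n2 d) :
    gsP.Adds (below 30) (fun A => A == 13) liftGens s (⋃ (i : Fin (n1 ^ d)) (j : Fin (n2 ^ d)),
      {gsRes (s.reg 10) (fun k => matAt (s.farr 13) [k]) (single (i, j) 1)}) := by
  refine GS.adds_loop_fin rfl rfl rfl rfl (by decide) (by decide) h.reg8 fun i => ?_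
  have h := h.putReg (i := 100) (by decide) i
  refine GS.adds_loop_fin rfl rfl rfl rfl (by decide) (by decide) h.reg9 fun j => ?_
  have h := h.putReg (i := 101) (by decide) j
  refine GS.adds_push_eq valid_gsP rfl rfl ⟨rfl, rfl, rfl⟩ h.reg8 h.reg9 h.reg10.ge fun c => ?_
  have h := (h.putReg (i := 110) (by decide) c.1).putReg (i := 111) (by decide) c.2
  simp only [FX.val, FOp.fn, BigOp.fn]
  rw [val_eqTuple (c := c) (c' := (i, j)) rfl rfl rfl rfl, gsRes, Pi.single_apply]
  congr 1
  refine sum_congr rfl fun k _ => ?_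
  rw [val_rowNorm valid_gsW (a := n1 ^ d) (b := n2 ^ d) (h.putReg (i := 112) (by decide) k).reg8
    (h.putReg (i := 112) (by decide) k).reg9]
  have hs : hdot (matAt (s.farr 13) [k]) (single (i, j) (1 : 𝕜)) =
      (starRingEnd 𝕜) (s.farr 13 [k, (i : ℕ), (j : ℕ)]) := by
    simp [hdot, Pi.single_apply, matAt]
  rw [hs]
  rfl

lemma run_lift (hn1 : 0 < n1) (hn2 : 0 < n2) (h4 : st.reg 4 = n1)
    (h5 : st.reg 5 = n2) (h6 : st.reg 6 = n1 * n2) (h7 : st.reg 7 = r + 1)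
    (h8 : st.reg 8 = n1 ^ (r + 1)) (h9 : st.reg 9 = n2 ^ (r + 1))
    (h10 : st.reg 10 = n1 ^ (r + 1) * n2 ^ (r + 1)) (h14 : st.reg 14 = ℓ)
    {u : Fin ℓ → MatSpace 𝕜 n1 n2} (hu : ∀ i : Fin ℓ, matAt (st.farr 10) [(i : ℕ)] = u i)
    (hne : ∀ i, u i ≠ 0) (ho : ∀ i j, i ≠ j → hdot (u i) (u j) = 0)
    (h33 : st.reg 33 = 0) (h34 : st.reg 34 = 0) (hf13 : st.farr 13 = fun _ => 0)
    (hf14 : st.farr 14 = fun _ => 0) :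
    Tables (lift.run st) n1 n2 (r + 1) ∧ IsBasisOf (fun (i : Fin ((lift.run st).reg 34)) x =>
        (matAt ((lift.run st).farr 14) [(i : ℕ)] : Fin (n1 ^ (r + 1)) × Fin (n2 ^ (r + 1)) → 𝕜)
          (tupleCode n1 n2 (r + 1) x)) (liftedSpace (r + 1) (minors 𝕜 n1 n2 r) u) := by
  obtain ⟨f1, d1⟩ := run_digits (A := 10) (n := 4) (b := 8) (by decide) (by decide) hn1 h4 h7 h8
  set s1 := (digits 10 4 8).run st
  obtain ⟨f2, d2⟩ := run_digits (A := 11) (n := 5) (b := 9) (st := s1) (by decide) (by decide) hn2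
    ((f1.1 5 (by decide)).trans h5) ((f1.1 7 (by decide)).trans h7) ((f1.1 9 (by decide)).trans h9)
  set s2 := (digits 11 5 9).run s1 with hs2
  have hr : ∀ i < 40, s2.reg i = st.reg i := fun i hi => (f2.1 i hi).trans (f1.1 i hi)
  have hf : s2.farr = st.farr := f2.2.1.trans f1.2.1
  have hT : Tables s2 n1 n2 (r + 1) := by
    refine ⟨(hr _ (by decide)).trans h4, (hr _ (by decide)).trans h5, (hr _ (by decide)).trans h6,
      (hr _ (by decide)).trans h7, (hr _ (by decide)).trans h8, (hr _ (by decide)).trans h9,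
      (hr _ (by decide)).trans h10, ?_, d2⟩
    rw [f2.2.2 10 (by decide)]
    exact d1
  have a3 := symmGens.agree_run (R := below 30) (V := fun A => A == 10) rfl rfl s2
  set s3 := symmGens.run s2 with hs3
  have a4 := powGens.agree_run (R := below 30) (V := fun A => A == 10) rfl rfl s3
  set s4 := powGens.run s3 with hs4
  have a5 := minorGens.agree_run (R := below 30) (V := fun A => A == 10) rfl rfl s4
  set s5 := minorGens.run s4 with hs5
  have k6 := liftGens.agree_run (R := below 30) (V := fun A => A == 13) rfl rfl s5
  have hrun : lift.run st = liftGens.run s5 := rfl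
  rw [hrun]
  have g5 : s5.reg 34 = 0 ∧ s5.farr 14 = fun _ => 0 := by
    have h3 := (Prog.seq symmGens (Prog.seq powGens minorGens)).agree_run
      (R := fun i => i == 34) (V := fun A => A == 14) rfl rfl s2
    exact ⟨(h3.reg 34 rfl).symm.trans ((hr 34 (by decide)).trans h34),
      (h3.farr 14 rfl).symm.trans (by rw [hf, hf14])⟩
  have hT5 : Tables s5 n1 n2 (r + 1) :=
    hT.congr ((a3.trans a4).trans a5).reg ((a3.trans a4).trans a5).narr
  have hTlast := hT5.congr k6.reg k6.narr
  refine ⟨hTlast, ?_⟩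
  have hO2 : gsW.Ortho s2 (⊥ : Submodule 𝕜 (Fin (n1 ^ (r + 1)) × Fin (n2 ^ (r + 1)) → 𝕜)) := by
    rw [GS.Ortho, show s2.reg gsW.cnt = 0 from (hr 33 (by decide)).trans h33, hf]
    refine orthoRows_bot fun k _ => ?_
    rw [show st.farr gsW.B = fun _ => 0 from hf13]
    rfl
  have hO3 := adds_symmGens hT s2 (Agree.refl _ _ _) _ hO2
  have hO4 := adds_powGens (hT.congr a3.reg a3.narr) (ℓ := ℓ)
    ((a3.reg 14 rfl).symm.trans ((hr 14 (by decide)).trans h14)) s3 (Agree.refl _ _ _) _ hO3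
  have hO5 := adds_minorGens (hT.congr (a3.trans a4).reg (a3.trans a4).narr) s4
    (Agree.refl _ _ _) _ hO4
  rw [bot_sup_eq, ← span_union, ← span_union] at hO5
  have hO6 := adds_liftGens hT5 s5 (Agree.refl _ _ _) ⊥ (by
    rw [GS.Ortho, show s5.reg gsP.cnt = 0 from g5.1]
    refine orthoRows_bot fun k _ => ?_
    rw [show s5.farr gsP.B = fun _ => 0 from g5.2]
    rfl)
  rw [bot_sup_eq] at hO6
  have hu' : (fun i : Fin ℓ => (matAt (s3.farr 10) [(i : ℕ)] : MatSpace 𝕜 n1 n2)) = u := by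
    funext i
    rw [← a3.farr 10 rfl, hf, hu]
  rw [hu'] at hO5
  refine isBasisOf_comp_equiv (tupleCode n1 n2 (r + 1)) hO6.isBasisOf fun t => ?_
  have hO : OrthoRows (s5.reg 10) (fun k => matAt (s5.farr 13) [k]) (s5.reg 33) _ := hO5
  have hset : (⋃ (i : Fin (n1 ^ (r + 1))) (j : Fin (n2 ^ (r + 1))),
      {gsRes (s5.reg 10) (fun k => matAt (s5.farr 13) [k]) (single (i, j) (1 : 𝕜))}) =
      range fun m => gsRes (s5.reg 10) (fun k => matAt (s5.farr 13) [k]) (single m (1 : 𝕜)) := by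
    ext y
    simp only [mem_iUnion, Set.mem_singleton_iff, Set.mem_range, Prod.exists, eq_comm]
  rw [hset, hO.mem_span_gsRes_single (by
    simp only [Fintype.card_prod, card_fin]
    exact hT5.reg10.ge), mem_liftedSpace_iff_hdot hne ho]
  have hc : ∀ x : (Fin (r + 1) → Fin n1 × Fin n2) → 𝕜, hdot (coded x) t =
      hdot x fun y => t (tupleCode n1 n2 (r + 1) y) := fun x => hdot_comp_equiv _ _ _
  have hsurj : ∀ m : Fin (r + 1) → Fin n1 × Fin n2, ∃ i j,
      (tupleCode n1 n2 (r + 1)).symm (i, j) = m := fun m =>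
    ⟨(tupleCode n1 n2 (r + 1) m).1, (tupleCode n1 n2 (r + 1) m).2, Equiv.symm_apply_apply _ m⟩
  constructor
  · intro H
    have H' := fun w hw => H w (subset_span hw)
    refine ⟨fun m k l => ?_, fun m => ?_, fun m => ?_⟩
    all_goals
      obtain ⟨i, j, rfl⟩ := hsurj m
      rw [← hc]
    · refine H' _ (Or.inl (Or.inl ?_))
      simp only [mem_iUnion]
      exact ⟨i, j, k, l, rfl⟩
    · refine H' _ (Or.inl (Or.inr ?_))
      simp only [mem_iUnion]
      exact ⟨i, j, rfl⟩
    refine H' _ (Or.inr ?_)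
    simp only [mem_iUnion]
    exact ⟨i, j, rfl⟩
  rintro ⟨h1, h2, h3⟩ w hw
  refine hdot_eq_zero_of_mem_span ?_ hw
  rintro y ((hy | hy) | hy) <;> simp only [mem_iUnion] at hy
  · obtain ⟨i, j, k, l, rfl⟩ := hy
    rw [hc, h1]
  · obtain ⟨i, j, rfl⟩ := hy
    rw [hc, h2]
  obtain ⟨i, j, rfl⟩ := hy
  rw [hc, h3]

end Program

/-! ### The matrix for the oracle -/

section Oracle

variable {ι : Type*} [Fintype ι] [DecidableEq ι] {r ℓ s : ℕ}

lemma linearIndependent_sum_smul {κ : Type*} {y : Fin ℓ → κ → 𝕜} (hy : LinearIndependent 𝕜 y)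
    {A : Matrix (Fin ℓ) (Fin ℓ) 𝕜} (hA : IsUnit A) :
    LinearIndependent 𝕜 fun i => ∑ a, A i a • y a := by
  rw [Fintype.linearIndependent_iff]
  intro g hg
  have h1 : ∑ a, (∑ i, g i * A i a) • y a = 0 := by
    rw [← hg]
    simp only [Finset.smul_sum, Finset.sum_smul, smul_smul]
    exact sum_comm
  have h2 : Matrix.vecMul g A = 0 := funext fun a => Fintype.linearIndependent_iff.1 hy _ h1 a
  exact congrFun (Matrix.vecMul_injective_iff_isUnit.2 hA (h2.trans (Matrix.zero_vecMul A).symm))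

lemma isUnit_hdot {u x : Fin ℓ → ι → 𝕜} (hx : LinearIndependent 𝕜 x)
    (hxu : ∀ a, x a ∈ span 𝕜 (range u)) :
    IsUnit (of fun i a => hdot (u i) (x a)) := by
  rw [← Matrix.mulVec_injective_iff_isUnit, ← Matrix.coe_mulVecLin, ← LinearMap.ker_eq_bot,
    LinearMap.ker_eq_bot']
  intro v hv
  have h1 : ∀ i, hdot (u i) (∑ a, v a • x a) = 0 := by
    intro i
    rw [hdot_sum, ← show _ = (0 : 𝕜) from congrFun hv i]
    simp only [hdot_smul, Matrix.mulVecLin_apply, Matrix.mulVec, dotProduct, of_apply, mul_comm]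
  have h2 : ∑ a, v a • x a = 0 := hdot_self_eq_zero.1 <| hdot_eq_zero_of_mem_span (by grind) (Submodule.sum_mem _ fun a _ => Submodule.smul_mem _ _ (hxu a))
  exact funext (Fintype.linearIndependent_iff.1 hx v h2)

lemma oracleMatrix_mul {κ : Type*} [Fintype κ] {y F G K : Fin ℓ → κ → 𝕜} {X : Matrix (Fin ℓ) (Fin ℓ) 𝕜}
    {φ ψ : Fin ℓ → 𝕜} (hψ : ∀ a, ψ a ≠ 0) (hF : ∀ i, F i = ∑ a, (X i a * φ a) • y a)
    (hG : ∀ i, G i = ∑ a, (X i a * ψ a) • y a) (hK : IsDualTo G K) :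
    (of fun i j => ∑ c, F i c * K j c) * X = X * diagonal fun a => φ a / ψ a := by
  set Y : Matrix (Fin ℓ) (Fin ℓ) 𝕜 := of fun a j => ∑ c, y a c * K j c
  have key : ∀ (θ : Fin ℓ → 𝕜) (H : Fin ℓ → κ → 𝕜), (∀ i, H i = ∑ a, (X i a * θ a) • y a) →
      (of fun i j => ∑ c, H i c * K j c) = X * diagonal θ * Y := by
    intro θ H hH
    ext i j
    simp only [Y, Matrix.mul_apply (M := X * _), Matrix.mul_diagonal, of_apply, hH,
      Finset.sum_apply, Pi.smul_apply, smul_eq_mul, sum_mul, mul_sum, mul_assoc]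
    exact sum_comm
  have h1 : X * diagonal ψ * Y = 1 := by
    rw [← key ψ G hG]
    ext i j
    rw [of_apply, Matrix.one_apply, ← if_congr eq_comm rfl rfl, ← hK j i]
    grind
  have h2 : Y * (X * diagonal ψ) = 1 := mul_eq_one_comm.1 h1
  have h3 : diagonal ψ * diagonal (fun a => (ψ a)⁻¹) = 1 := by simp_all
  have h4 : Y * X = diagonal (fun a => (ψ a)⁻¹) := by
    rw [← mul_one (Y * X), ← h3, mul_assoc, ← mul_assoc X, ← mul_assoc, h2, one_mul]
  rw [key φ F hF, mul_assoc _ Y, h4, mul_assoc, Matrix.diagonal_mul_diagonal]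
  grind

lemma exists_perm_of_diagonalizes {M X Q : Matrix (Fin ℓ) (Fin ℓ) 𝕜} {ρ l : Fin ℓ → 𝕜}
    (hX : IsUnit X) (hMX : M * X = X * diagonal ρ) (hρ : Injective ρ)
    (hQ : Diagonalizes M Q l) :
    ∃ (σ : Perm (Fin ℓ)) (c : Fin ℓ → 𝕜), (∀ b, c b ≠ 0) ∧ ∀ i b, Q i b = c b * X i (σ b) := by
  obtain ⟨hQu, hMQ⟩ := hQ
  obtain ⟨X', hX1, hX2⟩ := isUnit_iff_exists.1 hX
  obtain ⟨Q', hQ1, hQ2⟩ := isUnit_iff_exists.1 hQu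
  set Z := X' * Q with hZ
  have hXZ : X * Z = Q := by grind
  have hdiag : diagonal ρ * Z = Z * diagonal l := by
    have h1 : X * (diagonal ρ * Z) = X * (Z * diagonal l) := by grind
    rw [← one_mul (_ * Z), ← hX2, mul_assoc, h1, ← mul_assoc, hX2, one_mul]
  have hZ1 : Z * (Q' * X) = 1 := by grind
  have hZ2 : Q' * X * Z = 1 := mul_eq_one_comm.1 hZ1
  have hent : ∀ a b, Z a b ≠ 0 → ρ a = l b := by
    intro a b h
    have := congrFun (congrFun hdiag a) b
    rw [Matrix.diagonal_mul, Matrix.mul_diagonal, mul_comm] at this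
    grind
  have hcol : ∀ b, ∃ a, Z a b ≠ 0 := by
    intro b
    by_contra! h
    have := congrFun (congrFun hZ2 b) b
    simp [Matrix.mul_apply (N := Z), h] at this
  have hrow : ∀ a, ∃ b, Z a b ≠ 0 := by
    intro a
    by_contra! h
    have := congrFun (congrFun hZ1 a) a
    simp [Matrix.mul_apply (M := Z), h] at this
  choose σ hσ using hcol
  have huniq : ∀ a b, Z a b ≠ 0 → a = σ b := fun a b h =>
    hρ ((hent a b h).trans (hent _ b (hσ b)).symm)
  have hsurj : Function.Surjective σ := fun a => by
    obtain ⟨b, hb⟩ := hrow a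
    exact ⟨b, (huniq a b hb).symm⟩
  refine ⟨Equiv.ofBijective σ (Finite.surjective_iff_bijective.1 hsurj), fun b => Z (σ b) b, hσ,
    fun i b => ?_⟩
  rw [← hXZ, Matrix.mul_apply, sum_eq_single (σ b)]
  · grind
  · intro a _ ha
    rw [not_not.1 fun h => ha (huniq a b h), mul_zero]
  grind

/-- The contraction of the first slot. -/
def slotContr (w : ι → 𝕜) (F : (Fin (r + 1) → ι) → 𝕜) : (Fin (r + 1) → ι) → 𝕜 :=
  fun b => ∑ m, (∏ k, if k = 0 then (starRingEnd 𝕜) (w (m k)) else if m k = b k then 1 else 0) * F m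

/-- A power, regarded as independent of the first index. -/
def tailPow (r : ℕ) (x : ι → 𝕜) : (Fin (r + 1) → ι) → 𝕜 := fun b => ∏ k : Fin r, x (b k.succ)

lemma slotContr_powTensor (w x : ι → 𝕜) :
    slotContr w (powTensor (r + 1) x) = hdot w x • tailPow r x := by
  funext b
  simp only [slotContr, powTensor, ← prod_mul_distrib]
  rw [sum_prod_apply fun k i => (if k = 0 then (starRingEnd 𝕜) (w i) else
    if i = b k then 1 else 0) * x i, Fin.prod_univ_succ]
  simp [hdot, tailPow, Fin.succ_ne_zero]

lemma slotContr_sum (w : ι → 𝕜) (c : Fin ℓ → 𝕜) (F : Fin ℓ → (Fin (r + 1) → ι) → 𝕜) :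
    slotContr w (∑ a, c a • F a) = ∑ a, c a • slotContr w (F a) := by
  funext b
  simp only [slotContr, Finset.sum_apply, Pi.smul_apply, smul_eq_mul, mul_sum]
  rw [sum_comm]
  grind

lemma linearIndependent_tailPow [Nonempty ι] (hr : 0 < r) {x : Fin ℓ → ι → 𝕜}
    (hx : LinearIndependent 𝕜 x) : LinearIndependent 𝕜 fun a => tailPow r (x a) := by
  obtain ⟨e, rfl⟩ : ∃ e, r = e + 1 := ⟨r - 1, by omega⟩
  refine LinearIndependent.of_comp (LinearMap.funLeft 𝕜 𝕜
    fun b : Fin (e + 1) → ι => (Fin.cons (Classical.arbitrary ι) b : Fin (e + 1 + 1) → ι)) ?_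
  exact linearIndependent_powTensor hx

variable {n1 n2 : ℕ} {P : Fin s → (Fin (r + 1) → Fin n1 × Fin n2) → 𝕜}
  {f g : Fin s → 𝕜} {x : Fin ℓ → MatSpace 𝕜 n1 n2} {z : Fin ℓ → Fin s → 𝕜}

lemma Recovers.mem_span (hr : 0 < r) (h : Recovers P f g x z) {u : Fin ℓ → MatSpace 𝕜 n1 n2}
    (hP : ∀ i, P i ∈ tensorPow (span 𝕜 (range u)) (r + 1)) (a : Fin ℓ) :
    x a ∈ span 𝕜 (range u) := by
  obtain ⟨y, hy⟩ := exists_isDualTo h.indep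
  obtain ⟨i, hi⟩ : ∃ i, z a i ≠ 0 := by
    by_contra! hz
    exact h.good.left_ne a (by simp [hz])
  have := contractTail_mem (fun _ => y a) (hP i)
  rw [h.eq_sum, map_sum, sum_eq_single a] at this
  · rw [map_smul] at this
    unfold powTensor at this
    rw [contractTail_prod (fun _ => y a) fun _ => x a] at this
    simpa [hy a a, hi] using (Submodule.smul_mem_iff _ hi).1 this
  · intro b _ hb
    rw [map_smul]
    unfold powTensor
    rw [contractTail_prod (fun _ => y a) fun _ => x b]
    simp [hy a b, hb.symm, hr.ne']
  grind

/-- The powers of rescaled and permuted vectors. -/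
lemma Recovers.rescale (h : Recovers P f g x z) (σ : Perm (Fin ℓ)) {c : Fin ℓ → 𝕜}
    (hc : ∀ b, c b ≠ 0) {x' h' : Fin ℓ → MatSpace 𝕜 n1 n2} (hx' : ∀ b, x' b = c b • x (σ b))
    (hh' : IsDualTo x' h') :
    Recovers P f g x' fun b i => tensorEval (fun _ => h' b) (P i) := by
  have hpow : ∀ b, powTensor (r + 1) (x' b) = c b ^ (r + 1) • powTensor (r + 1) (x (σ b)) := by
    intro b
    funext m
    simp [powTensor, hx', prod_mul_distrib]
  have hcp : ∀ b, c b ^ (r + 1) ≠ 0 := fun b => pow_ne_zero _ (hc b)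
  have hsum : ∀ i, P i = ∑ b, ((c b ^ (r + 1))⁻¹ * z (σ b) i) • powTensor (r + 1) (x' b) := by
    intro i
    rw [h.eq_sum i, ← Equiv.sum_comp σ]
    refine sum_congr rfl fun b _ => ?_
    rw [hpow, smul_smul, mul_right_comm, inv_mul_cancel₀ (hcp b), one_mul]
  have hz : (fun b i => tensorEval (fun _ => h' b) (P i)) =
      fun b i => (c b ^ (r + 1))⁻¹ * z (σ b) i := by
    funext b i
    rw [hsum i, map_sum, sum_eq_single b]
    · rw [map_smul]
      unfold powTensor
      rw [tensorEval_prod]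
      simp [hh' b b]
    · intro b' _ hb
      rw [map_smul]
      unfold powTensor
      rw [tensorEval_prod]
      simp [hh' b b', hb.symm]
    grind
  have hpair : ∀ (q : Fin s → 𝕜) b, ∑ i, q i * ((c b ^ (r + 1))⁻¹ * z (σ b) i) =
      (c b ^ (r + 1))⁻¹ * ∑ i, q i * z (σ b) i := by
    intro q b
    rw [mul_sum]
    grind
  rw [hz]
  refine ⟨h.card_eq, linearIndependent_of_isDualTo hh', hsum, ⟨fun a => ?_, fun a => ?_, ?_⟩⟩
  · rw [hpair]
    exact mul_ne_zero (inv_ne_zero (hcp a)) (h.good.left_ne _)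
  · rw [hpair]
    exact mul_ne_zero (inv_ne_zero (hcp a)) (h.good.right_ne _)
  intro a b hab
  simp only [hpair, mul_div_mul_left _ _ (inv_ne_zero (hcp _))] at hab
  exact σ.injective (h.good.ratio hab)

end Oracle

namespace Program

lemma run_combine {A f : ℕ} (hA : A ≠ f ∧ A ≠ 14) {s : ℕ}
    (h8 : st.reg 8 = a) (h9 : st.reg 9 = b) (h15 : st.reg 15 = s) :
    ∃ m, (combine A f).run st = st.setArr A m ∧ ∀ c : Fin a × Fin b,
      matAt m [] c = ∑ i : Fin s, st.farr f [(i : ℕ)] * matAt (st.farr 14) [(i : ℕ)] c := by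
  obtain ⟨m, h1, h2, -⟩ := fill_run2 (A := A) (pre := []) (i := 110) (j := 111) (n := 8) (k := 9)
    (e := FX.big BigOp.sum 112 15 (FX.bin FOp.mul (FX.cell f [112]) (FX.cell 14 [112, 110, 111])))
    (by simp [FX.avoids, hA.1.symm, hA.2.symm]) (by decide) (by decide) (by decide) (by decide)
    (by decide) (by simp) (by simp) st
  refine ⟨m, h1, fun c => ?_⟩
  refine (h2 c.1 (by omega) c.2 (by omega)).trans ?_
  simp only [FX.val, BigOp.fn, FOp.fn]
  rw [show ((st.putReg 110 c.1).putReg 111 c.2).reg 15 = s from h15, sum_range]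
  rfl

lemma run_contract {A F : ℕ} (hA : A ≠ 10 ∧ A ≠ F)
    (h : Tables st n1 n2 (r + 1)) (h14 : st.reg 14 = ℓ) :
    ∃ m, (contract A F).run st = st.setArr A m ∧ ∀ (i : Fin ℓ) (b : Fin (r + 1) → Fin n1 × Fin n2),
      matAt m [(i : ℕ)] (tupleCode n1 n2 (r + 1) b) =
        slotContr (matAt (st.farr 10) [(i : ℕ)] : MatSpace 𝕜 n1 n2)
          (fun x => matAt (st.farr F) [] (tupleCode n1 n2 (r + 1) x)) b := by
  obtain ⟨m, h1, h2⟩ := fill_run3 (A := A) (a := 102) (i := 110) (j := 111) (l := 14) (n := 8)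
    (k := 9) (e := FX.sum2 103 8 104 9
    (FX.bin FOp.mul (FX.big BigOp.prod 115 7 (FX.ite NRel.eq (NX.reg 115) (NX.lit 0)
      (FX.bind 116 (NX.cell 10 [103, 115]) (FX.bind 117 (NX.cell 11 [104, 115])
        (FX.conj (FX.cell 10 [102, 116, 117]))))
      (FX.bin FOp.mul (eqInd (NX.cell 10 [103, 115]) (NX.cell 10 [110, 115]))
        (eqInd (NX.cell 11 [104, 115]) (NX.cell 11 [111, 115])))))
      (FX.cell F [103, 104])))
    (by simp [FX.avoids, FX.sum2, eqInd, hA.1.symm, hA.2.symm]) (by decide) (by decide) (by decide)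
    (by decide) (by decide) (by decide) st
  refine ⟨m, h1, fun i b => ?_⟩
  have hc := h2 i (by omega) (tupleCode n1 n2 (r + 1) b).1 (by rw [h.reg8]; exact Fin.is_lt _)
    (tupleCode n1 n2 (r + 1) b).2 (by rw [h.reg9]; exact Fin.is_lt _)
  refine hc.trans ?_
  have h := ((h.putReg (i := 102) (by decide) i).putReg (i := 110) (by decide)
    (tupleCode n1 n2 (r + 1) b).1).putReg (i := 111) (by decide) (tupleCode n1 n2 (r + 1) b).2
  rw [FX.val_sum2 (by decide) _ _ h.reg8 h.reg9, slotContr]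
  refine sum_equiv (tupleCode n1 n2 (r + 1)).symm _ _ fun c => ?_
  have h := (h.putReg (i := 103) (by decide) c.1).putReg (i := 104) (by decide) c.2
  have hb := h.digs (c := tupleCode n1 n2 (r + 1) b) (m := 110) (m' := 111) rfl rfl
  rw [Equiv.symm_apply_apply] at hb
  have hx := h.digs (c := c) (m := 103) (m' := 104) rfl rfl
  simp only [FX.val, FOp.fn, BigOp.fn]
  congr 1
  · rw [h.reg7, prod_range]
    refine prod_congr rfl fun k _ => ?_
    have e1 : st.narr 10 [(c.1 : ℕ), (k : ℕ)] = _ := (hx k).1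
    have e2 : st.narr 11 [(c.2 : ℕ), (k : ℕ)] = _ := (hx k).2
    have e3 : st.narr 10 [((tupleCode n1 n2 (r + 1) b).1 : ℕ), (k : ℕ)] = _ := (hb k).1
    have e4 : st.narr 11 [((tupleCode n1 n2 (r + 1) b).2 : ℕ), (k : ℕ)] = _ := (hb k).2
    simp only [eqInd, FX.val, NX.val, NRel.holds_eq, map_cons, map_nil, putReg_narr, reg_put]
    norm_num
    simp only [e1, e2, e3, e4, Prod.ext_iff, Fin.ext_iff, Fin.val_zero]
    by_cases hk : (k : ℕ) = 0
    · simp only [if_pos hk]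
      rfl
    simp only [if_neg hk]
    split_ifs <;> simp_all
  rw [Equiv.apply_symm_apply]
  rfl

lemma run_oracleMatrix (h8 : st.reg 8 = a) (h9 : st.reg 9 = b)
    (h14 : st.reg 14 = ℓ) : readMatrix ℓ ((oracleMatrix.run st).farr 21) =
      of fun i j : Fin ℓ => ∑ c : Fin a × Fin b, matAt (st.farr 17) [(i : ℕ)] c *
        matAt (st.farr 19) [(j : ℕ)] c := by
  obtain ⟨m, h1, h2, -⟩ := fill_run2 (A := 21) (pre := []) (i := 102) (j := 103) (n := 14) (k := 14)
    (e := FX.sum2 113 8 114 9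
      (FX.bin FOp.mul (FX.cell 17 [102, 113, 114]) (FX.cell 19 [103, 113, 114])))
    rfl (by decide) (by decide) (by decide) (by decide) (by decide) (by simp) (by simp) st
  rw [oracleMatrix, h1]
  ext i j
  refine (congrFun ((setArr_farr st 21 m 21).trans (if_pos rfl)) _).trans ?_
  refine (h2 i (by omega) j (by omega)).trans ?_
  exact FX.val_sum2 (p := 8) (q := 9) (by decide) _ ((st.putReg 102 i).putReg 103 j) h8 h9

lemma dualValid_gsG : gsG.DualValid 18 19 14 (below 30) (fun A => A == 18) := by
  refine ⟨?_, ?_, ?_, ?_, ?_, ?_, ?_, ?_, ?_, ?_, ?_⟩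
  · constructor <;> simp [gsG]
  all_goals first | rfl | decide

/-- The basis of the lifted space in array 14. -/
def liftBasis (st : MState 𝕜) (n1 n2 d s : ℕ) : Fin s → (Fin d → Fin n1 × Fin n2) → 𝕜 :=
  fun i x => matAt (st.farr 14) [(i : ℕ)] (tupleCode n1 n2 d x)

lemma run_prepare {s : ℕ} (hr : 0 < r) (hn1 : 0 < n1) (hn2 : 0 < n2)
    (h : Tables st n1 n2 (r + 1)) (h14 : st.reg 14 = ℓ) (h15 : st.reg 15 = s)
    {u : Fin ℓ → MatSpace 𝕜 n1 n2} (hu : ∀ i : Fin ℓ, matAt (st.farr 10) [(i : ℕ)] = u i)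
    {f g : ℕ → 𝕜} (hf : ∀ i, st.farr 1 [i] = f i) (hg : ∀ i, st.farr 2 [i] = g i)
    (hP : ∀ i, liftBasis st n1 n2 (r + 1) s i ∈ tensorPow (span 𝕜 (range u)) (r + 1))
    {x : Fin ℓ → MatSpace 𝕜 n1 n2} {z : Fin ℓ → Fin s → 𝕜}
    (hx : Recovers (liftBasis st n1 n2 (r + 1) s) (fun i => f i) (fun i => g i) x z) :
    ∃ ρ : Fin ℓ → 𝕜, Injective ρ ∧ IsUnit (of fun i a => hdot (u i) (x a)) ∧
      readMatrix ℓ ((prepare.run st).farr 21) * (of fun i a => hdot (u i) (x a)) =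
        (of fun i a => hdot (u i) (x a)) * diagonal ρ := by
  have hX := isUnit_hdot hx.indep (hx.mem_span hr hP)
  refine ⟨_, hx.good.ratio, hX, ?_⟩
  set X := of fun i a => hdot (u i) (x a) with hXdef
  obtain ⟨m1, hm1, hm1'⟩ := run_combine (A := 15) (f := 1) (by decide) h.reg8 h.reg9 h15
  set s1 := st.setArr 15 m1 with hs1
  obtain ⟨m2, hm2, hm2'⟩ := run_combine (A := 16) (f := 2) (by decide) (st := s1) h.reg8 h.reg9 h15
  set s2 := s1.setArr 16 m2 with hs2
  have h2 : Tables s2 n1 n2 (r + 1) := h.congr (fun _ _ => rfl) rfl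
  obtain ⟨m3, hm3, hm3'⟩ := run_contract (A := 17) (F := 15) (by decide) h2 h14
  set s3 := s2.setArr 17 m3 with hs3
  have h3 : Tables s3 n1 n2 (r + 1) := h.congr (fun _ _ => rfl) rfl
  obtain ⟨m4, hm4, hm4'⟩ := run_contract (A := 18) (F := 16) (by decide) h3 h14
  set s4 := s3.setArr 18 m4 with hs4
  have h4 : Tables s4 n1 n2 (r + 1) := h.congr (fun _ _ => rfl) rfl
  have hne : Nonempty (Fin n1 × Fin n2) := ⟨⟨⟨0, hn1⟩, ⟨0, hn2⟩⟩⟩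
  set y : Fin ℓ → Fin (n1 ^ (r + 1)) × Fin (n2 ^ (r + 1)) → 𝕜 := fun a =>
    coded (tailPow r (x a)) with hy
  have hyi : LinearIndependent 𝕜 y := by
    have := (linearIndependent_tailPow hr hx.indep).map'
      (LinearEquiv.funCongrLeft 𝕜 𝕜 (tupleCode n1 n2 (r + 1)).symm).toLinearMap
      (LinearEquiv.ker _)
    exact this
  have key : ∀ (q : ℕ → 𝕜) (m m' : List ℕ → 𝕜),
      (∀ c : Fin (n1 ^ (r + 1)) × Fin (n2 ^ (r + 1)), matAt m [] c =
        ∑ i : Fin s, q i * matAt (st.farr 14) [(i : ℕ)] c) →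
      (∀ (i : Fin ℓ) (b : Fin (r + 1) → Fin n1 × Fin n2),
        matAt m' [(i : ℕ)] (tupleCode n1 n2 (r + 1) b) = slotContr (u i)
          (fun x => matAt m [] (tupleCode n1 n2 (r + 1) x)) b) →
      ∀ i : Fin ℓ, (matAt m' [(i : ℕ)] : Fin (n1 ^ (r + 1)) × Fin (n2 ^ (r + 1)) → 𝕜) =
        ∑ a, (X i a * ∑ j : Fin s, q j * z a j) • y a := by
    intro q m m' hm hm' i
    funext c
    obtain ⟨b, rfl⟩ := (tupleCode n1 n2 (r + 1)).surjective c
    have e1 : (fun x => matAt m [] (tupleCode n1 n2 (r + 1) x)) =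
        ∑ a, (∑ j : Fin s, q j * z a j) • powTensor (r + 1) (x a) := by
      funext t
      rw [hm]
      have e2 : ∀ j : Fin s, matAt (st.farr 14) [(j : ℕ)] (tupleCode n1 n2 (r + 1) t) =
          (∑ a, z a j • powTensor (r + 1) (x a)) t := fun j => congrFun (hx.eq_sum j) t
      simp only [e2, Finset.sum_apply, Pi.smul_apply, smul_eq_mul, mul_sum, sum_mul, mul_assoc]
      exact sum_comm
    rw [hm', e1, slotContr_sum]
    simp only [slotContr_powTensor, Finset.sum_apply, Pi.smul_apply, smul_eq_mul, hy, coded,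
      Equiv.symm_apply_apply, hXdef, of_apply]
    exact sum_congr rfl fun a _ => by ring
  have hF := key f m1 m3 (fun c => by rw [hm1' c]; simp only [hf])
    (fun i b => by rw [hm3' i b, ← hu i]; rfl)
  have hG := key g m2 m4 (fun c => by
      rw [hm2' c]
      refine sum_congr rfl fun i _ => ?_
      rw [← hg]
      rfl) (fun i b => by rw [hm4' i b, ← hu i]; rfl)
  have hψ := hx.good.right_ne
  have hXψ : IsUnit (of fun i a => X i a * ∑ j : Fin s, g j * z a j) := by
    have : (of fun i a => X i a * ∑ j : Fin s, g j * z a j) =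
        X * diagonal fun a => ∑ j : Fin s, g j * z a j := by
      ext i a
      simp [Matrix.mul_diagonal]
    rw [this]
    refine hX.mul ?_
    rw [Matrix.isUnit_diagonal, Pi.isUnit_iff]
    exact fun a => (hψ a).isUnit
  have hGi : LinearIndependent 𝕜 fun i : Fin ℓ => (matAt (s4.farr 18) [(i : ℕ)] :
      Fin (n1 ^ (r + 1)) × Fin (n2 ^ (r + 1)) → 𝕜) := by
    convert linearIndependent_sum_smul hyi hXψ using 2 with i
    exact hG i
  have hK := GS.dual_run dualValid_gsG h4.reg8 h4.reg9 h4.reg10.ge h14 hGi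
  have a₅ := (gsG.dual 18 19 14).agree_run (R := below 30) (V := fun A => A == 17) rfl (by rfl) s4
  set s₅ := (gsG.dual 18 19 14).run s4 with hs₅
  have hrun : prepare.run st = oracleMatrix.run s₅ := by
    simp only [prepare, Prog.run]
    rw [hm1, hm2, hm3, hm4]
  have h₅ := h4.congr a₅.reg a₅.narr
  rw [hrun, run_oracleMatrix h₅.reg8 h₅.reg9 ((a₅.reg 14 rfl).symm.trans h14), ← a₅.farr 17 rfl]
  exact oracleMatrix_mul hψ hF hG hK

end Program

namespace Program

lemma val_powCell {A m m' : ℕ} (ha : a < 115) (hm : m < 115) (hm' : m' < 115)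
    (h7 : s.reg 7 = d) {x : Fin d → Fin n1 × Fin n2} (hx : Digs s m m' x) :
    (powCell A a m m').val s = powTensor d (matAt (s.farr A) [s.reg a] : MatSpace 𝕜 n1 n2) x := by
  have h1 : ∀ i < 115, i ≠ 115 ∧ i ≠ 116 ∧ i ≠ 117 := by omega
  simp only [powCell, FX.val, BigOp.fn, h7, prod_range, powTensor]
  refine prod_congr rfl fun k _ => ?_
  simp only [NX.val, reg_put, putReg_narr, putReg_farr, map_cons, map_nil, h1 a ha,
    h1 m hm, h1 m' hm', if_false]
  norm_num
  rw [(hx k).1, (hx k).2]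
  rfl

lemma run_candidates (h4 : st.reg 4 = n1) (h5 : st.reg 5 = n2)
    (h14 : st.reg 14 = ℓ) {u : Fin ℓ → MatSpace 𝕜 n1 n2}
    (hu : ∀ i : Fin ℓ, matAt (st.farr 10) [(i : ℕ)] = u i) :
    ∃ m, candidates.run st = st.setArr 3 m ∧ ∀ b : Fin ℓ, matAt m [(b : ℕ)] =
      ∑ i, (readMatrix ℓ (st.farr 22) i b / hdot (u i) (u i)) • u i := by
  obtain ⟨m, h1, h2⟩ := fill_run3 (A := 3) (a := 102) (i := 110) (j := 111) (l := 14) (n := 4)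
    (k := 5) (e := FX.big BigOp.sum 112 14
    (FX.bin FOp.mul (FX.bin FOp.div (FX.cell 22 [112, 102]) (rowNorm gsU))
      (FX.cell 10 [112, 110, 111]))) rfl (by decide) (by decide) (by decide)
    (by decide) (by decide) (by decide) st
  refine ⟨m, h1, fun b => funext fun c => ?_⟩
  refine (h2 b (by omega) c.1 (by omega) c.2 (by omega)).trans ?_
  simp only [FX.val, BigOp.fn, FOp.fn]
  rw [show (((st.putReg 102 b).putReg 110 c.1).putReg 111 c.2).reg 14 = ℓ from h14,
    sum_range, Finset.sum_apply]
  refine sum_congr rfl fun i _ => ?_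
  rw [val_rowNorm valid_gsU (a := n1) (b := n2)
    (s := (((st.putReg 102 b).putReg 110 c.1).putReg 111 c.2).putReg 112 i) h4 h5, Pi.smul_apply, smul_eq_mul, ← hu i]
  rfl

lemma run_coefficients {s : ℕ} (h : Tables st n1 n2 d)
    (h14 : st.reg 14 = ℓ) (h15 : st.reg 15 = s) :
    ∃ m, coefficients.run st = st.setArr 26 m ∧ ∀ (b : Fin ℓ) (i : Fin s), m [(b : ℕ), (i : ℕ)] =
      tensorEval (fun _ => matAt (st.farr 24) [(b : ℕ)]) (liftBasis st n1 n2 d s i) := by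
  obtain ⟨m, h1, h2, -⟩ := fill_run2 (A := 26) (pre := []) (i := 102) (j := 103) (n := 14) (k := 15)
    (e := FX.sum2 113 8 114 9 (FX.bin FOp.mul (FX.cell 14 [103, 113, 114])
      (powCell 24 102 113 114)))
    rfl (by decide) (by decide) (by decide) (by decide) (by decide) (by simp) (by simp) st
  refine ⟨m, h1, fun b i => ?_⟩
  refine (h2 b (by omega) i (by omega)).trans ?_
  have h := (h.putReg (i := 102) (by decide) b).putReg (i := 103) (by decide) i
  rw [FX.val_sum2 (by decide) _ _ h.reg8 h.reg9, tensorEval_apply]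
  refine sum_equiv (tupleCode n1 n2 d).symm _ _ fun c => ?_
  have h := (h.putReg (i := 113) (by decide) c.1).putReg (i := 114) (by decide) c.2
  simp only [FX.val, FOp.fn]
  rw [val_powCell (by decide) (by decide) (by decide) h.reg7 (h.digs (c := c) rfl rfl), mul_comm,
    liftBasis, Equiv.apply_symm_apply]
  rfl

lemma val_dualError (h4 : s.reg 4 = n1) (h5 : s.reg 5 = n2)
    (h14 : s.reg 14 = ℓ) : dualError.val s = 0 ↔
      IsDualTo (fun i : Fin ℓ => (matAt (s.farr 3) [(i : ℕ)] : MatSpace 𝕜 n1 n2))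
        fun i : Fin ℓ => matAt (s.farr 24) [(i : ℕ)] := by
  set E : Fin ℓ × Fin ℓ → 𝕜 := fun c => (∑ i : Fin n1 × Fin n2,
    matAt (s.farr 24) [(c.1 : ℕ)] i * matAt (s.farr 3) [(c.2 : ℕ)] i) - if c.1 = c.2 then 1 else 0
    with hE
  have : dualError.val s = hdot E E := by
    refine (FX.val_sum2 (p := 14) (q := 14) (by decide) _ s h14 h14).trans
      (sum_congr rfl fun c _ => ?_)
    have h : FX.val (FX.bin FOp.sub (FX.sum2 113 4 114 5 (FX.bin FOp.mul
        (FX.cell 24 [102, 113, 114]) (FX.cell 3 [103, 113, 114])))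
        (eqInd (NX.reg 102) (NX.reg 103))) ((s.putReg 102 c.1).putReg 103 c.2) = E c := by
      simp only [FX.val, FOp.fn]
      congr 1
      · exact FX.val_sum2 (p := 4) (q := 5) (by decide) _ ((s.putReg 102 c.1).putReg 103 c.2) h4 h5
      exact if_congr (Fin.ext_iff (a := c.1) (b := c.2)).symm rfl rfl
    simp only [sq, FX.val, FOp.fn] at h ⊢
    rw [h]
  rw [this, hdot_self_eq_zero, funext_iff, Prod.forall]
  simp only [hE, Pi.zero_apply, sub_eq_zero]
  rfl

lemma val_powError {k : ℕ} (h : Tables s n1 n2 d) (h14 : s.reg 14 = ℓ)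
    (h15 : s.reg 15 = k) : powError.val s = 0 ↔
      ∀ i, liftBasis s n1 n2 d k i = ∑ a : Fin ℓ, s.farr 26 [(a : ℕ), (i : ℕ)] •
        powTensor d (matAt (s.farr 3) [(a : ℕ)]) := by
  set E : Fin k × (Fin d → Fin n1 × Fin n2) → 𝕜 := fun c => liftBasis s n1 n2 d k c.1 c.2 -
    ∑ a : Fin ℓ, s.farr 26 [(a : ℕ), (c.1 : ℕ)] * powTensor d (matAt (s.farr 3) [(a : ℕ)]) c.2
    with hE
  have : powError.val s = hdot E E := by
    simp only [powError, FX.val, BigOp.fn]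
    rw [h15, sum_range, hdot, Fintype.sum_prod_type]
    refine sum_congr rfl fun i _ => ?_
    have h := h.putReg (i := 103) (by decide) i
    rw [FX.val_sum2 (by decide) _ _ h.reg8 h.reg9]
    refine sum_equiv (tupleCode n1 n2 d).symm _ _ fun c => ?_
    have h := (h.putReg (i := 110) (by decide) c.1).putReg (i := 111) (by decide) c.2
    have e1 : FX.val (FX.bin FOp.sub (FX.cell 14 [103, 110, 111]) (FX.big BigOp.sum 102 14
        (FX.bin FOp.mul (FX.cell 26 [102, 103]) (powCell 3 102 110 111))))
        (((s.putReg 103 i).putReg 110 c.1).putReg 111 c.2) =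
        E (i, (tupleCode n1 n2 d).symm c) := by
      simp only [FX.val, FOp.fn, BigOp.fn, hE, liftBasis, Equiv.apply_symm_apply]
      rw [show (((s.putReg 103 i).putReg 110 c.1).putReg 111 c.2).reg 14 = ℓ from h14, sum_range]
      congr 1
      refine sum_congr rfl fun a _ => ?_
      have h := h.putReg (i := 102) (by decide) a
      rw [val_powCell (by decide) (by decide) (by decide) h.reg7 (h.digs (c := c) rfl rfl)]
      rfl
    simp only [sq, FX.val, FOp.fn] at e1 ⊢
    rw [e1]
  rw [this, hdot_self_eq_zero, funext_iff, Prod.forall]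
  simp only [hE, Pi.zero_apply, sub_eq_zero, funext_iff (α := Fin d → Fin n1 × Fin n2),
    Finset.sum_apply, Pi.smul_apply, smul_eq_mul]

lemma val_genericity {k : ℕ} (h14 : s.reg 14 = ℓ) (h15 : s.reg 15 = k) :
    genericity.val s ≠ 0 ↔ GoodPair (fun (a : Fin ℓ) (i : Fin k) => s.farr 26 [(a : ℕ), (i : ℕ)])
      (fun i => s.farr 1 [(i : ℕ)]) fun i => s.farr 2 [(i : ℕ)] := by
  set p : ℕ → Fin ℓ → 𝕜 := fun f a => ∑ i : Fin k, s.farr f [(i : ℕ)] * s.farr 26 [(a : ℕ), (i : ℕ)]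
    with hp
  have hval : ∀ (f i : ℕ) (s' : MState 𝕜) (a : Fin ℓ), i ≠ 104 → s'.reg 15 = k → s'.farr = s.farr →
      s'.reg i = a → (pairing f i).val s' = p f a := by
    intro f i s' a hi h15' hf ha
    simp only [pairing, FX.val, BigOp.fn, FOp.fn, h15', sum_range, putReg_farr, hf,
      map_cons, map_nil, reg_put, if_neg hi, ha, hp, if_true]
  have : genericity.val s = ∏ a : Fin ℓ, (p 1 a * p 2 a *
      ∏ b : Fin ℓ, if a = b then 1 else p 1 a * p 2 b - p 1 b * p 2 a) := by
    simp only [genericity, FX.val, BigOp.fn, FOp.fn, h14, prod_range]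
    refine prod_congr rfl fun a _ => ?_
    rw [hval 1 102 (s.putReg 102 a) a (by decide) h15 rfl rfl,
      hval 2 102 (s.putReg 102 a) a (by decide) h15 rfl rfl,
      show (s.putReg 102 a).reg 14 = ℓ from h14]
    congr 1
    refine prod_congr rfl fun b _ => ?_
    have h15 : ((s.putReg 102 a).putReg 103 b).reg 15 = k := h15
    rw [hval 1 102 _ a (by decide) h15 rfl rfl, hval 2 102 _ a (by decide) h15 rfl rfl,
      hval 1 103 _ b (by decide) h15 rfl rfl, hval 2 103 _ b (by decide) h15 rfl rfl]
    exact if_congr (Fin.ext_iff (a := a) (b := b)).symm rfl rfl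
  rw [this, Finset.prod_ne_zero_iff]
  simp only [mul_ne_zero_iff, Finset.prod_ne_zero_iff, mem_univ, true_implies]
  constructor
  · intro h
    refine ⟨fun a => (h a).1.1, fun a => (h a).1.2, fun a b hab => ?_⟩
    by_contra hne
    have h1 := (h a).2 b
    rw [if_neg hne, sub_ne_zero] at h1
    exact h1 ((div_eq_div_iff (h a).1.2 (h b).1.2).1 hab)
  rintro ⟨h1, h2, h3⟩ a
  refine ⟨⟨h1 a, h2 a⟩, fun b => ?_⟩
  split_ifs with hab
  · exact one_ne_zero
  rw [sub_ne_zero]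
  exact fun h => hab (h3 ((div_eq_div_iff (h2 a) (h2 b)).2 h))

lemma run_verify {k : ℕ} (h : Tables s n1 n2 d) (h14 : s.reg 14 = ℓ)
    (h15 : s.reg 15 = k) : ∃ q, verify.run s = s.putReg 38 q ∧ (q ≠ 0 ↔ k = ℓ ∧
      IsDualTo (fun i : Fin ℓ => (matAt (s.farr 3) [(i : ℕ)] : MatSpace 𝕜 n1 n2))
        (fun i : Fin ℓ => matAt (s.farr 24) [(i : ℕ)]) ∧
      (∀ i, liftBasis s n1 n2 d k i = ∑ a : Fin ℓ, s.farr 26 [(a : ℕ), (i : ℕ)] •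
        powTensor d (matAt (s.farr 3) [(a : ℕ)])) ∧
      GoodPair (fun (a : Fin ℓ) (i : Fin k) => s.farr 26 [(a : ℕ), (i : ℕ)])
        (fun i => s.farr 1 [(i : ℕ)]) fun i => s.farr 2 [(i : ℕ)]) := by
  rw [← val_dualError h.reg4 h.reg5 h14, ← val_powError h h14 h15, ← val_genericity h14 h15]
  have hv : FX.val (FX.ite NRel.eq (NX.reg 15) (NX.reg 14)
      (FX.iteZero dualError (FX.iteZero powError (FX.iteZero genericity FX.one FX.zero) FX.one)
        FX.one) FX.one) s = if k = ℓ ∧ dualError.val s = 0 ∧ powError.val s = 0 ∧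
          genericity.val s ≠ 0 then 0 else 1 := by
    simp only [FX.val, NX.val, NRel.holds_eq, h14, h15]
    split_ifs <;> simp_all
  simp only [verify, Prog.run]
  rw [hv]
  split_ifs with h1 h2 h2
  · exact ⟨1, rfl, by simpa using h1⟩
  · exact absurd rfl h2
  · exact absurd h2 one_ne_zero
  exact ⟨0, rfl, by simpa using h1⟩

lemma dualValid_gsX : gsX.DualValid 3 24 14 (below 30) (fun A => A == 3) := by
  refine ⟨?_, ?_, ?_, ?_, ?_, ?_, ?_, ?_, ?_, ?_, ?_⟩
  · constructor <;> simp [gsX]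
  all_goals first | rfl | decide

lemma run_recover {s : ℕ} (h : Tables st n1 n2 (r + 1)) (h14 : st.reg 14 = ℓ)
    (h15 : st.reg 15 = s) {f g : ℕ → 𝕜} (hf : ∀ i, st.farr 1 [i] = f i)
    (hg : ∀ i, st.farr 2 [i] = g i) (hst' : st' = recover.run st) :
    (st'.reg 38 ≠ 0 → (∃ z, Recovers (liftBasis st n1 n2 (r + 1) s) (fun i => f i) (fun i => g i)
        (fun b : Fin ℓ => matAt (st'.farr 3) [(b : ℕ)]) z) ∧
      IsDualTo (fun b : Fin ℓ => (matAt (st'.farr 3) [(b : ℕ)] : MatSpace 𝕜 n1 n2))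
        fun b => matAt (st'.farr 24) [(b : ℕ)]) ∧
    ∀ {u : Fin ℓ → MatSpace 𝕜 n1 n2}, (∀ i : Fin ℓ, matAt (st.farr 10) [(i : ℕ)] = u i) →
      (∀ i, u i ≠ 0) → (∀ i j, i ≠ j → hdot (u i) (u j) = 0) →
      ∀ {x : Fin ℓ → MatSpace 𝕜 n1 n2} {z : Fin ℓ → Fin s → 𝕜},
      Recovers (liftBasis st n1 n2 (r + 1) s) (fun i => f i) (fun i => g i) x z →
      (∀ a, x a ∈ span 𝕜 (range u)) →
      ∀ {σ : Perm (Fin ℓ)} {c : Fin ℓ → 𝕜}, (∀ b, c b ≠ 0) →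
      (∀ i b, readMatrix ℓ (st.farr 22) i b = c b * hdot (u i) (x (σ b))) → st'.reg 38 ≠ 0 := by
  obtain ⟨m1, hm1, hm1'⟩ := run_candidates (st := st) (n1 := n1) (n2 := n2) (ℓ := ℓ) h.reg4 h.reg5
    h14 (u := fun i => matAt (st.farr 10) [(i : ℕ)]) fun _ => rfl
  set s1 := st.setArr 3 m1 with hs1
  have h1 : Tables s1 n1 n2 (r + 1) := h.congr (fun _ _ => rfl) rfl
  have a2 := (gsX.dual 3 24 14).agree_run (R := below 30)
    (V := fun A => A == 1 || A == 2 || A == 3 || A == 14) rfl (by rfl) s1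
  have hdual := GS.dual_run dualValid_gsX (a := n1) (b := n2) (st := s1) (N := ℓ) h1.reg4
    h1.reg5 h1.reg6.ge h14
  set s2 := (gsX.dual 3 24 14).run s1 with hs2
  have h2 : Tables s2 n1 n2 (r + 1) := h1.congr a2.reg a2.narr
  have h142 : s2.reg 14 = ℓ := (a2.reg 14 rfl).symm.trans h14
  have h152 : s2.reg 15 = s := (a2.reg 15 rfl).symm.trans h15
  obtain ⟨m3, hm3, hm3'⟩ := run_coefficients h2 h142 h152
  set s3 := s2.setArr 26 m3 with hs3
  have h3 : Tables s3 n1 n2 (r + 1) := h2.congr (fun _ _ => rfl) rfl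
  obtain ⟨q, hq, hq'⟩ := run_verify h3 (ℓ := ℓ) (k := s) h142 h152
  have hrun : st' = s3.putReg 38 q := by
    rw [hst']
    simp only [recover, Prog.run]
    rw [hm1, hm3, hq]
  have h38 : st'.reg 38 = q := by rw [hrun]; rfl
  have hf3 : s3.farr 3 = m1 := (a2.farr 3 rfl).symm
  have hP : liftBasis s3 n1 n2 (r + 1) s = liftBasis st n1 n2 (r + 1) s := by
    unfold liftBasis
    rw [show s3.farr 14 = st.farr 14 from (a2.farr 14 rfl).symm]
  have hff : (fun i : Fin s => s3.farr 1 [(i : ℕ)]) = fun i : Fin s => f i := by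
    rw [show s3.farr 1 = st.farr 1 from (a2.farr 1 rfl).symm]
    simp only [hf]
  have hgg : (fun i : Fin s => s3.farr 2 [(i : ℕ)]) = fun i : Fin s => g i := by
    rw [show s3.farr 2 = st.farr 2 from (a2.farr 2 rfl).symm]
    simp only [hg]
  rw [hP, hff, hgg] at hq'
  rw [h38]
  refine ⟨fun h => ?_, fun {u} hu hne ho x z hx hxu σ c hc hQ => hq'.2 ?_⟩
  · obtain ⟨e1, e2, e3, e4⟩ := hq'.1 h
    rw [hrun]
    exact ⟨⟨_, e1, linearIndependent_of_isDualTo e2, e3, e4⟩, e2⟩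
  have hx' : ∀ b : Fin ℓ, matAt m1 [(b : ℕ)] = c b • x (σ b) := by
    intro b
    rw [hm1' b, (isDualTo_of_orthogonal hne ho).eq_sum (hxu (σ b)), Finset.smul_sum]
    refine sum_congr rfl fun i _ => ?_
    rw [hQ, smul_smul, hu]
    congr 1
    rw [hdot, mul_sum, sum_div, mul_sum]
    exact sum_congr rfl fun j _ => by ring
  have hxi : LinearIndependent 𝕜 fun b : Fin ℓ => (matAt m1 [(b : ℕ)] : MatSpace 𝕜 n1 n2) := by
    rw [funext hx']
    exact (hx.indep.comp σ σ.injective).units_smul fun b => Units.mk0 (c b) (hc b)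
  have hd := hdual hxi
  have hres := hx.rescale σ hc (x' := fun b => matAt m1 [(b : ℕ)]) hx' hd
  have hz : (fun (b : Fin ℓ) (i : Fin s) => s3.farr 26 [(b : ℕ), (i : ℕ)]) =
      fun (b : Fin ℓ) i => tensorEval (fun _ => matAt (s2.farr 24) [(b : ℕ)])
        (liftBasis st n1 n2 (r + 1) s i) := by
    funext b i
    have := hm3' b i
    rw [← hP]
    exact this
  rw [hf3, hz]
  refine ⟨hres.card_eq, hd, fun i => ?_, hres.good⟩
  rw [hres.eq_sum i]
  refine sum_congr rfl fun a _ => ?_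
  rw [congrFun (congrFun hz a) i]

end Program

namespace Program

lemma run_output (st : MState 𝕜) (h2 : st.reg 2 = n3) (h4 : st.reg 4 = n1)
    (h5 : st.reg 5 = n2) (h14 : st.reg 14 = ℓ)
    (hT : HoldsTensor st T) :
    readOutput n1 n2 n3 (output.run st) = if st.reg 38 = 0 then none else
      some ⟨ℓ, fun a => matAt (st.farr 3) [(a : ℕ)], fun a k => ∑ i : Fin n1 × Fin n2,
        matAt (st.farr 24) [(a : ℕ)] i * T i k⟩ := by
  obtain ⟨m, h1, h₂, -⟩ := fill_run (A := 4) (idx := [102, 100]) (e := FX.sum2 113 4 114 5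
    (FX.bin FOp.mul (FX.cell 24 [102, 113, 114]) (FX.cell 0 [113, 114, 100]))) rfl
    [(100, 2), (102, 14)] st (by simp) (by simp) (by simp)
  have hrun : output.run st = ((st.setArr 4 m).putReg 0 (st.reg 38)).putReg 1 (st.reg 14) := by
    simp only [output, Prog.run]
    rw [h1]
    rfl
  rw [hrun]
  unfold readOutput
  refine if_congr Iff.rfl rfl (congrArg some ?_)
  subst h14
  have hw : (fun (a : Fin (st.reg 14)) (k : Fin n3) => m [(a : ℕ), (k : ℕ)]) =
      fun (a : Fin (st.reg 14)) k => ∑ i : Fin n1 × Fin n2, matAt (st.farr 24) [(a : ℕ)] i * T i k := by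
    funext a k
    refine (h₂ [(k : ℕ), (a : ℕ)] ⟨by omega, a.2, trivial⟩).trans ?_
    refine (FX.val_sum2 (p := 4) (q := 5) (by decide) _ ((st.putReg 100 k).putReg 102 a) h4
      h5).trans (sum_congr rfl fun c _ => ?_)
    rw [← hT c k]
    rfl
  exact congrArg (BlockList.mk (st.reg 14) fun a => matAt (st.farr 3) [(a : ℕ)]) hw

/-! ### The computation of the lifted space from the input -/

def stageN (st : MState 𝕜) : MState 𝕜 :=
  (sizeN.run ((st.putReg 4 (st.reg 0)).putReg 5 (st.reg 1))).putReg 6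
    ((sizeN.run ((st.putReg 4 (st.reg 0)).putReg 5 (st.reg 1))).reg 31)

def stageU (st : MState 𝕜) : MState 𝕜 :=
  ((slices.run st).putReg 14 ((slices.run st).reg 30)).putReg 7 ((slices.run st).reg 3 + 1)

def stageP (st : MState 𝕜) : MState 𝕜 :=
  ((powers.run st).putReg 8 ((powers.run st).reg 31)).putReg 9 ((powers.run st).reg 32)

def stageD (st : MState 𝕜) : MState 𝕜 := (sizeD.run st).putReg 10 ((sizeD.run st).reg 31)

def stageL (st : MState 𝕜) : MState 𝕜 := (lift.run st).putReg 15 ((lift.run st).reg 34)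

/-- The state in which the lifted space has been computed. -/
def lifted (st : MState 𝕜) : MState 𝕜 := stageL (stageD (stageP (stageU (stageN st))))

lemma agree_putReg (h : Agree visible V st st') (i : ℕ)
    {n n' : ℕ} (hn : n = n') : Agree visible V (st.putReg i n) (st'.putReg i n') := by
  subst hn
  exact (h.putReg i n).mono (fun j hj => by simp [hj]) fun _ h => h

lemma agree_lifted (h : Agree visible nonrandom st st') :
    Agree visible nonrandom (lifted st) (lifted st') := by
  have h1 := sizeN.run_agree scoped_sizeN
    (agree_putReg (agree_putReg h 4 (h.reg 0 rfl)) 5 (h.reg 1 rfl))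
  have h2 := slices.run_agree scoped_slices (agree_putReg h1 6 (h1.reg 31 rfl))
  have h3 := powers.run_agree scoped_powers
    (agree_putReg (agree_putReg h2 14 (h2.reg 30 rfl)) 7 (congrArg (· + 1) (h2.reg 3 rfl)))
  have h4 := sizeD.run_agree scoped_sizeD
    (agree_putReg (agree_putReg h3 8 (h3.reg 31 rfl)) 9 (h3.reg 32 rfl))
  have h5 := lift.run_agree scoped_lift (agree_putReg h4 10 (h4.reg 31 rfl))
  exact agree_putReg h5 15 (h5.reg 34 rfl)

/-- The orthogonal basis in array 10. -/
def sliceBasis (st : MState 𝕜) (n1 n2 : ℕ) : Fin (st.reg 14) → MatSpace 𝕜 n1 n2 :=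
  fun i => matAt (st.farr 10) [(i : ℕ)]

/-- What holds when the lifted space has been computed. -/
structure IsLifted (st : MState 𝕜) (r : ℕ) (T : TensorSpace 𝕜 n1 n2 n3) : Prop where
  tables : Tables st n1 n2 (r + 1)
  ne : ∀ i, sliceBasis st n1 n2 i ≠ 0
  orth : ∀ i j, i ≠ j → hdot (sliceBasis st n1 n2 i) (sliceBasis st n1 n2 j) = 0
  basis : IsBasisOf (sliceBasis st n1 n2) (sliceSpan T)
  lift : IsBasisOf (liftBasis st n1 n2 (r + 1) (st.reg 15))
    (liftedSpace (r + 1) (minors 𝕜 n1 n2 r) (sliceBasis st n1 n2))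
  card : st.reg 14 ≤ n1 * n2

/-- The registers that are kept up to the computation of the lifted space. -/
def keptRegs (i : ℕ) : Bool := below 30 i || i == 33 || i == 34

lemma stageN_spec (h0 : st.reg 0 = n1) (h1 : st.reg 1 = n2) :
    stageN st = (((st.putReg 4 n1).putReg 5 n2).putReg 31 (n1 * n2)).putReg 6 (n1 * n2) := by
  have e1 : sizeN.run ((st.putReg 4 n1).putReg 5 n2) =
      ((st.putReg 4 n1).putReg 5 n2).putReg 31 (n1 * n2) := by
    rw [run_sizeN]
    rfl
  rw [stageN, h0, h1, e1]
  rfl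

lemma stageU_reg (st : MState 𝕜) {i : ℕ} (hi : keptRegs i = true) (h14 : i ≠ 14) (h7 : i ≠ 7) :
    (stageU st).reg i = st.reg i := by
  rw [stageU, reg_put, if_neg h7, reg_put, if_neg h14]
  exact slices.run_keeps_reg (R := keptRegs) (V := fun _ => false) rfl st hi

lemma stageD_stageP (st : MState 𝕜) : ∃ s, stageD (stageP st) = s ∧ s.farr = st.farr ∧
    s.reg 8 = st.reg 4 ^ st.reg 7 ∧ s.reg 9 = st.reg 5 ^ st.reg 7 ∧
    s.reg 10 = st.reg 4 ^ st.reg 7 * st.reg 5 ^ st.reg 7 ∧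
    ∀ i, keptRegs i = true → i ≠ 8 → i ≠ 9 → i ≠ 10 → s.reg i = st.reg i := by
  have p := run_powers st
  have k := powers.agree_run (R := keptRegs) (V := fun _ => true) rfl rfl st
  have e : stageP st = ((powers.run st).putReg 8 (st.reg 4 ^ st.reg 7)).putReg 9
      (st.reg 5 ^ st.reg 7) := by
    rw [stageP, p.1, p.2]
  refine ⟨_, rfl, ?_⟩
  rw [stageD, run_sizeD, e]
  refine ⟨funext fun A => (k.farr A rfl).symm, rfl, rfl, rfl, fun i hi h8 h9 h10 => ?_⟩
  have h31 : i ≠ 31 := by rintro rfl; exact absurd hi (by decide)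
  rw [reg_put, if_neg h10, reg_put, if_neg h31, reg_put, if_neg h9, reg_put, if_neg h8]
  exact (k.reg i hi).symm

lemma isLifted_stageL (hn1 : 0 < n1) (hn2 : 0 < n2) (h4 : st.reg 4 = n1)
    (h5 : st.reg 5 = n2) (h6 : st.reg 6 = n1 * n2) (h7 : st.reg 7 = r + 1)
    (h8 : st.reg 8 = n1 ^ (r + 1)) (h9 : st.reg 9 = n2 ^ (r + 1))
    (h10 : st.reg 10 = n1 ^ (r + 1) * n2 ^ (r + 1))
    (hO : OrthoRows (n1 * n2) (fun k => (matAt (st.farr 10) [k] : MatSpace 𝕜 n1 n2)) (st.reg 14)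
      (sliceSpan T))
    (h33 : st.reg 33 = 0) (h34 : st.reg 34 = 0) (hf13 : st.farr 13 = fun _ => 0)
    (hf14 : st.farr 14 = fun _ => 0) : IsLifted (stageL st) r T := by
  have ho : ∀ i j : Fin (st.reg 14), i ≠ j → hdot (sliceBasis st n1 n2 i) (sliceBasis st n1 n2 j) = 0 :=
    fun i j hij => hO.orth i i.2 j j.2 fun h => hij (Fin.ext h)
  have hne : ∀ i, sliceBasis st n1 n2 i ≠ 0 := fun i => hO.ne i i.2
  have hL := run_lift hn1 hn2 h4 h5 h6 h7 h8 h9 h10 rfl (u := sliceBasis st n1 n2) (fun _ => rfl)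
    hne ho h33 h34 hf13 hf14
  have k14 : (lift.run st).reg 14 = st.reg 14 :=
    lift.run_keeps_reg (R := below 30) (V := fun A => A == 10) rfl st rfl
  have k10 : (lift.run st).farr 10 = st.farr 10 :=
    lift.run_keeps_farr (R := below 30) (V := fun A => A == 10) rfl st rfl
  have key : ∀ {ℓ : ℕ} (h : ℓ = st.reg 14) (v : Fin ℓ → MatSpace 𝕜 n1 n2),
      v = (fun i => sliceBasis st n1 n2 (Fin.cast h i)) → (∀ i, v i ≠ 0) ∧
        (∀ i j, i ≠ j → hdot (v i) (v j) = 0) ∧ IsBasisOf v (sliceSpan T) ∧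
        liftedSpace (r + 1) (minors 𝕜 n1 n2 r) v =
          liftedSpace (r + 1) (minors 𝕜 n1 n2 r) (sliceBasis st n1 n2) := by
    rintro ℓ rfl v rfl
    exact ⟨hne, ho, hO.isBasisOf, rfl⟩
  obtain ⟨c1, c2, c3, c4⟩ := key k14 (fun i => matAt ((lift.run st).farr 10) [(i : ℕ)])
    (by rw [k10]; rfl)
  have ht := hL.1
  refine ⟨⟨ht.reg4, ht.reg5, ht.reg6, ht.reg7, ht.reg8, ht.reg9, ht.reg10, ht.digits1, ht.digits2⟩,
    c1, c2, c3, Eq.mpr (congrArg (IsBasisOf _) c4) hL.2, ?_⟩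
  have := hO.le_card
  rw [Fintype.card_prod, card_fin, card_fin] at this
  exact k14.trans_le this

lemma isLifted_lifted (hn1 : 0 < n1) (hn2 : 0 < n2) (T : TensorSpace 𝕜 n1 n2 n3)
    (f g : Fin N → 𝕜) : IsLifted (lifted (initState r T f g)) r T := by
  have hzero : ∀ i, 2 < i → (initState r T f g).farr i = fun _ => 0 := by
    intro i hi
    funext idx
    simp only [initState]
    split <;> first | omega | rfl
  have hT : HoldsTensor (initState r T f g) T := by
    intro i k
    simp [initState]
  have h0 : (initState r T f g).reg 0 = n1 := rfl
  have h1 : (initState r T f g).reg 1 = n2 := rfl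
  have h2 : (initState r T f g).reg 2 = n3 := rfl
  have h3 : (initState r T f g).reg 3 = r := rfl
  have hreg : ∀ i, 3 < i → (initState r T f g).reg i = 0 := by
    intro i hi
    simp only [initState]
    rw [if_neg (by omega), if_neg (by omega), if_neg (by omega), if_neg (by omega)]
  rw [lifted]
  generalize initState r T f g = st at *
  have e := stageN_spec h0 h1
  have q2 : (stageN st).reg 2 = n3 := by rw [e]; exact h2
  have q3 : (stageN st).reg 3 = r := by rw [e]; exact h3
  have q4 : (stageN st).reg 4 = n1 := by rw [e]; rfl
  have q5 : (stageN st).reg 5 = n2 := by rw [e]; rfl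
  have q6 : (stageN st).reg 6 = n1 * n2 := by rw [e]; rfl
  have q30 : (stageN st).reg 30 = 0 := by rw [e]; exact hreg 30 (by decide)
  have q33 : (stageN st).reg 33 = 0 := by rw [e]; exact hreg 33 (by decide)
  have q34 : (stageN st).reg 34 = 0 := by rw [e]; exact hreg 34 (by decide)
  have qf : (stageN st).farr = st.farr := by rw [e]; rfl
  have qT : HoldsTensor (stageN st) T := by
    intro i k
    rw [qf]
    exact hT i k
  generalize stageN st = s at *
  have hO := run_slices q2 q4 q5 q6 q30 (qf ▸ hzero 10 (by decide)) qT
  have k6 : (slices.run s).reg 6 = n1 * n2 :=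
    (slices.run_keeps_reg (R := keptRegs) (V := fun _ => false) rfl s rfl).trans q6
  have kf : ∀ A, (A == 13 || A == 14) = true → (stageU s).farr A = st.farr A := by
    intro A hA
    rw [← qf]
    exact slices.run_keeps_farr (R := keptRegs) (V := fun A => A == 13 || A == 14) rfl s hA
  have hO' : OrthoRows (n1 * n2) (fun k => (matAt ((stageU s).farr 10) [k] : MatSpace 𝕜 n1 n2))
      ((stageU s).reg 14) (sliceSpan T) := by
    rw [← k6]
    exact hO
  have u4 := (stageU_reg s (i := 4) rfl (by decide) (by decide)).trans q4
  have u5 := (stageU_reg s (i := 5) rfl (by decide) (by decide)).trans q5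
  have u6 := (stageU_reg s (i := 6) rfl (by decide) (by decide)).trans q6
  have u33 := (stageU_reg s (i := 33) rfl (by decide) (by decide)).trans q33
  have u34 := (stageU_reg s (i := 34) rfl (by decide) (by decide)).trans q34
  have u7 : (stageU s).reg 7 = r + 1 := by
    change (slices.run s).reg 3 + 1 = _
    rw [slices.run_keeps_reg (R := keptRegs) (V := fun _ => false) rfl s (i := 3) rfl, q3]
  have f13 := (kf 13 rfl).trans (hzero 13 (by decide))
  have f14 := (kf 14 rfl).trans (hzero 14 (by decide))
  generalize stageU s = s' at *
  obtain ⟨s'', e', ef, e8, e9, e10, er⟩ := stageD_stageP s'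
  rw [e']
  rw [u4, u7] at e8
  rw [u5, u7] at e9
  rw [u4, u5, u7] at e10
  have er' : ∀ i n, keptRegs i = true → i ≠ 8 ∧ i ≠ 9 ∧ i ≠ 10 → s'.reg i = n → s''.reg i = n :=
    fun i n hi h h' => (er i hi h.1 h.2.1 h.2.2).trans h'
  refine isLifted_stageL hn1 hn2 (er' 4 _ rfl (by decide) u4) (er' 5 _ rfl (by decide) u5)
    (er' 6 _ rfl (by decide) u6) (er' 7 _ rfl (by decide) u7) e8 e9 e10 ?_
    (er' 33 _ rfl (by decide) u33) (er' 34 _ rfl (by decide) u34) (by rw [ef, f13])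
    (by rw [ef, f14])
  rw [ef, er' 14 _ rfl (by decide) rfl]
  exact hO'

end Program

namespace Program

lemma readMatrix_writeMatrix {k : ℕ} (Q : Matrix (Fin k) (Fin k) 𝕜) (m : List ℕ → 𝕜) :
    readMatrix k (writeMatrix Q m) = Q := by
  ext i j
  simp [readMatrix, writeMatrix]

lemma answerState_spec (D : DiagOracle 𝕜) (st : MState 𝕜) {k : ℕ}
    (M : Matrix (Fin k) (Fin k) 𝕜) : ∃ s, answerState D st 22 23 36 M = s ∧
      (∀ i, i ≠ 36 → s.reg i = st.reg i) ∧ s.narr = st.narr ∧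
      (∀ A, A ≠ 22 → A ≠ 23 → s.farr A = st.farr A) ∧
      ∀ Q l, Diagonalizes M Q l → ∃ l', Diagonalizes M (readMatrix k (s.farr 22)) l' := by
  refine ⟨_, rfl, ?_⟩
  unfold answerState
  split
  · rename_i h
    refine ⟨fun i hi => ?_, rfl, fun _ _ _ => rfl, fun Q l hQ => ?_⟩
    · rw [reg_put, if_neg hi]
    exact absurd ⟨Q, l, hQ⟩ (D.complete _ _ h)
  rename_i q l h
  dsimp only
  refine ⟨fun i hi => update_of_ne hi _ _, rfl, fun A h22 h23 => ?_, fun _ _ _ => ⟨l, ?_⟩⟩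
  · grind
  rw [update_of_ne (by decide), update_self, readMatrix_writeMatrix]
  exact D.sound _ _ _ _ h

/-- Clear the sizes that do not matter for the output. -/
def cleared (st : MState 𝕜) : MState 𝕜 :=
  ((((st.putReg 7 0).putReg 8 0).putReg 9 0).putReg 10 0).putReg 15 0

/-- The computation that follows the computation of the lifted space, up to the output. -/
def recovered (D : DiagOracle 𝕜) (st : MState 𝕜) : MState 𝕜 :=
  recover.run ((prepare.run st).afterDiag D 21 22 23 14 36)

/-- The field arrays that are kept after the computation of the lifted space. -/
def keptArrays (A : ℕ) : Bool := A == 0 || A == 1 || A == 2 || A == 10 || A == 14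

lemma recovered_reg (D : DiagOracle 𝕜) (st : MState 𝕜) {i : ℕ} (hi : below 30 i = true) :
    (recovered D st).reg i = st.reg i := by
  obtain ⟨s, hs, h1, -⟩ := answerState_spec D (prepare.run st)
    (readMatrix ((prepare.run st).reg 14) ((prepare.run st).farr 21))
  rw [recovered, afterDiag_eq, hs, recover.run_keeps_reg (R := below 30) (V := keptArrays) rfl s hi,
    h1 i (by rintro rfl; exact absurd hi (by decide)),
    prepare.run_keeps_reg (R := below 30) (V := keptArrays) rfl st hi]

lemma isEmpty_recovers {s : ℕ} {P : Fin s → (Fin (r + 1) → Fin n1 × Fin n2) → 𝕜}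
    {u : Fin 0 → MatSpace 𝕜 n1 n2} (hP : IsBasisOf P (liftedSpace (r + 1) (minors 𝕜 n1 n2 r) u))
    (f g : Fin s → 𝕜) : ∃ (x : Fin 0 → MatSpace 𝕜 n1 n2) (z : Fin 0 → Fin s → 𝕜),
      Recovers P f g x z := by
  have hs : s = 0 := by
    by_contra hs
    have h := hP.2
    rw [liftedSpace_eq_bot, Submodule.span_eq_bot] at h
    exact hP.1.ne_zero ⟨0, Nat.pos_of_ne_zero hs⟩ (h _ ⟨_, rfl⟩)
  subst hs
  exact ⟨Fin.elim0, Fin.elim0, rfl, linearIndependent_empty_type, fun i => i.elim0,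
    fun a => a.elim0, fun a => a.elim0, fun a => a.elim0⟩

lemma aidedDecompose_recovered {s : ℕ} (hr : 0 < r) (hn1 : 0 < n1) (hn2 : 0 < n2)
    (D : DiagOracle 𝕜) (h : Tables st n1 n2 (r + 1)) (h2 : st.reg 2 = n3)
    (h14 : st.reg 14 = ℓ) (h15 : st.reg 15 = s)
    (hT : HoldsTensor st T) {f g : ℕ → 𝕜} (hf : ∀ i, st.farr 1 [i] = f i)
    (hg : ∀ i, st.farr 2 [i] = g i) {u : Fin ℓ → MatSpace 𝕜 n1 n2}
    (hu : ∀ i : Fin ℓ, matAt (st.farr 10) [(i : ℕ)] = u i) (hne : ∀ i, u i ≠ 0)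
    (ho : ∀ i j, i ≠ j → hdot (u i) (u j) = 0)
    {P : Fin s → (Fin (r + 1) → Fin n1 × Fin n2) → 𝕜} (hPd : liftBasis st n1 n2 (r + 1) s = P)
    (hP : IsBasisOf P (liftedSpace (r + 1) (minors 𝕜 n1 n2 r) u)) :
    AidedDecompose T u P (fun i => f i) (fun i => g i)
      (readOutput n1 n2 n3 (output.run (cleared (recovered D st)))) := by
  have a1 : Agree (below 30) keptArrays st (prepare.run st) := prepare.agree_run rfl rfl st
  have hprep := fun (x : Fin ℓ → MatSpace 𝕜 n1 n2) (z : Fin ℓ → Fin s → 𝕜) hx =>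
    run_prepare hr hn1 hn2 h h14 h15 hu hf hg (x := x) (z := z) (fun i => by
      rw [hPd]
      have : P i ∈ liftedSpace (r + 1) (minors 𝕜 n1 n2 r) u := by
        rw [← hP.2]
        exact subset_span ⟨i, rfl⟩
      exact this.1.1) hx
  have hmem : ∀ {x : Fin ℓ → MatSpace 𝕜 n1 n2} {z : Fin ℓ → Fin s → 𝕜},
      Recovers P (fun i => f i) (fun i => g i) x z →
      ∀ a, x a ∈ span 𝕜 (range u) := fun hx => hx.mem_span hr fun i => by
    have : P i ∈ liftedSpace (r + 1) (minors 𝕜 n1 n2 r) u := by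
      rw [← hP.2]
      exact subset_span ⟨i, rfl⟩
    exact this.1.1
  have h14' : (prepare.run st).reg 14 = ℓ := (a1.reg 14 rfl).symm.trans h14
  obtain ⟨s2, hs2, r2, nn2, f2, d2⟩ := answerState_spec D (prepare.run st)
    (readMatrix ℓ ((prepare.run st).farr 21))
  have e : recovered D st = recover.run s2 := by rw [recovered, afterDiag_eq, h14', hs2]
  rw [e]
  have r2' : ∀ i, below 30 i = true → st.reg i = s2.reg i := fun i hi =>
    (a1.reg i hi).trans (r2 i (by rintro rfl; exact absurd hi (by decide))).symm
  have f2' : ∀ A, keptArrays A = true → s2.farr A = st.farr A := fun A hA =>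
    (f2 A (by rintro rfl; exact absurd hA (by decide))
      (by rintro rfl; exact absurd hA (by decide))).trans (a1.farr A hA).symm
  have t2 : Tables s2 n1 n2 (r + 1) := h.congr r2' (a1.narr.trans nn2.symm)
  have hP2 : liftBasis s2 n1 n2 (r + 1) s = P := by
    rw [← hPd]
    unfold liftBasis
    rw [f2' 14 rfl]
  obtain ⟨c1, c2⟩ := run_recover t2 ((r2' 14 rfl).symm.trans h14) ((r2' 15 rfl).symm.trans h15)
    (f := f) (g := g) (fun i => by rw [f2' 1 rfl, hf]) (fun i => by rw [f2' 2 rfl, hg]) rfl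
  have hcomp : (∃ (x : Fin ℓ → MatSpace 𝕜 n1 n2) (z : Fin ℓ → Fin s → 𝕜),
      Recovers P (fun i => f i) (fun i => g i) x z) → (recover.run s2).reg 38 ≠ 0 := by
    rintro ⟨x, z, hx⟩
    obtain ⟨ρ, hρ, hX, hMX⟩ := hprep x z (by grind)
    obtain ⟨l, hl⟩ := d2 _ _ ⟨hX, hMX⟩
    obtain ⟨σ, c, hc, hQ⟩ := exists_perm_of_diagonalizes hX hMX hρ hl
    exact c2 (fun i => by rw [f2' 10 rfl, hu]) hne ho (by rw [hP2]; exact hx) (hmem hx) hc hQ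
  have k3 : Agree (fun i => i == 2 || i == 4 || i == 5 || i == 14) (fun A => A == 0) s2
      (recover.run s2) := recover.agree_run rfl rfl s2
  rw [hP2] at c1
  generalize recover.run s2 = s3 at c1 hcomp k3 ⊢
  have k3' : ∀ i, (i == 2 || i == 4 || i == 5 || i == 14) = true → below 30 i = true →
      s3.reg i = st.reg i := fun i hi hi' => (k3.reg i hi).symm.trans (r2' i hi').symm
  rw [run_output (cleared s3) (ℓ := ℓ) (n1 := n1) (n2 := n2) (n3 := n3)
    ((k3' 2 rfl rfl).trans h2) ((k3' 4 rfl rfl).trans h.reg4) ((k3' 5 rfl rfl).trans h.reg5)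
    ((k3' 14 rfl rfl).trans h14) (T := T) (fun i k => by
      change s3.farr 0 _ = _
      rw [← k3.farr 0 rfl, f2' 0 rfl]
      exact hT i k)]
  have e38 : (cleared s3).reg 38 = s3.reg 38 := rfl
  rw [e38]
  split_ifs with h38
  · rcases Nat.eq_zero_or_pos ℓ with rfl | hℓ
    · exact absurd h38 (hcomp (isEmpty_recovers hP _ _))
    exact aidedDecompose_none hr hℓ T u P _ _ fun hx => hcomp hx h38
  obtain ⟨⟨z, hz⟩, hd⟩ := c1 h38
  rcases Nat.eq_zero_or_pos ℓ with rfl | hℓ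
  · exact AidedDecompose.empty rfl (Algorithm1.trivial (liftedSpace_eq_bot _ _)) _ _
  exact hz.aidedDecompose hr hℓ hP hd

end Program

namespace Program

lemma runs_copy (D : DiagOracle 𝕜) {i j : ℕ} (hj : visible j = true) (st : MState 𝕜) :
    Runs D (copy i j) st (st.putReg i (st.reg j)) 1 0 :=
  runs_setReg D fun _ h => (h.reg j hj).symm

lemma runs_clear (D : DiagOracle 𝕜) (i : ℕ) (st : MState 𝕜) :
    Runs D (clear i) st (st.putReg i 0) 1 0 := runs_setReg D fun _ _ => rfl

/-- The sizes are at most `b`. -/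
def Bounded (b : ℕ) (st : MState 𝕜) : Prop := ∀ i, 4 ≤ i → i < 30 → st.reg i ≤ b

lemma Bounded.putReg (h : Bounded b st) (i : ℕ) {n : ℕ} (hn : n ≤ b) :
    Bounded b (st.putReg i n) := by
  intro j hj hj'
  rw [reg_put]
  split_ifs
  · exact hn
  exact h j hj hj'

lemma Bounded.mono {b' : ℕ} (h : Bounded b st) (hb : b ≤ b') : Bounded b' st :=
  fun i hi hi' => (h i hi hi').trans hb

lemma Bounded.congr (h : Bounded b st)
    (h' : ∀ i, below 30 i = true → st'.reg i = st.reg i) : Bounded b st' := fun i hi hi' => by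
  rw [h' i (by simp [below, hi'])]
  exact h i hi hi'

lemma Bounded.run (h : Bounded b st) (p : Prog)
    (hp : p.keeps (below 30) (fun _ => false) = true) : Bounded b (p.run st) :=
  h.congr fun _ hi => p.run_keeps_reg hp st hi

lemma runs_light (D : DiagOracle 𝕜) {p : Prog} (hp : p.Scoped visible visible = true)
    (hl : p.light = true) {k : ℕ} (hb : Bounded b st) (hk : p.cost ≤ k) :
    Runs D p.comp st (p.run st) ((b + 2) ^ k) 0 := by
  intro s hs
  obtain ⟨s', τ, κ, h1, h2, h3, h4⟩ := runs_comp D hp hb s hs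
  refine ⟨s', τ, κ, h1, h2, h3.trans ?_, h4⟩
  rw [Prog.factor, if_pos hl, one_mul]
  exact Nat.pow_le_pow_right (by omega) hk

lemma runs_slow (D : DiagOracle 𝕜) {p : Prog} (hp : p.Scoped visible visible = true) (h2 : st.reg 2 = n3) {k : ℕ} (hb : Bounded b st) (hk : p.cost ≤ k) :
    Runs D p.comp st (p.run st) ((n3 + 1) * (b + 2) ^ k) 0 := by
  intro s hs
  obtain ⟨s', τ, κ, h1, h2', h3, h4⟩ := runs_comp D hp hb s hs
  refine ⟨s', τ, κ, h1, h2', h3.trans ?_, h4⟩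
  rw [h2]
  exact Nat.mul_le_mul (p.factor_le n3) (Nat.pow_le_pow_right (by omega) hk)

/-- An upper bound for the exponents in the running times. -/
def exponent : ℕ := sizeN.cost + slices.cost + powers.cost + sizeD.cost + lift.cost + prepare.cost +
  recover.cost + output.cost + 1

lemma cost_le_exponent : sizeN.cost ≤ exponent ∧ slices.cost ≤ exponent ∧
    powers.cost ≤ exponent ∧ sizeD.cost ≤ exponent ∧ lift.cost ≤ exponent ∧
    prepare.cost ≤ exponent ∧ recover.cost ≤ exponent ∧ output.cost ≤ exponent := by
  have key : ∀ a b c d e f g h : ℕ, a ≤ a + b + c + d + e + f + g + h + 1 ∧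
      b ≤ a + b + c + d + e + f + g + h + 1 ∧ c ≤ a + b + c + d + e + f + g + h + 1 ∧
      d ≤ a + b + c + d + e + f + g + h + 1 ∧ e ≤ a + b + c + d + e + f + g + h + 1 ∧
      f ≤ a + b + c + d + e + f + g + h + 1 ∧ g ≤ a + b + c + d + e + f + g + h + 1 ∧
      h ≤ a + b + c + d + e + f + g + h + 1 := by
    intros
    omega
  exact key _ _ _ _ _ _ _ _

lemma _root_.BlockDecomp.Runs.mono {c : Cmd} {t' q' : ℕ}
    (h : Runs D c st st' t q) (ht : t ≤ t') (hq : q ≤ q') : Runs D c st st' t' q' := by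
  intro s hs
  obtain ⟨s', τ, κ, h1, h2, h3, h4⟩ := h s hs
  exact ⟨s', τ, κ, h1, h2, h3.trans ht, h4.trans hq⟩

section Stages

variable {D : DiagOracle 𝕜} {c : Cmd} {st st' : MState 𝕜} {b k t q : ℕ}

lemma _root_.BlockDecomp.Runs.stageN (h : Bounded b ((st.putReg 4 (st.reg 0)).putReg 5 (st.reg 1)))
    (hk : sizeN.cost ≤ k) (hc : Runs D c (stageN st) st' t q) :
    Runs D (Cmd.seq (copy 4 0) <| Cmd.seq (copy 5 1) <| Cmd.seq sizeN.comp <|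
      Cmd.seq (copy 6 31) c) st st' (t + 3 + (b + 2) ^ k) q := by
  have r := (runs_copy D (i := 4) (j := 0) rfl st).seq <|
    (runs_copy D (i := 5) (j := 1) rfl _).seq <| (runs_light D (p := sizeN) rfl rfl h hk).seq <|
    (runs_copy D (i := 6) (j := 31) rfl _).seq hc
  exact r.mono (by omega) (by omega)

lemma _root_.BlockDecomp.Runs.stageU (h : Bounded b st) (h2 : st.reg 2 = n3) (hk : slices.cost ≤ k)
    (hc : Runs D c (stageU st) st' t q) :
    Runs D (Cmd.seq slices.comp <| Cmd.seq (copy 14 30) <|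
      Cmd.seq (Cmd.setReg 7 (NExp.add (NExp.reg 3) (NExp.lit 1))) c) st st'
      (t + 2 + (n3 + 1) * (b + 2) ^ k) q := by
  have r := (runs_slow D (p := slices) rfl h2 h hk).seq <|
    (runs_copy D (i := 14) (j := 30) rfl _).seq <|
    (runs_setReg D (i := 7) (e := NExp.add (NExp.reg 3) (NExp.lit 1)) fun s h =>
      (congrArg (· + 1) (h.reg 3 rfl)).symm).seq hc
  exact r.mono (by omega) (by omega)

lemma _root_.BlockDecomp.Runs.stageP (h : Bounded b st) (hk : powers.cost ≤ k)
    (hc : Runs D c (stageP st) st' t q) :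
    Runs D (Cmd.seq powers.comp <| Cmd.seq (copy 8 31) <| Cmd.seq (copy 9 32) c) st st'
      (t + 2 + (b + 2) ^ k) q := by
  have r := (runs_light D (p := powers) rfl rfl h hk).seq <|
    (runs_copy D (i := 8) (j := 31) rfl _).seq <| (runs_copy D (i := 9) (j := 32) rfl _).seq hc
  exact r.mono (by omega) (by omega)

lemma _root_.BlockDecomp.Runs.stageD (h : Bounded b st) (hk : sizeD.cost ≤ k)
    (hc : Runs D c (stageD st) st' t q) :
    Runs D (Cmd.seq sizeD.comp <| Cmd.seq (copy 10 31) c) st st' (t + 1 + (b + 2) ^ k) q := by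
  have r := (runs_light D (p := sizeD) rfl rfl h hk).seq <|
    (runs_copy D (i := 10) (j := 31) rfl _).seq hc
  exact r.mono (by omega) (by omega)

lemma _root_.BlockDecomp.Runs.stageL (h : Bounded b st) (hk : lift.cost ≤ k)
    (hc : Runs D c (stageL st) st' t q) :
    Runs D (Cmd.seq lift.comp <| Cmd.seq (copy 15 34) c) st st' (t + 1 + (b + 2) ^ k) q := by
  have r := (runs_light D (p := lift) rfl rfl h hk).seq <|
    (runs_copy D (i := 15) (j := 34) rfl _).seq hc
  exact r.mono (by omega) (by omega)

lemma _root_.BlockDecomp.Runs.recovered (h : Bounded b st) (hp : prepare.cost ≤ k) (hr : recover.cost ≤ k)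
    (hc : Runs D c (recovered D st) st' t q) :
    Runs D (Cmd.seq prepare.comp <| Cmd.seq (Cmd.diag 21 22 23 14 36) <| Cmd.seq recover.comp c)
      st st' (t + (st.reg 14 * st.reg 14 + 1) + 2 * (b + 2) ^ k) (q + 1) := by
  have k1 : Agree (below 30) (fun _ => false) st (prepare.run st) := prepare.agree_run rfl rfl _
  have h8 : Bounded b ((prepare.run st).afterDiag D 21 22 23 14 36) := by
    obtain ⟨s, hs, hr, -⟩ := answerState_spec D (prepare.run st)
      (readMatrix ((prepare.run st).reg 14) ((prepare.run st).farr 21))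
    rw [afterDiag_eq, hs]
    refine (h.congr fun i hi => (k1.reg i hi).symm).congr fun i hi => hr i ?_
    rintro rfl
    exact absurd hi (by decide)
  have r := (runs_light D (p := prepare) scoped_prepare rfl h hp).seq <|
    (runs_diag D (A := 21) (Q := 22) (L := 23) (k := 14) (flag := 36) rfl rfl rfl rfl _).seq <|
    (runs_light D (p := recover) scoped_recover rfl h8 hr).seq hc
  have h14 : (prepare.run st).reg 14 = st.reg 14 := (k1.reg 14 rfl).symm
  rw [h14] at r
  exact r.mono (by omega) (by omega)

lemma runs_finish (h : Bounded b (cleared st)) (h2 : (cleared st).reg 2 = n3)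
    (hk : output.cost ≤ k) :
    Runs D (Cmd.seq (clear 7) <| Cmd.seq (clear 8) <| Cmd.seq (clear 9) <| Cmd.seq (clear 10) <|
      Cmd.seq (clear 15) output.comp) st (output.run (cleared st)) (5 + (n3 + 1) * (b + 2) ^ k)
      0 := by
  have r := (runs_clear D 7 st).seq <| (runs_clear D 8 _).seq <| (runs_clear D 9 _).seq <|
    (runs_clear D 10 _).seq <| (runs_clear D 15 _).seq <|
    runs_slow D (p := output) scoped_output h2 h hk
  exact r.mono (by omega) (by omega)

end Stages

lemma runs_program (D : DiagOracle 𝕜) {B : ℕ}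
    (h1 : Bounded N ((st.putReg 4 (st.reg 0)).putReg 5 (st.reg 1))) (h2 : Bounded N (stageN st))
    (h3 : Bounded N (stageU (stageN st))) (h4 : Bounded B (stageP (stageU (stageN st))))
    (h5 : Bounded B (stageD (stageP (stageU (stageN st))))) (h6 : Bounded B (lifted st))
    (h7 : Bounded N (cleared (recovered D (lifted st)))) (hn : st.reg 2 = n3)
    (hn' : (cleared (recovered D (lifted st))).reg 2 = n3) (hℓ : (lifted st).reg 14 ≤ N) :
    Runs D program st (output.run (cleared (recovered D (lifted st))))
      (15 + 2 * (n3 + 1) * (N + 2) ^ exponent + 2 * (N + 2) ^ exponent +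
        4 * (B + 2) ^ exponent + N * N) 1 := by
  obtain ⟨c1, c2, c3, c4, c5, c6, c7, c8⟩ := cost_le_exponent
  generalize exponent = k at *
  have hn2 : (stageN st).reg 2 = n3 := by
    refine Eq.trans ?_ hn
    rw [stageN, run_sizeN]
    rfl
  have r := Runs.stageN h1 c1 <| Runs.stageU h2 hn2 c2 <| Runs.stageP h3 c3 <|
    Runs.stageD h4 c4 <| Runs.stageL h5 c5 <| Runs.recovered h6 c6 c7 <|
    runs_finish (D := D) h7 hn' c8
  refine Runs.mono r ?_ le_rfl
  have h14' := Nat.mul_le_mul hℓ hℓ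
  change _ + (((lifted st).reg 14) * ((lifted st).reg 14) + 1) + _ + _ + _ + _ + _ + _ + _ + _ + _ +
    _ + _ ≤ _
  generalize (N + 2) ^ k = x at *
  generalize (B + 2) ^ k = y at *
  generalize (lifted st).reg 14 * (lifted st).reg 14 = w at *
  generalize N * N = w' at *
  rw [show 2 * (n3 + 1) * x = (n3 + 1) * x + (n3 + 1) * x by ring]
  generalize (n3 + 1) * x = v at *
  omega

end Program

namespace Program

lemma exponent_pos : 0 < exponent := Nat.add_pos_right _ Nat.one_pos

lemma time_le {n k : ℕ} (hN : 4 ≤ N) (hr : 0 < r) (hk : 0 < k) :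
    15 + 2 * (n + 1) * (N + 2) ^ k + 2 * (N + 2) ^ k + 4 * (N ^ (r + 1) + 2) ^ k + N * N ≤
      N ^ ((3 * k + 3) * r) + n * N ^ (3 * k + 3) := by
  have hmono : ∀ {a b : ℕ}, a ≤ b → N ^ a ≤ N ^ b := fun h => Nat.pow_le_pow_right (by omega) h
  have hrk : k ≤ k * r := Nat.le_mul_of_pos_right k hr
  have h1 : (N + 2) ^ k ≤ N ^ (2 * k) := by
    rw [pow_mul]
    exact Nat.pow_le_pow_left (by nlinarith) k
  have h2 : (N ^ (r + 1) + 2) ^ k ≤ N ^ (3 * (k * r)) := by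
    have h : N ^ (r + 1) + 2 ≤ N ^ (3 * r) := by
      refine le_trans ?_ (hmono (show r + 2 ≤ 3 * r by omega))
      have := hmono (show 1 ≤ r + 1 by omega)
      rw [pow_one] at this
      rw [pow_succ N (r + 1)]
      nlinarith
    refine (Nat.pow_le_pow_left h k).trans_eq ?_
    rw [← pow_mul]
    ring_nf
  have h3 : N ^ (2 * k) ≤ N ^ (3 * (k * r)) := hmono (by omega)
  have h4 : N * N ≤ N ^ (3 * (k * r)) := by
    rw [← pow_two]
    exact hmono (by omega)
  have h5 : 24 * N ^ (3 * (k * r)) ≤ N ^ ((3 * k + 3) * r) := by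
    refine le_trans ?_ (hmono (show 3 * (k * r) + 3 ≤ (3 * k + 3) * r by nlinarith))
    rw [pow_add, mul_comm]
    refine Nat.mul_le_mul_left _ (le_trans (by norm_num) (Nat.pow_le_pow_left hN 3))
  have h6 : n * (2 * N ^ (2 * k)) ≤ n * N ^ (3 * k + 3) := by
    refine Nat.mul_le_mul_left _ (le_trans ?_ (hmono (show 2 * k + 1 ≤ 3 * k + 3 by omega)))
    rw [pow_succ, mul_comm]
    exact Nat.mul_le_mul_left _ (by omega)
  have h7 : n * (N + 2) ^ k ≤ n * N ^ (2 * k) := Nat.mul_le_mul_left _ h1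
  grind

lemma stageU_reg_14 (st : MState 𝕜) : (stageU st).reg 14 = (slices.run st).reg 30 := rfl

lemma stageU_reg_7 (st : MState 𝕜) : (stageU st).reg 7 = (slices.run st).reg 3 + 1 := rfl

lemma lifted_reg_15 (st : MState 𝕜) :
    (lifted st).reg 15 = (lift.run (stageD (stageP (stageU (stageN st))))).reg 34 := by
  rw [lifted, stageL, reg_put, if_pos rfl]

section Init

variable {N r : ℕ} (T : TensorSpace 𝕜 n1 n2 n3) (f g : Fin N → 𝕜)

lemma initState_reg {i : ℕ} (hi : 3 < i) : (initState r T f g).reg i = 0 := by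
  simp only [initState]
  grind

lemma agree_initState (f' g' : Fin N → 𝕜) :
    Agree visible nonrandom (initState r T f g) (initState r T f' g') := by
  refine ⟨fun _ _ => rfl, rfl, fun A hA => ?_⟩
  funext idx
  have h1 : A ≠ 1 := by rintro rfl; exact absurd hA (by decide)
  have h2 : A ≠ 2 := by rintro rfl; exact absurd hA (by decide)
  simp only [initState]
  grind

lemma lifted_reg (st : MState 𝕜) {i : ℕ} (hi : below 30 i = true) (h8 : i ≠ 8) (h9 : i ≠ 9)
    (h10 : i ≠ 10) (h15 : i ≠ 15) : (lifted st).reg i = (stageU (stageN st)).reg i := by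
  obtain ⟨s, hs, -, -, -, -, h⟩ := stageD_stageP (stageU (stageN st))
  rw [lifted, hs, stageL, reg_put, if_neg h15,
    lift.run_keeps_reg (R := below 30) (V := fun _ => false) rfl s hi,
    h i (by simp [keptRegs, hi]) h8 h9 h10]

lemma lifted_farr {A : ℕ} (hA : A < 3) :
    (lifted (initState r T f g)).farr A = (initState r T f g).farr A := by
  have hA' : below 3 A = true := by simp [below, hA]
  have e := stageN_spec (st := initState r T f g) rfl rfl
  obtain ⟨s, hs, h, -⟩ := stageD_stageP (stageU (stageN (initState r T f g)))
  have e1 : (lifted (initState r T f g)).farr A = s.farr A := by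
    rw [lifted, hs]
    exact lift.run_keeps_farr (R := fun _ => false) (V := below 3) rfl s hA'
  have e2 : (stageU (stageN (initState r T f g))).farr A = (stageN (initState r T f g)).farr A :=
    slices.run_keeps_farr (R := fun _ => false) (V := below 3) rfl _ hA'
  rw [e1, h, e2, e]
  rfl

lemma reg_le_of_isLifted (h : IsLifted st r T) : st.reg 15 ≤ (n1 * n2) ^ (r + 1) := by
  have := h.lift.1.fintype_card_le_finrank
  simpa using this

lemma runs_initState (D : DiagOracle 𝕜) (hr : 0 < r) (h1 : r < n1) (h2 : r < n2) :
    Runs D program (initState r T f g)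
      (output.run (cleared (recovered D (lifted (initState r T f g)))))
      ((n1 * n2) ^ ((3 * exponent + 3) * r) + n3 * (n1 * n2) ^ (3 * exponent + 3)) 1 := by
  have hL := isLifted_lifted (r := r) (by omega) (by omega) T f g
  have hN : 4 ≤ n1 * n2 := Nat.mul_le_mul (show 2 ≤ n1 by omega) (show 2 ≤ n2 by omega)
  have hn1 : n1 ≤ n1 * n2 := Nat.le_mul_of_pos_right _ (by omega)
  have hn2 : n2 ≤ n1 * n2 := Nat.le_mul_of_pos_left _ (by omega)
  have hNB : n1 * n2 ≤ (n1 * n2) ^ (r + 1) := Nat.le_self_pow (by omega) _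
  have hp1 : n1 ^ (r + 1) ≤ (n1 * n2) ^ (r + 1) := Nat.pow_le_pow_left hn1 _
  have hp2 : n2 ^ (r + 1) ≤ (n1 * n2) ^ (r + 1) := Nat.pow_le_pow_left hn2 _
  have hreg : ∀ i, 3 < i → (initState r T f g).reg i = 0 := fun i hi => initState_reg T f g hi
  have q0 : (initState r T f g).reg 0 = n1 := rfl
  have q1 : (initState r T f g).reg 1 = n2 := rfl
  have q2 : (initState r T f g).reg 2 = n3 := rfl
  have q3 : (initState r T f g).reg 3 = r := rfl
  generalize initState r T f g = st at *
  have b0 : Bounded (n1 * n2) st := fun i hi _ => (hreg i (by omega)).trans_le (Nat.zero_le _)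
  have b1 : Bounded (n1 * n2) ((st.putReg 4 (st.reg 0)).putReg 5 (st.reg 1)) := by
    rw [q0, q1]
    exact (b0.putReg 4 hn1).putReg 5 hn2
  have e := stageN_spec q0 q1
  have b2 : Bounded (n1 * n2) (stageN st) := by
    rw [e]
    exact (((b0.putReg 4 hn1).putReg 5 hn2).putReg 31 le_rfl).putReg 6 le_rfl
  have s2 : (stageN st).reg 2 = n3 := by rw [e]; exact q2
  have s3 : (stageN st).reg 3 = r := by rw [e]; exact q3
  have s4 : (stageN st).reg 4 = n1 := by rw [e]; rfl
  have s5 : (stageN st).reg 5 = n2 := by rw [e]; rfl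
  have u14 : (slices.run (stageN st)).reg 30 ≤ n1 * n2 := by
    rw [← stageU_reg_14, ← lifted_reg st rfl (by decide) (by decide) (by decide) (by decide)]
    exact hL.card
  have u3 : (slices.run (stageN st)).reg 3 = r :=
    (slices.run_keeps_reg (R := keptRegs) (V := fun _ => false) rfl _ rfl).trans s3
  have b3 : Bounded (n1 * n2) (stageU (stageN st)) :=
    ((b2.run slices rfl).putReg 14 u14).putReg 7 (by omega)
  have l2 : (lifted st).reg 2 = n3 := by
    rw [lifted_reg st rfl (by decide) (by decide) (by decide) (by decide),
      stageU_reg _ rfl (by decide) (by decide), s2]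
  have u4 : (stageU (stageN st)).reg 4 = n1 := (stageU_reg _ rfl (by decide) (by decide)).trans s4
  have u5 : (stageU (stageN st)).reg 5 = n2 := (stageU_reg _ rfl (by decide) (by decide)).trans s5
  have u7 : (stageU (stageN st)).reg 7 = r + 1 := by rw [stageU_reg_7, u3]
  have hlr := fun i => lifted_reg st (i := i)
  have b6' : (lift.run (stageD (stageP (stageU (stageN st))))).reg 34 ≤ (n1 * n2) ^ (r + 1) := by
    rw [← lifted_reg_15]
    exact reg_le_of_isLifted T hL
  have hℓ := hL.card
  have b7 : Bounded (n1 * n2) (cleared (recovered D (lifted st))) := by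
    intro i hi hi'
    have hb : below 30 i = true := by simp [below, hi']
    simp only [cleared, reg_put]
    split_ifs with h15 h10 h9 h8 h7
    any_goals grind
    rw [recovered_reg D _ hb, hlr i hb h8 h9 h10 h15]
    exact b3 i hi hi'
  have b3' := b3.mono hNB
  have p := run_powers (stageU (stageN st))
  rw [u4, u5, u7] at p
  have b4 : Bounded ((n1 * n2) ^ (r + 1)) (stageP (stageU (stageN st))) :=
    ((b3'.run powers rfl).putReg 8 (p.1.trans_le hp1)).putReg 9 (p.2.trans_le hp2)
  have b5 : Bounded ((n1 * n2) ^ (r + 1)) (stageD (stageP (stageU (stageN st)))) := by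
    obtain ⟨s, hs, -, -, -, h10, -⟩ := stageD_stageP (stageU (stageN st))
    refine (b4.run sizeD rfl).putReg 10 ?_
    rw [← hs] at h10
    refine Eq.trans_le h10 ?_
    rw [u4, u5, u7, mul_pow]
  have b6 : Bounded ((n1 * n2) ^ (r + 1)) (lifted st) := (b5.run lift rfl).putReg 15 b6'
  have l2' : (cleared (recovered D (lifted st))).reg 2 = n3 :=
    (recovered_reg D (lifted st) (i := 2) rfl).trans l2
  have hR := runs_program D b1 b2 b3 b4 b5 b6 b7 q2 l2' hℓ
  have hk := exponent_pos
  generalize exponent = k at *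
  exact hR.mono (time_le hN hr hk) le_rfl

end Init

lemma agree_readOutput (h : Agree visible visible st st') :
    readOutput n1 n2 n3 st = readOutput n1 n2 n3 st' := by
  rw [readOutput, readOutput, h.reg 0 rfl, h.reg 1 rfl, h.farr 3 rfl, h.farr 4 rfl]

lemma computes_program (D : DiagOracle 𝕜) (hr : 0 < r) (h1 : r < n1) (h2 : r < n2)
    (T : TensorSpace 𝕜 n1 n2 n3) : ∃ (ℓ s : ℕ) (u : Fin ℓ → MatSpace 𝕜 n1 n2)
      (P : Fin s → (Fin (r + 1) → Fin n1 × Fin n2) → 𝕜), IsBasisOf u (sliceSpan T) ∧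
      IsBasisOf P (liftedSpace (r + 1) (minors 𝕜 n1 n2 r) u) ∧
      ∀ f g : Fin (n1 * n2) → 𝕜, ∃ (t q : ℕ) (out : Option (BlockList 𝕜 n1 n2 n3)),
        Computes D program r T f g t q out ∧
        t ≤ (n1 * n2) ^ ((3 * exponent + 3) * r) + n3 * (n1 * n2) ^ (3 * exponent + 3) ∧
        q ≤ 3 * exponent + 3 ∧
        AidedDecompose T u P (fun i => extendZero f i) (fun i => extendZero g i) out := by
  have h0 := isLifted_lifted (r := r) (by omega) (by omega) T (0 : Fin (n1 * n2) → 𝕜) 0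
  refine ⟨_, _, _, _, h0.basis, h0.lift, fun f g => ?_⟩
  obtain ⟨s, t, q, he, hs, ht, hq⟩ :=
    runs_initState T f g D hr h1 h2 _ (Agree.refl visible visible _)
  refine ⟨t, q, _, ⟨s, he, rfl⟩, ht, hq.trans (by omega), ?_⟩
  rw [← agree_readOutput hs]
  have ha := agree_lifted (agree_initState (r := r) T f g 0 0)
  have hL := isLifted_lifted (r := r) (by omega) (by omega) T f g
  have hu : ∀ i : Fin ((lifted (initState r T (0 : Fin (n1 * n2) → 𝕜) 0)).reg 14),
      matAt ((lifted (initState r T f g)).farr 10) [(i : ℕ)] =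
        sliceBasis (lifted (initState r T (0 : Fin (n1 * n2) → 𝕜) 0)) n1 n2 i := fun i => by
    rw [ha.farr 10 rfl]
    rfl
  have hP : liftBasis (lifted (initState r T f g)) n1 n2 (r + 1)
      ((lifted (initState r T (0 : Fin (n1 * n2) → 𝕜) 0)).reg 15) =
      liftBasis (lifted (initState r T (0 : Fin (n1 * n2) → 𝕜) 0)) n1 n2 (r + 1)
      ((lifted (initState r T (0 : Fin (n1 * n2) → 𝕜) 0)).reg 15) := by
    unfold liftBasis
    rw [ha.farr 14 rfl]
  refine aidedDecompose_recovered hr (by omega) (by omega) D hL.tables ?_ (ha.reg 14 rfl)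
    (ha.reg 15 rfl) ?_ (fun i => ?_) (fun i => ?_) hu h0.ne h0.orth hP h0.lift
  · rw [lifted_reg _ rfl (by decide) (by decide) (by decide) (by decide),
      stageU_reg _ rfl (by decide) (by decide), stageN_spec (n1 := n1) (n2 := n2) rfl rfl]
    rfl
  · intro i k
    rw [lifted_farr T f g (by decide)]
    simp [initState]
  · rw [lifted_farr T f g (by decide)]
    rfl
  rw [lifted_farr T f g (by decide)]
  rfl

end Program

end Programs

end BlockDecomp

end

theorem corollary6p7 (𝕜 : Type*) [RCLike 𝕜] :
    -- the bound is `Ω_r(n₁ n₂)`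
    (∀ r : ℕ, 0 < r → ∃ c : ℝ, 0 < c ∧ ∀ n₁ n₂ : ℕ, r < n₁ → r < n₂ →
      c * ((n₁ : ℝ) * n₂) ≤ rankBound n₁ n₂ r) ∧
    ∃ (prog : Cmd) (C : ℕ), ∀ n₁ n₂ n₃ r : ℕ, 0 < n₁ → 0 < n₂ → 0 < n₃ → 0 < r →
      r < min n₁ n₂ →
      -- on every input, the program runs the procedure based on Algorithm 1, within the stated time
      (∀ (D : DiagOracle 𝕜) (T : TensorSpace 𝕜 n₁ n₂ n₃),
        ∃ (ℓ s : ℕ) (u : Fin ℓ → MatSpace 𝕜 n₁ n₂)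
          (P : Fin s → (Fin (r + 1) → Fin n₁ × Fin n₂) → 𝕜),
          IsBasisOf u (sliceSpan T) ∧
          IsBasisOf P (liftedSpace (r + 1) (minors 𝕜 n₁ n₂ r) u) ∧
          ∀ f g : Fin (n₁ * n₂) → 𝕜, ∃ (t q : ℕ) (out : Option (BlockList 𝕜 n₁ n₂ n₃)),
            Computes D prog r T f g t q out ∧
            t ≤ (n₁ * n₂) ^ (C * r) + n₃ * (n₁ * n₂) ^ C ∧ q ≤ C ∧
            AidedDecompose T u P (fun i => extendZero f i) (fun i => extendZero g i) out) ∧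
      -- on every input, a decomposition that the procedure outputs is correct and unique
      (∀ (T : TensorSpace 𝕜 n₁ n₂ n₃) (ℓ s : ℕ) (u : Fin ℓ → MatSpace 𝕜 n₁ n₂)
          (P : Fin s → (Fin (r + 1) → Fin n₁ × Fin n₂) → 𝕜) (f g : Fin s → 𝕜)
          (L : BlockList 𝕜 n₁ n₂ n₃),
          IsBasisOf u (sliceSpan T) →
          IsBasisOf P (liftedSpace (r + 1) (minors 𝕜 n₁ n₂ r) u) →
          AidedDecompose T u P f g (some L) →
          IsUniqueAidedRankDecomposition r T L.v L.w) ∧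
      -- genericity
      ∀ R : ℕ, R ≤ n₃ → (R : ℝ) ≤ rankBound n₁ n₂ r →
        ∃ A : Set (ParamIndex n₁ n₂ n₃ R → 𝕜),
          IsZariskiOpenDenseIn A (paramVariety 𝕜 n₁ n₂ n₃ r R) ∧
          ∀ x ∈ A,
            -- the decomposition is the unique one
            IsUniqueAidedRankDecomposition r (sumTensor (paramV x) (paramW x))
              (paramV x) (paramW x) ∧
            -- on any basis of `T(W^*)`, Algorithm 1 almost surely outputs the `v a`
            (∀ (ℓ s : ℕ) (u : Fin ℓ → MatSpace 𝕜 n₁ n₂)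
              (P : Fin s → (Fin (r + 1) → Fin n₁ × Fin n₂) → 𝕜),
              IsBasisOf u (sliceSpan (sumTensor (paramV x) (paramW x))) →
              IsBasisOf P (liftedSpace (r + 1) (minors 𝕜 n₁ n₂ r) u) →
              ∀ᵐ fg ∂(pairMeasure 𝕜 s),
                (∃ out, Algorithm1 (minors 𝕜 n₁ n₂ r) u P fg.1 fg.2 out) ∧
                ∀ out, Algorithm1 (minors 𝕜 n₁ n₂ r) u P fg.1 fg.2 out →
                  out.Lists (paramV x)) ∧
            -- the program almost surely outputs the decomposition
            ∀ D : DiagOracle 𝕜, ∀ᵐ fg ∂(pairMeasure 𝕜 (n₁ * n₂)),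
              ∃ (t q : ℕ) (v' : Fin R → MatSpace 𝕜 n₁ n₂) (w' : Fin R → Fin n₃ → 𝕜),
                Computes D prog r (sumTensor (paramV x) (paramW x)) fg.1 fg.2 t q
                  (some ⟨R, v', w'⟩) ∧
                t ≤ (n₁ * n₂) ^ (C * r) + n₃ * (n₁ * n₂) ^ C ∧ q ≤ C ∧
                SameSummands (paramV x) v' (paramW x) w' := by
  refine ⟨fun r _ => exists_mul_le_rankBound r, BlockDecomp.program, 3 * Program.exponent + 3,
    fun n₁ n₂ n₃ r h₁ h₂ _ hr hrn => ⟨fun D T => ?_, fun T ℓ s u P f g L hu hP hL =>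
      hL.unique hr hu hP, fun R hR₃ hR => ?_⟩⟩
  · exact Program.computes_program D hr (lt_min_iff.1 hrn).1 (lt_min_iff.1 hrn).2 T
  · obtain ⟨A, hA, hgen⟩ := exists_isGenericPoint (𝕜 := 𝕜) hr (Nat.mul_pos h₁ h₂) hR₃ hR
    refine ⟨A, hA, fun x hx => ⟨(hgen x hx).unique hr, fun ℓ s u P hu hP =>
      (hgen x hx).ae_lists hr hu hP, fun D => ?_⟩⟩
    obtain ⟨ℓ, s, u, P, hu, hP, h⟩ := Program.computes_program D hr (lt_min_iff.1 hrn).1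
      (lt_min_iff.1 hrn).2 (sumTensor (paramV x) (paramW x))
    filter_upwards [(hgen x hx).ae_sameSummands hr rfl hu hP] with fg hfg
    obtain ⟨t, q, out, hc, ht, hq, ho⟩ := h fg.1 fg.2
    obtain ⟨v', w', rfl, hs⟩ := hfg out ho
    exact ⟨t, q, v', w', hc, ht, hq, hs⟩
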